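/- **Theorem 2.7.** Let $(\mathcal X,d,\mu)$ be a metric space with a Borel measure such that * $(\mathcal X,d)$ is geometrically doubling: there is $N_0\in\mathbb N$ such that every ball $B(x,r)$ can be covered by at most $N_0$ balls of radius $r/2$; * $\mu$ is upper doubling: there are $\lambda:\mathcal X\times(0,\infty)\to(0,\infty)$, non-decreasing in the second variable, and $C_\lambda>0$ with $\mu(B(x,r))\le\lambda(x,r)\le C_\lambda\lambda(x,r/2)$ for all $x$, $r$, and $\lambda(x,r)\le C_\lambda\lambda(y,r)$ whenever $d(x,y)\le r$. For balls $B\subset S$ (each with a given centre $c_B$ and radius; $\rho B$ denotes the concentric dilation) put $K_{B,S}:=1+\int_{2S\setminus B}\lambda(c_B,d(x,c_B))^{-1}\,d\mu(x)$. Functions are complex-valued and identified when equal $\mu$-almost everywhere. Fix $\rho,\sigma\in(1,\infty)$ and $s\in(1,\infty]$. * $\mathrm{RBMO}(\mu)$ is the space of all $f\in L^1_{\rm loc}(\mu)$ for which there are $C\ge 0$ and numbers $f_B$, one for each ball $B$, with $\int_B|f-f_B|\,d\mu\le C\mu(\rho B)$ for all balls $B$ and $|f_B-f_S|\le CK_{B,S}$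 for all balls $B\subset S$; $\|f\|_{\mathrm{RBMO}(\mu)}$ is the infimum of such $C$. * An atomic block is a function $b$ supported in a ball $B$ with $\int b\,d\mu=0$ and $b=\lambda_1a_1+\lambda_2a_2$, where $\lambda_j\in\mathbb C$, $a_j$ is supported in a ball $B_j\subset B$ and $\|a_j\|_{L^s(\mu)}\le\mu(\sigma B_j)^{1/s-1}K_{B_j,B}^{-1}$; its size is $|\lambda_1|+|\lambda_2|$. $H^1(\mu)$ is the space of all $f\in L^1(\mu)$ with $f=\sum_{i=1}^\infty b_i$ in $L^1(\mu)$ for atomic blocks $b_i$ whose sizes have a finite sum; $\|f\|_{H^1(\mu)}$ is the infimum of these sums. * $\|f\|_{L^{r,\infty}(\mu)}:=\sup_{t>0}t\,\mu(\{|f|>t\})^{1/r}$. An operator $T$ is sublinear on a linear space of functions if $|T(f+g)|\le|Tf|+|Tg|$ and $|T(cf)|=|c||Tf|$ almost everywhere, for all $f,g$ in the space and $c\in\mathbb C$. Let $p_0\in(1,\infty]$ and $1/p_0+1/p_0'=1$. Let $T$ be an operator, defined on $L^{p_0}(\mu)\cup H^1(\mu)$ and sublinear on each of the two spaces, that is bounded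 from $L^{p_0}(\mu)$ into $\mathrm{RBMO}(\mu)$, that is $\|Tf\|_{\mathrm{RBMO}(\mu)}\le C\|f\|_{L^{p_0}(\mu)}$, and bounded from $H^1(\mu)$ into $L^{p_0',\infty}(\mu)$, that is $\|Tf\|_{L^{p_0',\infty}(\mu)}\le C\|f\|_{H^1(\mu)}$. Then, for all $p\in(1,p_0)$ and $1/q=1/p-1/p_0$, $T$ extends to a bounded sublinear operator from $L^p(\mu)$ into $L^q(\mu)$: there are an operator $\widetilde T$, sublinear on $L^p(\mu)$, and a constant $C$ with $\|\widetilde Tf\|_{L^q(\mu)}\le C\|f\|_{L^p(\mu)}$ for all $f\in L^p(\mu)$, such that $\widetilde Tf=Tf$ for all $f\in H^1(\mu)\cap L^p(\mu)$ and, if $\mu(\mathcal X)<\infty$, also for all $f\in L^{p_0}(\mu)$. If $T$ is linear on $L^{p_0}(\mu)$ and on $H^1(\mu)$, then $\widetilde T$ can be chosen linear on $L^p(\mu)$. -/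

import Mathlib

open MeasureTheory Set Filter Topology Metric
open scoped ENNReal NNReal

namespace NonHomogeneous

noncomputable section

/-- Measurable functions modulo equality `μ`-almost everywhere (the ambient space of `Lp E p μ`). -/
abbrev AEFun {X : Type*} [MeasurableSpace X] (E : Type*) [NormedAddCommGroup E] (μ : Measure X) :
    Type _ :=
  X →ₘ[μ] E

/-- A metric space is geometrically doubling if, for some `N₀`, every ball of radius `r` is covered
by at most `N₀` balls of radius `r / 2`. -/
def GeometricallyDoubling (X : Type*) [MetricSpace X] : Prop :=
  ∃ N₀ : ℕ, ∀ (x : X) (r : ℝ), 0 < r →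
    ∃ t : Finset X, t.card ≤ N₀ ∧ ball x r ⊆ ⋃ y ∈ t, ball y (r / 2)

/-- `lam : X × (0, ∞) → (0, ∞)` is a dominating function for `μ` (so that `(X, d, μ)` is upper
doubling), with the usual regularity in the first variable. Only the values `lam x r` with `0 < r`
matter. -/
structure IsDominatingFunction {X : Type*} [MetricSpace X] [MeasurableSpace X]
    (μ : Measure X) (lam : X → ℝ → ℝ) : Prop where
  pos : ∀ (x : X) (r : ℝ), 0 < r → 0 < lam x r
  mono : ∀ (x : X) (r s : ℝ), 0 < r → r ≤ s → lam x r ≤ lam x s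
  measure_ball_le : ∀ (x : X) (r : ℝ), 0 < r → μ (ball x r) ≤ ENNReal.ofReal (lam x r)
  doubling : ∃ C : ℝ, 0 < C ∧
    (∀ (x : X) (r : ℝ), 0 < r → lam x r ≤ C * lam x (r / 2)) ∧
    (∀ (x y : X) (r : ℝ), 0 < r → dist x y ≤ r → lam x r ≤ C * lam y r)

/-- The coefficient `K_{B,S} = 1 + ∫_{2S ∖ B} dμ(z) / λ(c_B, d(z, c_B))` of the balls
`B = ball x r` and `S = ball y R`. A ball is always given by its centre and radius. -/
def coefK {X : Type*} [MetricSpace X] [MeasurableSpace X] (μ : Measure X) (lam : X → ℝ → ℝ)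
    (x : X) (r : ℝ) (y : X) (R : ℝ) : ℝ≥0∞ :=
  1 + ∫⁻ z in ball y (2 * R) \ ball x r, ENNReal.ofReal (1 / lam x (dist z x)) ∂μ

/-- `C` is an admissible constant for `f` in the definition of `RBMO(μ)` with parameter `ρ`:
there are numbers `f_B` with `∫_B |f - f_B| dμ ≤ C μ(ρB)` for all balls `B`, and
`|f_B - f_S| ≤ C K_{B,S}` for all balls `B ⊆ S`. -/
def IsRBMOConst {X : Type*} [MetricSpace X] [MeasurableSpace X] (μ : Measure X)
    (lam : X → ℝ → ℝ) (ρ : ℝ) (f : AEFun ℂ μ) (C : ℝ≥0) : Prop :=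
  LocallyIntegrable f μ ∧ ∃ fB : X → ℝ → ℂ,
    (∀ (x : X) (r : ℝ), 0 < r →
      ∫⁻ z in ball x r, ‖f z - fB x r‖ₑ ∂μ ≤ C * μ (ball x (ρ * r))) ∧
    (∀ (x y : X) (r R : ℝ), 0 < r → 0 < R → ball x r ⊆ ball y R →
      ‖fB x r - fB y R‖ₑ ≤ C * coefK μ lam x r y R)

/-- The `RBMO(μ)` (semi)norm; it is finite exactly when `f ∈ RBMO(μ)`. -/
def rbmoNorm {X : Type*} [MetricSpace X] [MeasurableSpace X] (μ : Measure X)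
    (lam : X → ℝ → ℝ) (ρ : ℝ) (f : AEFun ℂ μ) : ℝ≥0∞ :=
  ⨅ (C : ℝ≥0) (_ : IsRBMOConst μ lam ρ f C), (C : ℝ≥0∞)

/-- `a` is supported on `B = ball x r ⊆ S = ball y R` and
`‖a‖_{L^s(μ)} ≤ μ(ρB)^{1/s - 1} K_{B,S}⁻¹`, written without division. -/
def IsAtomPiece {X : Type*} [MetricSpace X] [MeasurableSpace X] (μ : Measure X)
    (lam : X → ℝ → ℝ) (ρ : ℝ) (s : ℝ≥0∞) (y : X) (R : ℝ) (a : AEFun ℂ μ) : Prop :=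
  ∃ (x : X) (r : ℝ), 0 < r ∧ ball x r ⊆ ball y R ∧ (∀ᵐ z ∂μ, z ∉ ball x r → a z = 0) ∧
    eLpNorm a s μ * μ (ball x (ρ * r)) ^ (1 - s⁻¹.toReal) * coefK μ lam x r y R ≤ 1

/-- `b` is an `(s, 1)_λ`-atomic block supported on some ball, and `b = k₁ a₁ + k₂ a₂` is an
admissible representation of it with `m = |k₁| + |k₂|`. -/
def IsAtomicBlock {X : Type*} [MetricSpace X] [MeasurableSpace X] (μ : Measure X)
    (lam : X → ℝ → ℝ) (ρ : ℝ) (s : ℝ≥0∞) (b : AEFun ℂ μ) (m : ℝ≥0) : Prop :=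
  ∃ (y : X) (R : ℝ), 0 < R ∧ (∀ᵐ z ∂μ, z ∉ ball y R → b z = 0) ∧ (∫ z, b z ∂μ) = 0 ∧
    ∃ (a₁ a₂ : AEFun ℂ μ) (k₁ k₂ : ℂ),
      IsAtomPiece μ lam ρ s y R a₁ ∧ IsAtomPiece μ lam ρ s y R a₂ ∧
      b = k₁ • a₁ + k₂ • a₂ ∧ m = ‖k₁‖₊ + ‖k₂‖₊

/-- `f = ∑ bᵢ` in `L¹(μ)`, with atomic blocks `bᵢ` of sizes `mᵢ`. -/
def IsBlockDecomposition {X : Type*} [MetricSpace X] [MeasurableSpace X] (μ : Measure X)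
    (lam : X → ℝ → ℝ) (ρ : ℝ) (s : ℝ≥0∞) (f : AEFun ℂ μ)
    (b : ℕ → AEFun ℂ μ) (m : ℕ → ℝ≥0) : Prop :=
  (∀ i, IsAtomicBlock μ lam ρ s (b i) (m i)) ∧ MemLp f 1 μ ∧
    Tendsto (fun n => eLpNorm (f - ∑ i ∈ Finset.range n, b i : AEFun ℂ μ) 1 μ) atTop (𝓝 0)

/-- The norm of the atomic Hardy space `H¹(μ)`: the infimum of `∑ |bᵢ|` over all decompositions of
`f` into atomic blocks; it is finite exactly when `f ∈ H¹(μ)`. -/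
def hardyNorm {X : Type*} [MetricSpace X] [MeasurableSpace X] (μ : Measure X)
    (lam : X → ℝ → ℝ) (ρ : ℝ) (s : ℝ≥0∞) (f : AEFun ℂ μ) : ℝ≥0∞ :=
  ⨅ (b : ℕ → AEFun ℂ μ) (m : ℕ → ℝ≥0) (_ : IsBlockDecomposition μ lam ρ s f b m),
    ∑' i, (m i : ℝ≥0∞)

/-- The atomic Hardy space `H¹(μ)`. -/
def hardySpace {X : Type*} [MetricSpace X] [MeasurableSpace X] (μ : Measure X)
    (lam : X → ℝ → ℝ) (ρ : ℝ) (s : ℝ≥0∞) : Set (AEFun ℂ μ) :=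
  {f | hardyNorm μ lam ρ s f < ∞}

/-- The weak Lebesgue quasinorm `sup_{t > 0} t μ({|f| > t})^{1/s}` of `L^{s,∞}(μ)`. -/
def weakNorm {X : Type*} [MeasurableSpace X] (μ : Measure X) (s : ℝ) (f : AEFun ℂ μ) : ℝ≥0∞ :=
  ⨆ t : ℝ≥0, (t : ℝ≥0∞) * μ {x | (t : ℝ≥0∞) < ‖f x‖ₑ} ^ (1 / s)

/-- `T` is sublinear on the space `S` of (classes of) functions; `T` is a total function, but only
its values on `S` are used. -/
def IsSublinearOn {X : Type*} [MeasurableSpace X] {μ : Measure X} (S : Set (AEFun ℂ μ))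
    (T : (AEFun ℂ μ) → (AEFun ℂ μ)) : Prop :=
  (∀ f ∈ S, ∀ g ∈ S, ∀ᵐ x ∂μ, ‖T (f + g) x‖ ≤ ‖T f x‖ + ‖T g x‖) ∧
    ∀ (c : ℂ), ∀ f ∈ S, ∀ᵐ x ∂μ, ‖T (c • f) x‖ = ‖c‖ * ‖T f x‖

/-- `T` is linear on the space `S` of (classes of) functions. -/
def IsLinearOn {X : Type*} [MeasurableSpace X] {μ : Measure X} (S : Set (AEFun ℂ μ))
    (T : (AEFun ℂ μ) → (AEFun ℂ μ)) : Prop :=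
  (∀ f ∈ S, ∀ g ∈ S, T (f + g) = T f + T g) ∧ ∀ (c : ℂ), ∀ f ∈ S, T (c • f) = c • T f

end

end NonHomogeneous

/-! The proof is a good-λ argument in which `f` is decomposed anew at every level. Let `P = p₀'` and
`‖f‖_p ≤ 1`. At height `t` write `f = g + b` with `|g| ≲ t`, `‖g‖_p ≲ 1` and `t^(p₁-1) ‖b‖_{H¹} ≲
∫_{|f|>t} |f|^{p₁}` for a fixed `1 < p₁ < p` (`exists_good_add_bad`). Then `‖g‖_{p₀} ≲ t^{p/q}`, so
`T g` has RBMO norm `≲ t^{p/q}`, while `T b` is controlled in weak `L^P`. By sublinearity `||T f| -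
|T g|| ≤ |T b|`, hence `|T f|` has mean oscillation `≲ t^{p/q}` up to an error governed by `T b`.

When `p₀ = ∞` one has `P = 1`, and functions in weak `L^1` need not have finite averages. Everything
is therefore done with `|T f|^{1/2}`: the root of `T b` lies in weak `L^{2P}` with `2P ≥ 2`, where
the maximal function is bounded (`measure_MSet_le`). The good-λ inequality
`OscBound.measure_diff_le` compares the maximal function over doubling balls at levels `l` and `2l`.
Linking the level `2^i ℓ` to a height `t_i` by `(2^i ℓ)² ≈ t_i^{p/q}`, the exceptional terms sum to
at most a constant times `(∑ t_i^(p-p₁) ∫_{|f|>t_i} |f|^{p₁})^P ≲ (∫ |f|^p)^P`. This is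
`EndpointBounded.exists_lintegral_le`.

The measure is not doubling, so the Calderón–Zygmund decomposition uses stopping balls with a
dilated ball in the denominator, and the mass of each bad piece is moved to a concentric doubling
ball at bounded `K`-distance (`DoublingData`). The exponent `s` may be `∞`, so pieces that are only
in `L^{p₁}` are not atoms. They are placed in `H¹` by iterating the decomposition: each generation
halves both the total size and the total measure (`exists_recenter_step`,
`exists_hNorm_recenter_le`).

The lowest level `ℓ` is treated separately. If `μ(X) = ∞`, the a priori weak bound for `f ∈ H¹` and
`q > P` let `ℓ` tend to zero. If `μ(X) < ∞`, mean zero functions in `L^p` belong to `H¹` with a norm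
bound, so one fixed `ℓ` serves the whole unit ball; constants are handled by `RBMO ⊆ L^q`. Finally
`T` is extended from a dense subspace. In the sublinear case it is the modulus `|T|` that is
Lipschitz and extends (`exists_sublinear_extension`). -/

namespace NonHomogeneous

/-! ### Covering numbers, growth of the dominating function, and annular integrals. -/

section Basics

variable {X : Type*} [MetricSpace X]

lemma GeometricallyDoubling.exists_iterate (hX : GeometricallyDoubling X) :
    ∃ N : ℕ, 1 ≤ N ∧ ∀ (d : ℕ) (x : X) (r : ℝ), 0 < r →
      ∃ t : Finset X, t.card ≤ N ^ d ∧ ball x r ⊆ ⋃ y ∈ t, ball y (r / 2 ^ d) := by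
  classical
  obtain ⟨N₀, hN⟩ := hX
  refine ⟨N₀ + 1, by omega, fun d => ?_⟩
  induction d with
  | zero => intro x r hr; exact ⟨{x}, by simp, by simp⟩
  | succ d ih =>
    intro x r hr
    obtain ⟨t, ht, hcov⟩ := ih x r hr
    choose u hu hucov using fun y => hN y (r / 2 ^ d) (by positivity)
    refine ⟨t.biUnion u, ?_, ?_⟩
    · calc (t.biUnion u).card ≤ t.card * (N₀ + 1) :=
            Finset.card_biUnion_le_card_mul _ _ _ fun y _ => (hu y).trans (by omega)
        _ ≤ (N₀ + 1) ^ d * (N₀ + 1) := Nat.mul_le_mul_right _ ht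
        _ = _ := (pow_succ _ _).symm
    · intro z hz
      obtain ⟨y, hy, hzy⟩ := mem_iUnion₂.1 (hcov hz)
      obtain ⟨w, hw, hzw⟩ := mem_iUnion₂.1 (hucov y hzy)
      refine mem_iUnion₂.2 ⟨w, Finset.mem_biUnion.2 ⟨y, hy, hw⟩, ?_⟩
      rwa [pow_succ, ← div_div]

/-- Balls have finite `ε`-nets. Separability is what makes disjoint families of balls countable in
the covering arguments below. -/
lemma GeometricallyDoubling.secondCountableTopology (hX : GeometricallyDoubling X) :
    SecondCountableTopology X := by
  rcases isEmpty_or_nonempty X with h | ⟨⟨x₀⟩⟩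
  · infer_instance
  obtain ⟨N, -, hN⟩ := hX.exists_iterate
  refine secondCountable_of_almost_dense_set fun ε hε => ?_
  have : ∀ n : ℕ, ∃ t : Finset X, ball x₀ (n + 1 : ℝ) ⊆ ⋃ y ∈ t, ball y ε := by
    intro n
    obtain ⟨d, hd⟩ := pow_unbounded_of_one_lt ((n + 1 : ℝ) / ε) one_lt_two
    obtain ⟨t, -, ht⟩ := hN d x₀ (n + 1) (by positivity)
    refine ⟨t, ht.trans (iUnion₂_mono fun y _ => ball_subset_ball ?_)⟩
    rw [div_le_iff₀ (by positivity)]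
    rw [div_lt_iff₀ hε] at hd
    linarith
  choose t ht using this
  refine ⟨⋃ n, (t n : Set X), countable_iUnion fun n => (t n).countable_toSet, fun x => ?_⟩
  obtain ⟨n, hn⟩ := exists_nat_gt (dist x x₀)
  obtain ⟨y, hy, hxy⟩ := mem_iUnion₂.1 (ht n (show x ∈ ball x₀ (n + 1 : ℝ) by
    rw [mem_ball]; linarith))
  exact ⟨y, mem_iUnion.2 ⟨n, hy⟩, (mem_ball.1 hxy).le⟩

variable [MeasurableSpace X] {μ : Measure X} {lam : X → ℝ → ℝ}

/-- The integral in the coefficient `K`, over an annulus centred at `x`. -/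
noncomputable def gap (μ : Measure X) (lam : X → ℝ → ℝ) (x : X) (r R : ℝ) : ℝ≥0∞ :=
  ∫⁻ z in ball x R \ ball x r, ENNReal.ofReal (1 / lam x (dist z x)) ∂μ

lemma gap_mono {x : X} {r r' R R' : ℝ} (hr : r' ≤ r) (hR : R ≤ R') :
    gap μ lam x r R ≤ gap μ lam x r' R' :=
  lintegral_mono_set (sdiff_subset_sdiff (ball_subset_ball hR) (ball_subset_ball hr))

lemma gap_le_add [OpensMeasurableSpace X] {x : X} {r s R : ℝ} :
    gap μ lam x r R ≤ gap μ lam x r s + gap μ lam x s R := by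
  refine (lintegral_mono_set ?_).trans (lintegral_union_le _ _ _)
  intro z hz
  by_cases h : z ∈ ball x s
  · exact Or.inl ⟨h, hz.2⟩
  · exact Or.inr ⟨hz.1, h⟩

lemma coefK_le_one_add_gap {x y : X} {r R R' : ℝ} (h : ball y (2 * R) ⊆ ball x R') :
    coefK μ lam x r y R ≤ 1 + gap μ lam x r R' := by
  unfold coefK gap
  gcongr

lemma one_le_coefK {x y : X} {r R : ℝ} : 1 ≤ coefK μ lam x r y R := le_self_add

variable (hlam : IsDominatingFunction μ lam)
include hlam

lemma IsDominatingFunction.measure_ball_lt_top (x : X) (r : ℝ) : μ (ball x r) < ∞ := by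
  rcases le_or_gt r 0 with h | h
  · simp [ball_eq_empty.2 h]
  · exact (hlam.measure_ball_le x r h).trans_lt ENNReal.ofReal_lt_top

lemma IsDominatingFunction.isLocallyFiniteMeasure : IsLocallyFiniteMeasure μ :=
  ⟨fun x => ⟨ball x 1, ball_mem_nhds x one_pos, hlam.measure_ball_lt_top x 1⟩⟩

lemma IsDominatingFunction.exists_const : ∃ c : ℝ, 1 ≤ c ∧
    (∀ (n : ℕ) (x : X) (r : ℝ), 0 < r → lam x (2 ^ n * r) ≤ c ^ n * lam x r) ∧
    (∀ (x y : X) (r : ℝ), 0 < r → dist x y ≤ r → lam x r ≤ c * lam y r) := by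
  obtain ⟨C, hC, h1, h2⟩ := hlam.doubling
  refine ⟨max C 1, le_max_right _ _, fun n => ?_, fun x y r hr h => ?_⟩
  · induction n with
    | zero => intro x r hr; simp
    | succ n ih =>
      intro x r hr
      have h3 := h1 x (2 ^ (n + 1) * r) (by positivity)
      have h4 := ih x r hr
      have e : (2 : ℝ) ^ (n + 1) * r / 2 = 2 ^ n * r := by ring
      rw [e] at h3
      have p := hlam.pos x (2 ^ n * r) (by positivity)
      calc lam x (2 ^ (n + 1) * r) ≤ C * lam x (2 ^ n * r) := h3
        _ ≤ max C 1 * lam x (2 ^ n * r) := by gcongr; exact le_max_left _ _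
        _ ≤ max C 1 * (max C 1 ^ n * lam x r) := by gcongr
        _ = _ := by ring
  · have p := hlam.pos y r hr
    exact (h2 x y r hr h).trans (by gcongr; exact le_max_left _ _)

lemma IsDominatingFunction.gap_le_mul [OpensMeasurableSpace X] {x : X} {r R : ℝ} (hr : 0 < r) :
    gap μ lam x r R ≤ ENNReal.ofReal (1 / lam x r) * μ (ball x R) := by
  unfold gap
  calc _ ≤ ∫⁻ z in ball x R \ ball x r, ENNReal.ofReal (1 / lam x r) ∂μ := by
        refine setLIntegral_mono' (measurableSet_ball.diff measurableSet_ball) fun z hz => ?_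
        have h1 : r ≤ dist z x := by simpa using hz.2
        have := hlam.pos x r hr
        have := hlam.mono x r _ hr h1
        exact ENNReal.ofReal_le_ofReal (by gcongr)
    _ = ENNReal.ofReal (1 / lam x r) * μ (ball x R \ ball x r) := by simp
    _ ≤ _ := by gcongr; exact sdiff_subset

lemma IsDominatingFunction.coefK_lt_top [OpensMeasurableSpace X] {x y : X} {r R : ℝ}
    (hr : 0 < r) : coefK μ lam x r y R < ∞ := by
  refine (coefK_le_one_add_gap (R' := 2 * R + dist y x)
    (ball_subset_ball' le_rfl)).trans_lt ?_
  refine ENNReal.add_lt_top.2 ⟨by simp, (hlam.gap_le_mul hr).trans_lt ?_⟩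
  exact ENNReal.mul_lt_top ENNReal.ofReal_lt_top (hlam.measure_ball_lt_top _ _)

/-- A radius comparison: gaps between comparable radii are bounded. -/
lemma IsDominatingFunction.exists_gap_le [OpensMeasurableSpace X] (M : ℝ) : ∃ C : ℝ≥0,
    ∀ (x : X) (r : ℝ), 0 < r → gap μ lam x r (M * r) ≤ C := by
  obtain ⟨c, hc, h1, -⟩ := hlam.exists_const
  obtain ⟨n, hn⟩ := pow_unbounded_of_one_lt M one_lt_two
  refine ⟨(c ^ n).toNNReal, fun x r hr => ?_⟩
  calc gap μ lam x r (M * r) ≤ gap μ lam x r (2 ^ n * r) := gap_mono le_rfl (by gcongr)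
    _ ≤ ENNReal.ofReal (1 / lam x r) * ENNReal.ofReal (lam x (2 ^ n * r)) :=
        (hlam.gap_le_mul hr).trans (by gcongr; exact hlam.measure_ball_le _ _ (by positivity))
    _ = ENNReal.ofReal (1 / lam x r * lam x (2 ^ n * r)) := by
        rw [ENNReal.ofReal_mul]; exact (one_div_pos.2 (hlam.pos x r hr)).le
    _ ≤ ENNReal.ofReal (c ^ n) := by
        refine ENNReal.ofReal_le_ofReal ?_
        have := hlam.pos x r hr
        rw [one_div, inv_mul_le_iff₀ this]
        linarith [h1 n x r hr]
    _ = _ := rfl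

end Basics


/-! ### Doubling balls: concentric ones at bounded distance, and arbitrarily small ones almost
everywhere. -/

section Doubling

variable {X : Type*} [MetricSpace X] [MeasurableSpace X] {μ : Measure X} {lam : X → ℝ → ℝ}

/-- The ball `B = ball x r` satisfies `μ(D B) ≤ β μ(B)`. -/
def DoublingBall (μ : Measure X) (D : ℝ) (β : ℝ≥0) (x : X) (r : ℝ) : Prop :=
  μ (ball x (D * r)) ≤ β * μ (ball x r)

/-- Every ball of positive measure has a concentric doubling dilation at bounded distance, and
almost every point is the centre of arbitrarily small doubling balls. -/
structure DoublingData (μ : Measure X) (lam : X → ℝ → ℝ) (D : ℝ) (β K : ℝ≥0)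
    (up : X → ℝ → ℝ) : Prop where
  one_le_beta : 1 ≤ β
  le_up : ∀ x r, 0 < r → μ (ball x r) ≠ 0 → D * r ≤ up x r
  doubling_up : ∀ x r, 0 < r → μ (ball x r) ≠ 0 → DoublingBall μ D β x (up x r)
  gap_up : ∀ x r, 0 < r → μ (ball x r) ≠ 0 → gap μ lam x r (32 * up x r) ≤ K
  ae_small : ∀ᵐ x ∂μ, ∀ ε > 0, ∃ r, 0 < r ∧ r < ε ∧
    μ (ball x (D * r)) ≤ β * μ (ball x (r / 2))

variable [OpensMeasurableSpace X] (hlam : IsDominatingFunction μ lam)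
include hlam

/-- Each failure of doubling multiplies the measure by more than `β ≥ 2 c^d`, whereas `lam` gains at
most `c^d`. Hence the innermost annulus before `n` failures contributes at most `c^d / 2^n`, and the
contributions form a geometric series. The induction peels off the innermost annulus. -/
lemma IsDominatingFunction.gap_le_of_not_doubling {c : ℝ} {d : ℕ} {β : ℝ≥0} (hc : 1 ≤ c)
    (hc1 : ∀ (n : ℕ) (x : X) (r : ℝ), 0 < r → lam x (2 ^ n * r) ≤ c ^ n * lam x r)
    (hβ : 2 * c ^ d ≤ β) (n : ℕ) (x : X) (r : ℝ) (hr : 0 < r)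
    (h : ∀ i : ℕ, 1 ≤ i → i < n → ¬ DoublingBall μ (2 ^ d) β x ((2 ^ d) ^ i * r)) :
    gap μ lam x r ((2 ^ d) ^ n * r) ≤ ENNReal.ofReal (2 * c ^ d * (1 - 1 / 2 ^ n)) := by
  induction n generalizing r with
  | zero => simp [gap]
  | succ n ih =>
    have hstep := ih ((2 ^ d) * r) (by positivity) (fun i h1 h2 => by
      have := h (i + 1) (by omega) (by omega)
      rwa [show ((2 : ℝ) ^ d) ^ (i + 1) * r = (2 ^ d) ^ i * (2 ^ d * r) by ring] at this)
    rw [show ((2 : ℝ) ^ d) ^ n * (2 ^ d * r) = (2 ^ d) ^ (n + 1) * r by ring] at hstep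
    have hmeas : ∀ i : ℕ, i ≤ n → (β : ℝ≥0∞) ^ i * μ (ball x (2 ^ d * r)) ≤
        μ (ball x ((2 ^ d) ^ (i + 1) * r)) := by
      intro i hi
      induction i with
      | zero => simp
      | succ i ihi =>
        have h1 := h (i + 1) (by omega) (by omega)
        unfold DoublingBall at h1
        rw [not_le] at h1
        calc (β : ℝ≥0∞) ^ (i + 1) * μ (ball x (2 ^ d * r))
            = β * (β ^ i * μ (ball x (2 ^ d * r))) := by ring
          _ ≤ β * μ (ball x ((2 ^ d) ^ (i + 1) * r)) := by gcongr; exact ihi (by omega)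
          _ ≤ _ := h1.le
          _ = _ := by congr 2; ring
    have hpos : 0 < lam x r := hlam.pos x r hr
    have hc0 : 0 < c := by linarith
    have key : gap μ lam x r (2 ^ d * r) ≤ ENNReal.ofReal (c ^ d * (1 / 2 ^ n)) := by
      refine (hlam.gap_le_mul hr).trans ?_
      have h2 := (hmeas n le_rfl).trans (hlam.measure_ball_le x _ (by positivity))
      have h3 : lam x ((2 ^ d) ^ (n + 1) * r) ≤ (c ^ d) ^ (n + 1) * lam x r := by
        rw [← pow_mul, ← pow_mul]; exact hc1 _ x r hr
      have hβ0 : (0 : ℝ) < β := lt_of_lt_of_le (by positivity) hβ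
      have hlt := hlam.measure_ball_lt_top x (2 ^ d * r)
      rw [← ENNReal.ofReal_toReal hlt.ne] at h2 ⊢
      rw [← ENNReal.ofReal_coe_nnreal, ← ENNReal.ofReal_pow hβ0.le,
        ← ENNReal.ofReal_mul (by positivity),
        ENNReal.ofReal_le_ofReal_iff (hlam.pos _ _ (by positivity)).le] at h2
      rw [← ENNReal.ofReal_mul (by positivity)]
      refine ENNReal.ofReal_le_ofReal ?_
      set m := (μ (ball x (2 ^ d * r))).toReal
      have h4 : (2 * c ^ d) ^ n * m ≤ (c ^ d) ^ (n + 1) * lam x r := by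
        refine le_trans ?_ (h2.trans h3)
        gcongr
      have h5 : (c ^ d) ^ n * (2 ^ n * m) ≤ (c ^ d) ^ n * (c ^ d * lam x r) := by
        calc _ = (2 * c ^ d) ^ n * m := by ring
          _ ≤ _ := h4
          _ = _ := by ring
      have h6 := le_of_mul_le_mul_left h5 (by positivity)
      rw [one_div, inv_mul_le_iff₀ hpos, mul_one_div, mul_div_assoc', le_div_iff₀ (by positivity)]
      linarith
    refine gap_le_add.trans ((add_le_add key hstep).trans ?_)
    rw [← ENNReal.ofReal_add (by positivity)]
    · refine ENNReal.ofReal_le_ofReal (le_of_eq ?_)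
      rw [pow_succ]; field_simp; ring
    · have : (1 : ℝ) / 2 ^ n ≤ 1 := by
        rw [div_le_one (by positivity)]; exact one_le_pow₀ (by norm_num)
      have : 0 ≤ 1 - (1 : ℝ) / 2 ^ n := by linarith
      positivity

-- If no dilate were doubling, the measure would grow like `(2 c^d)^n`, which outruns the bound
-- `(c^d)^(n+1) * lam x r`.
omit [OpensMeasurableSpace X] in
lemma IsDominatingFunction.exists_doublingBall {c : ℝ} {d : ℕ} {β : ℝ≥0} (hc : 1 ≤ c)
    (hc1 : ∀ (n : ℕ) (x : X) (r : ℝ), 0 < r → lam x (2 ^ n * r) ≤ c ^ n * lam x r)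
    (hβ : 2 * c ^ d ≤ β) (x : X) (r : ℝ) (hr : 0 < r) (hμ : μ (ball x r) ≠ 0) :
    ∃ i : ℕ, 1 ≤ i ∧ DoublingBall μ (2 ^ d) β x ((2 ^ d) ^ i * r) := by
  by_contra! h
  have hmeas : ∀ i : ℕ, (β : ℝ≥0∞) ^ i * μ (ball x (2 ^ d * r)) ≤
      μ (ball x ((2 ^ d) ^ (i + 1) * r)) := by
    intro i
    induction i with
    | zero => simp
    | succ i ihi =>
      have h1 := h (i + 1) (by omega)
      unfold DoublingBall at h1
      rw [not_le] at h1
      calc (β : ℝ≥0∞) ^ (i + 1) * μ (ball x (2 ^ d * r))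
          = β * (β ^ i * μ (ball x (2 ^ d * r))) := by ring
        _ ≤ β * μ (ball x ((2 ^ d) ^ (i + 1) * r)) := by gcongr
        _ ≤ _ := h1.le
        _ = _ := by congr 2; ring
  have hlt := hlam.measure_ball_lt_top x (2 ^ d * r)
  have hne : μ (ball x (2 ^ d * r)) ≠ 0 := by
    intro h0
    refine hμ (measure_mono_null (ball_subset_ball ?_) h0)
    have : (1 : ℝ) ≤ 2 ^ d := one_le_pow₀ (by norm_num)
    nlinarith
  have hm : 0 < (μ (ball x (2 ^ d * r))).toReal := ENNReal.toReal_pos hne hlt.ne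
  have hpos : 0 < lam x r := hlam.pos x r hr
  have hc0 : 0 < c := by linarith
  have hβ0 : (0 : ℝ) < β := lt_of_lt_of_le (by positivity) hβ
  obtain ⟨n, hn⟩ := pow_unbounded_of_one_lt
    (c ^ d * lam x r / (μ (ball x (2 ^ d * r))).toReal) one_lt_two
  have h2 := (hmeas n).trans (hlam.measure_ball_le x _ (by positivity))
  have h3 : lam x ((2 ^ d) ^ (n + 1) * r) ≤ (c ^ d) ^ (n + 1) * lam x r := by
    rw [← pow_mul, ← pow_mul]; exact hc1 _ x r hr
  rw [← ENNReal.ofReal_toReal hlt.ne] at h2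
  rw [← ENNReal.ofReal_coe_nnreal, ← ENNReal.ofReal_pow hβ0.le,
    ← ENNReal.ofReal_mul (by positivity),
    ENNReal.ofReal_le_ofReal_iff (hlam.pos _ _ (by positivity)).le] at h2
  set m := (μ (ball x (2 ^ d * r))).toReal
  have h4 : (2 * c ^ d) ^ n * m ≤ (c ^ d) ^ (n + 1) * lam x r := by
    refine le_trans ?_ (h2.trans h3)
    gcongr
  have h5 : (c ^ d) ^ n * (2 ^ n * m) ≤ (c ^ d) ^ n * (c ^ d * lam x r) := by
    calc _ = (2 * c ^ d) ^ n * m := by ring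
      _ ≤ _ := h4
      _ = _ := by ring
  have h6 := le_of_mul_le_mul_left h5 (by positivity)
  rw [div_lt_iff₀ hm] at hn
  linarith

-- Around a point with no doubling ball of radius at most `δ`, balls of radius `δ / 2^(dj)` have
-- measure at most `β^{-j} M`. About `N^{dj}` balls of that scale cover a bounded set, and `β ≥ 2
-- N^d` makes the total measure of such points at most a constant times `2^{-j}`.
omit [OpensMeasurableSpace X] in
lemma IsDominatingFunction.ae_frequently_doublingBall {N d : ℕ} {β : ℝ≥0} (hN1 : 1 ≤ N)
    (hN : ∀ (d : ℕ) (x : X) (r : ℝ), 0 < r →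
      ∃ t : Finset X, t.card ≤ N ^ d ∧ ball x r ⊆ ⋃ y ∈ t, ball y (r / 2 ^ d))
    (hβ : 2 * (N : ℝ≥0) ^ d ≤ β) :
    ∀ᵐ x ∂μ, ∀ ε > 0, ∃ r, 0 < r ∧ r < ε ∧ DoublingBall μ (2 ^ d) β x r := by
  rcases isEmpty_or_nonempty X with hX | ⟨⟨x₀⟩⟩
  · exact Eventually.of_forall fun x => (hX.false x).elim
  have hβ0 : (0 : ℝ≥0) < β := lt_of_lt_of_le (by positivity) hβ
  set Bad : ℕ → ℕ → Set X := fun n m => {x ∈ ball x₀ (n + 1 : ℝ) |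
    ∀ r : ℝ, 0 < r → r ≤ 1 / 2 ^ m → ¬ DoublingBall μ (2 ^ d) β x r}
  have hBad : ∀ n m, μ (Bad n m) = 0 := by
    intro n m
    set δ : ℝ := 1 / 2 ^ m
    have hδ : 0 < δ := by positivity
    set M := μ (ball x₀ (n + 1 + δ))
    have hM : M < ∞ := hlam.measure_ball_lt_top _ _
    -- The `e` additional halvings make twice the covering radius at most `δ / (2^d)^j`, so that a
    -- covering ball meeting the bad set lies in a ball centred at a bad point.
    obtain ⟨e, he⟩ := pow_unbounded_of_one_lt ((n + 1 : ℝ) * 2 / δ) one_lt_two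
    have small : ∀ z ∈ Bad n m, ∀ j : ℕ,
        (β : ℝ≥0∞) ^ j * μ (ball z (δ / (2 ^ d) ^ j)) ≤ M := by
      intro z hz j
      induction j with
      | zero =>
        simp only [pow_zero, one_mul, div_one]
        refine measure_mono (ball_subset_ball' ?_)
        have := mem_ball.1 hz.1
        linarith
      | succ j ih =>
        have h1 := hz.2 (δ / (2 ^ d) ^ (j + 1)) (by positivity)
          (div_le_self hδ.le (one_le_pow₀ (one_le_pow₀ (by norm_num))))
        unfold DoublingBall at h1
        rw [not_le] at h1
        refine le_trans ?_ ih
        rw [pow_succ, mul_assoc]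
        gcongr
        refine h1.le.trans (le_of_eq ?_)
        congr 2
        rw [pow_succ]; field_simp
    have bound : ∀ j : ℕ, μ (Bad n m) ≤ (N : ℝ≥0∞) ^ e * M * (1 / 2) ^ j := by
      intro j
      classical
      obtain ⟨t, ht, hcov⟩ := hN (d * j + e) x₀ (n + 1) (by positivity)
      have hsub : Bad n m ⊆ ⋃ y ∈ t, (ball y ((n + 1 : ℝ) / 2 ^ (d * j + e)) ∩ Bad n m) := by
        intro z hz
        obtain ⟨y, hy, hzy⟩ := mem_iUnion₂.1 (hcov hz.1)
        exact mem_iUnion₂.2 ⟨y, hy, hzy, hz⟩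
      have each : ∀ y ∈ t, μ (ball y ((n + 1 : ℝ) / 2 ^ (d * j + e)) ∩ Bad n m) ≤
          ((β : ℝ≥0∞) ^ j)⁻¹ * M := by
        intro y _
        rcases (ball y ((n + 1 : ℝ) / 2 ^ (d * j + e)) ∩ Bad n m).eq_empty_or_nonempty with h0 | h0
        · simp [h0]
        obtain ⟨z, hz1, hz2⟩ := h0
        have h3 := small z hz2 j
        rw [← ENNReal.div_eq_inv_mul, ENNReal.le_div_iff_mul_le (by simp [hβ0.ne'])
          (by simp), mul_comm]
        refine le_trans ?_ h3
        gcongr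
        refine inter_subset_left.trans (ball_subset_ball' ?_)
        have h4 : (n + 1 : ℝ) * 2 / 2 ^ (d * j + e) ≤ δ / (2 ^ d) ^ j := by
          rw [div_lt_iff₀ hδ] at he
          rw [div_le_div_iff₀ (by positivity) (by positivity), pow_add, pow_mul]
          have : (0 : ℝ) < (2 ^ d) ^ j := by positivity
          nlinarith
        have h5 : dist y z < (n + 1 : ℝ) / 2 ^ (d * j + e) := by
          rw [dist_comm]; exact mem_ball.1 hz1
        have h6 : (n + 1 : ℝ) * 2 / 2 ^ (d * j + e) = (n + 1 : ℝ) / 2 ^ (d * j + e) +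
          (n + 1 : ℝ) / 2 ^ (d * j + e) := by ring
        linarith
      calc μ (Bad n m) ≤ ∑ y ∈ t, μ (ball y ((n + 1 : ℝ) / 2 ^ (d * j + e)) ∩ Bad n m) :=
            (measure_mono hsub).trans (measure_biUnion_finset_le _ _)
        _ ≤ ∑ y ∈ t, ((β : ℝ≥0∞) ^ j)⁻¹ * M := Finset.sum_le_sum each
        _ = t.card * (((β : ℝ≥0∞) ^ j)⁻¹ * M) := by simp
        _ ≤ ((N ^ (d * j + e) : ℕ) : ℝ≥0∞) * (((β : ℝ≥0∞) ^ j)⁻¹ * M) := by gcongr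
        _ ≤ (N : ℝ≥0∞) ^ (d * j + e) * (((2 * (N : ℝ≥0∞) ^ d) ^ j)⁻¹ * M) := by
            rw [Nat.cast_pow]
            gcongr
            exact_mod_cast hβ
        _ = (N : ℝ≥0∞) ^ e * M * (1 / 2) ^ j := by
            have hN0 : (N : ℝ≥0∞) ≠ 0 := by positivity
            have hNt : ((N : ℝ≥0∞) ^ d) ^ j ≠ ∞ := by simp
            have hN0' : ((N : ℝ≥0∞) ^ d) ^ j ≠ 0 := by positivity
            rw [mul_pow, ENNReal.mul_inv (by simp) (by simp), pow_add, pow_mul, one_div,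
              ENNReal.inv_pow]
            have hcancel := ENNReal.mul_inv_cancel hN0' hNt
            generalize ((N : ℝ≥0∞) ^ d) ^ j = A at *
            generalize ((N : ℝ≥0∞) ^ e) = B at *
            generalize (2⁻¹ : ℝ≥0∞) ^ j = E at *
            calc A * B * (E * A⁻¹ * M) = (A * A⁻¹) * (B * M * E) := by ring
              _ = _ := by rw [hcancel, one_mul]
    have hlim : Tendsto (fun j : ℕ => (N : ℝ≥0∞) ^ e * M * (1 / 2) ^ j) atTop (𝓝 0) := by
      have := ENNReal.Tendsto.const_mul (a := (N : ℝ≥0∞) ^ e * M)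
        (ENNReal.tendsto_pow_atTop_nhds_zero_of_lt_one (r := 1 / 2) (by simp))
        (Or.inr (ENNReal.mul_ne_top (by simp) hM.ne))
      simpa using this
    exact le_antisymm (ge_of_tendsto' hlim bound) bot_le
  have hall : ∀ᵐ x ∂μ, ∀ n m, x ∉ Bad n m := by
    rw [ae_all_iff]; intro n
    rw [ae_all_iff]; intro m
    exact measure_eq_zero_iff_ae_notMem.1 (hBad n m)
  filter_upwards [hall] with x hx ε hε
  obtain ⟨n, hn⟩ := exists_nat_gt (dist x x₀)
  obtain ⟨m, hm⟩ := pow_unbounded_of_one_lt (1 / ε) one_lt_two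
  have h1 := hx n m
  by_contra! h2
  refine h1 ⟨mem_ball.2 (by linarith), fun r hr hrm => h2 r hr (hrm.trans_lt ?_)⟩
  rwa [div_lt_comm₀ (by positivity) hε]

theorem IsDominatingFunction.exists_doublingData (hX : GeometricallyDoubling X) (D₀ : ℝ) :
    ∃ (D : ℝ) (β K : ℝ≥0) (up : X → ℝ → ℝ), D₀ ≤ D ∧ 1 ≤ D ∧ DoublingData μ lam D β K up := by
  classical
  obtain ⟨c, hc, hc1, -⟩ := hlam.exists_const
  obtain ⟨N, hN1, hN⟩ := hX.exists_iterate
  obtain ⟨d, hd⟩ := pow_unbounded_of_one_lt D₀ one_lt_two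
  -- The first entry beats the growth of `lam`, the second the covering numbers. The exponent is `d
  -- + 1` because the small doubling balls are to be compared with their halves.
  set β : ℝ≥0 := max (2 * c ^ d).toNNReal (2 * (N : ℝ≥0) ^ (d + 1))
  have hβ1 : 2 * c ^ d ≤ β := (Real.le_coe_toNNReal _).trans (by
    exact_mod_cast le_max_left _ _)
  have hβ2 : 2 * (N : ℝ≥0) ^ (d + 1) ≤ β := le_max_right _ _
  -- The factor `32` leaves room for the enlarged common balls of `exists_coefK_le`.
  obtain ⟨C32, hC32⟩ := hlam.exists_gap_le 32
  have hex : ∀ (x : X) (r : ℝ), ∃ R : ℝ, 0 < r → μ (ball x r) ≠ 0 → 2 ^ d * r ≤ R ∧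
      DoublingBall μ (2 ^ d) β x R ∧ gap μ lam x r (32 * R) ≤ (2 * c ^ d).toNNReal + C32 := by
    intro x r
    by_cases h : 0 < r ∧ μ (ball x r) ≠ 0
    · obtain ⟨hr, hμ⟩ := h
      -- The first doubling dilate is taken: its minimality is the hypothesis of
      -- `gap_le_of_not_doubling`.
      have hP := hlam.exists_doublingBall hc hc1 hβ1 x r hr hμ
      refine ⟨(2 ^ d) ^ (Nat.find hP) * r, fun _ _ => ?_⟩
      obtain ⟨h1, h2⟩ := Nat.find_spec hP
      refine ⟨?_, h2, ?_⟩
      · gcongr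
        exact le_self_pow₀ (one_le_pow₀ (by norm_num)) (by omega)
      · refine (gap_le_add (s := (2 ^ d) ^ (Nat.find hP) * r)).trans (add_le_add ?_ ?_)
        · refine (hlam.gap_le_of_not_doubling hc hc1 hβ1 (Nat.find hP) x r hr
            fun i hi1 hi2 hi => Nat.find_min hP hi2 ⟨hi1, hi⟩).trans ?_
          refine ENNReal.ofReal_le_ofReal ?_
          have : (0 : ℝ) < 1 / 2 ^ (Nat.find hP) := by positivity
          have : 0 < 2 * c ^ d := by positivity
          nlinarith
        · exact hC32 x _ (by positivity)
    · exact ⟨0, fun h1 h2 => (h ⟨h1, h2⟩).elim⟩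
  choose up hup using hex
  refine ⟨2 ^ d, β, (2 * c ^ d).toNNReal + C32, up, hd.le, one_le_pow₀
      (by norm_num), ⟨?_, ?_, ?_, ?_, ?_⟩⟩
  · refine le_trans ?_ hβ2
    have : (1 : ℝ≥0) ≤ (N : ℝ≥0) ^ (d + 1) := one_le_pow₀ (by exact_mod_cast hN1)
    calc (1 : ℝ≥0) ≤ 2 * 1 := by norm_num
      _ ≤ _ := by gcongr
  · exact fun x r hr h => (hup x r hr h).1
  · exact fun x r hr h => (hup x r hr h).2.1
  · exact fun x r hr h => by simpa using (hup x r hr h).2.2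
  · filter_upwards [hlam.ae_frequently_doublingBall (d := d + 1) hN1 hN hβ2] with x hx ε hε
    -- Doubling by `2^(d+1)` at radius `r` is doubling by `2^d` at radius `2r` against the half
    -- ball. The spare factor lets closed balls be inserted in between.
    obtain ⟨r, hr, hrε, h⟩ := hx (ε / 2) (by positivity)
    refine ⟨2 * r, by positivity, by linarith, ?_⟩
    unfold DoublingBall at h
    convert h using 3
    · ring
    · ring_nf

end Doubling


/-! ### Vitali coverings: weak type bounds and differentiation along doubling balls. -/

section WeakType

variable {X : Type*} [MetricSpace X] [MeasurableSpace X] {μ : Measure X}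

/-- The union of all balls `ball c r` with `P c r`. -/
def ballUnion (P : X → ℝ → Prop) : Set X := {x | ∃ c r, P c r ∧ x ∈ ball c r}

omit [MeasurableSpace X] in
lemma ballUnion_mono {P Q : X → ℝ → Prop} (h : ∀ c r, P c r → Q c r) :
    ballUnion P ⊆ ballUnion Q := fun _ ⟨c, r, hP, hx⟩ => ⟨c, r, h c r hP, hx⟩

omit [MeasurableSpace X] in
lemma isOpen_ballUnion (P : X → ℝ → Prop) : IsOpen (ballUnion P) := by
  have : ballUnion P = ⋃ (c : X) (r : ℝ) (_ : P c r), ball c r := by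
    ext x; simp [ballUnion]
  rw [this]
  exact isOpen_iUnion fun c => isOpen_iUnion fun r => isOpen_iUnion fun _ => isOpen_ball

omit [MeasurableSpace X] in
lemma countable_of_disjoint_balls [SecondCountableTopology X] {ι : Type*} {u : Set ι} {x : ι → X}
    {r : ι → ℝ} (hr : ∀ a ∈ u, 0 < r a) (hd : u.PairwiseDisjoint fun a => ball (x a) (r a)) :
    u.Countable :=
  hd.countable_of_isOpen (fun _ _ => isOpen_ball) fun a ha => nonempty_ball.2 (hr a ha)

lemma tsum_setLIntegral_le_of_disjoint [OpensMeasurableSpace X] {ι : Type*} {u : Set ι}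
    (hu : u.Countable) {B : ι → Set X} (hB : ∀ a ∈ u, MeasurableSet (B a))
    (hd : u.PairwiseDisjoint B) (w : X → ℝ≥0∞) :
    ∑' a : u, ∫⁻ z in B a, w z ∂μ ≤ ∫⁻ z, w z ∂μ := by
  rw [← lintegral_biUnion hu hB hd]
  exact setLIntegral_le_lintegral _ _

variable [OpensMeasurableSpace X]

/-- A disjoint subfamily covers the union after dilation by `6`. This explains the dilated ball on
the left of the hypothesis, which replaces doubling of `μ`. -/
lemma measure_ballUnion_le_of_bounded [SecondCountableTopology X] {P : X → ℝ → Prop} {R : ℝ}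
    {κ : ℝ≥0∞} {w : X → ℝ≥0∞}
    (hP : ∀ c r, P c r → 0 < r ∧ r ≤ R ∧ κ * μ (ball c (6 * r)) ≤ ∫⁻ z in ball c r, w z ∂μ) :
    κ * μ (ballUnion P) ≤ ∫⁻ z, w z ∂μ := by
  obtain ⟨u, hut, hd, hcov⟩ := Vitali.exists_disjoint_subfamily_covering_enlargement_ball
    {a : X × ℝ | P a.1 a.2} Prod.fst Prod.snd R (fun a ha => (hP _ _ ha).2.1) 6 (by norm_num)
  have hu : u.Countable := countable_of_disjoint_balls (fun a ha => (hP _ _ (hut ha)).1) hd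
  have hsub : ballUnion P ⊆ ⋃ a ∈ u, ball a.1 (6 * a.2) := by
    rintro x ⟨c, r, hp, hx⟩
    obtain ⟨b, hb, hsub⟩ := hcov (c, r) hp
    exact mem_iUnion₂.2 ⟨b, hb, hsub hx⟩
  calc κ * μ (ballUnion P) ≤ κ * ∑' a : u, μ (ball a.1.1 (6 * a.1.2)) := by
        gcongr; exact (measure_mono hsub).trans (measure_biUnion_le μ hu _)
    _ = ∑' a : u, κ * μ (ball a.1.1 (6 * a.1.2)) := ENNReal.tsum_mul_left.symm
    _ ≤ ∑' a : u, ∫⁻ z in ball a.1.1 a.1.2, w z ∂μ :=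
        ENNReal.tsum_le_tsum fun a => (hP _ _ (hut a.2)).2.2
    _ ≤ _ := tsum_setLIntegral_le_of_disjoint hu (B := fun a : X × ℝ => ball a.1 a.2)
        (fun _ _ => measurableSet_ball) hd w

/-- The weak type `(1, 1)` inequality for unions of balls selected by a large average. -/
lemma measure_ballUnion_le [SecondCountableTopology X] {P : X → ℝ → Prop}
    {κ : ℝ≥0∞} {w : X → ℝ≥0∞}
    (hP : ∀ c r, P c r → 0 < r ∧ κ * μ (ball c (6 * r)) ≤ ∫⁻ z in ball c r, w z ∂μ) :
    κ * μ (ballUnion P) ≤ ∫⁻ z, w z ∂μ := by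
  -- The bound for radii at most `n` has a constant independent of `n`, so continuity from below
  -- removes the restriction.
  have h1 : ballUnion P = ⋃ n : ℕ, ballUnion fun c r => P c r ∧ r ≤ n := by
    ext x
    constructor
    · rintro ⟨c, r, hp, hx⟩
      obtain ⟨n, hn⟩ := exists_nat_ge r
      exact mem_iUnion.2 ⟨n, c, r, ⟨hp, hn⟩, hx⟩
    · intro hx
      obtain ⟨n, c, r, ⟨hp, -⟩, hx⟩ := mem_iUnion.1 hx
      exact ⟨c, r, hp, hx⟩
  have h2 : Monotone fun n : ℕ => ballUnion fun c r => P c r ∧ r ≤ n := by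
    intro m n hmn
    exact ballUnion_mono fun c r h => ⟨h.1, h.2.trans (by exact_mod_cast hmn)⟩
  rw [h1, h2.measure_iUnion, ENNReal.mul_iSup]
  exact iSup_le fun n => measure_ballUnion_le_of_bounded (R := n) fun c r h =>
    ⟨(hP c r h.1).1, h.2, (hP c r h.1).2⟩

/-- A differentiation theorem along small doubling balls. -/
lemma ae_le_of_small_balls [BorelSpace X] [SecondCountableTopology X] [IsLocallyFiniteMeasure μ]
    [SigmaFinite μ] {E : Set X} (hE : MeasurableSet E) {w : X → ℝ≥0∞}
    (hw : Measurable w) {C t : ℝ≥0}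
    (h : ∀ᵐ x ∂μ, x ∈ E → ∀ ε > 0, ∃ r, 0 < r ∧ r < ε ∧
      μ (closedBall x (3 * r)) ≤ C * μ (closedBall x r) ∧
      ∫⁻ z in closedBall x r, w z ∂μ ≤ t * μ (closedBall x r)) :
    ∀ᵐ x ∂μ, x ∈ E → w x ≤ t := by
  rw [← ae_restrict_iff' hE]
  refine ae_le_of_forall_setLIntegral_le_of_sigmaFinite (μ := μ.restrict E) hw
    fun s hs hsE => ?_
  rw [Measure.restrict_restrict hs, lintegral_const, Measure.restrict_apply_univ]
  rw [Measure.restrict_apply hs] at hsE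
  set A : Set X := {x | x ∈ E → ∀ ε > 0, ∃ r, 0 < r ∧ r < ε ∧
      μ (closedBall x (3 * r)) ≤ C * μ (closedBall x r) ∧
      ∫⁻ z in closedBall x r, w z ∂μ ≤ t * μ (closedBall x r)}
  have hA : μ Aᶜ = 0 := h
  refine ENNReal.le_of_forall_pos_le_add fun ε hε _ => ?_
  have hδ : (ε / (t + 1) : ℝ≥0∞) ≠ 0 := by
    refine (ENNReal.div_pos (by simpa using hε.ne') (by simp)).ne'
  obtain ⟨U, hsU, hU, hμU⟩ := (s ∩ E).exists_isOpen_le_add μ hδ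
  -- The measure-theoretic Vitali theorem only asks that the selected balls be doubling. Keeping
  -- them inside `U` makes their total measure exceed that of `s ∩ E` by an arbitrarily small
  -- amount.
  obtain ⟨v, hv, hvc, hvd, hvcov⟩ := Vitali.exists_disjoint_covering_ae μ ((s ∩ E) ∩ A)
    {a : X × ℝ | 0 < a.2 ∧ closedBall a.1 a.2 ⊆ U ∧
      μ (closedBall a.1 (3 * a.2)) ≤ C * μ (closedBall a.1 a.2) ∧
      ∫⁻ z in closedBall a.1 a.2, w z ∂μ ≤ t * μ (closedBall a.1 a.2)} C Prod.snd Prod.fst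
    (fun a => closedBall a.1 a.2) (fun a _ => Subset.rfl) (fun a ha => ha.2.2.1)
    (fun a ha => ⟨a.1, ball_subset_interior_closedBall (mem_ball_self ha.1)⟩)
    (fun a _ => isClosed_closedBall) (by
      rintro x ⟨hx, hxA⟩ ε' hε'
      obtain ⟨ρ, hρ, hρU⟩ := Metric.isOpen_iff.1 hU x (hsU hx)
      obtain ⟨r, hr, hrε, h1, h2⟩ := hxA hx.2 (min ε' ρ) (lt_min hε' hρ)
      refine ⟨(x, r), ⟨hr, (closedBall_subset_ball ?_).trans hρU, h1, h2⟩,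
        hrε.le.trans (min_le_left _ _), rfl⟩
      exact hrε.trans_le (min_le_right _ _))
  have hcov : μ ((s ∩ E) \ ⋃ a ∈ v, closedBall a.1 a.2) = 0 := by
    refine measure_mono_null (t := ((s ∩ E) ∩ A) \ (⋃ a ∈ v, closedBall a.1 a.2) ∪ Aᶜ) ?_ ?_
    · intro x hx
      by_cases hxA : x ∈ A
      · exact Or.inl ⟨⟨hx.1, hxA⟩, hx.2⟩
      · exact Or.inr hxA
    · exact measure_union_null hvcov hA
  calc ∫⁻ z in s ∩ E, w z ∂μ ≤ ∫⁻ z in ⋃ a ∈ v, closedBall a.1 a.2, w z ∂μ :=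
        lintegral_mono' (Measure.restrict_mono_ae (ae_le_set.2 hcov)) le_rfl
    _ = ∑' a : v, ∫⁻ z in closedBall a.1.1 a.1.2, w z ∂μ :=
        lintegral_biUnion hvc (fun _ _ => isClosed_closedBall.measurableSet) hvd _
    _ ≤ ∑' a : v, t * μ (closedBall a.1.1 a.1.2) :=
        ENNReal.tsum_le_tsum fun a => (hv a.2).2.2.2
    _ = t * μ (⋃ a ∈ v, closedBall a.1 a.2) := by
        rw [ENNReal.tsum_mul_left, measure_biUnion hvc hvd
          (fun _ _ => isClosed_closedBall.measurableSet)]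
    _ ≤ t * μ U := by gcongr; exact iUnion₂_subset fun a ha => (hv ha).2.1
    _ ≤ t * (μ (s ∩ E) + ε / (t + 1)) := by gcongr
    _ ≤ t * μ (s ∩ E) + ε := by
        rw [mul_add]
        gcongr
        rw [← mul_div_assoc]
        refine ENNReal.div_le_of_le_mul ?_
        rw [mul_comm]
        gcongr
        exact le_self_add

end WeakType


/-! ### Series of functions with summable `L^1` norms. -/

section Series

variable {X : Type*} [MeasurableSpace X] {μ : Measure X}

lemma ae_summable_of_tsum_lintegral_ne_top {ι : Type*} [Countable ι] {b : ι → X → ℂ}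
    (hb : ∀ i, AEStronglyMeasurable (b i) μ) (h : ∑' i, ∫⁻ x, ‖b i x‖ₑ ∂μ ≠ ∞) :
    ∀ᵐ x ∂μ, ∑' i, ‖b i x‖ₑ < ∞ ∧ Summable fun i => b i x := by
  rw [← lintegral_tsum fun i => (hb i).enorm] at h
  filter_upwards [ae_lt_top' (AEMeasurable.tsum fun i => (hb i).enorm) h] with x hx
  exact ⟨hx, Summable.of_enorm hx.ne⟩

lemma lintegral_enorm_sub_sum_le {b : ℕ → X → ℂ} (hb : ∀ i, AEStronglyMeasurable (b i) μ)
    {f : X → ℂ} (hf : ∀ᵐ x ∂μ, HasSum (fun i => b i x) (f x)) (n : ℕ) :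
    ∫⁻ x, ‖f x - ∑ i ∈ Finset.range n, b i x‖ₑ ∂μ ≤ ∑' i, ∫⁻ x, ‖b (i + n) x‖ₑ ∂μ := by
  rw [← lintegral_tsum fun i => (hb (i + n)).enorm]
  refine lintegral_mono_ae ?_
  filter_upwards [hf] with x hx
  rw [← hx.tsum_eq, ← hx.summable.sum_add_tsum_nat_add n, add_sub_cancel_left]
  exact enorm_tsum_le_tsum_enorm

lemma tendsto_lintegral_enorm_sub_sum {b : ℕ → X → ℂ} (hb : ∀ i, AEStronglyMeasurable (b i) μ)
    {f : X → ℂ} (hf : ∀ᵐ x ∂μ, HasSum (fun i => b i x) (f x))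
    (h : ∑' i, ∫⁻ x, ‖b i x‖ₑ ∂μ ≠ ∞) :
    Tendsto (fun n => ∫⁻ x, ‖f x - ∑ i ∈ Finset.range n, b i x‖ₑ ∂μ) atTop (𝓝 0) :=
  tendsto_of_tendsto_of_tendsto_of_le_of_le tendsto_const_nhds
    (ENNReal.tendsto_sum_nat_add _ h) (fun _ => zero_le) fun n => lintegral_enorm_sub_sum_le hb hf n

/-- The series converges absolutely almost everywhere, its pointwise sum is also its `L^1` limit,
and `L^1` limits are unique. -/
lemma ae_hasSum_of_tendsto {b : ℕ → X → ℂ} (hb : ∀ i, AEStronglyMeasurable (b i) μ)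
    {f : X → ℂ} (hfm : AEStronglyMeasurable f μ)
    (h : ∑' i, ∫⁻ x, ‖b i x‖ₑ ∂μ ≠ ∞)
    (hf : Tendsto (fun n => ∫⁻ x, ‖f x - ∑ i ∈ Finset.range n, b i x‖ₑ ∂μ) atTop (𝓝 0)) :
    ∀ᵐ x ∂μ, HasSum (fun i => b i x) (f x) := by
  have hs := ae_summable_of_tsum_lintegral_ne_top hb h
  set g : X → ℂ := fun x => ∑' i, b i x
  have hg : ∀ᵐ x ∂μ, HasSum (fun i => b i x) (g x) := by
    filter_upwards [hs] with x hx using hx.2.hasSum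
  have hgm : AEStronglyMeasurable g μ := by
    refine aestronglyMeasurable_of_tendsto_ae atTop
      (f := fun n x => ∑ i ∈ Finset.range n, b i x) (fun n => ?_) ?_
    · exact Finset.aestronglyMeasurable_fun_sum _ fun i _ => hb i
    · filter_upwards [hg] with x hx using hx.tendsto_sum_nat
  have h0 : ∫⁻ x, ‖f x - g x‖ₑ ∂μ = 0 := by
    have hlim := hf.add (tendsto_lintegral_enorm_sub_sum hb hg h)
    rw [add_zero] at hlim
    refine le_antisymm (ge_of_tendsto' hlim fun n => ?_) bot_le
    rw [← lintegral_add_left']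
    · refine lintegral_mono fun x => ?_
      have := enorm_sub_le (a := f x - ∑ i ∈ Finset.range n, b i x)
        (b := g x - ∑ i ∈ Finset.range n, b i x)
      rwa [sub_sub_sub_cancel_right] at this
    · exact (hfm.sub (Finset.aestronglyMeasurable_fun_sum _ fun i _ => hb i)).enorm
  replace h0 := (lintegral_eq_zero_iff' (f := fun x => ‖f x - g x‖ₑ) (hfm.sub hgm).enorm).1 h0
  filter_upwards [h0, hg] with x hx hgx
  have : f x = g x := by simpa [sub_eq_zero] using hx
  rwa [this]

lemma eLpNorm_eq_restrict_of_ae_support {u : X → ℂ} {B : Set X} (hB : MeasurableSet B)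
    (h : ∀ᵐ z ∂μ, z ∉ B → u z = 0) (p : ℝ≥0∞) :
    eLpNorm u p μ = eLpNorm u p (μ.restrict B) := by
  rw [← eLpNorm_indicator_eq_eLpNorm_restrict hB]
  refine eLpNorm_congr_ae ?_
  filter_upwards [h] with z hz
  by_cases hzB : z ∈ B
  · simp [hzB]
  · simp [hzB, hz hzB]

end Series

/-! ### The `H¹` norm: countable subadditivity, homogeneity, and blocks built from bounded
functions. -/

section Hardy

variable {X : Type*} [MetricSpace X] [MeasurableSpace X] {μ : Measure X} {lam : X → ℝ → ℝ}
  {σ : ℝ} {s : ℝ≥0∞}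

/-- The norm of `H¹(μ)`, for functions instead of classes of functions. -/
noncomputable def hNorm (μ : Measure X) (lam : X → ℝ → ℝ) (σ : ℝ) (s : ℝ≥0∞) (u : X → ℂ) : ℝ≥0∞ :=
  ⨅ (f : AEFun ℂ μ) (_ : f =ᵐ[μ] u), hardyNorm μ lam σ s f

lemma hNorm_coe (f : AEFun ℂ μ) : hNorm μ lam σ s f = hardyNorm μ lam σ s f := by
  refine le_antisymm (iInf₂_le f (ae_eq_refl _)) (le_iInf₂ fun g hg => ?_)
  rw [AEEqFun.ext hg]

lemma hNorm_congr {u v : X → ℂ} (h : u =ᵐ[μ] v) : hNorm μ lam σ s u = hNorm μ lam σ s v := by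
  unfold hNorm
  congr! 3 with f
  exact ⟨fun h' => h'.trans h, fun h' => h'.trans h.symm⟩

lemma hNorm_mk {u : X → ℂ} (hu : AEStronglyMeasurable u μ) :
    hNorm μ lam σ s u = hardyNorm μ lam σ s (AEEqFun.mk u hu) := by
  rw [← hNorm_coe, hNorm_congr (AEEqFun.coeFn_mk u hu)]

lemma aestronglyMeasurable_of_hNorm_lt {u : X → ℂ} {C : ℝ≥0∞} (h : hNorm μ lam σ s u < C) :
    AEStronglyMeasurable u μ := by
  simp only [hNorm, iInf_lt_iff] at h
  obtain ⟨f, hf, -⟩ := h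
  exact f.aestronglyMeasurable.congr hf

variable [OpensMeasurableSpace X]

/-- Hölder's inequality on the supporting ball; replacing the ball by its `σ`-dilate and inserting
`K ≥ 1` only enlarges the bound. -/
lemma IsAtomPiece.lintegral_le (hσ : 1 ≤ σ) (hs : 1 ≤ s) {y : X} {R : ℝ} {a : AEFun ℂ μ}
    (h : IsAtomPiece μ lam σ s y R a) : ∫⁻ z, ‖a z‖ₑ ∂μ ≤ 1 := by
  obtain ⟨x, r, hr, -, hsupp, hle⟩ := h
  have hs0 : s ≠ 0 := (zero_lt_one.trans_le hs).ne'
  have he : 0 ≤ 1 - s⁻¹.toReal := by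
    have : s⁻¹.toReal ≤ (1 : ℝ≥0∞).toReal :=
      ENNReal.toReal_mono (by simp) (by rwa [ENNReal.inv_le_one])
    simpa using this
  rw [← eLpNorm_one_eq_lintegral_enorm]
  calc eLpNorm a 1 μ = eLpNorm a 1 (μ.restrict (ball x r)) :=
        eLpNorm_eq_restrict_of_ae_support measurableSet_ball hsupp 1
    _ ≤ eLpNorm a s (μ.restrict (ball x r)) *
        (μ.restrict (ball x r)) univ ^ (1 / (1 : ℝ≥0∞).toReal - 1 / s.toReal) :=
        eLpNorm_le_eLpNorm_mul_rpow_measure_univ hs a.aestronglyMeasurable.restrict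
    _ ≤ eLpNorm a s μ * μ (ball x (σ * r)) ^ (1 - s⁻¹.toReal) := by
        gcongr ?_ * ?_
        · exact eLpNorm_mono_measure _ Measure.restrict_le_self
        · rw [Measure.restrict_apply_univ, ENNReal.toReal_inv]
          simp only [ENNReal.toReal_one, div_one, one_div]
          rw [ENNReal.toReal_inv] at he
          gcongr
          nlinarith
    _ ≤ eLpNorm a s μ * μ (ball x (σ * r)) ^ (1 - s⁻¹.toReal) * coefK μ lam x r y R :=
        le_mul_of_one_le_right zero_le one_le_coefK
    _ ≤ 1 := hle

lemma IsAtomicBlock.lintegral_le (hσ : 1 ≤ σ) (hs : 1 ≤ s) {b : AEFun ℂ μ} {m : ℝ≥0}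
    (h : IsAtomicBlock μ lam σ s b m) : ∫⁻ z, ‖b z‖ₑ ∂μ ≤ m := by
  obtain ⟨y, R, -, -, -, a₁, a₂, k₁, k₂, h1, h2, rfl, rfl⟩ := h
  have e : (k₁ • a₁ + k₂ • a₂ : AEFun ℂ μ) =ᵐ[μ] fun z => k₁ * a₁ z + k₂ * a₂ z := by
    filter_upwards [AEEqFun.coeFn_add (k₁ • a₁) (k₂ • a₂), AEEqFun.coeFn_smul k₁ a₁,
      AEEqFun.coeFn_smul k₂ a₂] with z h1 h2 h3
    rw [h1, Pi.add_apply, h2, h3]; rfl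
  calc ∫⁻ z, ‖(k₁ • a₁ + k₂ • a₂ : AEFun ℂ μ) z‖ₑ ∂μ
      = ∫⁻ z, ‖k₁ * a₁ z + k₂ * a₂ z‖ₑ ∂μ := by
        refine lintegral_congr_ae ?_
        filter_upwards [e] with z hz
        rw [hz]
    _ ≤ ∫⁻ z, (‖k₁‖ₑ * ‖a₁ z‖ₑ + ‖k₂‖ₑ * ‖a₂ z‖ₑ) ∂μ := by
        refine lintegral_mono fun z => ?_
        rw [← enorm_mul, ← enorm_mul]
        exact enorm_add_le _ _
    _ = ‖k₁‖ₑ * ∫⁻ z, ‖a₁ z‖ₑ ∂μ + ‖k₂‖ₑ * ∫⁻ z, ‖a₂ z‖ₑ ∂μ := by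
        rw [lintegral_add_left' (a₁.aestronglyMeasurable.enorm.const_mul _),
          lintegral_const_mul'' _ a₁.aestronglyMeasurable.enorm,
          lintegral_const_mul'' _ a₂.aestronglyMeasurable.enorm]
    _ ≤ ‖k₁‖ₑ * 1 + ‖k₂‖ₑ * 1 := by
        gcongr
        exacts [h1.lintegral_le hσ hs, h2.lintegral_le hσ hs]
    _ = _ := by simp [enorm_eq_nnnorm]

omit [MetricSpace X] [OpensMeasurableSpace X] in
lemma eLpNorm_sub_sum_eq (f : AEFun ℂ μ) (b : ℕ → AEFun ℂ μ) (n : ℕ) :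
    eLpNorm (f - ∑ i ∈ Finset.range n, b i : AEFun ℂ μ) 1 μ =
      ∫⁻ x, ‖f x - ∑ i ∈ Finset.range n, b i x‖ₑ ∂μ := by
  rw [eLpNorm_one_eq_lintegral_enorm]
  refine lintegral_congr_ae ?_
  filter_upwards [AEEqFun.coeFn_sub f (∑ i ∈ Finset.range n, b i),
    AEEqFun.coeFn_fun_finsetSum (Finset.range n) b] with z h1 h2
  rw [h1, Pi.sub_apply, h2]

lemma IsBlockDecomposition.tsum_lintegral_le (hσ : 1 ≤ σ) (hs : 1 ≤ s) {f : AEFun ℂ μ}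
    {b : ℕ → AEFun ℂ μ} {m : ℕ → ℝ≥0} (h : IsBlockDecomposition μ lam σ s f b m) :
    ∑' i, ∫⁻ x, ‖b i x‖ₑ ∂μ ≤ ∑' i, (m i : ℝ≥0∞) :=
  ENNReal.tsum_le_tsum fun i => (h.1 i).lintegral_le hσ hs

lemma IsBlockDecomposition.ae_hasSum (hσ : 1 ≤ σ) (hs : 1 ≤ s) {f : AEFun ℂ μ}
    {b : ℕ → AEFun ℂ μ} {m : ℕ → ℝ≥0} (h : IsBlockDecomposition μ lam σ s f b m)
    (hm : ∑' i, (m i : ℝ≥0∞) ≠ ∞) : ∀ᵐ x ∂μ, HasSum (fun i => b i x) (f x) := by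
  refine ae_hasSum_of_tendsto (fun i => (b i).aestronglyMeasurable) f.aestronglyMeasurable
    (ne_top_of_le_ne_top hm (h.tsum_lintegral_le hσ hs)) ?_
  simpa only [eLpNorm_sub_sum_eq] using h.2.2

omit [OpensMeasurableSpace X] in
lemma exists_decomposition_of_hNorm_lt {u : X → ℂ} {C : ℝ≥0∞} (h : hNorm μ lam σ s u < C) :
    ∃ (f : AEFun ℂ μ) (b : ℕ → AEFun ℂ μ) (m : ℕ → ℝ≥0), f =ᵐ[μ] u ∧
      IsBlockDecomposition μ lam σ s f b m ∧ ∑' i, (m i : ℝ≥0∞) < C := by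
  simp only [hNorm, hardyNorm, iInf_lt_iff] at h
  obtain ⟨f, hf, b, m, hb, hm⟩ := h
  exact ⟨f, b, m, hf, hb, hm⟩

/-- The blocks have integral zero, and the absolute summability of their `L^1` norms allows
integration term by term. -/
lemma integral_eq_zero_of_hNorm_lt_top (hσ : 1 ≤ σ) (hs : 1 ≤ s) {u : X → ℂ}
    (h : hNorm μ lam σ s u < ∞) : ∫ x, u x ∂μ = 0 := by
  obtain ⟨f, b, m, hfu, hb, hm⟩ := exists_decomposition_of_hNorm_lt h
  have hle := ne_top_of_le_ne_top hm.ne (hb.tsum_lintegral_le hσ hs)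
  have hbi : ∀ i, Integrable (b i) μ := fun i =>
    ⟨(b i).aestronglyMeasurable, ((hb.1 i).lintegral_le hσ hs).trans_lt ENNReal.coe_lt_top⟩
  rw [← integral_congr_ae hfu]
  have h1 := integral_tsum (fun i => (b i).aestronglyMeasurable) hle
  rw [integral_congr_ae (g := fun x => ∑' i, b i x)]
  · rw [h1]
    have : ∀ i, ∫ x, b i x ∂μ = 0 := fun i => by
      obtain ⟨_, _, _, _, h0, _⟩ := hb.1 i
      exact h0
    simp [this]
  · filter_upwards [hb.ae_hasSum hσ hs hm.ne] with x h2
    exact h2.tsum_eq.symm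

omit [OpensMeasurableSpace X] in
lemma isAtomPiece_zero (y : X) {R : ℝ} (hR : 0 < R) : IsAtomPiece μ lam σ s y R 0 := by
  refine ⟨y, R, hR, Subset.rfl, ?_, ?_⟩
  · filter_upwards [AEEqFun.coeFn_zero (α := X) (β := ℂ) (μ := μ)] with z hz _
    simp [hz]
  · rw [eLpNorm_congr_ae AEEqFun.coeFn_zero]
    simp

omit [OpensMeasurableSpace X] in
lemma isAtomicBlock_zero (y : X) : IsAtomicBlock μ lam σ s (0 : AEFun ℂ μ) 0 := by
  refine ⟨y, 1, one_pos, ?_, ?_, 0, 0, 0, 0, isAtomPiece_zero y one_pos,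
    isAtomPiece_zero y one_pos, by simp, by simp⟩
  · filter_upwards [AEEqFun.coeFn_zero (α := X) (β := ℂ) (μ := μ)] with z hz _
    simp [hz]
  · rw [integral_congr_ae AEEqFun.coeFn_zero]; simp

/-- The block is completed to a sequence by zero blocks of size zero. -/
lemma hNorm_le_of_isAtomicBlock (hσ : 1 ≤ σ) (hs : 1 ≤ s) {b : AEFun ℂ μ} {m : ℝ≥0}
    (h : IsAtomicBlock μ lam σ s b m) {u : X → ℂ} (hu : b =ᵐ[μ] u) :
    hNorm μ lam σ s u ≤ m := by
  have hX : Nonempty X := ⟨h.choose⟩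
  have y := hX.some
  refine (iInf₂_le b hu).trans ?_
  unfold hardyNorm
  refine (iInf_le_of_le (fun n => if n = 0 then b else 0) (iInf_le_of_le
    (fun n => if n = 0 then m else 0) (iInf_le_of_le ⟨fun i => ?_, ?_, ?_⟩ ?_)))
  · by_cases hi : i = 0
    · simpa [hi] using h
    · simpa [hi] using isAtomicBlock_zero y
  · rw [memLp_one_iff_integrable]
    exact ⟨b.aestronglyMeasurable, (h.lintegral_le hσ hs).trans_lt ENNReal.coe_lt_top⟩
  · refine tendsto_const_nhds.congr' ?_
    filter_upwards [eventually_ge_atTop 1] with n hn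
    have : ∑ i ∈ Finset.range n, (if i = 0 then b else 0) = b := by
      rw [Finset.sum_ite_eq' (Finset.range n) 0 fun _ => b]
      simp; omega
    rw [this, sub_self, eLpNorm_congr_ae AEEqFun.coeFn_zero]
    simp
  · rw [tsum_eq_single 0 (by intro n hn; simp [hn])]
    simp

/-- Countable subadditivity of the `H¹` norm. -/
lemma hNorm_le_tsum [Nonempty X] (hσ : 1 ≤ σ) (hs : 1 ≤ s) {ι : Type*} [Countable ι]
    {v : ι → X → ℂ} {f : X → ℂ} (hfm : AEStronglyMeasurable f μ)
    (hf : ∀ᵐ x ∂μ, HasSum (fun i => v i x) (f x)) :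
    hNorm μ lam σ s f ≤ ∑' i, hNorm μ lam σ s (v i) := by
  rcases isEmpty_or_nonempty ι with hι | hι
  · have h0 : (0 : AEFun ℂ μ) =ᵐ[μ] f := by
      filter_upwards [hf, AEEqFun.coeFn_zero (α := X) (β := ℂ) (μ := μ)] with x hx h0
      rw [h0, ← hx.tsum_eq]; simp
    have := hNorm_le_of_isAtomicBlock hσ hs (isAtomicBlock_zero (lam := lam) (σ := σ) (s := s)
      (Classical.arbitrary X)) h0
    exact (this.trans (by simp)).trans bot_le
  by_cases htop : ∑' i, hNorm μ lam σ s (v i) = ∞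
  · rw [htop]; exact le_top
  have hv : ∀ i, hNorm μ lam σ s (v i) < ∞ := fun i =>
    (ENNReal.ne_top_of_tsum_ne_top htop i).lt_top
  refine ENNReal.le_of_forall_pos_le_add fun ε hε _ => ?_
  obtain ⟨ε', hε', hsum⟩ := ENNReal.exists_pos_sum_of_countable (ε := ε)
    (by simpa using hε.ne') ι
  have hlt : ∀ i, hNorm μ lam σ s (v i) < hNorm μ lam σ s (v i) + ε' i := fun i =>
    ENNReal.lt_add_right (hv i).ne (by simpa using (hε' i).ne')
  choose g b m hg hb hm using fun i => exists_decomposition_of_hNorm_lt (hlt i)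
  have : Denumerable (ι × ℕ) := (nonempty_denumerable (ι × ℕ)).some
  set e : ℕ ≃ ι × ℕ := (Denumerable.eqv (ι × ℕ)).symm
  have hmi : ∀ i, ∑' k, (m i k : ℝ≥0∞) ≠ ∞ := fun i => (hm i).ne_top
  have htot : ∑' a : ι × ℕ, (m a.1 a.2 : ℝ≥0∞) ≤ ∑' i, hNorm μ lam σ s (v i) + ε := by
    rw [ENNReal.tsum_prod (f := fun i k => (m i k : ℝ≥0∞))]
    calc ∑' i, ∑' k, (m i k : ℝ≥0∞) ≤ ∑' i, (hNorm μ lam σ s (v i) + ε' i) :=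
          ENNReal.tsum_le_tsum fun i => (hm i).le
      _ = ∑' i, hNorm μ lam σ s (v i) + ∑' i, (ε' i : ℝ≥0∞) := ENNReal.tsum_add
      _ ≤ _ := by gcongr
  have htot' : ∑' a : ι × ℕ, (m a.1 a.2 : ℝ≥0∞) ≠ ∞ :=
    ne_top_of_le_ne_top (ENNReal.add_ne_top.2 ⟨htop, ENNReal.coe_ne_top⟩) htot
  have hL1 : ∑' a : ι × ℕ, ∫⁻ x, ‖b a.1 a.2 x‖ₑ ∂μ ≤ ∑' a : ι × ℕ, (m a.1 a.2 : ℝ≥0∞) :=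
    ENNReal.tsum_le_tsum fun a => ((hb a.1).1 a.2).lintegral_le hσ hs
  have hL1e : ∑' n, ∫⁻ x, ‖b (e n).1 (e n).2 x‖ₑ ∂μ ≤ ∑' a : ι × ℕ, (m a.1 a.2 : ℝ≥0∞) := by
    rw [e.tsum_eq (fun a : ι × ℕ => ∫⁻ x, ‖b a.1 a.2 x‖ₑ ∂μ)]
    exact hL1
  -- The double family is absolutely summable almost everywhere, so its unordered sum equals the
  -- iterated sum, and any enumeration by `ℕ` may be used.
  have hHas : ∀ᵐ x ∂μ, HasSum (fun a : ι × ℕ => b a.1 a.2 x) (f x) := by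
    have h1 := ae_summable_of_tsum_lintegral_ne_top
      (fun a : ι × ℕ => (b a.1 a.2).aestronglyMeasurable) (ne_top_of_le_ne_top htot' hL1)
    have h2 : ∀ᵐ x ∂μ, ∀ i, HasSum (fun k => b i k x) (v i x) := by
      rw [ae_all_iff]
      intro i
      filter_upwards [(hb i).ae_hasSum hσ hs (hmi i), hg i] with x hx hgx
      rwa [← hgx]
    filter_upwards [h1, h2, hf] with x h1 h2 h3
    have h4 := h1.2.hasSum.prod_fiberwise h2
    rw [h3.unique h4]
    exact h1.2.hasSum
  have hHas' : ∀ᵐ x ∂μ, HasSum (fun n => b (e n).1 (e n).2 x) (f x) := by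
    filter_upwards [hHas] with x hx
    exact (e.hasSum_iff (f := fun a : ι × ℕ => b a.1 a.2 x)).2 hx
  have hmk := AEEqFun.coeFn_mk f hfm
  refine le_trans ?_ htot
  rw [hNorm_mk hfm]
  unfold hardyNorm
  refine (iInf_le_of_le (fun n => b (e n).1 (e n).2) (iInf_le_of_le
    (fun n => m (e n).1 (e n).2) (iInf_le_of_le ⟨fun n => (hb _).1 _, ?_, ?_⟩ ?_)))
  · rw [memLp_one_iff_integrable]
    refine ⟨AEEqFun.aestronglyMeasurable _, ?_⟩
    refine lt_of_le_of_lt ?_ (htot'.lt_top.trans_le' hL1)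
    rw [← lintegral_tsum fun a : ι × ℕ => (b a.1 a.2).aestronglyMeasurable.enorm]
    refine lintegral_mono_ae ?_
    filter_upwards [hHas, hmk] with x hx hmk
    rw [hmk, ← hx.tsum_eq]
    exact enorm_tsum_le_tsum_enorm
  · simp only [eLpNorm_sub_sum_eq]
    refine tendsto_lintegral_enorm_sub_sum (fun n => (b (e n).1 (e n).2).aestronglyMeasurable) ?_
      (ne_top_of_le_ne_top htot' hL1e)
    filter_upwards [hHas', hmk] with x hx hmk
    rwa [hmk]
  · rw [e.tsum_eq (fun a : ι × ℕ => (m a.1 a.2 : ℝ≥0∞))]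

lemma hNorm_zero [Nonempty X] (hσ : 1 ≤ σ) (hs : 1 ≤ s) :
    hNorm μ lam σ s (fun _ => 0) = 0 := by
  have := hNorm_le_tsum (μ := μ) (lam := lam) hσ hs (ι := Empty) (v := fun _ _ => 0)
    (f := fun _ => 0) aestronglyMeasurable_const (Eventually.of_forall fun x => hasSum_empty)
  simpa using this

lemma hNorm_add_le [Nonempty X] (hσ : 1 ≤ σ) (hs : 1 ≤ s) (u v : X → ℂ) :
    hNorm μ lam σ s (fun x => u x + v x) ≤ hNorm μ lam σ s u + hNorm μ lam σ s v := by
  by_cases h : hNorm μ lam σ s u < ∞ ∧ hNorm μ lam σ s v < ∞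
  · have := hNorm_le_tsum (μ := μ) (lam := lam) (σ := σ) (s := s) hσ hs (ι := Bool)
      (v := fun i => if i then u else v) (f := fun x => u x + v x)
      ((aestronglyMeasurable_of_hNorm_lt h.1).add (aestronglyMeasurable_of_hNorm_lt h.2))
      (Eventually.of_forall fun x => by
        have := hasSum_fintype (fun i : Bool => (if i then u else v) x)
        simpa using this)
    simpa [tsum_fintype] using this
  · have : hNorm μ lam σ s u + hNorm μ lam σ s v = ∞ := by
      rw [ENNReal.add_eq_top]
      by_contra! h'
      exact h ⟨h'.1.lt_top, h'.2.lt_top⟩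
    rw [this]; exact le_top

omit [OpensMeasurableSpace X] in
lemma IsAtomicBlock.smul {b : AEFun ℂ μ} {m : ℝ≥0} (h : IsAtomicBlock μ lam σ s b m) (c : ℂ) :
    IsAtomicBlock μ lam σ s (c • b) (‖c‖₊ * m) := by
  obtain ⟨y, R, hR, hsupp, hint, a₁, a₂, k₁, k₂, h1, h2, rfl, rfl⟩ := h
  refine ⟨y, R, hR, ?_, ?_, a₁, a₂, c * k₁, c * k₂, h1, h2, ?_, ?_⟩
  · filter_upwards [hsupp, AEEqFun.coeFn_smul c (k₁ • a₁ + k₂ • a₂)] with z h1 h2 hz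
    rw [h2, Pi.smul_apply, h1 hz, smul_zero]
  · rw [integral_congr_ae (AEEqFun.coeFn_smul c (k₁ • a₁ + k₂ • a₂))]
    simp only [Pi.smul_apply]
    rw [integral_smul, hint, smul_zero]
  · rw [smul_add, smul_smul, smul_smul]
  · rw [nnnorm_mul, nnnorm_mul, mul_add]

lemma hNorm_smul_le [Nonempty X] (hσ : 1 ≤ σ) (hs : 1 ≤ s) (c : ℂ) (u : X → ℂ) :
    hNorm μ lam σ s (fun x => c * u x) ≤ ‖c‖ₑ * hNorm μ lam σ s u := by
  rcases eq_or_ne c 0 with rfl | hc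
  · simp [hNorm_zero hσ hs]
  by_cases h : hNorm μ lam σ s u < ∞
  · refine ENNReal.le_of_forall_pos_le_add fun ε hε _ => ?_
    have hce : ‖c‖ₑ ≠ 0 := by simpa using hc
    have hlt : hNorm μ lam σ s u < hNorm μ lam σ s u + ε / ‖c‖ₑ :=
      ENNReal.lt_add_right h.ne (ENNReal.div_pos (by simpa using hε.ne') enorm_ne_top).ne'
    obtain ⟨f, b, m, hf, hb, hm⟩ := exists_decomposition_of_hNorm_lt hlt
    have h1 : ∀ i, hNorm μ lam σ s (fun x => c * b i x) ≤ ((‖c‖₊ * m i : ℝ≥0) : ℝ≥0∞) := fun i =>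
      hNorm_le_of_isAtomicBlock hσ hs ((hb.1 i).smul c) (AEEqFun.coeFn_smul c (b i))
    calc hNorm μ lam σ s (fun x => c * u x) ≤ ∑' i, hNorm μ lam σ s (fun x => c * b i x) := by
          refine hNorm_le_tsum hσ hs ((aestronglyMeasurable_of_hNorm_lt h).const_mul c) ?_
          filter_upwards [hb.ae_hasSum hσ hs hm.ne_top, hf] with x hx hfx
          rw [← hfx]
          exact hx.mul_left c
      _ ≤ ∑' i, ‖c‖ₑ * (m i : ℝ≥0∞) := ENNReal.tsum_le_tsum fun i => by
          simpa [enorm_eq_nnnorm] using h1 i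
      _ = ‖c‖ₑ * ∑' i, (m i : ℝ≥0∞) := ENNReal.tsum_mul_left
      _ ≤ ‖c‖ₑ * (hNorm μ lam σ s u + ε / ‖c‖ₑ) := by gcongr
      _ = ‖c‖ₑ * hNorm μ lam σ s u + ε := by
          rw [mul_add, ENNReal.mul_div_cancel hce enorm_ne_top]
  · rw [not_lt, top_le_iff] at h
    rw [h, ENNReal.mul_top (by simpa using hc)]
    exact le_top

/-- A bounded function on a ball is a multiple of an admissible piece of an atomic block. -/
lemma exists_isAtomPiece (hσ : 1 ≤ σ) (hs : 1 ≤ s) (hlam : IsDominatingFunction μ lam)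
    {u : X → ℂ} (hu : AEStronglyMeasurable u μ) {M : ℝ≥0} (hM : ∀ᵐ z ∂μ, ‖u z‖ₑ ≤ M)
    {x y : X} {r R : ℝ} (hr : 0 < r) (hR : 0 < R) (hxy : ball x r ⊆ ball y R)
    (hsupp : ∀ᵐ z ∂μ, z ∉ ball x r → u z = 0) :
    ∃ (a : AEFun ℂ μ) (k : ℂ), IsAtomPiece μ lam σ s y R a ∧ (k • a : AEFun ℂ μ) =ᵐ[μ] u ∧
      ‖k‖ₑ ≤ M * μ (ball x (σ * r)) * coefK μ lam x r y R := by
  -- `w` is exactly the factor by which `u` must be divided to satisfy the size condition of an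
  -- atom. Since `K ≥ 1`, it vanishes only if `M = 0` or the ball is null, and then `u = 0`.
  set w := M * μ (ball x (σ * r)) * coefK μ lam x r y R
  have hs0 : s ≠ 0 := (zero_lt_one.trans_le hs).ne'
  have hwt : w ≠ ∞ := ENNReal.mul_ne_top (ENNReal.mul_ne_top ENNReal.coe_ne_top
    (hlam.measure_ball_lt_top _ _).ne) (hlam.coefK_lt_top hr).ne
  by_cases hw : w = 0
  · refine ⟨0, 0, isAtomPiece_zero y hR, ?_, by simp⟩
    have hu0 : ∀ᵐ z ∂μ, u z = 0 := by
      rcases mul_eq_zero.1 hw with h | h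
      · rcases mul_eq_zero.1 h with h | h
        · filter_upwards [hM] with z hz
          rw [h] at hz
          simpa using hz
        · have h0 : μ (ball x r) = 0 :=
            measure_mono_null (ball_subset_ball (by nlinarith)) h
          filter_upwards [hsupp, measure_eq_zero_iff_ae_notMem.1 h0] with z h1 h2 using h1 h2
      · exact absurd h (zero_lt_one.trans_le one_le_coefK).ne'
    rw [smul_zero]
    filter_upwards [hu0, AEEqFun.coeFn_zero (α := X) (β := ℂ) (μ := μ)] with z h1 h2
    rw [h1, h2]; rfl
  · set k : ℂ := (w.toReal : ℂ)
    have hwr : 0 < w.toReal := ENNReal.toReal_pos hw hwt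
    have hk : k ≠ 0 := by simpa [k] using hwr.ne'
    have hkw : ‖k‖ₑ = w := by
      rw [← ofReal_norm, Complex.norm_real, Real.norm_eq_abs, abs_of_pos hwr,
        ENNReal.ofReal_toReal hwt]
    set a : AEFun ℂ μ := k⁻¹ • AEEqFun.mk u hu
    have ha : a =ᵐ[μ] k⁻¹ • u := by
      filter_upwards [AEEqFun.coeFn_smul k⁻¹ (AEEqFun.mk u hu), AEEqFun.coeFn_mk u hu] with z h1 h2
      rw [h1, Pi.smul_apply, h2]; rfl
    refine ⟨a, k, ⟨x, r, hr, hxy, ?_, ?_⟩, ?_, hkw.le⟩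
    · filter_upwards [ha, hsupp] with z h1 h2 hz
      rw [h1, Pi.smul_apply, h2 hz, smul_zero]
    · rw [eLpNorm_congr_ae ha, eLpNorm_const_smul, enorm_inv hk, hkw]
      have hus : eLpNorm u s μ ≤ μ (ball x (σ * r)) ^ (s⁻¹.toReal) * M := by
        rw [eLpNorm_eq_restrict_of_ae_support measurableSet_ball hsupp]
        have hb : ∀ᵐ z ∂μ.restrict (ball x r), ‖u z‖ ≤ (M : ℝ) := by
          refine ae_restrict_of_ae ?_
          filter_upwards [hM] with z hz
          rw [enorm_eq_nnnorm] at hz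
          exact_mod_cast hz
        refine (eLpNorm_le_of_ae_bound hb).trans ?_
        rw [Measure.restrict_apply_univ, ENNReal.toReal_inv]
        gcongr
        · nlinarith
        · simp
      by_cases hμ : μ (ball x (σ * r)) = 0
      · exact absurd (by simp [w, hμ]) hw
      calc w⁻¹ * eLpNorm u s μ * μ (ball x (σ * r)) ^ (1 - s⁻¹.toReal) * coefK μ lam x r y R
          ≤ w⁻¹ * (μ (ball x (σ * r)) ^ (s⁻¹.toReal) * M) *
            μ (ball x (σ * r)) ^ (1 - s⁻¹.toReal) * coefK μ lam x r y R := by gcongr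
        _ = w⁻¹ * (M * (μ (ball x (σ * r)) ^ (s⁻¹.toReal) *
            μ (ball x (σ * r)) ^ (1 - s⁻¹.toReal)) * coefK μ lam x r y R) := by ring
        _ = w⁻¹ * w := by
            rw [← ENNReal.rpow_add _ _ hμ (hlam.measure_ball_lt_top _ _).ne]
            simp [w]
        _ = 1 := ENNReal.inv_mul_cancel hw hwt
        _ ≤ 1 := le_rfl
    · filter_upwards [AEEqFun.coeFn_smul k a, ha] with z h1 h2
      rw [h1, Pi.smul_apply, h2, Pi.smul_apply, smul_smul, mul_inv_cancel₀ hk, one_smul]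

/-- The `H¹` norm of an atomic block made of two bounded functions. -/
lemma hNorm_two_piece_le (hσ : 1 ≤ σ) (hs : 1 ≤ s) (hlam : IsDominatingFunction μ lam)
    {u₁ u₂ : X → ℂ} (hu₁ : AEStronglyMeasurable u₁ μ) (hu₂ : AEStronglyMeasurable u₂ μ)
    {M₁ M₂ : ℝ≥0} (hM₁ : ∀ᵐ z ∂μ, ‖u₁ z‖ₑ ≤ M₁) (hM₂ : ∀ᵐ z ∂μ, ‖u₂ z‖ₑ ≤ M₂)
    {x₁ x₂ y : X} {r₁ r₂ R : ℝ} (hr₁ : 0 < r₁) (hr₂ : 0 < r₂) (hR : 0 < R)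
    (hB₁ : ball x₁ r₁ ⊆ ball y R) (hB₂ : ball x₂ r₂ ⊆ ball y R)
    (hs₁ : ∀ᵐ z ∂μ, z ∉ ball x₁ r₁ → u₁ z = 0) (hs₂ : ∀ᵐ z ∂μ, z ∉ ball x₂ r₂ → u₂ z = 0)
    (hint : ∫ z, (u₁ z + u₂ z) ∂μ = 0) :
    hNorm μ lam σ s (fun z => u₁ z + u₂ z) ≤
      M₁ * μ (ball x₁ (σ * r₁)) * coefK μ lam x₁ r₁ y R +
      M₂ * μ (ball x₂ (σ * r₂)) * coefK μ lam x₂ r₂ y R := by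
  obtain ⟨a₁, k₁, ha₁, hk₁, hle₁⟩ := exists_isAtomPiece hσ hs hlam hu₁ hM₁ hr₁ hR hB₁ hs₁
  obtain ⟨a₂, k₂, ha₂, hk₂, hle₂⟩ := exists_isAtomPiece hσ hs hlam hu₂ hM₂ hr₂ hR hB₂ hs₂
  have e : (k₁ • a₁ + k₂ • a₂ : AEFun ℂ μ) =ᵐ[μ] fun z => u₁ z + u₂ z := by
    filter_upwards [AEEqFun.coeFn_add (k₁ • a₁) (k₂ • a₂), hk₁, hk₂] with z h1 h2 h3
    rw [h1, Pi.add_apply, h2, h3]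
  have hblock : IsAtomicBlock μ lam σ s (k₁ • a₁ + k₂ • a₂) (‖k₁‖₊ + ‖k₂‖₊) := by
    refine ⟨y, R, hR, ?_, ?_, a₁, a₂, k₁, k₂, ha₁, ha₂, rfl, rfl⟩
    · filter_upwards [e, hs₁, hs₂] with z h h1 h2 hz
      rw [h, h1 fun h' => hz (hB₁ h'), h2 fun h' => hz (hB₂ h'), add_zero]
    · rw [integral_congr_ae e, hint]
  refine (hNorm_le_of_isAtomicBlock hσ hs hblock e).trans ?_
  rw [ENNReal.coe_add]
  exact add_le_add hle₁ hle₂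

end Hardy


/-! ### Hölder's inequality, sparse selection from a packing condition, disjoint refinements. -/

section Tools

variable {X : Type*} [MeasurableSpace X] {μ : Measure X}

/-- Hölder's inequality against a constant. -/
lemma setLIntegral_enorm_le_rpow {p : ℝ} (hp : 1 < p) {f : X → ℂ} (hf : AEStronglyMeasurable f μ)
    (A : Set X) : ∫⁻ z in A, ‖f z‖ₑ ∂μ ≤
      (∫⁻ z in A, ‖f z‖ₑ ^ p ∂μ) ^ (1 / p) * μ A ^ (1 - 1 / p) := by
  have h := ENNReal.lintegral_mul_le_Lp_mul_Lq (μ.restrict A)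
    (Real.HolderConjugate.conjExponent hp) (f := fun z => ‖f z‖ₑ) (g := fun _ => 1)
    hf.restrict.enorm aemeasurable_const
  have e : 1 / p.conjExponent = 1 - 1 / p := by
    rw [Real.conjExponent]; field_simp
  simpa [e] using h

/-- Given a Carleson packing condition, one can choose large subsets which overlap boundedly. -/
lemma exists_subsets_of_packing {ι : Type*} [Countable ι] {S : ι → Set X}
    (hS : ∀ i, MeasurableSet (S i)) (hS0 : ∀ i, μ (S i) ≠ 0) (hSt : ∀ i, μ (S i) ≠ ∞)
    (R : ι → ℝ) (M : ι → ℝ≥0∞) {T : ℝ≥0} (hT : T ≠ 0)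
    (h : ∀ i, ∑' j, (open Classical in if R j ≤ R i ∧ (S j ∩ S i).Nonempty then M j else 0) ≤
      T * μ (S i)) :
    ∃ A : ι → Set X, (∀ i, MeasurableSet (A i) ∧ A i ⊆ S i ∧ μ (S i) ≤ 2 * μ (A i)) ∧
      ∀ z, ∑' i, (A i).indicator (fun _ => M i / μ (S i)) z ≤ 2 * T := by
  classical
  set w : ι → X → ℝ≥0∞ := fun j => (S j).indicator fun _ => M j / μ (S j)
  have hw : ∀ j, Measurable (w j) := fun j => measurable_const.indicator (hS j)
  -- `F i` adds the densities of all sets whose radius is not larger than that of `S i`. Its mean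
  -- over `S i` is at most `T`, so by Chebyshev's inequality `F i ≤ 2T` on at least half of `S i`.
  set F : ι → X → ℝ≥0∞ := fun i z => ∑' j, if R j ≤ R i then w j z else 0
  have hF : ∀ i, Measurable (F i) := fun i => Measurable.tsum fun j => by
    by_cases hj : R j ≤ R i
    · simpa [hj] using hw j
    · simp [hj]
  have hint : ∀ i, ∫⁻ z in S i, F i z ∂μ ≤ T * μ (S i) := by
    intro i
    refine le_trans ?_ (h i)
    rw [lintegral_tsum]
    · refine ENNReal.tsum_le_tsum fun j => ?_
      by_cases hj : R j ≤ R i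
      · simp only [hj, if_true, true_and, w]
        rw [lintegral_indicator (hS j), Measure.restrict_restrict (hS j), lintegral_const,
          Measure.restrict_apply_univ]
        split_ifs with hne
        · calc M j / μ (S j) * μ (S j ∩ S i) ≤ M j / μ (S j) * μ (S j) := by
                gcongr; exact inter_subset_left
            _ ≤ M j := (ENNReal.div_mul_cancel (hS0 j) (hSt j)).le
        · rw [not_nonempty_iff_eq_empty.1 hne]; simp
      · simp [hj]
    · intro j
      by_cases hj : R j ≤ R i
      · simpa [hj] using (hw j).aemeasurable
      · simp [hj]
  refine ⟨fun i => S i ∩ {z | F i z ≤ 2 * T}, fun i => ⟨(hS i).inter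
    (measurableSet_le (hF i) measurable_const), inter_subset_left, ?_⟩, fun z => ?_⟩
  · have hTT : (2 * T : ℝ≥0∞) ≠ 0 := by simpa using hT
    have hTt : (2 * T : ℝ≥0∞) ≠ ∞ := ENNReal.mul_ne_top (by simp) (by simp)
    have h1 : (2 * T : ℝ≥0∞) * μ (S i \ {z | F i z ≤ 2 * T}) ≤ T * μ (S i) := by
      have h2 := mul_meas_ge_le_lintegral (μ := μ.restrict (S i)) (hF i) (2 * T)
      refine le_trans ?_ (h2.trans (hint i))
      rw [Measure.restrict_apply (measurableSet_le measurable_const (hF i))]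
      gcongr
      rintro z ⟨h1, h2⟩
      exact ⟨(not_le.1 (show ¬ F i z ≤ 2 * T from h2)).le, h1⟩
    have h3 : 2 * μ (S i \ {z | F i z ≤ 2 * T}) ≤ μ (S i) := by
      have h1' : (T : ℝ≥0∞) * (2 * μ (S i \ {z | F i z ≤ 2 * T})) ≤ T * μ (S i) := by
        refine le_trans (le_of_eq ?_) h1
        ring
      exact (ENNReal.mul_le_mul_iff_right (ENNReal.coe_ne_zero.2 hT) ENNReal.coe_ne_top).1 h1'
    have h4 : μ (S i) ≤ μ (S i ∩ {z | F i z ≤ 2 * T}) + μ (S i \ {z | F i z ≤ 2 * T}) := by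
      conv_lhs => rw [← inter_union_sdiff (S i) {z | F i z ≤ 2 * T}]
      exact measure_union_le _ _
    have h5 : μ (S i) + μ (S i) ≤ 2 * μ (S i ∩ {z | F i z ≤ 2 * T}) + μ (S i) := by
      calc μ (S i) + μ (S i) = 2 * μ (S i) := (two_mul _).symm
        _ ≤ 2 * (μ (S i ∩ {z | F i z ≤ 2 * T}) + μ (S i \ {z | F i z ≤ 2 * T})) := by gcongr
        _ = 2 * μ (S i ∩ {z | F i z ≤ 2 * T}) + 2 * μ (S i \ {z | F i z ≤ 2 * T}) := mul_add _ _ _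
        _ ≤ _ := by gcongr
    exact (ENNReal.add_le_add_iff_right (hSt i)).1 h5
  · rw [ENNReal.tsum_eq_iSup_sum]
    refine iSup_le fun s => ?_
    set s' := s.filter fun i => z ∈ S i ∩ {z | F i z ≤ 2 * T}
    have hs' : ∑ i ∈ s, (S i ∩ {z | F i z ≤ 2 * T}).indicator (fun _ => M i / μ (S i)) z =
        ∑ i ∈ s', M i / μ (S i) := by
      rw [Finset.sum_filter]
      refine Finset.sum_congr rfl fun i _ => ?_
      simp only [indicator_apply]
    rw [hs']
    rcases s'.eq_empty_or_nonempty with h0 | h0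
    · simp [h0]
    -- Among the finitely many chosen sets through `z`, let `i` have the largest radius. All the
    -- others are then counted in `F i z`, which is at most `2T`.
    · obtain ⟨i, hi, hmax⟩ := s'.exists_max_image R h0
      refine le_trans ?_ (Finset.mem_filter.1 hi).2.2
      refine le_trans (le_of_eq ?_) (ENNReal.sum_le_tsum s')
      refine Finset.sum_congr rfl fun j hj => ?_
      rw [if_pos (hmax j hj)]
      simp only [w, indicator_of_mem (Finset.mem_filter.1 hj).2.1]

/-- A countable family of measurable sets can be made disjoint, preserving the union. -/
lemma exists_disjoint_refinement {ι : Type*} [Countable ι] {B : ι → Set X}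
    (hB : ∀ i, MeasurableSet (B i)) :
    ∃ V : ι → Set X, (∀ i, MeasurableSet (V i) ∧ V i ⊆ B i) ∧ Pairwise (Function.onFun Disjoint V) ∧
      ⋃ i, V i = ⋃ i, B i := by
  classical
  have := Encodable.ofCountable ι
  refine ⟨fun i => B i \ ⋃ j ∈ {j | Encodable.encode j < Encodable.encode i}, B j,
    fun i => ⟨(hB i).diff (MeasurableSet.biUnion (to_countable _) fun j _ => hB j),
      sdiff_subset⟩, ?_, ?_⟩
  · have key : ∀ i j, Encodable.encode i < Encodable.encode j → Disjoint
        (B i \ ⋃ k ∈ {k | Encodable.encode k < Encodable.encode i}, B k)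
        (B j \ ⋃ k ∈ {k | Encodable.encode k < Encodable.encode j}, B k) := by
      intro i j hij
      rw [Set.disjoint_left]
      rintro z ⟨h1, -⟩ ⟨-, h2⟩
      exact h2 (mem_iUnion₂.2 ⟨i, hij, h1⟩)
    intro i j hij
    rcases lt_or_gt_of_ne (Encodable.encode_injective.ne hij) with h | h
    · exact key i j h
    · exact (key j i h).symm
  · refine Subset.antisymm (iUnion_mono fun i => sdiff_subset) fun z hz => ?_
    obtain ⟨i, hi⟩ := mem_iUnion.1 hz
    have hex : ∃ n, ∃ i, Encodable.encode i = n ∧ z ∈ B i := ⟨_, i, rfl, hi⟩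
    obtain ⟨j, hj, hzj⟩ := Nat.find_spec hex
    refine mem_iUnion.2 ⟨j, hzj, fun hz' => ?_⟩
    obtain ⟨k, hk, hzk⟩ := mem_iUnion₂.1 hz'
    exact Nat.find_min hex (by rw [← hj]; exact hk) ⟨k, rfl, hzk⟩

end Tools

/-! ### Almost maximal radii and a covering lemma for radii of linear growth. -/

section Selection

variable {X : Type*} [MetricSpace X] [MeasurableSpace X] {μ : Measure X}

lemma exists_lt_measure_ball (x₀ : X) {a : ℝ≥0∞} (ha : a < μ univ) :
    ∃ R : ℝ, 0 < R ∧ a < μ (ball x₀ R) := by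
  have hmono : Monotone fun n : ℕ => ball x₀ (n : ℝ) := fun m n h =>
    ball_subset_ball (by exact_mod_cast h)
  have hU : ⋃ n : ℕ, ball x₀ (n : ℝ) = univ := iUnion_ball_nat x₀
  rw [← hU, hmono.measure_iUnion, lt_iSup_iff] at ha
  obtain ⟨n, hn⟩ := ha
  rcases Nat.eq_zero_or_pos n with rfl | h
  · simp at hn
  · exact ⟨n, by exact_mod_cast h, hn⟩

/-- In a bounded nonempty set of positive numbers there is an almost maximal one. -/
lemma exists_almost_max {A : Set ℝ} (hne : A.Nonempty) (hpos : ∀ r ∈ A, 0 < r) {R : ℝ}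
    (hR : ∀ r ∈ A, r ≤ R) : ∃ r ∈ A, ∀ r' ∈ A, r' < 2 * r := by
  have hbdd : BddAbove A := ⟨R, hR⟩
  obtain ⟨a, ha⟩ := hne
  have hs : 0 < sSup A := (hpos a ha).trans_le (le_csSup hbdd ha)
  obtain ⟨r, hr, hlt⟩ := exists_lt_of_lt_csSup ⟨a, ha⟩ (half_lt_self hs)
  exact ⟨r, hr, fun r' hr' => by linarith [le_csSup hbdd hr']⟩

omit [MeasurableSpace X] in
/-- A Vitali covering lemma with radii which are only bounded by a small multiple of the distance
to a fixed point. -/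
lemma exists_disjoint_balls_of_linear_growth {t : Set X} {r : X → ℝ} {x₀ : X} {R η : ℝ}
    (hη : 14 ≤ η) (hR : 0 < R) (hr : ∀ x ∈ t, 0 < r x) (hle : ∀ x ∈ t, η * r x ≤ dist x x₀ + R) :
    ∃ u ⊆ t, (u.PairwiseDisjoint fun x => ball x (r x)) ∧
      ∀ x ∈ t, ∃ y ∈ u, ball x (r x) ⊆ ball y (7 * r y) := by
  have hw : ∀ x : X, 0 < dist x x₀ + R := fun x => by positivity
  -- The selection compares the relative radii `r x / (dist x x₀ + R)`, which are bounded although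
  -- the radii themselves may not be.
  obtain ⟨u, hut, hd, hcov⟩ := Vitali.exists_disjoint_subfamily_covering_enlargement
    (fun x => ball x (r x)) t (fun x => r x / (dist x x₀ + R)) 2 (by norm_num)
    (fun x hx => (div_pos (hr x hx) (hw x)).le) 1 (fun x hx => by
      rw [div_le_one (hw x)]
      have := hle x hx
      have := hr x hx
      nlinarith)
    (fun x hx => ⟨x, mem_ball_self (hr x hx)⟩)
  refine ⟨u, hut, hd, fun x hx => ?_⟩
  obtain ⟨y, hy, ⟨z, hzx, hzy⟩, hδ⟩ := hcov x hx
  refine ⟨y, hy, ?_⟩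
  have hrx := hr x hx
  have hry := hr y (hut hy)
  have h1 := hle x hx
  have h2 := hle y (hut hy)
  have hxy : dist x y < r x + r y := by
    rw [mem_ball] at hzx hzy
    have := dist_triangle x z y
    rw [dist_comm x z] at this
    linarith
  have h3 : dist x x₀ ≤ dist x y + dist y x₀ := dist_triangle _ _ _
  rw [div_le_iff₀ (hw x), mul_assoc, div_mul_eq_mul_div, ← mul_div_assoc, le_div_iff₀ (hw y)] at hδ
  have h14x : 14 * r x ≤ dist x x₀ + R := by nlinarith
  have h14y : 14 * r y ≤ dist y x₀ + R := by nlinarith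
  set a := dist x x₀ + R
  set b := dist y x₀ + R
  -- Two meeting balls are small relative to their distance from `x₀`, so their weights are
  -- comparable. Thus relative radii within a factor `2` give `r x ≤ 5/2 * r y`, and `2 * (5/2) + 1
  -- ≤ 7`.
  have hab : a ≤ 5 / 4 * b := by linarith
  have hb : 0 < b := hw y
  have hrr : r x ≤ 5 / 2 * r y := by
    have h5 : r x * b ≤ (5 / 2 * r y) * b := by nlinarith
    exact le_of_mul_le_mul_right h5 hb
  exact ball_subset_ball' (by linarith)

end Selection


/-! ### The Calderón–Zygmund decomposition. -/

section CZ

variable {X : Type*} [MetricSpace X] [MeasurableSpace X] {μ : Measure X} {lam : X → ℝ → ℝ}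

/-- A Calderón–Zygmund decomposition of `f` at height `t`: balls `ball (c i) (r i)`, disjoint sets
`V i ⊆ ball (c i) (7 * r i)` outside of which `f` is bounded, and bounded functions `φ i` on
concentric doubling balls with the integral of `f` on `V i`. -/
structure CZData (μ : Measure X) (up : X → ℝ → ℝ) (η : ℝ) (β : ℝ≥0) (p : ℝ) (t : ℝ≥0) (f : X → ℂ)
    {ι : Type*} (c : ι → X) (r : ι → ℝ) (V : ι → Set X) (φ : ι → X → ℂ) : Prop where
  r_pos : ∀ i, 0 < r i
  selected : ∀ i, (t : ℝ≥0∞) ^ p * μ (ball (c i) (η * r i)) < ∫⁻ z in ball (c i)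
      (r i), ‖f z‖ₑ ^ p ∂μ
  sum_selected : ∑' i, (t : ℝ≥0∞) ^ p * μ (ball (c i) (η * r i)) ≤ ∫⁻ z, ‖f z‖ₑ ^ p ∂μ
  V_meas : ∀ i, MeasurableSet (V i)
  V_sub : ∀ i, V i ⊆ ball (c i) (7 * r i)
  V_disj : Pairwise (Function.onFun Disjoint V)
  off : ∀ᵐ z ∂μ, z ∉ ⋃ i, V i → ‖f z‖ₑ ≤ β * t
  φ_meas : ∀ i, Measurable (φ i)
  φ_supp : ∀ i z, z ∉ ball (c i) (up (c i) (7 * r i)) → φ i z = 0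
  φ_int : ∀ i, ∫ z, φ i z ∂μ = ∫ z in V i, f z ∂μ
  φ_bound : ∀ i z, ‖φ i z‖ₑ * μ (ball (c i) (up (c i) (7 * r i))) ≤ 2 * ∫⁻ z in V i, ‖f z‖ₑ ∂μ
  φ_sum : ∀ z, ∑' i, ‖φ i z‖ₑ ≤ 4 * β * t

lemma CZData.measure_ne_zero {up : X → ℝ → ℝ} {η : ℝ} {β : ℝ≥0} {p : ℝ} {t : ℝ≥0} {f : X → ℂ}
    {ι : Type*} {c : ι → X} {r : ι → ℝ} {V : ι → Set X} {φ : ι → X → ℂ}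
    (h : CZData μ up η β p t f c r V φ) {i : ι} {ρ : ℝ} (hρ : r i ≤ ρ) :
    μ (ball (c i) ρ) ≠ 0 := by
  intro h0
  have h1 := h.selected i
  rw [setLIntegral_measure_zero _ _ (measure_mono_null (ball_subset_ball hρ) h0)] at h1
  exact not_lt_bot h1

/-- Stopping balls are those whose `p`-average, normalised by the `η`-dilate, exceeds `t^p`. Almost
maximal ones are selected disjointly, and their `7`-dilates cover every point having a stopping
ball. To replace `f` on `V i` by a function with the same integral and with bounded overlap,
constants are placed on large subsets of the doubling balls `S i`; the packing condition needed for
this comes from maximality of the stopping radius. -/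
theorem exists_czData [BorelSpace X] [SecondCountableTopology X]
    (hlam : IsDominatingFunction μ lam) {η D : ℝ} {β K : ℝ≥0} {up : X → ℝ → ℝ}
    (hη : 14 ≤ η) (hD : 3 * η ≤ D) (hdd : DoublingData μ lam D β K up) {p : ℝ} (hp : 1 < p)
    {t : ℝ≥0} (ht : t ≠ 0) {f : X → ℂ} (hf : Measurable f)
    (hI : ∫⁻ z, ‖f z‖ₑ ^ p ∂μ < (t : ℝ≥0∞) ^ p * μ univ) :
    ∃ (u : Set X) (r : u → ℝ) (V : u → Set X) (φ : u → X → ℂ),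
      u.Countable ∧ CZData μ up η β p t f (Subtype.val : u → X) r V φ := by
  classical
  have hp0 : 0 < p := by linarith
  have htp0 : (t : ℝ≥0∞) ^ p ≠ 0 :=
    (ENNReal.rpow_pos (ENNReal.coe_pos.2 ht.bot_lt) ENNReal.coe_ne_top).ne'
  have htpt : (t : ℝ≥0∞) ^ p ≠ ∞ := ENNReal.rpow_ne_top_of_nonneg hp0.le ENNReal.coe_ne_top
  have hXne : Nonempty X := by
    by_contra hX
    rw [not_nonempty_iff] at hX
    rw [univ_eq_empty_iff.2 hX] at hI
    simp at hI
  obtain ⟨x₀⟩ := hXne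
  have hlf := hlam.isLocallyFiniteMeasure
  set I : ℝ≥0∞ := ∫⁻ z, ‖f z‖ₑ ^ p ∂μ
  -- A ball about `x₀` so large that the `η`-dilate of a stopping ball cannot contain it. This gives
  -- the linear growth of the stopping radii; it is where the strict inequality with `μ univ`
  -- enters.
  obtain ⟨R₀, hR₀, hIR⟩ := exists_lt_measure_ball (μ := μ) x₀ (a := I / (t : ℝ≥0∞) ^ p) (by
    rw [ENNReal.div_lt_iff (Or.inl htp0) (Or.inl htpt), mul_comm]; exact hI)
  -- stopping radii
  set Rad : X → Set ℝ := fun x => {r | 0 < r ∧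
    (t : ℝ≥0∞) ^ p * μ (ball x (η * r)) < ∫⁻ z in ball x r, ‖f z‖ₑ ^ p ∂μ}
  set Om : Set X := {x | (Rad x).Nonempty}
  have hRad : ∀ x, ∀ r ∈ Rad x, η * r ≤ dist x x₀ + R₀ := by
    rintro x r ⟨hr, h⟩
    by_contra! hlt
    have h1 : ball x₀ R₀ ⊆ ball x (η * r) := ball_subset_ball' (by rw [dist_comm]; linarith)
    have h2 : (t : ℝ≥0∞) ^ p * μ (ball x (η * r)) < I := h.trans_le (setLIntegral_le_lintegral _ _)
    rw [ENNReal.div_lt_iff (Or.inl htp0) (Or.inl htpt), mul_comm] at hIR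
    refine absurd (hIR.trans_le ?_) (not_lt.2 h2.le)
    gcongr
  have hmax : ∀ x, ∃ r, x ∈ Om → r ∈ Rad x ∧ ∀ r' ∈ Rad x, r' < 2 * r := by
    intro x
    by_cases hx : x ∈ Om
    · obtain ⟨r, hr, h⟩ := exists_almost_max hx (fun r hr => hr.1)
        (R := (dist x x₀ + R₀) / η) (fun r hr => by
          rw [le_div_iff₀ (by linarith), mul_comm]; exact hRad x r hr)
      exact ⟨r, fun _ => ⟨hr, h⟩⟩
    · exact ⟨0, fun h => absurd h hx⟩
  choose rad hrad using hmax
  obtain ⟨u, huO, hud, hcov⟩ := exists_disjoint_balls_of_linear_growth (t := Om) (r := rad)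
    (x₀ := x₀) hη hR₀ (fun x hx => (hrad x hx).1.1) (fun x hx => hRad x _ (hrad x hx).1)
  have huc : u.Countable := countable_of_disjoint_balls (x := id)
    (fun x hx => (hrad x (huO hx)).1.1) hud
  have : Countable u := huc.to_subtype
  have hr : ∀ i : u, 0 < rad i := fun i => (hrad i (huO i.2)).1.1
  have hselected : ∀ i : u, (t : ℝ≥0∞) ^ p * μ (ball (i : X) (η * rad i)) <
      ∫⁻ z in ball (i : X) (rad i), ‖f z‖ₑ ^ p ∂μ := fun i => (hrad i (huO i.2)).1.2
  -- Beyond twice an almost maximal stopping radius no radius is stopping, so the reverse inequality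
  -- holds.
  have hbig : ∀ i : u, ∀ ρ, 2 * rad i ≤ ρ →
      ∫⁻ z in ball (i : X) ρ, ‖f z‖ₑ ^ p ∂μ ≤ (t : ℝ≥0∞) ^ p * μ (ball (i : X) (η * ρ)) := by
    intro i ρ hρ
    by_contra! h
    have := (hrad i (huO i.2)).2 ρ ⟨by linarith [hr i], h⟩
    linarith
  obtain ⟨V, hV, hVd, hVU⟩ := exists_disjoint_refinement
    (B := fun i : u => ball (i : X) (7 * rad i)) (fun i => measurableSet_ball)
  set S : u → Set X := fun i => ball (i : X) (up i (7 * rad i))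
  have hμr : ∀ i : u, ∀ ρ, rad i ≤ ρ → μ (ball (i : X) ρ) ≠ 0 := by
    intro i ρ hρ h0
    have h1 := hselected i
    rw [setLIntegral_measure_zero _ _ (measure_mono_null (ball_subset_ball hρ) h0)] at h1
    exact not_lt_bot h1
  have h7 : ∀ i : u, rad i ≤ 7 * rad i := fun i => by linarith [hr i]
  have hup : ∀ i : u, D * (7 * rad i) ≤ up i (7 * rad i) := fun i =>
    hdd.le_up i _ (by linarith [hr i]) (hμr i _ (h7 i))
  have hup' : ∀ i : u, 7 * rad i ≤ up i (7 * rad i) := fun i => by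
    have := hup i; have := hr i; nlinarith
  have hVS : ∀ i, V i ⊆ S i := fun i => (hV i).2.trans (ball_subset_ball (hup' i))
  have hβ0 : β ≠ 0 := (zero_lt_one.trans_le hdd.one_le_beta).ne'
  -- packing
  obtain ⟨A, hA, hAsum⟩ := exists_subsets_of_packing (μ := μ) (S := S) (fun i => measurableSet_ball)
    (fun i => hμr i _ ((h7 i).trans (hup' i))) (fun i => (hlam.measure_ball_lt_top _ _).ne)
    (fun i => up i (7 * rad i)) (fun i => ∫⁻ z in V i, ‖f z‖ₑ ∂μ) (T := β * t)
    (mul_ne_zero hβ0 ht) (by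
      intro i
      set R := up i (7 * rad i)
      set V' : u → Set X := fun j =>
        if up j (7 * rad j) ≤ R ∧ (S j ∩ S i).Nonempty then V j else ∅
      have hV' : ∀ j, V' j ⊆ V j := fun j => by
        simp only [V']; split_ifs
        · exact Subset.rfl
        · exact empty_subset _
      have e : ∑' j : u, (if up j (7 * rad j) ≤ R ∧ (S j ∩ S i).Nonempty then
          ∫⁻ z in V j, ‖f z‖ₑ ∂μ else 0) = ∫⁻ z in ⋃ j, V' j, ‖f z‖ₑ ∂μ := by
        rw [lintegral_iUnion]
        · refine tsum_congr fun j => ?_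
          simp only [V']; split_ifs <;> simp
        · intro j
          simp only [V']; split_ifs
          · exact (hV j).1
          · exact MeasurableSet.empty
        · exact fun j k hjk => (hVd hjk).mono (hV' j) (hV' k)
      rw [e]
      -- Every `S j` of radius at most `R` meeting `S i` lies in the ball of radius `3R`. The sets
      -- `V j` are disjoint, so their masses add up to at most the integral of `|f|` over that ball,
      -- which Hölder's inequality, `hbig` and `3η ≤ D` bound by `β t μ(S i)`.
      have hsub : ⋃ j, V' j ⊆ ball (i : X) (3 * R) := by
        refine iUnion_subset fun j z hz => ?_
        simp only [V'] at hz
        split_ifs at hz with hj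
        · obtain ⟨hle, w, hw1, hw2⟩ := hj
          have h1 := mem_ball.1 (hVS j hz)
          have h2 := mem_ball.1 hw1
          have h3 := mem_ball.1 hw2
          have h4 := dist_triangle4 z (j : X) w (i : X)
          rw [dist_comm (j : X) w] at h4
          rw [mem_ball]
          linarith
        · exact absurd hz (notMem_empty z)
      have hR0 : 0 < R := by linarith [hup' i, hr i]
      have hR2 : 2 * rad i ≤ 3 * R := by linarith [hup' i, hr i]
      have hsubη : ball (i : X) (3 * R) ⊆ ball (i : X) (η * (3 * R)) :=
        ball_subset_ball (by nlinarith)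
      have hm0 : μ (ball (i : X) (η * (3 * R))) ≠ 0 := hμr i _ (by nlinarith [hr i])
      have hmt : μ (ball (i : X) (η * (3 * R))) ≠ ∞ := (hlam.measure_ball_lt_top _ _).ne
      have h1p : 0 ≤ 1 - 1 / p := by
        rw [sub_nonneg, div_le_one hp0]; exact hp.le
      calc ∫⁻ z in ⋃ j, V' j, ‖f z‖ₑ ∂μ ≤ ∫⁻ z in ball (i : X) (3 * R), ‖f z‖ₑ ∂μ :=
            lintegral_mono_set hsub
        _ ≤ (∫⁻ z in ball (i : X) (3 * R), ‖f z‖ₑ ^ p ∂μ) ^ (1 / p) *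
            μ (ball (i : X) (3 * R)) ^ (1 - 1 / p) :=
            setLIntegral_enorm_le_rpow hp hf.aestronglyMeasurable _
        _ ≤ ((t : ℝ≥0∞) ^ p * μ (ball (i : X) (η * (3 * R)))) ^ (1 / p) *
            μ (ball (i : X) (η * (3 * R))) ^ (1 - 1 / p) := by
            gcongr
            exact hbig i _ hR2
        _ = t * μ (ball (i : X) (η * (3 * R))) := by
            rw [ENNReal.mul_rpow_of_nonneg _ _ (by positivity), ← ENNReal.rpow_mul,
              mul_one_div_cancel hp0.ne', ENNReal.rpow_one, mul_assoc,
              ← ENNReal.rpow_add _ _ hm0 hmt]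
            simp
        _ ≤ t * (β * μ (S i)) := by
            gcongr
            refine le_trans (measure_mono (ball_subset_ball ?_))
              (hdd.doubling_up i _ (by linarith [hr i]) (hμr i _ (h7 i)))
            nlinarith
        _ = ((β * t : ℝ≥0) : ℝ≥0∞) * μ (S i) := by push_cast; ring)
  set m : u → ℂ := fun i => ∫ z in V i, f z ∂μ
  have hA0 : ∀ i, μ (A i) ≠ 0 := fun i h0 => by
    have := (hA i).2.2
    rw [h0, mul_zero] at this
    exact hμr i _ ((h7 i).trans (hup' i)) (le_antisymm this bot_le)
  have hAt : ∀ i, μ (A i) ≠ ∞ := fun i =>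
    ((measure_mono (hA i).2.1).trans_lt (hlam.measure_ball_lt_top _ _)).ne
  have hme : ∀ i, ‖m i‖ₑ ≤ ∫⁻ z in V i, ‖f z‖ₑ ∂μ := fun i => enorm_integral_le_lintegral_enorm _
  -- The constant on `A i` that reproduces the integral of `f` over `V i`; since `A i` fills half of
  -- `S i`, it is at most twice the mass divided by `μ (S i)`.
  set k : u → ℂ := fun i => m i / ((μ (A i)).toReal : ℂ)
  have hk : ∀ i, ‖k i‖ₑ ≤ 2 * (∫⁻ z in V i, ‖f z‖ₑ ∂μ) / μ (S i) := by
    intro i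
    have hAr : 0 < (μ (A i)).toReal := ENNReal.toReal_pos (hA0 i) (hAt i)
    have e : ‖k i‖ₑ = ‖m i‖ₑ / μ (A i) := by
      simp only [k]
      rw [div_eq_mul_inv, enorm_mul, enorm_inv (by simpa using hAr.ne'), ← div_eq_mul_inv]
      congr 1
      rw [← ofReal_norm, Complex.norm_real, Real.norm_eq_abs, abs_of_pos hAr,
        ENNReal.ofReal_toReal (hAt i)]
    rw [e, ENNReal.le_div_iff_mul_le (Or.inl (hμr i _ ((h7 i).trans (hup' i))))
      (Or.inl (hlam.measure_ball_lt_top _ _).ne)]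
    calc ‖m i‖ₑ / μ (A i) * μ (S i) ≤ ‖m i‖ₑ / μ (A i) * (2 * μ (A i)) := by
          gcongr; exact (hA i).2.2
      _ = 2 * (‖m i‖ₑ / μ (A i) * μ (A i)) := by ring
      _ = 2 * ‖m i‖ₑ := by rw [ENNReal.div_mul_cancel (hA0 i) (hAt i)]
      _ ≤ _ := by gcongr; exact hme i
  set φ : u → X → ℂ := fun i => (A i).indicator fun _ => k i
  refine ⟨u, fun i => rad i, V, φ, huc, ⟨hr, hselected, ?_, fun i => (hV i).1, fun i =>
      (hV i).2, hVd,
    ?_, ?_, ?_, ?_, ?_, ?_⟩⟩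
  · calc ∑' i : u, (t : ℝ≥0∞) ^ p * μ (ball (i : X) (η * rad i))
        ≤ ∑' i : u, ∫⁻ z in ball (i : X) (rad i), ‖f z‖ₑ ^ p ∂μ :=
          ENNReal.tsum_le_tsum fun i => (hselected i).le
      _ ≤ _ := tsum_setLIntegral_le_of_disjoint huc (fun _ _ => measurableSet_ball) hud _
  · -- boundedness off the selected balls
    have hE : MeasurableSet (⋃ i, V i)ᶜ := (MeasurableSet.iUnion fun i => (hV i).1).compl
    have hsf : SigmaFinite μ := inferInstance
    have h1 := ae_le_of_small_balls (μ := μ) hE (w := fun z => ‖f z‖ₑ ^ p)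
      (hf.enorm.pow_const p) (C := β) (t := t ^ p * β) (by
        filter_upwards [hdd.ae_small] with x hx hxE ε hε
        obtain ⟨ρ, hρ, hρε, hdbl⟩ := hx ε hε
        refine ⟨ρ / 2, by positivity, by linarith, ?_, ?_⟩
        · calc μ (closedBall x (3 * (ρ / 2))) ≤ μ (ball x (D * ρ)) :=
                measure_mono (closedBall_subset_ball (by nlinarith))
            _ ≤ β * μ (ball x (ρ / 2)) := hdbl
            _ ≤ β * μ (closedBall x (ρ / 2)) := by gcongr; exact ball_subset_closedBall
        -- Points with a stopping radius are covered by the selected `7`-dilates, hence at `x` every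
        -- radius satisfies the reverse inequality.
        · have hxO : x ∉ Om := by
            intro hxO
            refine hxE ?_
            rw [hVU]
            obtain ⟨y, hy, hsub⟩ := hcov x hxO
            exact mem_iUnion.2 ⟨⟨y, hy⟩, hsub (mem_ball_self (hrad x hxO).1.1)⟩
          have hnot : ¬ ((t : ℝ≥0∞) ^ p * μ (ball x (η * ρ)) <
              ∫⁻ z in ball x ρ, ‖f z‖ₑ ^ p ∂μ) := fun h => hxO ⟨ρ, hρ, h⟩
          calc ∫⁻ z in closedBall x (ρ / 2), ‖f z‖ₑ ^ p ∂μ ≤ ∫⁻ z in ball x ρ, ‖f z‖ₑ ^ p ∂μ :=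
                lintegral_mono_set (closedBall_subset_ball (by linarith))
            _ ≤ (t : ℝ≥0∞) ^ p * μ (ball x (η * ρ)) := not_lt.1 hnot
            _ ≤ (t : ℝ≥0∞) ^ p * μ (ball x (D * ρ)) := by
                gcongr; nlinarith
            _ ≤ (t : ℝ≥0∞) ^ p * (β * μ (closedBall x (ρ / 2))) := by
                gcongr
                exact hdbl.trans (by gcongr; exact ball_subset_closedBall)
            _ = _ := by
                rw [ENNReal.coe_mul, ENNReal.coe_rpow_of_nonneg _ hp0.le, mul_assoc])
    filter_upwards [h1] with z hz hzV
    have h2 : ‖f z‖ₑ ^ p ≤ ((β * t : ℝ≥0) : ℝ≥0∞) ^ p := by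
      refine (hz hzV).trans ?_
      rw [← ENNReal.coe_rpow_of_nonneg _ hp0.le]
      refine ENNReal.coe_le_coe.2 ?_
      rw [NNReal.mul_rpow, mul_comm]
      gcongr
      calc β = β ^ (1 : ℝ) := (NNReal.rpow_one _).symm
        _ ≤ β ^ p := NNReal.rpow_le_rpow_of_exponent_le hdd.one_le_beta hp.le
    have h3 := (ENNReal.rpow_le_rpow_iff hp0).1 h2
    rwa [ENNReal.coe_mul] at h3
  · exact fun i => measurable_const.indicator (hA i).1
  · exact fun i z hz => indicator_of_notMem (fun h => hz ((hA i).2.1 h)) _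
  · intro i
    have hAr : 0 < (μ (A i)).toReal := ENNReal.toReal_pos (hA0 i) (hAt i)
    simp only [φ]
    rw [integral_indicator (hA i).1, setIntegral_const, Measure.real]
    simp only [k, Complex.real_smul]
    rw [mul_div_cancel₀]
    simpa using hAr.ne'
  · intro i z
    have h1 : ‖φ i z‖ₑ ≤ 2 * (∫⁻ z in V i, ‖f z‖ₑ ∂μ) / μ (S i) := by
      simp only [φ, indicator_apply]
      split_ifs
      · exact hk i
      · simp
    calc _ ≤ 2 * (∫⁻ z in V i, ‖f z‖ₑ ∂μ) / μ (S i) * μ (S i) := by gcongr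
      _ = _ := ENNReal.div_mul_cancel (hμr i _ ((h7 i).trans (hup' i)))
          (hlam.measure_ball_lt_top _ _).ne
  · intro z
    calc ∑' i, ‖φ i z‖ₑ ≤ ∑' i, 2 * (A i).indicator
          (fun _ => (∫⁻ z in V i, ‖f z‖ₑ ∂μ) / μ (S i)) z := by
          refine ENNReal.tsum_le_tsum fun i => ?_
          simp only [φ, indicator_apply]
          split_ifs
          · rw [← mul_div_assoc]; exact hk i
          · simp
      _ = 2 * ∑' i, (A i).indicator (fun _ => (∫⁻ z in V i, ‖f z‖ₑ ∂μ) / μ (S i)) z :=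
          ENNReal.tsum_mul_left
      _ ≤ 2 * (2 * ((β * t : ℝ≥0) : ℝ≥0∞)) := by gcongr; exact hAsum z
      _ = _ := by push_cast; ring

end CZ


/-! ### Moving mass between doubling balls at the cost of one atomic block. -/

section Transport

variable {X : Type*} [MetricSpace X] [MeasurableSpace X] {μ : Measure X} {lam : X → ℝ → ℝ}
  {σ : ℝ} {s : ℝ≥0∞}

/-- The normalized indicator of the ball `ball x R`. -/
noncomputable def ballAvg (μ : Measure X) (x : X) (R : ℝ) : X → ℂ :=
  (ball x R).indicator fun _ => ((μ (ball x R)).toReal : ℂ)⁻¹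

variable [OpensMeasurableSpace X]

lemma measurable_ballAvg (x : X) (R : ℝ) : Measurable (ballAvg μ x R) :=
  measurable_const.indicator measurableSet_ball

omit [OpensMeasurableSpace X] in
lemma ballAvg_of_notMem {x z : X} {R : ℝ} (h : z ∉ ball x R) : ballAvg μ x R z = 0 :=
  indicator_of_notMem h _

omit [OpensMeasurableSpace X] in
lemma enorm_ballAvg_le {x : X} {R : ℝ} (h0 : μ (ball x R) ≠ 0) (ht : μ (ball x R) ≠ ∞) (z : X) :
    ‖ballAvg μ x R z‖ₑ ≤ (μ (ball x R))⁻¹ := by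
  have hr : 0 < (μ (ball x R)).toReal := ENNReal.toReal_pos h0 ht
  unfold ballAvg
  by_cases hz : z ∈ ball x R
  · rw [indicator_of_mem hz, enorm_inv (by simpa using hr.ne'), ← ofReal_norm, Complex.norm_real,
      Real.norm_eq_abs,
      abs_of_pos hr, ENNReal.ofReal_toReal ht]
  · simp [hz]

lemma integral_ballAvg {x : X} {R : ℝ} (h0 : μ (ball x R) ≠ 0) (ht : μ (ball x R) ≠ ∞) :
    ∫ z, ballAvg μ x R z ∂μ = 1 := by
  have hr : 0 < (μ (ball x R)).toReal := ENNReal.toReal_pos h0 ht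
  unfold ballAvg
  rw [integral_indicator measurableSet_ball, setIntegral_const, Measure.real, Complex.real_smul,
    mul_inv_cancel₀]
  simpa using hr.ne'

lemma integrable_of_bounded_of_support {u : X → ℂ} (hu : AEStronglyMeasurable u μ) {M : ℝ≥0}
    (hM : ∀ᵐ z ∂μ, ‖u z‖ₑ ≤ M) {x : X} {r : ℝ} (ht : μ (ball x r) ≠ ∞)
    (hsupp : ∀ᵐ z ∂μ, z ∉ ball x r → u z = 0) : Integrable u μ := by
  refine ⟨hu, ?_⟩
  unfold HasFiniteIntegral
  calc ∫⁻ z, ‖u z‖ₑ ∂μ ≤ ∫⁻ z, (ball x r).indicator (fun _ => (M : ℝ≥0∞)) z ∂μ := by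
        refine lintegral_mono_ae ?_
        filter_upwards [hM, hsupp] with z h1 h2
        by_cases hz : z ∈ ball x r
        · simpa [hz] using h1
        · simp [h2 hz]
    _ = M * μ (ball x r) := by rw [lintegral_indicator measurableSet_ball]; simp
    _ < ∞ := ENNReal.mul_lt_top ENNReal.coe_lt_top ht.lt_top

lemma integrable_ballAvg {x : X} {R : ℝ} (h0 : μ (ball x R) ≠ 0) (ht : μ (ball x R) ≠ ∞) :
    Integrable (ballAvg μ x R) μ := by
  refine integrable_of_bounded_of_support (measurable_ballAvg x R).aestronglyMeasurable
    (M := (μ (ball x R))⁻¹.toNNReal) (Eventually.of_forall fun z => ?_) ht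
    (Eventually.of_forall fun z hz => ballAvg_of_notMem hz)
  rw [ENNReal.coe_toNNReal (ENNReal.inv_ne_top.2 h0)]
  exact enorm_ballAvg_le h0 ht z

/-- Moving the mass of a bounded function to a doubling ball. -/
lemma hNorm_sub_ballAvg_le (hσ : 1 ≤ σ) (hs : 1 ≤ s) (hlam : IsDominatingFunction μ lam)
    {u : X → ℂ} (hu : AEStronglyMeasurable u μ) {M : ℝ≥0} (hM : ∀ᵐ z ∂μ, ‖u z‖ₑ ≤ M)
    {x₁ x₂ y : X} {r₁ r₂ R : ℝ} {K₁ K₂ β : ℝ≥0} (hr₁ : 0 < r₁) (hr₂ : 0 < r₂) (hR : 0 < R)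
    (hB₁ : ball x₁ r₁ ⊆ ball y R) (hB₂ : ball x₂ r₂ ⊆ ball y R)
    (hs₁ : ∀ᵐ z ∂μ, z ∉ ball x₁ r₁ → u z = 0) (h0 : μ (ball x₂ r₂) ≠ 0)
    (hdbl : μ (ball x₂ (σ * r₂)) ≤ β * μ (ball x₂ r₂))
    (hK₁ : coefK μ lam x₁ r₁ y R ≤ K₁) (hK₂ : coefK μ lam x₂ r₂ y R ≤ K₂) :
    hNorm μ lam σ s (fun z => u z - (∫ w, u w ∂μ) * ballAvg μ x₂ r₂ z) ≤
      M * μ (ball x₁ (σ * r₁)) * K₁ + ‖∫ w, u w ∂μ‖ₑ * β * K₂ := by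
  set m := ∫ w, u w ∂μ
  have ht := (hlam.measure_ball_lt_top x₂ r₂).ne
  have hui := integrable_of_bounded_of_support hu hM (hlam.measure_ball_lt_top x₁ r₁).ne hs₁
  have hmt : ‖m‖ₑ * (μ (ball x₂ r₂))⁻¹ ≠ ∞ :=
    ENNReal.mul_ne_top enorm_ne_top (ENNReal.inv_ne_top.2 h0)
  have key := hNorm_two_piece_le (lam := lam) (u₁ := u) (u₂ := fun z => -(m * ballAvg μ x₂ r₂ z))
    (M₁ := M) (M₂ := (‖m‖ₑ * (μ (ball x₂ r₂))⁻¹).toNNReal) hσ hs hlam hu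
    ((measurable_ballAvg x₂ r₂).const_mul m).neg.aestronglyMeasurable hM
    (Eventually.of_forall fun z => by
      rw [ENNReal.coe_toNNReal hmt, enorm_neg, enorm_mul]
      gcongr
      exact enorm_ballAvg_le h0 ht z) hr₁ hr₂ hR hB₁ hB₂ hs₁
    (Eventually.of_forall fun z hz => by rw [ballAvg_of_notMem hz]; simp)
    (by
      simp only [← sub_eq_add_neg]
      rw [integral_sub hui ((integrable_ballAvg h0 ht).const_mul m), integral_const_mul,
        integral_ballAvg h0 ht]
      simp [m])
  simp only [← sub_eq_add_neg] at key
  refine key.trans ?_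
  rw [ENNReal.coe_toNNReal hmt]
  refine add_le_add (by gcongr) (mul_le_mul' ?_ hK₂)
  calc ‖m‖ₑ * (μ (ball x₂ r₂))⁻¹ * μ (ball x₂ (σ * r₂))
      ≤ ‖m‖ₑ * (μ (ball x₂ r₂))⁻¹ * (β * μ (ball x₂ r₂)) := by gcongr
    _ = ‖m‖ₑ * β * ((μ (ball x₂ r₂))⁻¹ * μ (ball x₂ r₂)) := by ring
    _ = ‖m‖ₑ * β := by rw [ENNReal.inv_mul_cancel h0 ht, mul_one]

/-- Moving mass from one doubling ball to another one. -/
lemma hNorm_ballAvg_sub_ballAvg_le (hσ : 1 ≤ σ) (hs : 1 ≤ s) (hlam : IsDominatingFunction μ lam)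
    (m : ℂ) {x₁ x₂ y : X} {r₁ r₂ R : ℝ} {K₁ K₂ β : ℝ≥0} (hr₁ : 0 < r₁) (hr₂ : 0 < r₂) (hR : 0 < R)
    (hB₁ : ball x₁ r₁ ⊆ ball y R) (hB₂ : ball x₂ r₂ ⊆ ball y R)
    (h₁0 : μ (ball x₁ r₁) ≠ 0) (h₂0 : μ (ball x₂ r₂) ≠ 0)
    (hdbl₁ : μ (ball x₁ (σ * r₁)) ≤ β * μ (ball x₁ r₁))
    (hdbl₂ : μ (ball x₂ (σ * r₂)) ≤ β * μ (ball x₂ r₂))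
    (hK₁ : coefK μ lam x₁ r₁ y R ≤ K₁) (hK₂ : coefK μ lam x₂ r₂ y R ≤ K₂) :
    hNorm μ lam σ s (fun z => m * ballAvg μ x₁ r₁ z - m * ballAvg μ x₂ r₂ z) ≤
      ‖m‖ₑ * β * (K₁ + K₂) := by
  have ht := (hlam.measure_ball_lt_top x₁ r₁).ne
  have hmt : ‖m‖ₑ * (μ (ball x₁ r₁))⁻¹ ≠ ∞ :=
    ENNReal.mul_ne_top enorm_ne_top (ENNReal.inv_ne_top.2 h₁0)
  have hint : ∫ z, m * ballAvg μ x₁ r₁ z ∂μ = m := by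
    rw [integral_const_mul, integral_ballAvg h₁0 ht, mul_one]
  have key := hNorm_sub_ballAvg_le (lam := lam) (s := s) (u := fun z => m * ballAvg μ x₁ r₁ z)
    (M := (‖m‖ₑ * (μ (ball x₁ r₁))⁻¹).toNNReal) hσ hs hlam
    ((measurable_ballAvg x₁ r₁).const_mul m).aestronglyMeasurable
    (Eventually.of_forall fun z => by
      rw [ENNReal.coe_toNNReal hmt, enorm_mul]
      gcongr
      exact enorm_ballAvg_le h₁0 ht z) hr₁ hr₂ hR hB₁ hB₂
    (Eventually.of_forall fun z hz => by rw [ballAvg_of_notMem hz]; simp) h₂0 hdbl₂ hK₁ hK₂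
  rw [hint] at key
  refine key.trans ?_
  rw [ENNReal.coe_toNNReal hmt, mul_add]
  refine add_le_add (mul_le_mul' ?_ le_rfl) le_rfl
  calc ‖m‖ₑ * (μ (ball x₁ r₁))⁻¹ * μ (ball x₁ (σ * r₁))
      ≤ ‖m‖ₑ * (μ (ball x₁ r₁))⁻¹ * (β * μ (ball x₁ r₁)) := by gcongr
    _ = ‖m‖ₑ * β * ((μ (ball x₁ r₁))⁻¹ * μ (ball x₁ r₁)) := by ring
    _ = ‖m‖ₑ * β := by rw [ENNReal.inv_mul_cancel h₁0 ht, mul_one]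

end Transport

/-! ### Bounded coefficients between nearby doubling balls. -/

section Geometry

variable {X : Type*} [MetricSpace X] [MeasurableSpace X] {μ : Measure X} {lam : X → ℝ → ℝ}

/-- Comparison of the kernels `1 / λ(x, d(z, x))` for different centres. -/
lemma IsDominatingFunction.kernel_le (hlam : IsDominatingFunction μ lam) {c : ℝ} (hc : 1 ≤ c)
    (h1 : ∀ (n : ℕ) (x : X) (r : ℝ), 0 < r → lam x (2 ^ n * r) ≤ c ^ n * lam x r)
    (h2 : ∀ (x y : X) (r : ℝ), 0 < r → dist x y ≤ r → lam x r ≤ c * lam y r)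
    {x y : X} {a b : ℝ} (ha : 0 < a) (hb : 0 < b) (hxy : dist x y ≤ 4 * b) (hab : a ≤ 4 * b) :
    ENNReal.ofReal (1 / lam y b) ≤ ENNReal.ofReal (c ^ 3) * ENNReal.ofReal (1 / lam x a) := by
  rw [← ENNReal.ofReal_mul (by positivity)]
  refine ENNReal.ofReal_le_ofReal ?_
  have hpa := hlam.pos x a ha
  have hpb := hlam.pos y b hb
  have h3 : lam x a ≤ c ^ 3 * lam y b := by
    calc lam x a ≤ lam x (4 * b) := hlam.mono x a _ ha hab
      _ ≤ c * lam y (4 * b) := h2 x y _ (by positivity) hxy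
      _ = c * lam y (2 ^ 2 * b) := by norm_num
      _ ≤ c * (c ^ 2 * lam y b) := by gcongr; exact h1 2 y b hb
      _ = c ^ 3 * lam y b := by ring
  rw [mul_one_div, div_le_div_iff₀ hpb hpa]
  linarith

/-- The coefficients between two nearby doubling balls and a common large ball are bounded. -/
lemma IsDominatingFunction.exists_coefK_le [OpensMeasurableSpace X]
    (hlam : IsDominatingFunction μ lam) (K : ℝ≥0) : ∃ C : ℝ≥0,
    ∀ (x y : X) (r r' R R' : ℝ), 0 < r → 0 < r' → r' ≤ 7 / 4 * r → dist y x ≤ 5 / 4 * r →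
      8 * r ≤ R → r / 2 ≤ R' → gap μ lam x r (32 * R) ≤ K → gap μ lam y r' (32 * R') ≤ K →
      coefK μ lam x R x (4 * max R R') ≤ C ∧ coefK μ lam y R' x (4 * max R R') ≤ C := by
  obtain ⟨c, hc, h1, h2⟩ := hlam.exists_const
  obtain ⟨C16, hC16⟩ := hlam.exists_gap_le 16
  have hc0 : 0 < c := by linarith
  set c3 : ℝ≥0 := (c ^ 3).toNNReal
  have hc3 : ENNReal.ofReal (c ^ 3) = c3 := rfl
  refine ⟨1 + C16 + c3 * (1 + K), ?_⟩
  intro x y r r' R R' hr hr' hr'r hxy hR hR' hg hg'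
  have hRpos : 0 < R := by linarith
  have hR'pos : 0 < R' := by linarith
  have hxy' : dist x y ≤ 5 / 4 * r := by rwa [dist_comm]
  rcases le_total R' R with hle | hle
  · rw [max_eq_left hle]
    constructor
    · refine (coefK_le_one_add_gap (R' := 16 * R) (ball_subset_ball (by linarith))).trans ?_
      push_cast
      rw [add_assoc]
      gcongr
      exact (hC16 x R hRpos).trans le_self_add
    · unfold coefK
      push_cast
      rw [add_assoc]
      refine add_le_add le_rfl (le_trans ?_ le_add_self)
      -- Inside `ball x r` the distance to `y` is at least `R' ≥ r/2`, so the kernel is comparable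
      -- to `1 / lam x r`. Outside it the kernels centred at `x` and `y` are comparable, and the gap
      -- at `x` is at most `K`.
      have hsplit : ball x (2 * (4 * R)) \ ball y R' ⊆
          (ball x r \ ball y R') ∪ ((ball x (32 * R) \ ball x r) \ ball y R') := by
        rintro z ⟨hz1, hz2⟩
        by_cases hz : z ∈ ball x r
        · exact Or.inl ⟨hz, hz2⟩
        · exact Or.inr ⟨⟨ball_subset_ball (by linarith) hz1, hz⟩, hz2⟩
      refine (lintegral_mono_set hsplit).trans ((lintegral_union_le _ _ _).trans ?_)
      rw [mul_add, mul_one]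
      refine add_le_add ?_ ?_
      · calc ∫⁻ z in ball x r \ ball y R', ENNReal.ofReal (1 / lam y (dist z y)) ∂μ
            ≤ ∫⁻ z in ball x r \ ball y R', c3 * ENNReal.ofReal (1 / lam x r) ∂μ := by
              refine setLIntegral_mono' (measurableSet_ball.diff measurableSet_ball) fun z hz => ?_
              have hd : R' ≤ dist z y := by simpa using hz.2
              rw [← hc3]
              exact hlam.kernel_le hc h1 h2 hr (by linarith) (by linarith) (by linarith)
          _ ≤ c3 * ENNReal.ofReal (1 / lam x r) * μ (ball x r) := by
              rw [setLIntegral_const]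
              gcongr
              exact sdiff_subset
          _ ≤ c3 * ENNReal.ofReal (1 / lam x r) * ENNReal.ofReal (lam x r) := by
              gcongr
              exact hlam.measure_ball_le x r hr
          _ = c3 := by
              have := hlam.pos x r hr
              rw [mul_assoc, ← ENNReal.ofReal_mul (by positivity), one_div_mul_cancel this.ne']
              simp
      · calc ∫⁻ z in (ball x (32 * R) \ ball x r) \ ball y R',
              ENNReal.ofReal (1 / lam y (dist z y)) ∂μ
            ≤ ∫⁻ z in (ball x (32 * R) \ ball x r) \ ball y R',
              c3 * ENNReal.ofReal (1 / lam x (dist z x)) ∂μ := by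
              refine setLIntegral_mono' ((measurableSet_ball.diff measurableSet_ball).diff
                measurableSet_ball) fun z hz => ?_
              have hd : R' ≤ dist z y := by simpa using hz.2
              have hd' : r ≤ dist z x := by simpa using hz.1.2
              have := dist_triangle z y x
              rw [← hc3]
              exact hlam.kernel_le hc h1 h2 (by linarith) (by linarith) (by linarith) (by linarith)
          _ ≤ ∫⁻ z in ball x (32 * R) \ ball x r,
              c3 * ENNReal.ofReal (1 / lam x (dist z x)) ∂μ := lintegral_mono_set sdiff_subset
          _ = c3 * gap μ lam x r (32 * R) := lintegral_const_mul' _ _ (by simp)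
          _ ≤ c3 * K := by gcongr
  · rw [max_eq_right hle]
    constructor
    · unfold coefK
      push_cast
      rw [add_assoc]
      refine add_le_add le_rfl (le_trans ?_ le_add_self)
      -- With `R'` the larger radius the kernel is transferred from `x` to `y`. As `R ≥ 8r`, the
      -- annulus about `x` avoids `ball y r'` and is covered by the gap at `y`.
      calc ∫⁻ z in ball x (2 * (4 * R')) \ ball x R, ENNReal.ofReal (1 / lam x (dist z x)) ∂μ
          ≤ ∫⁻ z in ball x (2 * (4 * R')) \ ball x R,
            c3 * ENNReal.ofReal (1 / lam y (dist z y)) ∂μ := by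
            refine setLIntegral_mono' (measurableSet_ball.diff measurableSet_ball) fun z hz => ?_
            have hd : R ≤ dist z x := by simpa using hz.2
            have t1 := dist_triangle z y x
            have t2 := dist_triangle z x y
            rw [← hc3]
            exact hlam.kernel_le hc h1 h2 (by linarith) (by linarith) (by linarith) (by linarith)
        _ ≤ ∫⁻ z in ball y (32 * R') \ ball y r',
            c3 * ENNReal.ofReal (1 / lam y (dist z y)) ∂μ := by
            refine lintegral_mono_set fun z hz => ⟨ball_subset_ball' (by linarith) hz.1, ?_⟩
            have hd : R ≤ dist z x := by simpa using hz.2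
            have t1 := dist_triangle z y x
            rw [mem_ball, not_lt]
            linarith
        _ = c3 * gap μ lam y r' (32 * R') := lintegral_const_mul' _ _ (by simp)
        _ ≤ c3 * (1 + K) := by
            gcongr
            exact hg'.trans le_add_self
    · refine (coefK_le_one_add_gap (R' := 16 * R') (ball_subset_ball' (by linarith))).trans ?_
      push_cast
      rw [add_assoc]
      gcongr
      exact (hC16 y R' hR'pos).trans le_self_add

end Geometry


/-! ### Hölder's inequality for sums; restriction to disjoint sets. -/

section Tools

variable {X : Type*} [MeasurableSpace X] {μ : Measure X}

lemma ENNReal_tsum_rpow_mul_rpow_le {ι : Type*} {p : ℝ} (hp : 1 < p) (a b : ι → ℝ≥0∞) :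
    ∑' i, a i ^ (1 / p) * b i ^ (1 - 1 / p) ≤
      (∑' i, a i) ^ (1 / p) * (∑' i, b i) ^ (1 - 1 / p) := by
  have hp0 : 0 < p := by linarith
  have hq0 : 0 < 1 - 1 / p := by
    rw [sub_pos, div_lt_one hp0]; exact hp
  have e : 1 / p.conjExponent = 1 - 1 / p := by
    rw [Real.conjExponent]; field_simp
  have hq : 0 < p.conjExponent := (Real.HolderConjugate.conjExponent hp).symm.pos
  rw [ENNReal.tsum_eq_iSup_sum]
  refine iSup_le fun s => ?_
  have h := ENNReal.inner_le_Lp_mul_Lq s (fun i => a i ^ (1 / p)) (fun i => b i ^ (1 - 1 / p))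
    (Real.HolderConjugate.conjExponent hp)
  refine h.trans ?_
  simp only [← ENNReal.rpow_mul]
  rw [one_div_mul_cancel hp0.ne', ← e, one_div_mul_cancel hq.ne']
  simp only [ENNReal.rpow_one]
  gcongr
  · exact ENNReal.sum_le_tsum s
  · exact ENNReal.sum_le_tsum s

omit [MeasurableSpace X] in
lemma hasSum_indicator_of_disjoint {ι : Type*} {V : ι → Set X}
    (hV : Pairwise (Function.onFun Disjoint V)) (a : X → ℂ) (z : X) :
    HasSum (fun i => (V i).indicator a z) ((⋃ i, V i).indicator a z) := by
  by_cases hz : z ∈ ⋃ i, V i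
  · obtain ⟨i, hi⟩ := mem_iUnion.1 hz
    rw [indicator_of_mem hz, ← indicator_of_mem hi a]
    refine hasSum_single i fun j hj => indicator_of_notMem (fun h => ?_) _
    exact Set.disjoint_left.1 (hV hj) h hi
  · rw [indicator_of_notMem hz]
    have : ∀ i, (V i).indicator a z = 0 := fun i =>
      indicator_of_notMem (fun h => hz (mem_iUnion.2 ⟨i, h⟩)) _
    simp [this]

lemma tsum_setLIntegral_le {ι : Type*} [Countable ι] {V : ι → Set X}
    (hm : ∀ i, MeasurableSet (V i)) (hV : Pairwise (Function.onFun Disjoint V)) (w : X → ℝ≥0∞) :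
    ∑' i, ∫⁻ z in V i, w z ∂μ ≤ ∫⁻ z, w z ∂μ := by
  rw [← lintegral_iUnion hm hV]
  exact setLIntegral_le_lintegral _ _

lemma lintegral_enorm_rpow_indicator {p : ℝ} (hp : 0 < p) {V : Set X} (hV : MeasurableSet V)
    (a : X → ℂ) : ∫⁻ z, ‖V.indicator a z‖ₑ ^ p ∂μ = ∫⁻ z in V, ‖a z‖ₑ ^ p ∂μ := by
  rw [← lintegral_indicator hV]
  refine lintegral_congr fun z => ?_
  by_cases hz : z ∈ V
  · simp [hz]
  · simp [hz, hp]

end Tools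

/-! ### Functions recentred by spreading their mass over a doubling ball. -/

section Recenter

variable {X : Type*} [MetricSpace X] [MeasurableSpace X] {μ : Measure X} {lam : X → ℝ → ℝ}
  {σ : ℝ} {s : ℝ≥0∞} {D : ℝ} {β K : ℝ≥0} {up : X → ℝ → ℝ} {p : ℝ}

/-- The function `a` minus its mass spread over the ball `ball x (up x r)`. -/
noncomputable def recenter (μ : Measure X) (up : X → ℝ → ℝ) (x : X) (r : ℝ) (a : X → ℂ) : X → ℂ :=
  fun z => a z - (∫ w, a w ∂μ) * ballAvg μ x (up x r) z

/-- The quantity `‖a‖_p μ(2σB)^{1 - 1/p}` for a function `a` on the ball `B = ball x r`. -/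
noncomputable def ballSize (μ : Measure X) (p σ : ℝ) (x : X) (r : ℝ) (a : X → ℂ) : ℝ≥0∞ :=
  (∫⁻ z, ‖a z‖ₑ ^ p ∂μ) ^ (1 / p) * μ (ball x (2 * σ * r)) ^ (1 - 1 / p)

lemma lintegral_enorm_le_ballSize [OpensMeasurableSpace X] (hσ : 1 ≤ σ) (hp : 1 < p) {x : X}
    {r : ℝ} (hr : 0 < r) {a : X → ℂ} (ha : Measurable a) (hsupp : ∀ z, z ∉ ball x r → a z = 0) :
    ∫⁻ z, ‖a z‖ₑ ∂μ ≤ ballSize μ p σ x r a := by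
  have h1 : ∫⁻ z, ‖a z‖ₑ ∂μ = ∫⁻ z in ball x r, ‖a z‖ₑ ∂μ := by
    rw [setLIntegral_eq_of_support_subset]
    intro z hz
    by_contra h
    exact hz (by simp [hsupp z h])
  rw [h1]
  refine (setLIntegral_enorm_le_rpow hp ha.aestronglyMeasurable _).trans ?_
  have : 0 ≤ 1 - 1 / p := by
    rw [sub_nonneg, div_le_one (by linarith)]; exact hp.le
  unfold ballSize
  gcongr
  · exact Measure.restrict_le_self
  · nlinarith

lemma recenter_ae_eq_zero {x : X} {r : ℝ} {a : X → ℂ} (ha : a =ᵐ[μ] 0) :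
    recenter μ up x r a =ᵐ[μ] fun _ => 0 := by
  have h0 : ∫ w, a w ∂μ = 0 := by rw [integral_congr_ae ha]; simp
  filter_upwards [ha] with z hz
  simp [recenter, hz, h0]

variable [BorelSpace X] [Nonempty X]

/-- A single atomic block in the ball of radius `up x r`, whose coefficient relative to `ball x r`
is at most `1 + K`. This crude bound, which sees only the supremum and the measure, serves as the
remainder estimate of the iteration. -/
lemma exists_hNorm_recenter_le_of_bounded (hσ : 1 ≤ σ) (hs : 1 ≤ s)
    (hlam : IsDominatingFunction μ lam) (hD : 42 * σ ≤ D) (hdd : DoublingData μ lam D β K up) :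
    ∃ C : ℝ≥0, ∀ (x : X) (r : ℝ) (a : X → ℂ) (M : ℝ≥0), 0 < r → Measurable a →
      (∀ z, z ∉ ball x r → a z = 0) → (∀ z, ‖a z‖ₑ ≤ M) →
      hNorm μ lam σ s (recenter μ up x r a) ≤ C * M * μ (ball x (2 * σ * r)) := by
  obtain ⟨C2, hC2⟩ := hlam.exists_gap_le 2
  refine ⟨1 + K + β * (1 + C2), ?_⟩
  intro x r a M hr ha hsupp hM
  -- On a null ball nothing is known about `up`, but there `a` vanishes almost everywhere.
  by_cases hμ : μ (ball x r) = 0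
  · have h0 : a =ᵐ[μ] 0 := by
      filter_upwards [measure_eq_zero_iff_ae_notMem.1 hμ] with z hz using hsupp z hz
    rw [hNorm_congr (recenter_ae_eq_zero h0), hNorm_zero hσ hs]
    exact bot_le
  have hup := hdd.le_up x r hr hμ
  have hupr : r ≤ up x r := by nlinarith
  have hup0 : 0 < up x r := by linarith
  have hμu : μ (ball x (up x r)) ≠ 0 := fun h =>
    hμ (measure_mono_null (ball_subset_ball hupr) h)
  have key := hNorm_sub_ballAvg_le (lam := lam) (s := s) (u := a) (M := M) (σ := σ)
    (x₁ := x) (x₂ := x) (y := x) (r₁ := r) (r₂ := up x r) (R := up x r) (K₁ := 1 + K)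
    (K₂ := 1 + C2) (β := β) hσ hs hlam ha.aestronglyMeasurable (Eventually.of_forall hM) hr hup0
    hup0 (ball_subset_ball hupr) Subset.rfl (Eventually.of_forall hsupp) hμu
    ((measure_mono (ball_subset_ball (by nlinarith))).trans (hdd.doubling_up x r hr hμ))
    (by
      push_cast
      refine (coefK_le_one_add_gap (R' := 32 * up x r) (ball_subset_ball (by linarith))).trans ?_
      gcongr
      exact hdd.gap_up x r hr hμ)
    (by
      push_cast
      refine (coefK_le_one_add_gap (R' := 2 * up x r) Subset.rfl).trans ?_
      gcongr
      exact hC2 x _ hup0)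
  refine key.trans ?_
  have h1 : ‖∫ w, a w ∂μ‖ₑ ≤ M * μ (ball x (2 * σ * r)) := by
    refine (enorm_integral_le_lintegral_enorm _).trans ?_
    calc ∫⁻ z, ‖a z‖ₑ ∂μ = ∫⁻ z in ball x r, ‖a z‖ₑ ∂μ := by
          rw [setLIntegral_eq_of_support_subset]
          intro z hz
          by_contra h
          exact hz (by simp [hsupp z h])
      _ ≤ ∫⁻ z in ball x r, M ∂μ := lintegral_mono fun z => hM z
      _ = M * μ (ball x r) := setLIntegral_const _ _
      _ ≤ _ := by gcongr; nlinarith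
  calc _ ≤ M * μ (ball x (2 * σ * r)) * ((1 + K : ℝ≥0) : ℝ≥0∞) +
        M * μ (ball x (2 * σ * r)) * β * ((1 + C2 : ℝ≥0) : ℝ≥0∞) := by
        gcongr
        nlinarith
    _ = _ := by push_cast; ring

end Recenter


/-- The height is chosen so that the factor in front of `I` is `2^{p/(p-1)}`: raised to the power `1
- 1/p` it equals `2`, the gain per generation in the iteration. -/
lemma exists_height {p : ℝ} (hp : 1 < p) {I m : ℝ≥0∞} (hI0 : I ≠ 0) (hIt : I ≠ ∞) (hm0 : m ≠ 0)
    (hmt : m ≠ ∞) : ∃ t : ℝ≥0, t ≠ 0 ∧ (t : ℝ≥0∞) ^ p * m = 2 ^ (p / (p - 1)) * I ∧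
      t * m = 2 ^ (1 / (p - 1)) * (I ^ (1 / p) * m ^ (1 - 1 / p)) := by
  have hp0 : 0 < p := by linarith
  have hp1 : 0 < p - 1 := by linarith
  set T : ℝ≥0∞ := 2 ^ (1 / (p - 1)) * (I ^ (1 / p) * m ^ (-(1 / p)))
  have hT0 : T ≠ 0 := by
    refine mul_ne_zero ?_ (mul_ne_zero ?_ ?_)
    · exact (ENNReal.rpow_pos (by norm_num) (by norm_num)).ne'
    · exact (ENNReal.rpow_pos hI0.bot_lt hIt).ne'
    · exact (ENNReal.rpow_pos hm0.bot_lt hmt).ne'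
  have hTt : T ≠ ∞ := by
    refine ENNReal.mul_ne_top ?_ (ENNReal.mul_ne_top ?_ ?_)
    · exact ENNReal.rpow_ne_top_of_nonneg (by positivity) (by norm_num)
    · exact ENNReal.rpow_ne_top_of_nonneg (by positivity) hIt
    · rw [ENNReal.rpow_neg]
      exact ENNReal.inv_ne_top.2 (ENNReal.rpow_pos hm0.bot_lt hmt).ne'
  refine ⟨T.toNNReal, ?_, ?_, ?_⟩
  · rw [Ne, ENNReal.toNNReal_eq_zero_iff]; tauto
  · rw [ENNReal.coe_toNNReal hTt]
    simp only [T]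
    rw [ENNReal.mul_rpow_of_nonneg _ _ hp0.le, ENNReal.mul_rpow_of_nonneg _ _ hp0.le,
      ← ENNReal.rpow_mul, ← ENNReal.rpow_mul, ← ENNReal.rpow_mul, one_div_mul_cancel hp0.ne',
      show -(1 / p) * p = -1 by field_simp, ENNReal.rpow_one, ENNReal.rpow_neg_one, mul_assoc,
      mul_assoc, ENNReal.inv_mul_cancel hm0 hmt, mul_one, one_div_mul_eq_div]
  · rw [ENNReal.coe_toNNReal hTt]
    simp only [T]
    rw [mul_assoc, mul_assoc]
    congr 2
    rw [show 1 - 1 / p = -(1 / p) + 1 by ring, ENNReal.rpow_add _ _ hm0 hmt, ENNReal.rpow_one]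

/-! ### One generation of the decomposition of a recentred function. -/

section Step

variable {X : Type*} [MetricSpace X] [MeasurableSpace X] {μ : Measure X} {lam : X → ℝ → ℝ}
  {σ : ℝ} {s : ℝ≥0∞} {D : ℝ} {β K : ℝ≥0} {up : X → ℝ → ℝ} {p : ℝ}

/-- Stopping balls for a function supported in `ball x r` are small and close to `ball x r`. -/
lemma stopping_ball_close [OpensMeasurableSpace X] (hσ : 1 ≤ σ) {t : ℝ≥0∞} {x c : X} {r r' : ℝ}
    (hr' : 0 < r')
    {w : X → ℝ≥0∞} (hw : ∀ z, z ∉ ball x r → w z = 0)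
    (h : t * μ (ball c (14 * σ * r')) < ∫⁻ z in ball c r', w z ∂μ)
    (hI : ∫⁻ z, w z ∂μ ≤ t * μ (ball x (2 * σ * r))) :
    r' ≤ r / 4 ∧ dist c x ≤ 5 / 4 * r := by
  have hmeet : ∃ z, z ∈ ball c r' ∧ z ∈ ball x r := by
    by_contra! hno
    rw [setLIntegral_congr_fun measurableSet_ball fun z hz => hw z (hno z hz)] at h
    simp at h
  obtain ⟨z, hz1, hz2⟩ := hmeet
  rw [mem_ball] at hz1 hz2
  have hd := dist_triangle c z x
  rw [dist_comm c z] at hd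
  -- If `r' > r/4`, the `14σ`-dilate of the stopping ball would contain the `2σ`-dilate of `ball x
  -- r`, and the stopping inequality would contradict `hI`.
  have h4 : r' ≤ r / 4 := by
    by_contra! hlt
    have hsub : ball x (2 * σ * r) ⊆ ball c (14 * σ * r') := by
      refine ball_subset_ball' ?_
      rw [dist_comm x c]
      nlinarith
    refine absurd h (not_lt.2 ?_)
    calc ∫⁻ z in ball c r', w z ∂μ ≤ ∫⁻ z, w z ∂μ := setLIntegral_le_lintegral _ _
      _ ≤ t * μ (ball x (2 * σ * r)) := hI
      _ ≤ _ := by gcongr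
  exact ⟨h4, by linarith⟩

variable [BorelSpace X] [Nonempty X]

/-- Both functions carry the mass of `f` on `V i` and are bounded on the same doubling ball by a
multiple of its average, so their difference is one block. -/
lemma CZData.hNorm_bump_le (hσ : 1 ≤ σ) (hs : 1 ≤ s) (hlam : IsDominatingFunction μ lam)
    {η : ℝ} (hD : σ ≤ D) (hdd : DoublingData μ lam D β K up) {t : ℝ≥0} {f : X → ℂ}
    {ι : Type*} {c : ι → X} {r : ι → ℝ} {V : ι → Set X} {φ : ι → X → ℂ}
    (h : CZData μ up η β p t f c r V φ) (hf : Integrable f μ) {C2 : ℝ≥0}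
    (hC2 : ∀ (x : X) (r : ℝ), 0 < r → gap μ lam x r (2 * r) ≤ C2) (i : ι) :
    hNorm μ lam σ s (fun z => (∫ w in V i, f w ∂μ) * ballAvg μ (c i) (up (c i) (7 * r i)) z -
      φ i z) ≤ ((3 * β * (1 + C2) : ℝ≥0) : ℝ≥0∞) * ∫⁻ z in V i, ‖f z‖ₑ ∂μ := by
  have hri := h.r_pos i
  set R := up (c i) (7 * r i)
  set I := ∫⁻ z in V i, ‖f z‖ₑ ∂μ
  have h7 : μ (ball (c i) (7 * r i)) ≠ 0 := h.measure_ne_zero (by linarith)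
  have hle := hdd.le_up _ _ (by linarith) h7
  have hR0 : 0 < R := by nlinarith
  have hRr : r i ≤ R := by nlinarith
  have hμR : μ (ball (c i) R) ≠ 0 := h.measure_ne_zero hRr
  have hμRt := (hlam.measure_ball_lt_top (c i) R).ne
  have hIt : I ≠ ∞ := ne_top_of_le_ne_top hf.2.ne (setLIntegral_le_lintegral _ _)
  have hMt : 2 * I / μ (ball (c i) R) ≠ ∞ :=
    ENNReal.div_ne_top (ENNReal.mul_ne_top (by norm_num) hIt) hμR
  have hdb : μ (ball (c i) (σ * R)) ≤ β * μ (ball (c i) R) :=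
    (measure_mono (ball_subset_ball (by gcongr))).trans (hdd.doubling_up _ _ (by linarith) h7)
  have hK : coefK μ lam (c i) R (c i) R ≤ ((1 + C2 : ℝ≥0) : ℝ≥0∞) := by
    push_cast
    refine (coefK_le_one_add_gap Subset.rfl).trans ?_
    gcongr
    exact hC2 _ _ hR0
  have key := hNorm_sub_ballAvg_le (lam := lam) (s := s) (u := φ i)
    (M := (2 * I / μ (ball (c i) R)).toNNReal) hσ hs hlam (h.φ_meas i).aestronglyMeasurable
    (Eventually.of_forall fun z => by
      rw [ENNReal.coe_toNNReal hMt, ENNReal.le_div_iff_mul_le (Or.inl hμR) (Or.inl hμRt)]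
      exact h.φ_bound i z) hR0 hR0 hR0 Subset.rfl Subset.rfl
    (Eventually.of_forall fun z hz => h.φ_supp i z hz) hμR hdb hK hK
  rw [ENNReal.coe_toNNReal hMt, h.φ_int i] at key
  have e : (fun z => (∫ w in V i, f w ∂μ) * ballAvg μ (c i) R z - φ i z) =
      fun z => (-1 : ℂ) * (φ i z - (∫ w in V i, f w ∂μ) * ballAvg μ (c i) R z) := by
    funext z; ring
  rw [e]
  refine (hNorm_smul_le hσ hs _ _).trans ?_
  rw [enorm_neg, enorm_one, one_mul]
  refine key.trans ?_
  calc _ ≤ 2 * I / μ (ball (c i) R) * (β * μ (ball (c i) R)) * ((1 + C2 : ℝ≥0) : ℝ≥0∞) +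
        I * β * ((1 + C2 : ℝ≥0) : ℝ≥0∞) := by
        gcongr
        exact enorm_integral_le_lintegral_enorm _
    _ = (2 * I / μ (ball (c i) R) * μ (ball (c i) R)) * (β * ((1 + C2 : ℝ≥0) : ℝ≥0∞)) +
        I * β * ((1 + C2 : ℝ≥0) : ℝ≥0∞) := by ring
    _ = _ := by
        rw [ENNReal.div_mul_cancel hμR hμRt]; push_cast; ring


section Good

variable {t : ℝ≥0} {f : X → ℂ} {ι : Type*} {c : ι → X} {r : ι → ℝ} {V : ι → Set X}
  {φ : ι → X → ℂ} {η : ℝ}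

/-- The good part of a Calderón–Zygmund decomposition, with bumps for the indices in `J`. -/
noncomputable def goodPart (f : X → ℂ) (V : ι → Set X) (φ : ι → X → ℂ) (J : Set ι) : X → ℂ :=
  fun z => (⋃ i, V i)ᶜ.indicator f z + ∑' i, J.indicator (fun j => φ j z) i

omit [BorelSpace X] [Nonempty X] in
lemma CZData.tsum_enorm_indicator_le (h : CZData μ up η β p t f c r V φ) (J : Set ι) (z : X) :
    ∑' i, ‖J.indicator (fun j => φ j z) i‖ₑ ≤ 4 * β * t := by
  refine (ENNReal.tsum_le_tsum fun i => ?_).trans (h.φ_sum z)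
  by_cases hi : i ∈ J <;> simp [hi]

omit [BorelSpace X] [Nonempty X] in
lemma CZData.summable_indicator (h : CZData μ up η β p t f c r V φ) (J : Set ι) (z : X) :
    Summable fun i => J.indicator (fun j => φ j z) i := by
  refine Summable.of_enorm (ne_top_of_le_ne_top ?_ (h.tsum_enorm_indicator_le J z))
  exact_mod_cast ENNReal.coe_ne_top (r := 4 * β * t)

-- Off the sets `V i` the good part differs from `f` only by the bumps, so the error is the sum of
-- the pieces of `f` on the disjoint `V i` minus the bumps kept.
omit [BorelSpace X] [Nonempty X] in
lemma CZData.hasSum_error (h : CZData μ up η β p t f c r V φ) (J : Set ι) (z : X) :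
    HasSum (fun i => (V i).indicator f z - J.indicator (fun j => φ j z) i)
      (f z - goodPart f V φ J z) := by
  have h1 := (hasSum_indicator_of_disjoint h.V_disj f z).sub (h.summable_indicator J z).hasSum
  have h2 := congrFun (indicator_self_add_compl (⋃ i, V i) f) z
  rw [Pi.add_apply] at h2
  have h3 : f z - goodPart f V φ J z =
      (⋃ i, V i).indicator f z - ∑' i, J.indicator (fun j => φ j z) i := by
    unfold goodPart
    linear_combination -h2
  rw [h3]
  exact h1

omit [BorelSpace X] [Nonempty X] in
lemma CZData.measurable_goodPart [Countable ι] (h : CZData μ up η β p t f c r V φ)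
    (hf : Measurable f) (J : Set ι) : Measurable (goodPart f V φ J) := by
  refine (hf.indicator (MeasurableSet.iUnion h.V_meas).compl).add (Measurable.tsum fun i => ?_)
  by_cases hi : i ∈ J
  · simpa [hi] using h.φ_meas i
  · simp [hi]

omit [BorelSpace X] [Nonempty X] in
lemma CZData.enorm_goodPart_le (h : CZData μ up η β p t f c r V φ) (J : Set ι) :
    ∀ᵐ z ∂μ, ‖goodPart f V φ J z‖ₑ ≤ ((5 * β * t : ℝ≥0) : ℝ≥0∞) := by
  filter_upwards [h.off] with z hz
  refine (enorm_add_le _ _).trans ?_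
  have h1 : ‖(⋃ i, V i)ᶜ.indicator f z‖ₑ ≤ β * t := by
    by_cases hzV : z ∈ ⋃ i, V i
    · rw [indicator_of_notMem (by simpa using hzV)]; simp
    · rw [indicator_of_mem hzV]; exact hz hzV
  have h2 := enorm_tsum_le_tsum_enorm.trans (h.tsum_enorm_indicator_le J z)
  calc _ ≤ (β * t : ℝ≥0∞) + 4 * β * t := add_le_add h1 h2
    _ = _ := by push_cast; ring

omit [BorelSpace X] [Nonempty X] in
lemma CZData.lintegral_bump_le [OpensMeasurableSpace X] (hlam : IsDominatingFunction μ lam)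
    (hD : 1 ≤ D)
    (hdd : DoublingData μ lam D β K up) (h : CZData μ up η β p t f c r V φ) (i : ι) :
    ∫⁻ z, ‖φ i z‖ₑ ∂μ ≤ 2 * ∫⁻ z in V i, ‖f z‖ₑ ∂μ := by
  have hri := h.r_pos i
  set R := up (c i) (7 * r i)
  have hle := hdd.le_up _ _ (by linarith) (h.measure_ne_zero (i := i) (ρ := 7 * r i) (by linarith))
  have hμR : μ (ball (c i) R) ≠ 0 := h.measure_ne_zero (by nlinarith)
  have hμRt := (hlam.measure_ball_lt_top (c i) R).ne
  calc ∫⁻ z, ‖φ i z‖ₑ ∂μ = ∫⁻ z in ball (c i) R, ‖φ i z‖ₑ ∂μ := by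
        rw [setLIntegral_eq_of_support_subset]
        intro z hz
        by_contra h'
        exact hz (by simp [h.φ_supp i z h'])
    _ ≤ ∫⁻ z in ball (c i) R, (2 * ∫⁻ z in V i, ‖f z‖ₑ ∂μ) / μ (ball (c i) R) ∂μ := by
        refine lintegral_mono fun z => ?_
        rw [ENNReal.le_div_iff_mul_le (Or.inl hμR) (Or.inl hμRt)]
        exact h.φ_bound i z
    _ = _ := by rw [setLIntegral_const, ENNReal.div_mul_cancel hμR hμRt]

-- A bump restores the mass of `f` on its `V i`. What is missing is the mass for the indices outside
-- `J`, which `exists_recenter_step` sends to the large doubling ball instead.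
omit [BorelSpace X] [Nonempty X] in
lemma CZData.integral_goodPart [OpensMeasurableSpace X] [Countable ι]
    (hlam : IsDominatingFunction μ lam) (hD : 1 ≤ D)
    (hdd : DoublingData μ lam D β K up) (h : CZData μ up η β p t f c r V φ)
    (hf : Integrable f μ) (J : Set ι) :
    Integrable (goodPart f V φ J) μ ∧
    HasSum (fun i => Jᶜ.indicator (fun j => ∫ z in V j, f z ∂μ) i)
      (∫ z, f z ∂μ - ∫ z, goodPart f V φ J z ∂μ) := by
  have hVm := MeasurableSet.iUnion h.V_meas
  have hm : ∀ i, Measurable fun z => J.indicator (fun j => φ j z) i := fun i => by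
    by_cases hi : i ∈ J
    · simpa [hi] using h.φ_meas i
    · simp [hi]
  have hsum : ∑' i, ∫⁻ z, ‖J.indicator (fun j => φ j z) i‖ₑ ∂μ ≠ ∞ := by
    refine ne_top_of_le_ne_top (b := 2 * ∫⁻ z, ‖f z‖ₑ ∂μ)
      (ENNReal.mul_ne_top (by norm_num) hf.2.ne) ?_
    calc _ ≤ ∑' i, 2 * ∫⁻ z in V i, ‖f z‖ₑ ∂μ := by
          refine ENNReal.tsum_le_tsum fun i => ?_
          by_cases hi : i ∈ J
          · simpa [hi] using h.lintegral_bump_le hlam hD hdd i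
          · simp [hi]
      _ ≤ _ := by
          rw [ENNReal.tsum_mul_left]
          gcongr
          exact tsum_setLIntegral_le h.V_meas h.V_disj _
  have hint := integral_tsum (fun i => (hm i).aestronglyMeasurable) hsum
  have hI2 : Integrable (fun z => ∑' i, J.indicator (fun j => φ j z) i) μ := by
    refine ⟨(Measurable.tsum hm).aestronglyMeasurable, ?_⟩
    refine lt_of_le_of_lt (lintegral_mono fun z => enorm_tsum_le_tsum_enorm) ?_
    rw [lintegral_tsum fun i => (hm i).enorm.aemeasurable]
    exact hsum.lt_top
  have hI1 : Integrable ((⋃ i, V i)ᶜ.indicator f) μ := hf.indicator hVm.compl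
  refine ⟨hI1.add hI2, ?_⟩
  have e : ∫ z, goodPart f V φ J z ∂μ =
      ∫ z in (⋃ i, V i)ᶜ, f z ∂μ + ∑' i, J.indicator (fun j => ∫ z in V j, f z ∂μ) i := by
    unfold goodPart
    rw [integral_add hI1 hI2, integral_indicator hVm.compl, hint]
    congr 1
    refine tsum_congr fun i => ?_
    by_cases hi : i ∈ J
    · simp [hi, h.φ_int i]
    · simp [hi]
  have hs := hasSum_integral_iUnion h.V_meas h.V_disj hf.integrableOn
  have hs1 := hs.summable.indicator J
  have hs2 := hs.sub hs1.hasSum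
  rw [e, ← integral_add_compl hVm hf]
  have e1 : (fun i => Jᶜ.indicator (fun j => ∫ z in V j, f z ∂μ) i) = fun i =>
      ∫ z in V i, f z ∂μ - J.indicator (fun j => ∫ z in V j, f z ∂μ) i := by
    funext i
    by_cases hi : i ∈ J <;> simp [hi]
  rw [e1, add_comm (∫ z in ⋃ i, V i, f z ∂μ), add_sub_add_left_eq_sub]
  exact hs2

end Good


/-- The recentred function splits into the recentred good part, which is bounded on `ball x (2 *
r)`; the recentred pieces of `a` on the sets `V i`, of the same type as `a` itself; and transport
terms moving each mass from the doubling ball of its piece to its bump or to the doubling ball of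
`ball x r`. The first and last groups cost at most a multiple of `ballSize`, and by the choice of
height the pieces have half the total size and half the total measure. -/
lemma exists_recenter_step [SecondCountableTopology X] (hσ : 1 ≤ σ) (hs : 1 ≤ s) (hp : 1 < p)
    (hlam : IsDominatingFunction μ lam) (hD : 42 * σ ≤ D) (hdd : DoublingData μ lam D β K up) :
    ∃ C : ℝ≥0, ∀ (x : X) (r : ℝ) (a : X → ℂ), 0 < r → Measurable a →
      (∀ z, z ∉ ball x r → a z = 0) → ∫⁻ z, ‖a z‖ₑ ^ p ∂μ ≠ 0 → ∫⁻ z, ‖a z‖ₑ ^ p ∂μ ≠ ∞ →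
      ∃ (u : Set X) (r' : u → ℝ) (V : u → Set X), u.Countable ∧ (∀ i, 0 < r' i) ∧
        (∀ i, MeasurableSet (V i)) ∧ (∀ i, V i ⊆ ball (i : X) (r' i)) ∧
        hNorm μ lam σ s (recenter μ up x r a) ≤ C * ballSize μ p σ x r a +
          ∑' i : u, hNorm μ lam σ s (recenter μ up (i : X) (r' i) ((V i).indicator a)) ∧
        2 * ∑' i : u, ballSize μ p σ (i : X) (r' i) ((V i).indicator a) ≤ ballSize μ p σ x r a ∧
        2 * ∑' i : u, μ (ball (i : X) (2 * σ * r' i)) ≤ μ (ball x (2 * σ * r)) := by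
  obtain ⟨C2, hC2⟩ := hlam.exists_gap_le 2
  obtain ⟨CL, hCL⟩ := hlam.exists_coefK_le K
  set L : ℝ≥0 := 2 ^ (1 / (p - 1))
  set Cg : ℝ≥0 := 5 * β * L * (1 + K) + 5 * β * L * β * (1 + C2)
  set Cw : ℝ≥0 := 3 * β * (1 + C2) + β * (CL + CL)
  refine ⟨Cg + Cw, ?_⟩
  intro x r a hr ha hsupp hI0 hIt
  have hp0 : 0 < p := by linarith
  have hp1 : 0 < p - 1 := by linarith
  have hL : (2 : ℝ≥0∞) ^ (1 / (p - 1)) = L := by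
    rw [ENNReal.coe_rpow_of_nonneg _ (by positivity)]; simp
  set I := ∫⁻ z, ‖a z‖ₑ ^ p ∂μ
  set m₀ := μ (ball x (2 * σ * r))
  have hμr : μ (ball x r) ≠ 0 := by
    intro h0
    refine hI0 ((lintegral_eq_zero_iff (ha.enorm.pow_const p)).2 ?_)
    filter_upwards [measure_eq_zero_iff_ae_notMem.1 h0] with z hz
    simp [hsupp z hz, hp0]
  have hm0 : m₀ ≠ 0 := fun h => hμr (measure_mono_null (ball_subset_ball (by nlinarith)) h)
  have hmt : m₀ ≠ ∞ := (hlam.measure_ball_lt_top _ _).ne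
  obtain ⟨t, ht0, htp, htm⟩ := exists_height hp hI0 hIt hm0 hmt
  have htp0 : (t : ℝ≥0∞) ^ p ≠ 0 :=
    (ENNReal.rpow_pos (ENNReal.coe_pos.2 ht0.bot_lt) ENNReal.coe_ne_top).ne'
  have htpt : (t : ℝ≥0∞) ^ p ≠ ∞ := ENNReal.rpow_ne_top_of_nonneg hp0.le ENNReal.coe_ne_top
  have h2L : (2 : ℝ≥0∞) ≤ 2 ^ (p / (p - 1)) := by
    conv_lhs => rw [← ENNReal.rpow_one 2]
    exact ENNReal.rpow_le_rpow_of_exponent_le (by norm_num) (by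
      rw [le_div_iff₀ hp1]; linarith)
  have hIm : I < (t : ℝ≥0∞) ^ p * m₀ := by
    rw [htp]
    calc I < I + I := ENNReal.lt_add_right hIt hI0
      _ = 2 * I := (two_mul I).symm
      _ ≤ _ := by gcongr
  have hsize : ∫⁻ z, ‖a z‖ₑ ∂μ ≤ ballSize μ p σ x r a :=
    lintegral_enorm_le_ballSize hσ hp hr ha hsupp
  have hsizet : ballSize μ p σ x r a ≠ ∞ :=
    ENNReal.mul_ne_top (ENNReal.rpow_ne_top_of_nonneg (by positivity) hIt)
      (ENNReal.rpow_ne_top_of_nonneg (by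
        rw [sub_nonneg, div_le_one hp0]; exact hp.le) hmt)
  have hai : Integrable a μ := ⟨ha.aestronglyMeasurable, hsize.trans_lt hsizet.lt_top⟩
  -- The value `14σ` is `2σ * 7`: the pieces live on `7`-dilates and their size is measured on the
  -- `2σ`-dilate of these.
  obtain ⟨u, r', V, φ, hu, h⟩ := exists_czData (η := 14 * σ) hlam (by linarith) (by linarith) hdd hp
    ht0 ha (hIm.trans_le (mul_le_mul' le_rfl (measure_mono (subset_univ _))))
  have hcu : Countable u := hu.to_subtype
  have hclose : ∀ i : u, r' i ≤ r / 4 ∧ dist (i : X) x ≤ 5 / 4 * r := fun i =>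
    stopping_ball_close hσ (h.r_pos i) (fun z hz => by simp [hsupp z hz, hp0]) (h.selected i) hIm.le
  have hexp : 0 < 1 - 1 / p := by rw [sub_pos, div_lt_one hp0]; exact hp
  have hVint : ∀ i, ∫ z, (V i).indicator a z ∂μ = ∫ z in V i, a z ∂μ := fun i =>
    integral_indicator (h.V_meas i)
  have e14 : ∀ i : u, 2 * σ * (7 * r' i) = 14 * σ * r' i := fun i => by ring
  have hmsum : 2 ^ (p / (p - 1)) * ∑' i : u, μ (ball (i : X) (14 * σ * r' i)) ≤ m₀ := by
    have h1 := h.sum_selected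
    rw [ENNReal.tsum_mul_left] at h1
    rw [← ENNReal.mul_le_mul_iff_right hI0 hIt]
    calc I * (2 ^ (p / (p - 1)) * ∑' i : u, μ (ball (i : X) (14 * σ * r' i)))
        = 2 ^ (p / (p - 1)) * I * ∑' i : u, μ (ball (i : X) (14 * σ * r' i)) := by ring
      _ = m₀ * ((t : ℝ≥0∞) ^ p * ∑' i : u, μ (ball (i : X) (14 * σ * r' i))) := by
          rw [← htp]; ring
      _ ≤ m₀ * I := by gcongr
      _ = I * m₀ := mul_comm _ _
  refine ⟨u, fun i => 7 * r' i, V, hu, fun i => by have := h.r_pos i; positivity, h.V_meas,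
    h.V_sub, ?_, ?_, ?_⟩
  · set R := up x r
    have hup := hdd.le_up x r hr hμr
    have h8R : 8 * r ≤ R := by nlinarith
    have hrR : 2 * r ≤ R := by linarith
    have hR0 : 0 < R := by linarith
    have hσD : σ ≤ D := by linarith
    have hμR : μ (ball x R) ≠ 0 := fun h' =>
      hμr (measure_mono_null (ball_subset_ball (by linarith)) h')
    have hdR : μ (ball x (σ * R)) ≤ β * μ (ball x R) :=
      (measure_mono (ball_subset_ball (by gcongr))).trans (hdd.doubling_up x r hr hμr)
    -- Bumps of radius at most `r/2` keep the good part supported in `ball x (2 * r)`. For the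
    -- others the radius is at least `r/2`, and `exists_coefK_le` allows moving their mass directly
    -- to the doubling ball of `ball x r`.
    set J : Set u := {i | up (i : X) (7 * r' i) ≤ r / 2}
    set g := goodPart a V φ J
    set vg : X → ℂ := fun z => g z - (∫ w, g w ∂μ) * ballAvg μ x R z
    -- The transport term of the piece `i`: its mass leaves the concentric doubling ball and goes to
    -- the bump if `i ∈ J`, and to `ball x R` otherwise.
    set w : u → X → ℂ := fun i z => (∫ y in V i, a y ∂μ) * ballAvg μ (i : X) (up i (7 * r' i)) z -
      (J.indicator (fun j => φ j z) i +
        Jᶜ.indicator (fun j => ∫ y in V j, a y ∂μ) i * ballAvg μ x R z)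
    have hgm : Measurable g := h.measurable_goodPart ha J
    obtain ⟨hgi, hgs⟩ := h.integral_goodPart hlam (by linarith) hdd hai J
    have hsumz : ∀ z, HasSum (fun i : u => recenter μ up (i : X) (7 * r' i) ((V i).indicator a) z
        + w i z) (recenter μ up x r a z - vg z) := by
      intro z
      have e1 : (fun i : u => recenter μ up (i : X) (7 * r' i) ((V i).indicator a) z + w i z) =
          fun i => ((V i).indicator a z - J.indicator (fun j => φ j z) i) -
            Jᶜ.indicator (fun j => ∫ y in V j, a y ∂μ) i * ballAvg μ x R z := by
        funext i
        simp only [recenter, w, hVint]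
        ring
      have e2 : recenter μ up x r a z - vg z = (a z - g z) -
          (∫ z, a z ∂μ - ∫ z, g z ∂μ) * ballAvg μ x R z := by
        simp only [recenter, vg]
        ring
      rw [e1, e2]
      exact (h.hasSum_error J z).sub (hgs.mul_right _)
    have hwle : ∀ i : u, hNorm μ lam σ s (w i) ≤ Cw * ∫⁻ z in V i, ‖a z‖ₑ ∂μ := by
      intro i
      by_cases hi : i ∈ J
      · have e : w i = fun z => (∫ y in V i, a y ∂μ) * ballAvg μ (i : X) (up i (7 * r' i)) z -
            φ i z := by
          funext z; simp [w, hi]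
        rw [e]
        refine (h.hNorm_bump_le hσ hs hlam hσD hdd hai hC2 i).trans ?_
        gcongr
        exact le_self_add
      · have e : w i = fun z => (∫ y in V i, a y ∂μ) * ballAvg μ (i : X) (up i (7 * r' i)) z -
            (∫ y in V i, a y ∂μ) * ballAvg μ x R z := by
          funext z; simp [w, hi]
        have hri := h.r_pos i
        obtain ⟨hc1, hc2⟩ := hclose i
        set R' := up (i : X) (7 * r' i)
        have h7 : μ (ball (i : X) (7 * r' i)) ≠ 0 := h.measure_ne_zero (by linarith)
        have hup' := hdd.le_up (i : X) (7 * r' i) (by linarith) h7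
        have hR'0 : 0 < R' := by nlinarith
        have hR'r : r / 2 ≤ R' := le_of_not_ge hi
        obtain ⟨k1, k2⟩ := hCL x i r (7 * r' i) R R' hr (by linarith) (by linarith) hc2 h8R hR'r
          (hdd.gap_up x r hr hμr) (hdd.gap_up _ _ (by linarith) h7)
        have m1 := le_max_left R R'
        have m2 := le_max_right R R'
        rw [e]
        refine (hNorm_ballAvg_sub_ballAvg_le (y := x) (R := 4 * max R R') hσ hs hlam _ hR'0 hR0
          (by linarith) (ball_subset_ball' (by linarith)) (ball_subset_ball (by linarith))
          (h.measure_ne_zero (by nlinarith)) hμR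
          ((measure_mono (ball_subset_ball (by gcongr))).trans
            (hdd.doubling_up _ _ (by linarith) h7)) hdR k2 k1).trans ?_
        calc _ ≤ (∫⁻ z in V i, ‖a z‖ₑ ∂μ) * β * (CL + CL) := by
              gcongr
              exact enorm_integral_le_lintegral_enorm _
          _ = ((β * (CL + CL) : ℝ≥0) : ℝ≥0∞) * ∫⁻ z in V i, ‖a z‖ₑ ∂μ := by push_cast; ring
          _ ≤ _ := by
              gcongr
              exact le_add_self
    have hgle : ∀ᵐ z ∂μ, ‖g z‖ₑ ≤ ((5 * β * t : ℝ≥0) : ℝ≥0∞) := h.enorm_goodPart_le J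
    have hgsupp : ∀ z, z ∉ ball x (2 * r) → g z = 0 := by
      intro z hz
      have h1 : a z = 0 := hsupp z fun h' => hz (ball_subset_ball (by linarith) h')
      have h2 : ∀ i : u, J.indicator (fun j => φ j z) i = 0 := by
        intro i
        by_cases hi : i ∈ J
        · rw [indicator_of_mem hi]
          refine h.φ_supp i z fun h' => hz ?_
          have hi' : up (i : X) (7 * r' i) ≤ r / 2 := hi
          exact ball_subset_ball' (by linarith [(hclose i).2]) h'
        · exact indicator_of_notMem hi _
      simp only [g, goodPart, h2, tsum_zero, add_zero]
      by_cases hzV : z ∈ (⋃ i, V i)ᶜ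
      · rw [indicator_of_mem hzV, h1]
      · rw [indicator_of_notMem hzV]
    have h2m : μ (ball x (2 * r)) ≤ m₀ := measure_mono (ball_subset_ball (by nlinarith))
    have htm' : (t : ℝ≥0∞) * m₀ = L * ballSize μ p σ x r a := by rw [htm, hL]; rfl
    have hgint : ‖∫ z, g z ∂μ‖ₑ ≤ ((5 * β * L : ℝ≥0) : ℝ≥0∞) * ballSize μ p σ x r a := by
      refine (enorm_integral_le_lintegral_enorm _).trans ?_
      calc ∫⁻ z, ‖g z‖ₑ ∂μ = ∫⁻ z in ball x (2 * r), ‖g z‖ₑ ∂μ := by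
            rw [setLIntegral_eq_of_support_subset]
            intro z hz
            by_contra h'
            exact hz (by simp [hgsupp z h'])
        _ ≤ ∫⁻ z in ball x (2 * r), ((5 * β * t : ℝ≥0) : ℝ≥0∞) ∂μ :=
            lintegral_mono_ae (ae_restrict_of_ae hgle)
        _ = ((5 * β * t : ℝ≥0) : ℝ≥0∞) * μ (ball x (2 * r)) := setLIntegral_const _ _
        _ ≤ ((5 * β * t : ℝ≥0) : ℝ≥0∞) * m₀ := by gcongr
        _ = 5 * β * (t * m₀) := by push_cast; ring
        _ = _ := by rw [htm']; push_cast; ring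
    have hvg : hNorm μ lam σ s vg ≤ Cg * ballSize μ p σ x r a := by
      have key := hNorm_sub_ballAvg_le (lam := lam) (s := s) (u := g) (y := x) (R := R)
        (K₁ := 1 + K) (K₂ := 1 + C2) hσ hs hlam hgm.aestronglyMeasurable hgle
        (by positivity : 0 < 2 * r) hR0 hR0 (ball_subset_ball hrR) Subset.rfl
        (Eventually.of_forall hgsupp) hμR hdR
        (by
          push_cast
          refine (coefK_le_one_add_gap (R' := 32 * R) (ball_subset_ball (by linarith))).trans ?_
          gcongr
          exact (gap_mono (by linarith) le_rfl).trans (hdd.gap_up x r hr hμr))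
        (by
          push_cast
          refine (coefK_le_one_add_gap Subset.rfl).trans ?_
          gcongr
          exact hC2 _ _ hR0)
      refine key.trans ?_
      calc _ ≤ ((5 * β * t : ℝ≥0) : ℝ≥0∞) * m₀ * ((1 + K : ℝ≥0) : ℝ≥0∞) +
            ((5 * β * L : ℝ≥0) : ℝ≥0∞) * ballSize μ p σ x r a * β * ((1 + C2 : ℝ≥0) : ℝ≥0∞) := by
            gcongr
            exact measure_mono (ball_subset_ball (le_of_eq (by ring)))
        _ = 5 * β * (t * m₀) * ((1 + K : ℝ≥0) : ℝ≥0∞) +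
            ((5 * β * L : ℝ≥0) : ℝ≥0∞) * ballSize μ p σ x r a * β * ((1 + C2 : ℝ≥0) : ℝ≥0∞) := by
            push_cast; ring
        _ = _ := by rw [htm']; simp only [Cg]; push_cast; ring
    have hrm : Measurable (recenter μ up x r a) := ha.sub ((measurable_ballAvg x R).const_mul _)
    have hvm : Measurable vg := hgm.sub ((measurable_ballAvg x R).const_mul _)
    calc hNorm μ lam σ s (recenter μ up x r a)
        = hNorm μ lam σ s (fun z => vg z + (recenter μ up x r a z - vg z)) := by
          congr 1; funext z; ring
      _ ≤ hNorm μ lam σ s vg + hNorm μ lam σ s (fun z => recenter μ up x r a z - vg z) :=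
          hNorm_add_le hσ hs _ _
      _ ≤ Cg * ballSize μ p σ x r a +
          ∑' i : u, (hNorm μ lam σ s (recenter μ up (i : X) (7 * r' i) ((V i).indicator a)) +
            Cw * ∫⁻ z in V i, ‖a z‖ₑ ∂μ) := by
          refine add_le_add hvg ?_
          refine (hNorm_le_tsum hσ hs (hrm.sub hvm).aestronglyMeasurable
            (Eventually.of_forall hsumz)).trans (ENNReal.tsum_le_tsum fun i => ?_)
          exact (hNorm_add_le hσ hs _ _).trans (add_le_add le_rfl (hwle i))
      _ ≤ Cg * ballSize μ p σ x r a +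
          (∑' i : u, hNorm μ lam σ s (recenter μ up (i : X) (7 * r' i) ((V i).indicator a)) +
            Cw * ballSize μ p σ x r a) := by
          rw [ENNReal.tsum_add, ENNReal.tsum_mul_left]
          gcongr
          exact (tsum_setLIntegral_le h.V_meas h.V_disj _).trans hsize
      _ = _ := by push_cast; ring
  · unfold ballSize
    simp only [e14, lintegral_enorm_rpow_indicator hp0 (h.V_meas _)]
    -- The sum of the measures has gained `2^{p/(p-1)}`; Hölder's inequality for the sum turns this
    -- into a factor `2` for the sizes.
    have h2 : (2 : ℝ≥0∞) = (2 ^ (p / (p - 1))) ^ (1 - 1 / p) := by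
      rw [← ENNReal.rpow_mul, show p / (p - 1) * (1 - 1 / p) = 1 by field_simp, ENNReal.rpow_one]
    calc _ ≤ 2 * ((∑' i, ∫⁻ z in V i, ‖a z‖ₑ ^ p ∂μ) ^ (1 / p) *
          (∑' i : u, μ (ball (i : X) (14 * σ * r' i))) ^ (1 - 1 / p)) := by
          gcongr
          exact ENNReal_tsum_rpow_mul_rpow_le hp _ _
      _ = (∑' i, ∫⁻ z in V i, ‖a z‖ₑ ^ p ∂μ) ^ (1 / p) *
          (2 ^ (p / (p - 1)) * ∑' i : u, μ (ball (i : X) (14 * σ * r' i))) ^ (1 - 1 / p) := by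
          rw [ENNReal.mul_rpow_of_nonneg _ _ hexp.le, ← h2]; ring
      _ ≤ _ := by
          gcongr
          exact tsum_setLIntegral_le h.V_meas h.V_disj _
  · simp only [e14]
    exact (mul_le_mul' h2L le_rfl).trans hmsum

end Step


/-! ### Partitions with rapidly decreasing masses. -/

section Partition

variable {X : Type*} [MeasurableSpace X]

lemma exists_strictMono_measure_le {ν : Measure X} {T : ℕ → Set X} (hT : ∀ n, MeasurableSet (T n))
    (hanti : Antitone T) (hinter : ⋂ n, T n = ∅) (hfin : ν (T 0) ≠ ∞) {ε : ℕ → ℝ≥0∞}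
    (hε : ∀ n, 0 < ε n) : ∃ φ : ℕ → ℕ, StrictMono φ ∧ ∀ n, ν (T (φ n)) ≤ ε n := by
  have h := tendsto_measure_iInter_atTop (μ := ν) (fun n => (hT n).nullMeasurableSet) hanti
    ⟨0, hfin⟩
  rw [hinter, measure_empty] at h
  exact Filter.extraction_forall_of_eventually fun n => h.eventually_le_const (hε n)

/-- A countable partition whose pieces avoid the sets of a decreasing sequence and have rapidly
decreasing measure. -/
lemma exists_partition_measure_le {ν : Measure X} {T : ℕ → Set X} (hT : ∀ n, MeasurableSet (T n))
    (hanti : Antitone T) (hinter : ⋂ n, T n = ∅) (hfin : ν (T 0) ≠ ∞) {ε : ℕ → ℝ≥0∞}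
    (hε : ∀ n, 0 < ε n) : ∃ E : ℕ → Set X, (∀ n, MeasurableSet (E n)) ∧
      Pairwise (Function.onFun Disjoint E) ∧ ⋃ n, E n = univ ∧
      (∀ n, ∃ m, Disjoint (E n) (T m)) ∧ ∀ n, ν (E (n + 1)) ≤ ε n := by
  obtain ⟨φ, hφ, hle⟩ := exists_strictMono_measure_le hT hanti hinter hfin hε
  set U : ℕ → Set X := fun n => (T (φ n))ᶜ
  have hU : Monotone U := fun m n h => compl_subset_compl.2 (hanti (hφ.monotone h))
  refine ⟨disjointed U, fun n => MeasurableSet.disjointed (fun n => (hT _).compl) n,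
    disjoint_disjointed U, ?_, ?_, ?_⟩
  · rw [iUnion_disjointed]
    refine eq_univ_of_forall fun z => ?_
    have hz : z ∉ ⋂ n, T n := by rw [hinter]; simp
    obtain ⟨n, hn⟩ := by simpa using hz
    exact mem_iUnion.2 ⟨n, fun h => hn (hanti hφ.le_apply h)⟩
  · intro n
    exact ⟨φ n, disjoint_compl_left.mono_left (disjointed_subset U n)⟩
  · intro n
    refine (measure_mono ?_).trans (hle n)
    rw [hU.disjointed_add_one]
    rintro z ⟨-, hz⟩
    simpa [U] using hz

lemma ae_eq_zero_of_lintegral_rpow {μ : Measure X} {p : ℝ} (hp : 0 < p) {a : X → ℂ}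
    (ha : Measurable a)
    (h : ∫⁻ z, ‖a z‖ₑ ^ p ∂μ = 0) : a =ᵐ[μ] 0 := by
  filter_upwards [(lintegral_eq_zero_iff (ha.enorm.pow_const p)).1 h] with z hz
  simpa [hp.not_gt, hp] using hz

lemma tsum_rpow_one_div_le {p : ℝ} (hp : 0 < p) {v : ℕ → ℝ≥0∞} {I : ℝ≥0∞} (h0 : v 0 ≤ I)
    (h : ∀ n, v (n + 1) ≤ (2⁻¹ ^ n) ^ p * I) : ∑' n, v n ^ (1 / p) ≤ 3 * I ^ (1 / p) := by
  rw [tsum_eq_zero_add' ENNReal.summable]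
  have h1 : ∀ n, v (n + 1) ^ (1 / p) ≤ 2⁻¹ ^ n * I ^ (1 / p) := by
    intro n
    calc _ ≤ ((2⁻¹ ^ n) ^ p * I) ^ (1 / p) := ENNReal.rpow_le_rpow (h n) (by positivity)
      _ = _ := by
        rw [ENNReal.mul_rpow_of_nonneg _ _ (by positivity), ← ENNReal.rpow_mul,
          mul_one_div_cancel hp.ne', ENNReal.rpow_one]
  calc _ ≤ I ^ (1 / p) + ∑' n : ℕ, 2⁻¹ ^ n * I ^ (1 / p) :=
        add_le_add (ENNReal.rpow_le_rpow h0 (by positivity)) (ENNReal.tsum_le_tsum h1)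
    _ = I ^ (1 / p) + 2 * I ^ (1 / p) := by
        rw [ENNReal.tsum_mul_right, ENNReal.tsum_geometric, ENNReal.one_sub_inv_two, inv_inv]
    _ = _ := by ring

end Partition

/-! ### Recentred `L^p` functions on a ball belong to `H¹`. -/

section LemmaA

variable {X : Type*} [MetricSpace X] [MeasurableSpace X] {μ : Measure X} {lam : X → ℝ → ℝ}
  {σ : ℝ} {s : ℝ≥0∞} {D : ℝ} {β K : ℝ≥0} {up : X → ℝ → ℝ} {p : ℝ}

variable [BorelSpace X] [SecondCountableTopology X] [Nonempty X]

/-- The step is iterated `n` times. Sizes halve in each generation, so together they cost at most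
`2C` times the first; the remaining pieces are still bounded by `M` and have total measure at most
`2^{-n}` times the original one. -/
lemma exists_hNorm_recenter_le_aux (hσ : 1 ≤ σ) (hs : 1 ≤ s) (hp : 1 < p)
    (hlam : IsDominatingFunction μ lam) (hD : 42 * σ ≤ D) (hdd : DoublingData μ lam D β K up) :
    ∃ C C' : ℝ≥0, ∀ (n : ℕ) (x : X) (r : ℝ) (a : X → ℂ) (M : ℝ≥0), 0 < r → Measurable a →
      (∀ z, z ∉ ball x r → a z = 0) → ∫⁻ z, ‖a z‖ₑ ^ p ∂μ ≠ ∞ → (∀ z, ‖a z‖ₑ ≤ M) →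
      hNorm μ lam σ s (recenter μ up x r a) ≤ 2 * C * ballSize μ p σ x r a +
        C' * M * (2⁻¹ ^ n * μ (ball x (2 * σ * r))) := by
  have hp0 : 0 < p := by linarith
  obtain ⟨C, hC⟩ := exists_recenter_step (s := s) hσ hs hp hlam hD hdd
  obtain ⟨C', hC'⟩ := exists_hNorm_recenter_le_of_bounded (s := s) hσ hs hlam hD hdd
  refine ⟨C, C', fun n => ?_⟩
  induction n with
  | zero =>
    intro x r a M hr ha hsupp hI hM
    simpa using (hC' x r a M hr ha hsupp hM).trans le_add_self
  | succ n ih =>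
    intro x r a M hr ha hsupp hI hM
    by_cases hI0 : ∫⁻ z, ‖a z‖ₑ ^ p ∂μ = 0
    · rw [hNorm_congr (recenter_ae_eq_zero (ae_eq_zero_of_lintegral_rpow hp0 ha hI0)),
        hNorm_zero hσ hs]
      exact bot_le
    obtain ⟨u, r', V, hu, hr', hVm, hVs, h1, h2, h3⟩ := hC x r a hr ha hsupp hI0 hI
    have hcu := hu.to_subtype
    have hstep : ∀ i : u, hNorm μ lam σ s (recenter μ up (i : X) (r' i) ((V i).indicator a)) ≤
        2 * C * ballSize μ p σ (i : X) (r' i) ((V i).indicator a) +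
        C' * M * (2⁻¹ ^ n * μ (ball (i : X) (2 * σ * r' i))) := by
      intro i
      refine ih i (r' i) _ M (hr' i) (ha.indicator (hVm i)) (fun z hz => ?_) ?_ fun z => ?_
      · exact indicator_of_notMem (fun h => hz (hVs i h)) _
      · rw [lintegral_enorm_rpow_indicator hp0 (hVm i)]
        exact ne_top_of_le_ne_top hI (setLIntegral_le_lintegral _ _)
      · exact (enorm_indicator_le_enorm_self _ _).trans (hM z)
    refine h1.trans ?_
    calc _ ≤ C * ballSize μ p σ x r a + ∑' i : u,
          (2 * C * ballSize μ p σ (i : X) (r' i) ((V i).indicator a) +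
          C' * M * (2⁻¹ ^ n * μ (ball (i : X) (2 * σ * r' i)))) := by
          gcongr with i
          exact hstep i
      _ = C * ballSize μ p σ x r a +
          (C * (2 * ∑' i : u, ballSize μ p σ (i : X) (r' i) ((V i).indicator a)) +
          C' * M * (2⁻¹ ^ n * (2⁻¹ * (2 * ∑' i : u, μ (ball (i : X) (2 * σ * r' i)))))) := by
          rw [ENNReal.tsum_add, ENNReal.tsum_mul_left, ENNReal.tsum_mul_left,
            ENNReal.tsum_mul_left, ← mul_assoc 2⁻¹ 2, ENNReal.inv_mul_cancel (by norm_num)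
            (by norm_num)]
          ring
      _ ≤ C * ballSize μ p σ x r a + (C * ballSize μ p σ x r a +
          C' * M * (2⁻¹ ^ n * (2⁻¹ * μ (ball x (2 * σ * r))))) := by gcongr
      _ = _ := by ring

/-- Functions in `L^p` supported in a ball, recentred, belong to the Hardy space. -/
theorem exists_hNorm_recenter_le (hσ : 1 ≤ σ) (hs : 1 ≤ s) (hp : 1 < p)
    (hlam : IsDominatingFunction μ lam) (hD : 42 * σ ≤ D) (hdd : DoublingData μ lam D β K up) :
    ∃ C : ℝ≥0, ∀ (x : X) (r : ℝ) (a : X → ℂ), 0 < r → Measurable a →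
      (∀ z, z ∉ ball x r → a z = 0) → ∫⁻ z, ‖a z‖ₑ ^ p ∂μ ≠ ∞ →
      hNorm μ lam σ s (recenter μ up x r a) ≤ C * ballSize μ p σ x r a := by
  have hp0 : 0 < p := by linarith
  obtain ⟨C, C', hC⟩ := exists_hNorm_recenter_le_aux (s := s) hσ hs hp hlam hD hdd
  have hbdd : ∀ (x : X) (r : ℝ) (a : X → ℂ) (M : ℝ≥0), 0 < r → Measurable a →
      (∀ z, z ∉ ball x r → a z = 0) → ∫⁻ z, ‖a z‖ₑ ^ p ∂μ ≠ ∞ → (∀ z, ‖a z‖ₑ ≤ M) →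
      hNorm μ lam σ s (recenter μ up x r a) ≤ 2 * C * ballSize μ p σ x r a := by
    intro x r a M hr ha hsupp hI hM
    -- Letting `n` tend to infinity removes the dependence on `M`.
    have hlim : Tendsto (fun n : ℕ => 2 * C * ballSize μ p σ x r a +
        C' * M * (2⁻¹ ^ n * μ (ball x (2 * σ * r)))) atTop
        (𝓝 (2 * C * ballSize μ p σ x r a + C' * M * (0 * μ (ball x (2 * σ * r))))) := by
      refine tendsto_const_nhds.add (ENNReal.Tendsto.const_mul ?_ (Or.inr
        (ENNReal.mul_ne_top ENNReal.coe_ne_top ENNReal.coe_ne_top)))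
      exact ENNReal.Tendsto.mul_const
        (ENNReal.tendsto_pow_atTop_nhds_zero_of_lt_one (by norm_num))
        (Or.inr (hlam.measure_ball_lt_top _ _).ne)
    simpa using ge_of_tendsto' hlim fun n => hC n x r a M hr ha hsupp hI hM
  refine ⟨2 * C * 3, ?_⟩
  intro x r a hr ha hsupp hI
  set I := ∫⁻ z, ‖a z‖ₑ ^ p ∂μ
  by_cases hI0 : I = 0
  · rw [hNorm_congr (recenter_ae_eq_zero (ae_eq_zero_of_lintegral_rpow hp0 ha hI0)),
      hNorm_zero hσ hs]
    exact bot_le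
  have hsize := lintegral_enorm_le_ballSize (μ := μ) hσ hp hr ha hsupp
  have hexp : 0 ≤ 1 - 1 / p := by rw [sub_nonneg, div_le_one hp0]; exact hp.le
  have hsizet : ballSize μ p σ x r a ≠ ∞ :=
    ENNReal.mul_ne_top (ENNReal.rpow_ne_top_of_nonneg (by positivity) hI)
      (ENNReal.rpow_ne_top_of_nonneg hexp (hlam.measure_ball_lt_top _ _).ne)
  have hai : Integrable a μ := ⟨ha.aestronglyMeasurable, hsize.trans_lt hsizet.lt_top⟩
  set ν := μ.withDensity fun z => ‖a z‖ₑ ^ p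
  have hν : ∀ E, MeasurableSet E → ν E = ∫⁻ z in E, ‖a z‖ₑ ^ p ∂μ := fun E hE =>
    withDensity_apply _ hE
  set T : ℕ → Set X := fun n => {z | (n : ℝ≥0∞) < ‖a z‖ₑ}
  -- An unbounded `a` is cut into bounded layers whose masses decay so fast that the `L^p` norms
  -- themselves, and not only their `p`-th powers, are summable.
  obtain ⟨E, hEm, hEd, hEU, hEb, hEle⟩ := exists_partition_measure_le (ν := ν) (T := T)
    (ε := fun n => (2⁻¹ ^ n) ^ p * I) (fun n => measurableSet_lt measurable_const ha.enorm)
    (fun m n h z (hz : (n : ℝ≥0∞) < ‖a z‖ₑ) => lt_of_le_of_lt (by exact_mod_cast h) hz)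
    (by
      refine eq_empty_of_forall_notMem fun z hz => ?_
      obtain ⟨n, hn⟩ := ENNReal.exists_nat_gt (enorm_ne_top (x := a z))
      exact absurd (mem_iInter.1 hz n) (not_lt.2 hn.le))
    (by
      rw [hν _ (measurableSet_lt measurable_const ha.enorm)]
      exact ne_top_of_le_ne_top hI (setLIntegral_le_lintegral _ _))
    (fun n => ENNReal.mul_pos (ENNReal.rpow_pos (by simp [ENNReal.pow_pos]) (by simp)).ne' hI0)
  have hpiece : ∀ n, hNorm μ lam σ s (recenter μ up x r ((E n).indicator a)) ≤
      2 * C * (ν (E n) ^ (1 / p) * μ (ball x (2 * σ * r)) ^ (1 - 1 / p)) := by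
    intro n
    obtain ⟨m, hm⟩ := hEb n
    have := hbdd x r ((E n).indicator a) m hr (ha.indicator (hEm n))
      (fun z hz => by
        by_cases h : z ∈ E n
        · rw [indicator_of_mem h, hsupp z hz]
        · exact indicator_of_notMem h _)
      (by
        rw [lintegral_enorm_rpow_indicator hp0 (hEm n)]
        exact ne_top_of_le_ne_top hI (setLIntegral_le_lintegral _ _))
      (fun z => by
        by_cases h : z ∈ E n
        · rw [indicator_of_mem h]
          have : z ∉ T m := fun h' => Set.disjoint_left.1 hm h h'
          simpa [T] using this
        · rw [indicator_of_notMem h]; simp)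
    rwa [ballSize, lintegral_enorm_rpow_indicator hp0 (hEm n), ← hν _ (hEm n)] at this
  have hsumz : ∀ z, HasSum (fun n => recenter μ up x r ((E n).indicator a) z)
      (recenter μ up x r a z) := by
    intro z
    unfold recenter
    have h1 := hasSum_indicator_of_disjoint hEd a z
    have h2 := hasSum_integral_iUnion hEm hEd hai.integrableOn
    rw [hEU] at h1 h2
    rw [indicator_univ] at h1
    rw [setIntegral_univ] at h2
    simp only [integral_indicator (hEm _)]
    exact h1.sub (h2.mul_right _)
  have hrm : Measurable (recenter μ up x r a) := ha.sub ((measurable_ballAvg x _).const_mul _)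
  have hnu : ∑' n, ν (E n) ^ (1 / p) ≤ 3 * I ^ (1 / p) := by
    refine tsum_rpow_one_div_le hp0 ?_ hEle
    rw [hν _ (hEm 0)]
    exact setLIntegral_le_lintegral _ _
  calc hNorm μ lam σ s (recenter μ up x r a)
      ≤ ∑' n, hNorm μ lam σ s (recenter μ up x r ((E n).indicator a)) :=
        hNorm_le_tsum hσ hs hrm.aestronglyMeasurable (Eventually.of_forall hsumz)
    _ ≤ ∑' n, 2 * C * (ν (E n) ^ (1 / p) * μ (ball x (2 * σ * r)) ^ (1 - 1 / p)) :=
        ENNReal.tsum_le_tsum hpiece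
    _ = 2 * C * ((∑' n, ν (E n) ^ (1 / p)) * μ (ball x (2 * σ * r)) ^ (1 - 1 / p)) := by
        rw [ENNReal.tsum_mul_left, ENNReal.tsum_mul_right]
    _ ≤ 2 * C * (3 * I ^ (1 / p) * μ (ball x (2 * σ * r)) ^ (1 - 1 / p)) := by gcongr
    _ = _ := by unfold ballSize; push_cast; ring

end LemmaA


/-! ### Splitting `f` into a bounded part and a part in `H¹`. -/

section Truncation

variable {X : Type*} [MeasurableSpace X] {μ : Measure X}

lemma rpow_mul_setLIntegral_le {p₁ p : ℝ} (hp₁ : 0 ≤ p₁) (hp : p₁ ≤ p) {t : ℝ≥0∞} {f : X → ℂ}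
    (hf : Measurable f) :
    t ^ (p - p₁) * ∫⁻ z in {z | t < ‖f z‖ₑ}, ‖f z‖ₑ ^ p₁ ∂μ ≤ ∫⁻ z, ‖f z‖ₑ ^ p ∂μ := by
  have hm : MeasurableSet {z | t < ‖f z‖ₑ} := measurableSet_lt measurable_const hf.enorm
  rw [← lintegral_const_mul _ (hf.enorm.pow_const _)]
  refine (setLIntegral_mono' hm fun z hz => ?_).trans (setLIntegral_le_lintegral {z | t < ‖f z‖ₑ} _)
  have hz' : t < ‖f z‖ₑ := hz
  calc t ^ (p - p₁) * ‖f z‖ₑ ^ p₁ ≤ ‖f z‖ₑ ^ (p - p₁) * ‖f z‖ₑ ^ p₁ := by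
        gcongr
    _ = ‖f z‖ₑ ^ p := by
        rw [← ENNReal.rpow_add_of_nonneg _ _ (by linarith) hp₁]; congr 1; ring

end Truncation

variable {X : Type*} [MetricSpace X] [MeasurableSpace X] {μ : Measure X} {lam : X → ℝ → ℝ}
  {σ : ℝ} {s : ℝ≥0∞} {D : ℝ} {β K : ℝ≥0} {up : X → ℝ → ℝ} {p p₁ : ℝ}

variable [BorelSpace X] [SecondCountableTopology X] [Nonempty X]

/-- The Calderón–Zygmund decomposition with the bad part in the Hardy space. -/
theorem exists_good_add_bad (hσ : 1 ≤ σ) (hs : 1 ≤ s) (hp₁ : 1 < p₁) (hp : p₁ ≤ p)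
    (hlam : IsDominatingFunction μ lam) (hD : 42 * σ ≤ D) (hdd : DoublingData μ lam D β K up) :
    ∃ C : ℝ≥0, ∀ (t : ℝ≥0) (f : X → ℂ), t ≠ 0 → Measurable f → ∫⁻ z, ‖f z‖ₑ ^ p ∂μ ≠ ∞ →
      ∫⁻ z, ‖f z‖ₑ ^ p ∂μ < (t : ℝ≥0∞) ^ p * μ univ →
      ∃ g b : X → ℂ, Measurable g ∧ Measurable b ∧ (∀ z, f z = g z + b z) ∧
        (∀ᵐ z ∂μ, ‖g z‖ₑ ≤ C * t) ∧ ∫⁻ z, ‖g z‖ₑ ^ p ∂μ ≤ C * ∫⁻ z, ‖f z‖ₑ ^ p ∂μ ∧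
        (t : ℝ≥0∞) ^ (p₁ - 1) * hNorm μ lam σ s b ≤
          C * ∫⁻ z in {z | (t : ℝ≥0∞) < ‖f z‖ₑ}, ‖f z‖ₑ ^ p₁ ∂μ := by
  obtain ⟨C2, hC2⟩ := hlam.exists_gap_le 2
  obtain ⟨C, hC⟩ := exists_hNorm_recenter_le (s := s) hσ hs hp₁ hlam hD hdd
  set C3 : ℝ≥0 := (2 : ℝ≥0) ^ (p - 1) * (1 + (4 * β) ^ (p - 1) * 2)
  refine ⟨max (1 + 5 * β) (max C3 (C + 3 * β * (1 + C2))), ?_⟩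
  intro t f ht0 hf hFt hlt
  have hp₁0 : 0 < p₁ := by linarith
  have hp0 : 0 < p := by linarith
  have htE0 : (t : ℝ≥0∞) ≠ 0 := ENNReal.coe_ne_zero.2 ht0
  have hpow0 : ∀ e : ℝ, 0 ≤ e → (t : ℝ≥0∞) ^ e ≠ 0 := fun e he =>
    (ENNReal.rpow_pos htE0.bot_lt ENNReal.coe_ne_top).ne'
  have hpowt : ∀ e : ℝ, 0 ≤ e → (t : ℝ≥0∞) ^ e ≠ ∞ := fun e he =>
    ENNReal.rpow_ne_top_of_nonneg he ENNReal.coe_ne_top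
  set F := ∫⁻ z, ‖f z‖ₑ ^ p ∂μ
  set A : Set X := {z | (t : ℝ≥0∞) < ‖f z‖ₑ}
  have hA : MeasurableSet A := measurableSet_lt measurable_const hf.enorm
  set J := ∫⁻ z in A, ‖f z‖ₑ ^ p₁ ∂μ
  -- Only the part of `f` above height `t` is decomposed, and with the smaller exponent `p₁`. The
  -- `H¹` norm of the bad part then involves only `{|f| > t}`, which makes the sum over levels
  -- converge.
  set f₁ := A.indicator f
  have hf₁ : Measurable f₁ := hf.indicator hA
  have hJf₁ : ∫⁻ z, ‖f₁ z‖ₑ ^ p₁ ∂μ = J := lintegral_enorm_rpow_indicator hp₁0 hA f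
  have hJF : (t : ℝ≥0∞) ^ (p - p₁) * J ≤ F := rpow_mul_setLIntegral_le hp₁0.le hp hf
  have hJt : J ≠ ∞ := by
    intro h
    rw [h, ENNReal.mul_top (hpow0 _ (by linarith))] at hJF
    exact hFt (top_le_iff.1 hJF)
  have h1F : (t : ℝ≥0∞) ^ (p - 1) * ∫⁻ z, ‖f₁ z‖ₑ ∂μ ≤ F := by
    have := rpow_mul_setLIntegral_le (μ := μ) (p₁ := 1) (p := p) (t := t) zero_le_one
        (by linarith) hf
    have e := lintegral_enorm_rpow_indicator (μ := μ) (p := 1) one_pos hA f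
    simp only [ENNReal.rpow_one] at this e
    rwa [← e] at this
  have hf₁i : Integrable f₁ μ := by
    refine ⟨hf₁.aestronglyMeasurable, ?_⟩
    rw [HasFiniteIntegral, lt_top_iff_ne_top]
    intro h
    rw [h, ENNReal.mul_top (hpow0 _ (by linarith))] at h1F
    exact hFt (top_le_iff.1 h1F)
  -- On `{|f| > t}` one has `t^(p-p₁) |f|^{p₁} ≤ |f|^p`, so the smallness condition for `p` implies
  -- the one for `p₁`.
  have hJlt : ∫⁻ z, ‖f₁ z‖ₑ ^ p₁ ∂μ < (t : ℝ≥0∞) ^ p₁ * μ univ := by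
    rw [hJf₁]
    by_contra! hge
    refine absurd hlt (not_lt.2 ?_)
    calc (t : ℝ≥0∞) ^ p * μ univ = (t : ℝ≥0∞) ^ (p - p₁) * ((t : ℝ≥0∞) ^ p₁ * μ univ) := by
          rw [← mul_assoc, ← ENNReal.rpow_add_of_nonneg _ _ (by linarith) hp₁0.le, sub_add_cancel]
      _ ≤ (t : ℝ≥0∞) ^ (p - p₁) * J := by gcongr
      _ ≤ F := hJF
  obtain ⟨u, r, V, φ, hu, h⟩ := exists_czData (η := 14 * σ) hlam (by linarith) (by linarith) hdd
    hp₁ ht0 hf₁ hJlt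
  have hcu := hu.to_subtype
  set G := goodPart f₁ V φ univ
  have hGm : Measurable G := h.measurable_goodPart hf₁ univ
  refine ⟨fun z => f z - (f₁ z - G z), fun z => f₁ z - G z, hf.sub (hf₁.sub hGm), hf₁.sub hGm,
    fun z => by ring, ?_, ?_, ?_⟩
  · filter_upwards [h.enorm_goodPart_le univ] with z hz
    have h1 : ‖f z - f₁ z‖ₑ ≤ t := by
      by_cases hzA : z ∈ A
      · simp [f₁, hzA]
      · have e : f₁ z = 0 := indicator_of_notMem hzA f
        rw [e, sub_zero]
        exact not_lt.1 hzA
    calc ‖f z - (f₁ z - G z)‖ₑ = ‖(f z - f₁ z) + G z‖ₑ := by congr 1; ring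
      _ ≤ t + ((5 * β * t : ℝ≥0) : ℝ≥0∞) := (enorm_add_le _ _).trans (add_le_add h1 hz)
      _ = ((1 + 5 * β : ℝ≥0) : ℝ≥0∞) * t := by push_cast; ring
      _ ≤ _ := by
        gcongr
        exact le_max_left _ _
  · set ψ : X → ℂ := fun z => ∑' i, φ i z
    have hψm : Measurable ψ := Measurable.tsum h.φ_meas
    have hG : ∀ z, G z = (⋃ i, V i)ᶜ.indicator f₁ z + ψ z := fun z => by
      simp [G, goodPart, ψ]
    have hpt : ∀ z, ‖f z - (f₁ z - G z)‖ₑ ≤ ‖f z‖ₑ + ‖ψ z‖ₑ := by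
      intro z
      rw [show f z - (f₁ z - G z) = (f z - f₁ z + (⋃ i, V i)ᶜ.indicator f₁ z) + ψ z by
        rw [hG]; ring]
      refine (enorm_add_le _ _).trans (add_le_add ?_ le_rfl)
      by_cases hzV : z ∈ (⋃ i, V i)ᶜ
      · rw [indicator_of_mem hzV]; simp
      · rw [indicator_of_notMem hzV, add_zero]
        by_cases hzA : z ∈ A <;> simp [f₁, hzA]
    have hψle : ∀ z, ‖ψ z‖ₑ ≤ 4 * β * t := fun z =>
      enorm_tsum_le_tsum_enorm.trans (h.φ_sum z)
    have hψ1 : ∫⁻ z, ‖ψ z‖ₑ ∂μ ≤ 2 * ∫⁻ z, ‖f₁ z‖ₑ ∂μ := by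
      calc _ ≤ ∫⁻ z, ∑' i, ‖φ i z‖ₑ ∂μ := lintegral_mono fun z => enorm_tsum_le_tsum_enorm
        _ = ∑' i, ∫⁻ z, ‖φ i z‖ₑ ∂μ := lintegral_tsum fun i => (h.φ_meas i).enorm.aemeasurable
        _ ≤ ∑' i, 2 * ∫⁻ z in V i, ‖f₁ z‖ₑ ∂μ :=
            ENNReal.tsum_le_tsum fun i => h.lintegral_bump_le hlam (by linarith) hdd i
        _ ≤ _ := by
            rw [ENNReal.tsum_mul_left]
            gcongr
            exact tsum_setLIntegral_le h.V_meas h.V_disj _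
    -- The bumps are bounded by `4βt` and have `L^1` norm at most `2‖f₁‖₁`; interpolating these and
    -- using `t^(p-1) ‖f₁‖₁ ≤ F` gives the `L^p` bound.
    have hψp : ∫⁻ z, ‖ψ z‖ₑ ^ p ∂μ ≤ (((4 * β) ^ (p - 1) * 2 : ℝ≥0) : ℝ≥0∞) * F := by
      calc _ ≤ ∫⁻ z, (4 * β * t : ℝ≥0∞) ^ (p - 1) * ‖ψ z‖ₑ ∂μ := by
            refine lintegral_mono fun z => ?_
            calc ‖ψ z‖ₑ ^ p = ‖ψ z‖ₑ ^ (p - 1) * ‖ψ z‖ₑ := by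
                  conv_lhs => rw [show p = (p - 1) + 1 by ring]
                  rw [ENNReal.rpow_add_of_nonneg _ _ (by linarith) zero_le_one, ENNReal.rpow_one]
              _ ≤ _ := by
                  gcongr
                  · linarith
                  · exact hψle z
        _ = (4 * β * t : ℝ≥0∞) ^ (p - 1) * ∫⁻ z, ‖ψ z‖ₑ ∂μ := lintegral_const_mul _ hψm.enorm
        _ ≤ (4 * β * t : ℝ≥0∞) ^ (p - 1) * (2 * ∫⁻ z, ‖f₁ z‖ₑ ∂μ) := by gcongr
        _ = (4 * β : ℝ≥0∞) ^ (p - 1) * 2 * ((t : ℝ≥0∞) ^ (p - 1) * ∫⁻ z, ‖f₁ z‖ₑ ∂μ) := by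
            rw [ENNReal.mul_rpow_of_nonneg _ _ (by linarith : 0 ≤ p - 1)]; ring
        _ ≤ (4 * β : ℝ≥0∞) ^ (p - 1) * 2 * F := by gcongr
        _ = _ := by
            push_cast
            rw [ENNReal.coe_rpow_of_nonneg _ (by linarith)]
            push_cast
            rfl
    calc ∫⁻ z, ‖f z - (f₁ z - G z)‖ₑ ^ p ∂μ
        ≤ ∫⁻ z, 2 ^ (p - 1) * (‖f z‖ₑ ^ p + ‖ψ z‖ₑ ^ p) ∂μ := by
          refine lintegral_mono fun z => ?_
          exact (ENNReal.rpow_le_rpow (hpt z) hp0.le).trans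
            (ENNReal.rpow_add_le_mul_rpow_add_rpow _ _ (by linarith))
      _ = 2 ^ (p - 1) * (F + ∫⁻ z, ‖ψ z‖ₑ ^ p ∂μ) := by
          rw [lintegral_const_mul _ (by fun_prop), lintegral_add_left (hf.enorm.pow_const p)]
      _ ≤ 2 ^ (p - 1) * (F + (((4 * β) ^ (p - 1) * 2 : ℝ≥0) : ℝ≥0∞) * F) := by gcongr
      _ = C3 * F := by
          simp only [C3]
          push_cast
          rw [ENNReal.coe_rpow_of_nonneg 2 (by linarith : 0 ≤ p - 1),
            ENNReal.coe_rpow_of_nonneg _ (by linarith : 0 ≤ p - 1)]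
          push_cast
          ring
      _ ≤ _ := by
          gcongr
          exact (le_max_left _ _).trans (le_max_right _ _)
  · have hVint : ∀ i, ∫ z, (V i).indicator f₁ z ∂μ = ∫ z in V i, f₁ z ∂μ := fun i =>
      integral_indicator (h.V_meas i)
    have hexp : 0 < 1 - 1 / p₁ := by rw [sub_pos, div_lt_one hp₁0]; exact hp₁
    have hVsupp : ∀ i : u, ∀ z, z ∉ ball (i : X) (7 * r i) → (V i).indicator f₁ z = 0 :=
      fun i z hz => indicator_of_notMem (fun h' => hz (h.V_sub i h')) _
    have hsum : ∑' i : u, ballSize μ p₁ σ (i : X) (7 * r i) ((V i).indicator f₁) ≤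
        J ^ (1 / p₁) * (∑' i : u, μ (ball (i : X) (14 * σ * r i))) ^ (1 - 1 / p₁) := by
      have e14 : ∀ i : u, 2 * σ * (7 * r i) = 14 * σ * r i := fun i => by ring
      unfold ballSize
      simp only [e14, lintegral_enorm_rpow_indicator hp₁0 (h.V_meas _)]
      refine (ENNReal_tsum_rpow_mul_rpow_le hp₁ _ _).trans ?_
      gcongr
      rw [← hJf₁]
      exact tsum_setLIntegral_le h.V_meas h.V_disj _
    have hsum' : (t : ℝ≥0∞) ^ (p₁ - 1) *
        ∑' i : u, ballSize μ p₁ σ (i : X) (7 * r i) ((V i).indicator f₁) ≤ J := by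
      have h1 := h.sum_selected
      rw [ENNReal.tsum_mul_left, hJf₁] at h1
      calc _ ≤ (t : ℝ≥0∞) ^ (p₁ - 1) * (J ^ (1 / p₁) *
            (∑' i : u, μ (ball (i : X) (14 * σ * r i))) ^ (1 - 1 / p₁)) := by gcongr
        _ = J ^ (1 / p₁) * ((t : ℝ≥0∞) ^ p₁ * ∑' i : u, μ (ball (i : X) (14 * σ * r i))) ^
            (1 - 1 / p₁) := by
            rw [ENNReal.mul_rpow_of_nonneg _ _ hexp.le, ← ENNReal.rpow_mul,
              show p₁ * (1 - 1 / p₁) = p₁ - 1 by field_simp]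
            ring
        _ ≤ J ^ (1 / p₁) * J ^ (1 - 1 / p₁) := by gcongr
        _ = J := by
            rw [← ENNReal.rpow_add_of_nonneg _ _ (by positivity) hexp.le]
            simp
    -- Each bad piece is a recentred function plus the transport of its mass from the normalised
    -- indicator to the bump.
    have hbi : ∀ i : u, hNorm μ lam σ s (fun z => (V i).indicator f₁ z - φ i z) ≤
        (C + 3 * β * (1 + C2) : ℝ≥0) *
          ballSize μ p₁ σ (i : X) (7 * r i) ((V i).indicator f₁) := by
      intro i
      have hri := h.r_pos i
      have e : (fun z => (V i).indicator f₁ z - φ i z) = fun z =>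
          recenter μ up (i : X) (7 * r i) ((V i).indicator f₁) z +
          ((∫ w in V i, f₁ w ∂μ) * ballAvg μ (i : X) (up i (7 * r i)) z - φ i z) := by
        funext z
        simp only [recenter, hVint]
        ring
      rw [e]
      refine (hNorm_add_le hσ hs _ _).trans ?_
      rw [ENNReal.coe_add, add_mul]
      refine add_le_add (hC _ _ _ (by linarith) (hf₁.indicator (h.V_meas i)) (hVsupp i) ?_)
        ((h.hNorm_bump_le hσ hs hlam (by linarith) hdd hf₁i hC2 i).trans ?_)
      · rw [lintegral_enorm_rpow_indicator hp₁0 (h.V_meas i)]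
        exact ne_top_of_le_ne_top (hJf₁ ▸ hJt) (setLIntegral_le_lintegral _ _)
      · gcongr
        have h1 := lintegral_enorm_le_ballSize (μ := μ) hσ hp₁ (by linarith : 0 < 7 * r i)
          (hf₁.indicator (h.V_meas i)) (hVsupp i)
        have h2 := lintegral_enorm_rpow_indicator (μ := μ) (p := 1) one_pos (h.V_meas i) f₁
        simp only [ENNReal.rpow_one] at h2
        rwa [h2] at h1
    have hle : hNorm μ lam σ s (fun z => f₁ z - G z) ≤ (C + 3 * β * (1 + C2) : ℝ≥0) *
        ∑' i : u, ballSize μ p₁ σ (i : X) (7 * r i) ((V i).indicator f₁) := by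
      rw [← ENNReal.tsum_mul_left]
      refine (hNorm_le_tsum hσ hs (v := fun (i : u) z => (V i).indicator f₁ z - φ i z)
        (hf₁.sub hGm).aestronglyMeasurable (Eventually.of_forall fun z => ?_)).trans
        (ENNReal.tsum_le_tsum hbi)
      simpa using h.hasSum_error univ z
    calc (t : ℝ≥0∞) ^ (p₁ - 1) * hNorm μ lam σ s (fun z => f₁ z - G z)
        ≤ (t : ℝ≥0∞) ^ (p₁ - 1) * ((C + 3 * β * (1 + C2) : ℝ≥0) *
          ∑' i : u, ballSize μ p₁ σ (i : X) (7 * r i) ((V i).indicator f₁)) := by gcongr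
      _ = (C + 3 * β * (1 + C2) : ℝ≥0) * ((t : ℝ≥0∞) ^ (p₁ - 1) *
          ∑' i : u, ballSize μ p₁ σ (i : X) (7 * r i) ((V i).indicator f₁)) := by ring
      _ ≤ (C + 3 * β * (1 + C2) : ℝ≥0) * J := by gcongr
      _ ≤ _ := by
          gcongr
          exact (le_max_right _ _).trans (le_max_right _ _)


lemma NNReal_coe_le_edist_add (a b : ℝ≥0) : (a : ℝ≥0∞) ≤ edist a b + b := by
  have h := edist_triangle a b 0
  have e : ∀ c : ℝ≥0, edist c 0 = (c : ℝ≥0∞) := fun c => by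
    rw [edist_nndist, NNReal.nndist_zero_eq_val']
  rwa [e, e] at h

/-! ### The local good-λ estimate for the maximal function over doubling balls. -/

section GoodLambda

variable {X : Type*} [MetricSpace X] [MeasurableSpace X] {μ : Measure X} {lam : X → ℝ → ℝ}
  {ρ D : ℝ} {β K : ℝ≥0} {up : X → ℝ → ℝ}

/-- Doubling balls on which the average of `G` exceeds `l`. -/
def HighBall (μ : Measure X) (D : ℝ) (β : ℝ≥0) (G : X → ℝ≥0) (l : ℝ≥0) (c : X) (r : ℝ) : Prop :=
  0 < r ∧ DoublingBall μ D β c r ∧ l * μ (ball c r) < ∫⁻ z in ball c r, G z ∂μ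

/-- The set where the doubling maximal function of `G` exceeds `l`. -/
def NSet (μ : Measure X) (D : ℝ) (β : ℝ≥0) (G : X → ℝ≥0) (l : ℝ≥0) : Set X :=
  ballUnion (HighBall μ D β G l)

/-- The set where the maximal function of `H` with dilated balls in the denominator exceeds `κ`. -/
def MSet (μ : Measure X) (H : X → ℝ≥0) (κ : ℝ≥0) : Set X :=
  ballUnion fun c r => 0 < r ∧ κ * μ (ball c (6 * r)) < ∫⁻ z in ball c r, H z ∂μ

/-- The mean oscillation of `G` around the numbers `g` is controlled by `κ` and `H`. -/
structure OscBound (μ : Measure X) (lam : X → ℝ → ℝ) (ρ : ℝ) (G H : X → ℝ≥0) (κ : ℝ≥0)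
    (g : X → ℝ → ℝ≥0) : Prop where
  osc : ∀ c r, 0 < r → ∫⁻ z in ball c r, edist (G z) (g c r) ∂μ ≤
    κ * μ (ball c (ρ * r)) + ∫⁻ z in ball c r, H z ∂μ
  diff : ∀ x y r R, 0 < r → 0 < R → ball x r ⊆ ball y R →
    edist (g x r) (g y R) ≤ κ * coefK μ lam x r y R

lemma HighBall.measure_ne_zero {G : X → ℝ≥0} {l : ℝ≥0} {c : X} {r : ℝ}
    (h : HighBall μ D β G l c r) : μ (ball c r) ≠ 0 := by
  intro h0
  have := h.2.2
  rw [setLIntegral_measure_zero _ _ h0] at this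
  exact not_lt_bot this

lemma HighBall.mono {G : X → ℝ≥0} {l l' : ℝ≥0} (hl : l ≤ l') {c : X} {r : ℝ}
    (h : HighBall μ D β G l' c r) : HighBall μ D β G l c r :=
  ⟨h.1, h.2.1, lt_of_le_of_lt (by gcongr) h.2.2⟩

lemma NSet_anti {G : X → ℝ≥0} {l l' : ℝ≥0} (hl : l ≤ l') : NSet μ D β G l' ⊆ NSet μ D β G l :=
  ballUnion_mono fun _ _ h => h.mono hl

lemma lintegral_le_of_notMem_MSet {H : X → ℝ≥0} {κ : ℝ≥0} {x c : X} {r : ℝ} (hr : 0 < r)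
    (hx : x ∉ MSet μ H κ) (hxc : x ∈ ball c r) :
    ∫⁻ z in ball c r, H z ∂μ ≤ κ * μ (ball c (6 * r)) := by
  by_contra! h
  exact hx ⟨c, r, ⟨hr, h⟩, hxc⟩

/-- A point of the ball outside `MSet` controls the integral of `H`. Both dilates on the right are
absorbed by doubling, which is why `D` dominates `ρ` and `6`. -/
lemma OscBound.osc_le_of_doubling {G H : X → ℝ≥0} {κ : ℝ≥0} {g : X → ℝ → ℝ≥0}
    (h : OscBound μ lam ρ G H κ g) (hDρ : ρ ≤ D) (hD6 : 6 ≤ D) {x c : X} {r : ℝ} (hr : 0 < r)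
    (hd : DoublingBall μ D β c r) (hx : x ∉ MSet μ H κ) (hxc : x ∈ ball c r) :
    ∫⁻ z in ball c r, edist (G z) (g c r) ∂μ ≤ 2 * κ * β * μ (ball c r) := by
  calc _ ≤ κ * μ (ball c (ρ * r)) + κ * μ (ball c (6 * r)) :=
        (h.osc c r hr).trans (add_le_add le_rfl (lintegral_le_of_notMem_MSet hr hx hxc))
    _ ≤ κ * μ (ball c (D * r)) + κ * μ (ball c (D * r)) := by gcongr
    _ ≤ κ * (β * μ (ball c r)) + κ * (β * μ (ball c r)) := by gcongr <;> exact hd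
    _ = _ := by ring

/-- The number `g` of a doubling ball on which the average of `G` is at most `l`. -/
lemma OscBound.g_le {G H : X → ℝ≥0} (hG : Measurable G) {κ l : ℝ≥0} {g : X → ℝ → ℝ≥0}
    (h : OscBound μ lam ρ G H κ g) (hDρ : ρ ≤ D) (hD6 : 6 ≤ D) {x c : X} {r : ℝ} (hr : 0 < r)
    (hd : DoublingBall μ D β c r) (hx : x ∉ MSet μ H κ) (hxc : x ∈ ball c r)
    (h0 : μ (ball c r) ≠ 0) (ht : μ (ball c r) ≠ ∞)
    (hl : ∫⁻ z in ball c r, G z ∂μ ≤ l * μ (ball c r)) :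
    (g c r : ℝ≥0∞) ≤ l + 2 * κ * β := by
  rw [← ENNReal.mul_le_mul_iff_left h0 ht]
  calc (g c r : ℝ≥0∞) * μ (ball c r) = ∫⁻ z in ball c r, g c r ∂μ := (setLIntegral_const _ _).symm
    _ ≤ ∫⁻ z in ball c r, (edist (G z) (g c r) + G z) ∂μ := by
        refine lintegral_mono fun z => ?_
        rw [edist_comm]
        exact NNReal_coe_le_edist_add _ _
    _ = ∫⁻ z in ball c r, edist (G z) (g c r) ∂μ + ∫⁻ z in ball c r, G z ∂μ :=
        lintegral_add_left (hG.edist measurable_const) _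
    _ ≤ 2 * κ * β * μ (ball c r) + l * μ (ball c r) :=
        add_le_add (h.osc_le_of_doubling hDρ hD6 hr hd hx hxc) hl
    _ = _ := by ring

omit [MetricSpace X] in
lemma lintegral_le_edist_add {G : X → ℝ≥0} (hG : Measurable G) (B : Set X) (a : ℝ≥0) :
    ∫⁻ z in B, G z ∂μ ≤ ∫⁻ z in B, edist (G z) a ∂μ + a * μ B := by
  calc _ ≤ ∫⁻ z in B, (edist (G z) a + a) ∂μ :=
        lintegral_mono fun z => NNReal_coe_le_edist_add _ _
    _ = _ := by rw [lintegral_add_left (hG.edist measurable_const), setLIntegral_const]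

/-- The local good-`λ` estimate around an almost maximal ball. -/
lemma OscBound.local_estimate [OpensMeasurableSpace X] [SecondCountableTopology X]
    (hlam : IsDominatingFunction μ lam)
    (hdd : DoublingData μ lam D β K up) {G H : X → ℝ≥0} (hG : Measurable G) {κ l : ℝ≥0}
    {g : X → ℝ → ℝ≥0} (h : OscBound μ lam ρ G H κ g) (hρ : 0 < ρ) (hDρ : 8 * ρ ≤ D) (hD : 48 ≤ D)
    (hκ : 2 * (κ * (4 * β + 1 + K)) ≤ l) {x c : X} {R : ℝ} (hb : HighBall μ D β G l c R)
    (hxc : x ∈ ball c R) (hx : x ∉ MSet μ H κ)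
    (hmax : ∀ c' R', HighBall μ D β G l c' R' → x ∈ ball c' R' → R' < 2 * R) :
    l * μ ((NSet μ D β G (2 * l) \ MSet μ H κ) ∩ ball c (6 * R)) ≤ 4 * β * β * κ * μ
        (ball c R) := by
  have hR := hb.1
  have hμQ := hb.measure_ne_zero
  have hDρ' : ρ ≤ D := by linarith
  have hD6 : 6 ≤ D := by linarith
  have hκE : 2 * (κ * (4 * β + 1 + K)) ≤ (l : ℝ≥0∞) := by exact_mod_cast hκ
  -- the next doubling ball is low
  have hnext : ∀ c' r', HighBall μ D β G l c' r' → R ≤ r' → dist x c' < D * r' →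
      (g c' (up c' r') : ℝ≥0∞) ≤ l + 2 * κ * β ∧ D * r' ≤ up c' r' := by
    intro c' r' hb' hle hdist
    have hr' := hb'.1
    have hμ' := hb'.measure_ne_zero
    have hup := hdd.le_up c' r' hr' hμ'
    have hup' : 0 < up c' r' := by nlinarith
    have hμu : μ (ball c' (up c' r')) ≠ 0 := fun h0 =>
      hμ' (measure_mono_null (ball_subset_ball (by nlinarith)) h0)
    have hxS : x ∈ ball c' (up c' r') := by rw [mem_ball]; linarith
    refine ⟨h.g_le hG hDρ' hD6 hup' (hdd.doubling_up c' r' hr' hμ') hx hxS hμu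
      (hlam.measure_ball_lt_top _ _).ne ?_, hup⟩
    by_contra! hgt
    have := hmax c' (up c' r') ⟨hup', hdd.doubling_up c' r' hr' hμ', hgt⟩ hxS
    nlinarith
  have hgap : ∀ c' r' r'', HighBall μ D β G l c' r' → r' ≤ r'' → r'' ≤ D * r' →
      D * r' ≤ up c' r' → edist (g c' r'') (g c' (up c' r')) ≤ κ * (1 + K) := by
    intro c' r' r'' hb' h1 h2 h3
    have hr' := hb'.1
    refine (h.diff c' c' r'' _ (by linarith) (by linarith) (ball_subset_ball
        (by linarith))).trans ?_
    gcongr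
    refine (coefK_le_one_add_gap (R' := 32 * up c' r') (ball_subset_ball (by linarith))).trans ?_
    gcongr
    exact (gap_mono h1 le_rfl).trans (hdd.gap_up c' r' hr' hb'.measure_ne_zero)
  obtain ⟨hgS, hupQ⟩ := hnext c R hb le_rfl (by rw [mem_ball] at hxc; nlinarith)
  -- The next doubling ball is low by almost maximality of `R`, and its `g` differs from that of the
  -- `8`-dilate by a bounded multiple of `κ`.
  have hgW : (g c (8 * R) : ℝ≥0∞) ≤ l + 2 * κ * β + κ * (1 + K) := by
    have h1 := hgap c R (8 * R) hb (by linarith) (by nlinarith) hupQ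
    calc (g c (8 * R) : ℝ≥0∞) ≤ edist (g c (8 * R)) (g c (up c R)) + g c (up c R) :=
          NNReal_coe_le_edist_add _ _
      _ ≤ κ * (1 + K) + (l + 2 * κ * β) := add_le_add h1 hgS
      _ = _ := by ring
  have hsub : (NSet μ D β G (2 * l) \ MSet μ H κ) ∩ ball c (6 * R) ⊆ ballUnion fun c' r' =>
      HighBall μ D β G (2 * l) c' r' ∧ ball c' r' ⊆ ball c (8 * R) := by
    rintro y ⟨⟨⟨c', r', hb', hy⟩, hyM⟩, hyc⟩
    have hbl : HighBall μ D β G l c' r' := hb'.mono (by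
      rw [two_mul]; exact le_self_add)
    have hr' := hb'.1
    rw [mem_ball] at hyc hxc
    have hy' := mem_ball.1 hy
    refine ⟨c', r', ⟨hb', ?_⟩, hy⟩
    -- If `r' ≥ R`, the next doubling ball of `ball c' r'` contains `x` and is too large to be high,
    -- so its average is at most `l`. The oscillation bounds then force the average over `ball c'
    -- r'` to be at most `2l`, a contradiction.
    have hlt : r' < R := by
      by_contra! hge
      have t1 := dist_triangle x c c'
      have t2 := dist_triangle c y c'
      rw [dist_comm c y] at t2
      obtain ⟨g1, hup⟩ := hnext c' r' hbl hge (by nlinarith)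
      have g2 := hgap c' r' r' hbl le_rfl (by nlinarith) hup
      have hosc := h.osc_le_of_doubling hDρ' hD6 hr' hb'.2.1 hyM hy
      have hlow : ∫⁻ z in ball c' r', G z ∂μ ≤ (2 * l : ℝ≥0) * μ (ball c' r') := by
        calc _ ≤ ∫⁻ z in ball c' r', edist (G z) (g c' r') ∂μ + g c' r' * μ (ball c' r') :=
              lintegral_le_edist_add hG _ _
          _ ≤ 2 * κ * β * μ (ball c' r') + (κ * (1 + K) + (l + 2 * κ * β)) * μ (ball c' r') := by
              gcongr
              exact (NNReal_coe_le_edist_add _ _).trans (add_le_add g2 g1)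
          _ = (l + κ * (4 * β + 1 + K)) * μ (ball c' r') := by ring
          _ ≤ (l + l) * μ (ball c' r') := by
              gcongr
              refine le_trans ?_ hκE
              rw [two_mul]; exact le_self_add
          _ = _ := by push_cast; ring
      exact absurd hb'.2.2 (not_lt.2 hlow)
    refine ball_subset_ball' ?_
    have t2 := dist_triangle c' y c
    rw [dist_comm c' y] at t2
    linarith
  set w : X → ℝ≥0∞ := (ball c (8 * R)).indicator fun z => edist (G z) (g c (8 * R))
  have hweak : (l / (2 * β) : ℝ≥0∞) * μ (ballUnion fun c' r' =>
      HighBall μ D β G (2 * l) c' r' ∧ ball c' r' ⊆ ball c (8 * R)) ≤ ∫⁻ z, w z ∂μ := by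
    refine measure_ballUnion_le fun c' r' hh => ⟨hh.1.1, ?_⟩
    obtain ⟨hb', hsub'⟩ := hh
    have ht := (hlam.measure_ball_lt_top c' r').ne
    have hβ0 : (β : ℝ≥0∞) ≠ 0 := by
      have := hdd.one_le_beta
      exact_mod_cast (zero_lt_one.trans_le this).ne'
    have e1 : ∫⁻ z in ball c' r', w z ∂μ = ∫⁻ z in ball c' r', edist (G z) (g c (8 * R)) ∂μ := by
      refine setLIntegral_congr_fun measurableSet_ball fun z hz => ?_
      simp only [w]
      rw [indicator_of_mem (hsub' hz)]
    rw [e1]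
    have hr' := hb'.1
    have h3 : μ (ball c' (6 * r')) ≤ β * μ (ball c' r') :=
      (measure_mono (ball_subset_ball (by nlinarith))).trans hb'.2.1
    have h4 : (l / 2 : ℝ≥0∞) * μ (ball c' r') ≤ ∫⁻ z in ball c' r', edist (G z) (g c
        (8 * R)) ∂μ := by
      -- The average over a ball of level `2l` exceeds `g c (8 * R)` by at least `l/2`, so these
      -- balls are caught by the weak type inequality for the oscillation on the `8`-dilate.
      have h5 : (g c (8 * R) : ℝ≥0∞) ≤ l + l / 2 := by
        refine hgW.trans ?_
        rw [add_assoc]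
        gcongr
        rw [ENNReal.le_div_iff_mul_le (by simp) (by simp)]
        refine le_trans ?_ hκE
        calc (2 * κ * β + κ * (1 + K)) * 2 = (2 * (κ * (2 * β + 1 + K)) : ℝ≥0∞) := by ring
          _ ≤ _ := by gcongr; norm_num
      have h6 : (l / 2 + (l + l / 2) : ℝ≥0∞) = (2 * l : ℝ≥0) := by
        rw [add_left_comm, ENNReal.add_halves]; push_cast; ring
      have h7 : (l / 2 : ℝ≥0∞) * μ (ball c' r') + (l + l / 2) * μ (ball c' r') ≤
          ∫⁻ z in ball c' r', edist (G z) (g c (8 * R)) ∂μ + (l + l / 2) * μ (ball c' r') := by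
        rw [← add_mul, h6]
        exact hb'.2.2.le.trans ((lintegral_le_edist_add hG _ (g c (8 * R))).trans
          (add_le_add le_rfl (mul_le_mul' h5 le_rfl)))
      refine ENNReal.le_of_add_le_add_right (ENNReal.mul_ne_top ?_ ht) h7
      exact ENNReal.add_ne_top.2 ⟨ENNReal.coe_ne_top, ENNReal.div_ne_top ENNReal.coe_ne_top
        (by norm_num)⟩
    calc (l / (2 * β) : ℝ≥0∞) * μ (ball c' (6 * r'))
        ≤ (l / (2 * β) : ℝ≥0∞) * (β * μ (ball c' r')) := by gcongr
      _ = (l / 2 : ℝ≥0∞) * μ (ball c' r') := by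
          rw [← mul_assoc, ← ENNReal.mul_div_right_comm]
          rw [ENNReal.mul_div_mul_right _ _ hβ0 ENNReal.coe_ne_top]
      _ ≤ _ := h4
  have hw : ∫⁻ z, w z ∂μ ≤ 2 * β * κ * μ (ball c R) := by
    have hd : μ (ball c (D * R)) ≤ β * μ (ball c R) := hb.2.1
    rw [lintegral_indicator measurableSet_ball]
    calc _ ≤ κ * μ (ball c (ρ * (8 * R))) + κ * μ (ball c (6 * (8 * R))) :=
          (h.osc c (8 * R) (by linarith)).trans (add_le_add le_rfl
            (lintegral_le_of_notMem_MSet (by linarith) hx (ball_subset_ball (by linarith) hxc)))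
      _ ≤ κ * μ (ball c (D * R)) + κ * μ (ball c (D * R)) := by
          gcongr _ * μ ?_ + _ * μ ?_
          · exact ball_subset_ball (by nlinarith)
          · exact ball_subset_ball (by nlinarith)
      _ ≤ κ * (β * μ (ball c R)) + κ * (β * μ (ball c R)) := by gcongr
      _ = _ := by ring
  have hβ2 : (2 * β : ℝ≥0∞) ≠ 0 := by
    have := hdd.one_le_beta
    exact mul_ne_zero (by norm_num) (by exact_mod_cast (zero_lt_one.trans_le this).ne')
  have hβ2t : (2 * β : ℝ≥0∞) ≠ ∞ := ENNReal.mul_ne_top (by norm_num) ENNReal.coe_ne_top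
  calc l * μ ((NSet μ D β G (2 * l) \ MSet μ H κ) ∩ ball c (6 * R))
      ≤ l * μ (ballUnion fun c' r' =>
        HighBall μ D β G (2 * l) c' r' ∧ ball c' r' ⊆ ball c (8 * R)) := by gcongr
    _ = 2 * β * ((l / (2 * β) : ℝ≥0∞) * μ (ballUnion fun c' r' =>
        HighBall μ D β G (2 * l) c' r' ∧ ball c' r' ⊆ ball c (8 * R))) := by
        rw [← mul_assoc, ENNReal.mul_div_cancel hβ2 hβ2t]
    _ ≤ 2 * β * (2 * β * κ * μ (ball c R)) := by
        exact mul_le_mul' le_rfl (hweak.trans hw)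
    _ = _ := by ring

end GoodLambda


/-- Summing and absorbing would require `∑ v` to be finite. The induction avoids this by carrying an
additional `v n` next to the partial sum. -/
lemma tsum_le_of_succ_le {v w : ℕ → ℝ≥0∞} (h : ∀ i, 2 * v (i + 1) ≤ v i + 2 * w i) :
    ∑' i, v i ≤ 2 * v 0 + 2 * ∑' i, w i := by
  have key : ∀ n, ∑ i ∈ Finset.range (n + 1), v i + v n ≤
      2 * v 0 + 2 * ∑ i ∈ Finset.range n, w i := by
    intro n
    induction n with
    | zero => simp [two_mul]
    | succ n ih =>
      have e1 := Finset.sum_range_succ v (n + 1)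
      have e2 := Finset.sum_range_succ w n
      rw [e1, e2]
      calc _ = ∑ i ∈ Finset.range (n + 1), v i + 2 * v (n + 1) := by ring
        _ ≤ ∑ i ∈ Finset.range (n + 1), v i + (v n + 2 * w n) := by gcongr; exact h n
        _ = (∑ i ∈ Finset.range (n + 1), v i + v n) + 2 * w n := by ring
        _ ≤ (2 * v 0 + 2 * ∑ i ∈ Finset.range n, w i) + 2 * w n := by gcongr
        _ = _ := by ring
  rw [ENNReal.tsum_eq_iSup_nat]
  refine iSup_le fun n => ?_
  calc _ ≤ ∑ i ∈ Finset.range (n + 1), v i + v n := by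
        rw [Finset.sum_range_succ, add_assoc]; exact le_self_add
    _ ≤ _ := (key n).trans (by gcongr; exact ENNReal.sum_le_tsum _)

/-! ### Dyadic layers and tails of functions in weak Lebesgue spaces. -/

section Dyadic

variable {X : Type*} [MeasurableSpace X] {μ : Measure X}

lemma lintegral_rpow_le_tsum {G : X → ℝ≥0} (hG : Measurable G) {a : ℝ≥0} (ha : a ≠ 0) {Q : ℝ}
    (hQ : 0 ≤ Q) : ∫⁻ z in {z | a < G z}, (G z : ℝ≥0∞) ^ Q ∂μ ≤
      ∑' k : ℕ, ((2 ^ (k + 1) * a : ℝ≥0) : ℝ≥0∞) ^ Q * μ {z | 2 ^ k * a < G z} := by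
  have hm : ∀ b : ℝ≥0, MeasurableSet {z | b < G z} := fun b => measurableSet_lt measurable_const hG
  calc _ ≤ ∫⁻ z, ∑' k : ℕ, {z | 2 ^ k * a < G z}.indicator
        (fun _ => ((2 ^ (k + 1) * a : ℝ≥0) : ℝ≥0∞) ^ Q) z ∂μ := by
        rw [← lintegral_indicator (hm a)]
        refine lintegral_mono fun z => ?_
        by_cases hz : a < G z
        · rw [indicator_of_mem (show z ∈ {z | a < G z} from hz)]
          have hex : ∃ n : ℕ, G z ≤ 2 ^ n * a := by
            obtain ⟨n, hn⟩ := pow_unbounded_of_one_lt (G z / a) (one_lt_two (α := ℝ≥0))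
            exact ⟨n, by rw [← div_le_iff₀ ha.bot_lt]; exact hn.le⟩
          classical
          obtain ⟨k, hk⟩ : ∃ k, Nat.find hex = k + 1 := by
            refine Nat.exists_eq_succ_of_ne_zero fun h0 => ?_
            have := Nat.find_spec hex
            rw [h0, pow_zero, one_mul] at this
            exact absurd hz (not_lt.2 this)
          have h1 : G z ≤ 2 ^ (k + 1) * a := hk ▸ Nat.find_spec hex
          have h2 : 2 ^ k * a < G z := not_le.1 (Nat.find_min hex (by omega))
          refine le_trans ?_ (ENNReal.le_tsum k)
          rw [indicator_of_mem (show z ∈ {z | 2 ^ k * a < G z} from h2)]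
          gcongr
        · rw [indicator_of_notMem (show z ∉ {z | a < G z} from hz)]
          exact bot_le
    _ = _ := by
        rw [lintegral_tsum fun k => (measurable_const.indicator (hm _)).aemeasurable]
        refine tsum_congr fun k => ?_
        rw [lintegral_indicator (hm _), setLIntegral_const]

/-- The tail of a function in weak `L^P`, `P ≥ 2`. -/
lemma lintegral_tail_le {H : X → ℝ≥0} (hH : Measurable H) {P : ℝ} (hP : 2 ≤ P) {W : ℝ≥0∞}
    (hW : ∀ s : ℝ≥0, (s : ℝ≥0∞) ^ P * μ {z | s < H z} ≤ W) {a : ℝ≥0} (ha : a ≠ 0) :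
    (a : ℝ≥0∞) ^ (P - 1) * ∫⁻ z in {z | a < H z}, H z ∂μ ≤ 4 * W := by
  have h := lintegral_rpow_le_tsum (μ := μ) hH ha zero_le_one
  simp only [ENNReal.rpow_one] at h
  have hterm : ∀ k : ℕ, (a : ℝ≥0∞) ^ (P - 1) *
      (((2 ^ (k + 1) * a : ℝ≥0) : ℝ≥0∞) * μ {z | 2 ^ k * a < H z}) ≤ 2⁻¹ ^ k * (2 * W) := by
    intro k
    have e2 : (2⁻¹ ^ k * 2 ^ k : ℝ≥0∞) = 1 := by
      rw [← mul_pow, ENNReal.inv_mul_cancel (by norm_num) (by norm_num), one_pow]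
    have h1 : (a : ℝ≥0∞) ^ (P - 1) * (2 ^ k * a : ℝ≥0) ≤ 2⁻¹ ^ k *
        ((2 ^ k * a : ℝ≥0) : ℝ≥0∞) ^ P := by
      have e3 : ((2 ^ k * a : ℝ≥0) : ℝ≥0∞) ^ P =
          ((2 ^ k : ℝ≥0∞) ^ (P - 1) * a ^ (P - 1)) * (2 ^ k * a : ℝ≥0) := by
        conv_lhs => rw [show P = (P - 1) + 1 by ring]
        rw [ENNReal.rpow_add_of_nonneg _ _ (by linarith) zero_le_one, ENNReal.rpow_one]
        push_cast
        rw [ENNReal.mul_rpow_of_nonneg _ _ (by linarith)]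
      -- Here `P ≥ 2` enters: the dyadic layers of the tail decay at least like `2^{-k}`.
      have e4 : (2 ^ k : ℝ≥0∞) ≤ (2 ^ k : ℝ≥0∞) ^ (P - 1) := by
        conv_lhs => rw [← ENNReal.rpow_one (2 ^ k)]
        exact ENNReal.rpow_le_rpow_of_exponent_le (one_le_pow₀ (by norm_num)) (by linarith)
      rw [e3]
      calc (a : ℝ≥0∞) ^ (P - 1) * (2 ^ k * a : ℝ≥0)
          = (2⁻¹ ^ k * 2 ^ k) * ((a : ℝ≥0∞) ^ (P - 1) * (2 ^ k * a : ℝ≥0)) := by rw [e2, one_mul]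
        _ = 2⁻¹ ^ k * (2 ^ k * a ^ (P - 1) * (2 ^ k * a : ℝ≥0)) := by ring
        _ ≤ _ := by gcongr
    calc _ = 2 * (((a : ℝ≥0∞) ^ (P - 1) * (2 ^ k * a : ℝ≥0)) * μ {z | 2 ^ k * a < H z}) := by
          push_cast; ring
      _ ≤ 2 * ((2⁻¹ ^ k * ((2 ^ k * a : ℝ≥0) : ℝ≥0∞) ^ P) * μ {z | 2 ^ k * a < H z}) := by gcongr
      _ = 2 * (2⁻¹ ^ k * (((2 ^ k * a : ℝ≥0) : ℝ≥0∞) ^ P * μ {z | 2 ^ k * a < H z})) := by ring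
      _ ≤ 2 * (2⁻¹ ^ k * W) := by gcongr; exact hW _
      _ = _ := by ring
  calc _ ≤ (a : ℝ≥0∞) ^ (P - 1) *
        ∑' k : ℕ, ((2 ^ (k + 1) * a : ℝ≥0) : ℝ≥0∞) * μ {z | 2 ^ k * a < H z} := by gcongr
    _ ≤ ∑' k : ℕ, 2⁻¹ ^ k * (2 * W) := by
        rw [← ENNReal.tsum_mul_left]
        exact ENNReal.tsum_le_tsum hterm
    _ = _ := by
        rw [ENNReal.tsum_mul_right, ENNReal.tsum_geometric, ENNReal.one_sub_inv_two, inv_inv]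
        ring

/-- Values of `H` up to `κ/2` account for at most `(κ/2) m` of the integral, so the tail carries the
other half. -/
lemma half_mul_le_lintegral_tail {H : X → ℝ≥0} (hH : Measurable H) {B : Set X}
    {m : ℝ≥0∞} (hm : μ B ≤ m) {κ : ℝ≥0} (h : κ * m < ∫⁻ z in B, H z ∂μ) :
    ((κ / 2 : ℝ≥0) : ℝ≥0∞) * m ≤
      ∫⁻ z in B, {z | κ / 2 < H z}.indicator (fun z => (H z : ℝ≥0∞)) z ∂μ := by
  have hms : MeasurableSet {z | κ / 2 < H z} := measurableSet_lt measurable_const hH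
  have h1 : ∫⁻ z in B, H z ∂μ ≤
      ∫⁻ z in B, {z | κ / 2 < H z}.indicator (fun z => (H z : ℝ≥0∞)) z ∂μ +
        ((κ / 2 : ℝ≥0) : ℝ≥0∞) * μ B := by
    rw [← setLIntegral_const, ← lintegral_add_right _ measurable_const]
    refine lintegral_mono fun z => ?_
    by_cases hz : κ / 2 < H z
    · rw [indicator_of_mem (show z ∈ {z | κ / 2 < H z} from hz)]
      exact le_self_add
    · rw [indicator_of_notMem (show z ∉ {z | κ / 2 < H z} from hz), zero_add]
      exact ENNReal.coe_le_coe.2 (not_lt.1 hz)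
  have e : (κ : ℝ≥0∞) * m = ((κ / 2 : ℝ≥0) : ℝ≥0∞) * m + ((κ / 2 : ℝ≥0) : ℝ≥0∞) * m := by
    rw [← add_mul, ← ENNReal.coe_add, add_halves]
  by_cases hmt : m = ∞
  · by_contra! hlt
    have h2 := h.trans_le h1
    rw [hmt] at h2 hlt
    rcases eq_or_ne κ 0 with rfl | hκ
    · simp at hlt
    · rw [ENNReal.mul_top (by simpa using hκ)] at h2
      exact absurd h2 not_top_lt
  have h2 : ((κ / 2 : ℝ≥0) : ℝ≥0∞) * m + ((κ / 2 : ℝ≥0) : ℝ≥0∞) * m ≤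
      ∫⁻ z in B, {z | κ / 2 < H z}.indicator (fun z => (H z : ℝ≥0∞)) z ∂μ +
        ((κ / 2 : ℝ≥0) : ℝ≥0∞) * m := by
    rw [← e]
    exact h.le.trans (h1.trans (by gcongr))
  exact ENNReal.le_of_add_le_add_right (ENNReal.mul_ne_top ENNReal.coe_ne_top hmt) h2

end Dyadic

/-! ### Distributional bounds for the maximal functions and the integrated good-λ inequality. -/

section GoodLambda

variable {X : Type*} [MetricSpace X] [MeasurableSpace X] {μ : Measure X} {lam : X → ℝ → ℝ}
  {ρ D : ℝ} {β K : ℝ≥0} {up : X → ℝ → ℝ} [BorelSpace X] [SecondCountableTopology X]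

/-- The weak type `(1,1)` inequality is applied to `H` cut off below `κ/2`, and the tail estimate is
inserted: the maximal function preserves weak `L^P`. -/
lemma measure_MSet_le {H : X → ℝ≥0} (hH : Measurable H) {P : ℝ}
    (hP : 2 ≤ P) {W : ℝ≥0∞} (hW : ∀ s : ℝ≥0, (s : ℝ≥0∞) ^ P * μ {z | s < H z} ≤ W) {κ : ℝ≥0}
    (hκ : κ ≠ 0) : (κ : ℝ≥0∞) ^ P * μ (MSet μ H κ) ≤ 2 ^ P * (4 * W) := by
  have hms : MeasurableSet {z | κ / 2 < H z} := measurableSet_lt measurable_const hH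
  have h1 : ((κ / 2 : ℝ≥0) : ℝ≥0∞) * μ (MSet μ H κ) ≤ ∫⁻ z in {z | κ / 2 < H z}, H z ∂μ := by
    rw [← lintegral_indicator hms]
    refine measure_ballUnion_le fun c r h => ⟨h.1, ?_⟩
    have h0 := h.1
    exact half_mul_le_lintegral_tail hH
      (measure_mono (ball_subset_ball (by linarith))) h.2
  have h2 := lintegral_tail_le hH hP hW (a := κ / 2) (by positivity)
  have e : (κ : ℝ≥0∞) ^ P = 2 ^ P * (((κ / 2 : ℝ≥0) : ℝ≥0∞) ^ (P - 1) *
      ((κ / 2 : ℝ≥0) : ℝ≥0∞)) := by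
    have e1 : (κ : ℝ≥0∞) = 2 * ((κ / 2 : ℝ≥0) : ℝ≥0∞) := by
      rw [two_mul, ← ENNReal.coe_add, add_halves]
    conv_lhs => rw [e1, ENNReal.mul_rpow_of_nonneg _ _ (by linarith : 0 ≤ P)]
    congr 1
    conv_lhs => rw [show P = (P - 1) + 1 by ring]
    rw [ENNReal.rpow_add_of_nonneg _ _ (by linarith) zero_le_one, ENNReal.rpow_one]
  rw [e]
  calc _ = 2 ^ P * (((κ / 2 : ℝ≥0) : ℝ≥0∞) ^ (P - 1) *
        (((κ / 2 : ℝ≥0) : ℝ≥0∞) * μ (MSet μ H κ))) := by ring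
    _ ≤ 2 ^ P * (((κ / 2 : ℝ≥0) : ℝ≥0∞) ^ (P - 1) * ∫⁻ z in {z | κ / 2 < H z}, H z ∂μ) := by
        gcongr
    _ ≤ _ := by gcongr

-- On a doubling ball the measure of the `6`-dilate costs only a factor `β`, so the maximal function
-- over doubling balls is dominated by the one with dilated denominators.
omit [BorelSpace X] [SecondCountableTopology X] in
lemma NSet_subset_MSet (hD : 6 ≤ D) (hβ : β ≠ 0) {G : X → ℝ≥0} {l : ℝ≥0} :
    NSet μ D β G l ⊆ MSet μ G (l / β) := by
  refine ballUnion_mono fun c r h => ⟨h.1, lt_of_le_of_lt ?_ h.2.2⟩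
  have hr := h.1
  have h1 : μ (ball c (6 * r)) ≤ β * μ (ball c r) :=
    (measure_mono (ball_subset_ball (by nlinarith))).trans h.2.1
  calc ((l / β : ℝ≥0) : ℝ≥0∞) * μ (ball c (6 * r))
      ≤ ((l / β : ℝ≥0) : ℝ≥0∞) * (β * μ (ball c r)) := by gcongr
    _ = ((l / β * β : ℝ≥0) : ℝ≥0∞) * μ (ball c r) := by push_cast; ring
    _ = _ := by rw [div_mul_cancel₀ _ hβ]

lemma measure_NSet_le (hD : 6 ≤ D) (hβ : β ≠ 0)
    {G : X → ℝ≥0} (hG : Measurable G) {P : ℝ}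
    (hP : 2 ≤ P) {W : ℝ≥0∞} (hW : ∀ s : ℝ≥0, (s : ℝ≥0∞) ^ P * μ {z | s < G z} ≤ W) {l : ℝ≥0}
    (hl : l ≠ 0) : (l : ℝ≥0∞) ^ P * μ (NSet μ D β G l) ≤ β ^ P * (2 ^ P * (4 * W)) := by
  have h := measure_MSet_le hG hP hW (κ := l / β) (div_ne_zero hl hβ)
  have e : (l : ℝ≥0∞) ^ P = β ^ P * ((l / β : ℝ≥0) : ℝ≥0∞) ^ P := by
    rw [← ENNReal.mul_rpow_of_nonneg _ _ (by linarith), ← ENNReal.coe_mul, mul_div_cancel₀ _ hβ]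
  rw [e, mul_assoc]
  exact mul_le_mul' le_rfl
    ((mul_le_mul' le_rfl (measure_mono (NSet_subset_MSet hD hβ))).trans h)

lemma mul_measure_NSet_le (hD : 6 ≤ D) {G : X → ℝ≥0} {l : ℝ≥0} :
    l * μ (NSet μ D β G l) ≤ β * ∫⁻ z, G z ∂μ := by
  rcases eq_or_ne β 0 with rfl | hβ
  · have : NSet μ D 0 G l = ∅ := by
      refine eq_empty_of_forall_notMem ?_
      rintro x ⟨c, r, h, hx⟩
      have hr := h.1
      have h1 : μ (ball c (D * r)) ≤ 0 := by simpa [DoublingBall] using h.2.1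
      exact h.measure_ne_zero (le_antisymm
        ((measure_mono (ball_subset_ball (by nlinarith))).trans h1) bot_le)
    simp [this]
  have h1 : ((l / β : ℝ≥0) : ℝ≥0∞) * μ (MSet μ G (l / β)) ≤ ∫⁻ z, G z ∂μ :=
    measure_ballUnion_le fun c r h => ⟨h.1, h.2.le⟩
  calc l * μ (NSet μ D β G l) = β * (((l / β : ℝ≥0) : ℝ≥0∞) * μ (NSet μ D β G l)) := by
        rw [← mul_assoc, ← ENNReal.coe_mul, mul_div_cancel₀ _ hβ]
    _ ≤ β * (((l / β : ℝ≥0) : ℝ≥0∞) * μ (MSet μ G (l / β))) := by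
        gcongr
        exact NSet_subset_MSet hD hβ
    _ ≤ _ := by gcongr

/-- Differentiation along the small doubling balls about `x`, whose averages are at most `l`. The
factor `β` comes from passing to the closed ball of half the radius. -/
lemma ae_le_of_notMem_NSet (hlam : IsDominatingFunction μ lam) (hD : 2 ≤ D)
    (hdd : DoublingData μ lam D β K up) {G : X → ℝ≥0} (hG : Measurable G) (l : ℝ≥0) :
    ∀ᵐ z ∂μ, z ∉ NSet μ D β G l → G z ≤ β * l := by
  have := hlam.isLocallyFiniteMeasure
  have h := ae_le_of_small_balls (μ := μ) (E := (NSet μ D β G l)ᶜ) (w := fun z => (G z : ℝ≥0∞))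
    (C := β) (t := β * l) (isOpen_ballUnion _).measurableSet.compl hG.coe_nnreal_ennreal (by
      filter_upwards [hdd.ae_small] with x hx hxN ε hε
      obtain ⟨r, hr, hrε, hd⟩ := hx ε hε
      refine ⟨r / 2, by linarith, by linarith, ?_, ?_⟩
      · calc μ (closedBall x (3 * (r / 2))) ≤ μ (ball x (D * r)) :=
              measure_mono (closedBall_subset_ball (by nlinarith))
          _ ≤ β * μ (ball x (r / 2)) := hd
          _ ≤ _ := by gcongr; exact ball_subset_closedBall
      · have hdr : DoublingBall μ D β x r :=
          hd.trans (by gcongr; linarith)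
        have hlow : ∫⁻ z in ball x r, G z ∂μ ≤ l * μ (ball x r) := by
          by_contra! hgt
          exact hxN ⟨x, r, ⟨hr, hdr, hgt⟩, mem_ball_self hr⟩
        calc _ ≤ ∫⁻ z in ball x r, G z ∂μ :=
              lintegral_mono_set (closedBall_subset_ball (by linarith))
          _ ≤ l * μ (ball x r) := hlow
          _ ≤ l * (β * μ (ball x (r / 2))) := by
              gcongr
              exact (measure_mono (ball_subset_ball (by nlinarith))).trans hd
          _ ≤ l * (β * μ (closedBall x (r / 2))) := by gcongr; exact ball_subset_closedBall
          _ = _ := by push_cast; ring)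
  filter_upwards [h] with z hz hzN
  exact_mod_cast hz hzN

/-- The good-`λ` inequality. -/
lemma OscBound.measure_diff_le [Nonempty X] (hlam : IsDominatingFunction μ lam)
    (hdd : DoublingData μ lam D β K up) {G H : X → ℝ≥0} (hG : Measurable G) {κ l : ℝ≥0}
    {g : X → ℝ → ℝ≥0} (h : OscBound μ lam ρ G H κ g) (hρ : 0 < ρ) (hDρ : 8 * ρ ≤ D) (hD : 48 ≤ D)
    (hκ : 2 * (κ * (4 * β + 1 + K)) ≤ l)
    (hN : β * μ (NSet μ D β G l) < μ univ) :
    l * μ (NSet μ D β G (2 * l) \ MSet μ H κ) ≤ 4 * β * β * κ * μ (NSet μ D β G l) := by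
  obtain ⟨x₀⟩ := ‹Nonempty X›
  obtain ⟨R₁, hR₁, hlt⟩ := exists_lt_measure_ball (μ := μ) x₀ hN
  set E := NSet μ D β G (2 * l) \ MSet μ H κ
  -- For a larger radius the `D`-dilate would contain `ball x₀ R₁`, whose measure exceeds `β μ(N)`,
  -- while the ball itself lies in `N`; this contradicts doubling. Bounded radii are needed for
  -- almost maximal balls and for the Vitali lemma.
  have hrad : ∀ (n : ℝ) x c R, x ∈ ball x₀ n → HighBall μ D β G l c R → x ∈ ball c R →
      R ≤ R₁ + n := by
    intro n x c R hx hb hxc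
    by_contra! hgt
    rw [mem_ball] at hx hxc
    have t1 := dist_triangle x₀ x c
    rw [dist_comm x₀ x] at t1
    have hR := hb.1
    have hsub : ball x₀ R₁ ⊆ ball c (D * R) := ball_subset_ball' (by nlinarith)
    have hsub' : ball c R ⊆ NSet μ D β G l := fun z hz => ⟨c, R, hb, hz⟩
    refine absurd hlt (not_lt.2 ?_)
    calc μ (ball x₀ R₁) ≤ μ (ball c (D * R)) := measure_mono hsub
      _ ≤ β * μ (ball c R) := hb.2.1
      _ ≤ _ := by gcongr
  have hn : ∀ n : ℕ, l * μ (E ∩ ball x₀ n) ≤ 4 * β * β * κ * μ (NSet μ D β G l) := by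
    intro n
    set t : Set (X × ℝ) := {a | HighBall μ D β G l a.1 a.2 ∧ ∃ x ∈ E ∩ ball x₀ n,
      x ∈ ball a.1 a.2 ∧ ∀ c' R', HighBall μ D β G l c' R' → x ∈ ball c' R' → R' < 2 * a.2}
    obtain ⟨u, hut, hd, hcov⟩ := Vitali.exists_disjoint_subfamily_covering_enlargement_ball
      t Prod.fst Prod.snd (R₁ + n) (fun a ⟨hb, x, hx, hxa, _⟩ => hrad n x _ _ hx.2 hb hxa) 6
      (by norm_num)
    have hu : u.Countable := countable_of_disjoint_balls (fun a ha => (hut ha).1.1) hd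
    have hsub : E ∩ ball x₀ n ⊆ ⋃ a ∈ u, E ∩ ball a.1 (6 * a.2) := by
      rintro x ⟨hxE, hxn⟩
      obtain ⟨c₀, r₀, hb₀, hx₀⟩ := hxE.1
      obtain ⟨R, ⟨c, hb, hxc⟩, hmax⟩ := exists_almost_max
        (A := {R | ∃ c, HighBall μ D β G l c R ∧ x ∈ ball c R})
        ⟨r₀, c₀, hb₀.mono (by rw [two_mul]; exact le_self_add), hx₀⟩
        (fun R ⟨c, hb, _⟩ => hb.1) (R := R₁ + n) (fun R ⟨c, hb, hxc⟩ => hrad n x c R hxn hb hxc)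
      obtain ⟨b, hb', hsub⟩ := hcov (c, R) ⟨hb, x, ⟨hxE, hxn⟩, hxc,
        fun c' R' h1 h2 => hmax R' ⟨c', h1, h2⟩⟩
      exact mem_iUnion₂.2 ⟨b, hb', hxE, hsub hxc⟩
    calc l * μ (E ∩ ball x₀ n) ≤ l * ∑' a : u, μ (E ∩ ball a.1.1 (6 * a.1.2)) := by
          gcongr
          exact (measure_mono hsub).trans (measure_biUnion_le μ hu _)
      _ = ∑' a : u, l * μ (E ∩ ball a.1.1 (6 * a.1.2)) := ENNReal.tsum_mul_left.symm
      _ ≤ ∑' a : u, 4 * β * β * κ * μ (ball a.1.1 a.1.2) := by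
          refine ENNReal.tsum_le_tsum fun a => ?_
          obtain ⟨hb, x, hx, hxa, hmax⟩ := hut a.2
          exact h.local_estimate hlam hdd hG hρ hDρ hD hκ hb hxa hx.1.2 hmax
      _ = 4 * β * β * κ * μ (⋃ a ∈ u, ball a.1 a.2) := by
          rw [ENNReal.tsum_mul_left, measure_biUnion hu hd fun a _ => measurableSet_ball]
      _ ≤ _ := by
          gcongr
          exact iUnion₂_subset fun a ha z hz => ⟨_, _, (hut ha).1, hz⟩
  have hE : E = ⋃ n : ℕ, E ∩ ball x₀ n := by
    rw [← inter_iUnion, iUnion_ball_nat, inter_univ]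
  have hmono : Monotone fun n : ℕ => E ∩ ball x₀ n := fun m n hmn =>
    inter_subset_inter_right _ (ball_subset_ball (by exact_mod_cast hmn))
  rw [hE, hmono.measure_iUnion, ENNReal.mul_iSup]
  exact iSup_le hn

/-- The integrated form of the good-`λ` inequality, along dyadic levels starting from `ℓ`. -/
theorem exists_lintegral_rpow_le_of_oscBound [Nonempty X] (hlam : IsDominatingFunction μ lam)
    (hdd : DoublingData μ lam D β K up) (hρ : 0 < ρ) (hDρ : 8 * ρ ≤ D) (hD : 48 ≤ D) {Q : ℝ}
    (hQ : 0 < Q) : ∃ C δ : ℝ≥0, δ ≠ 0 ∧ ∀ (G : X → ℝ≥0) (H : ℕ → X → ℝ≥0) (κ : ℕ → ℝ≥0)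
      (g : ℕ → X → ℝ → ℝ≥0) (ℓ : ℝ≥0), Measurable G → ℓ ≠ 0 →
      (∀ i, OscBound μ lam ρ G (H i) (κ i) (g i)) → (∀ i, κ i ≤ δ * (2 ^ i * ℓ)) →
      β * μ (NSet μ D β G ℓ) < μ univ →
      ∫⁻ z in {z | β * ℓ < G z}, (G z : ℝ≥0∞) ^ Q ∂μ ≤ C * ((ℓ : ℝ≥0∞) ^ Q * μ (NSet μ D β G ℓ) +
        ∑' i, ((2 ^ i * ℓ : ℝ≥0) : ℝ≥0∞) ^ Q * μ (MSet μ (H i) (κ i))) := by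
  have hβ1 := hdd.one_le_beta
  have hβ0 : β ≠ 0 := (zero_lt_one.trans_le hβ1).ne'
  set A : ℝ≥0 := 2 ^ Q
  have hA : ((A : ℝ≥0) : ℝ≥0∞) = 2 ^ Q := by
    simp only [A]; rw [ENNReal.coe_rpow_of_nonneg _ hQ.le]; simp
  -- The second summand ensures the smallness of `κ` required by the good-λ inequality; the first
  -- makes its gain beat the factor `2^Q` between consecutive levels, with a factor `2` to spare.
  set B : ℝ≥0 := 8 * A * β * β + 2 * (4 * β + 1 + K)
  have hB : B ≠ 0 := by positivity
  refine ⟨(2 * β) ^ Q * (2 + 2 * A), B⁻¹, inv_ne_zero hB, ?_⟩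
  intro G H κ g ℓ hG hℓ hosc hκ hN
  set l : ℕ → ℝ≥0 := fun i => 2 ^ i * ℓ
  have hl : ∀ i, l i ≠ 0 := fun i => by positivity
  have hls : ∀ i, l (i + 1) = 2 * l i := fun i => by simp only [l]; ring
  have hκl : ∀ i, B * κ i ≤ l i := fun i => by
    have := mul_le_mul' (le_refl B) (hκ i)
    rwa [← mul_assoc, mul_inv_cancel₀ hB, one_mul] at this
  set v : ℕ → ℝ≥0∞ := fun i => (l i : ℝ≥0∞) ^ Q * μ (NSet μ D β G (l i))
  set w : ℕ → ℝ≥0∞ := fun i => (l i : ℝ≥0∞) ^ Q * μ (MSet μ (H i) (κ i))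
  have hstep : ∀ i, 2 * v (i + 1) ≤ v i + 2 * (A * w i) := by
    intro i
    have h1 := (hosc i).measure_diff_le hlam hdd hG hρ hDρ hD (l := l i) (by
      refine le_trans ?_ (hκl i)
      calc 2 * (κ i * (4 * β + 1 + K)) = (2 * (4 * β + 1 + K)) * κ i := by ring
        _ ≤ _ := by gcongr; exact le_add_self) (lt_of_le_of_lt (by
          gcongr
          exact NSet_anti (by
            calc ℓ = 1 * ℓ := (one_mul _).symm
              _ ≤ 2 ^ i * ℓ := by gcongr; exact one_le_pow₀ (by norm_num))) hN)
    have h2 : 2 * A * μ (NSet μ D β G (2 * l i) \ MSet μ (H i) (κ i)) ≤ μ (NSet μ D β G (l i)) := by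
      have hlE : (l i : ℝ≥0∞) ≠ 0 := ENNReal.coe_ne_zero.2 (hl i)
      rw [← ENNReal.mul_le_mul_iff_right hlE ENNReal.coe_ne_top]
      calc l i * (2 * A * μ (NSet μ D β G (2 * l i) \ MSet μ (H i) (κ i)))
          = 2 * A * (l i * μ (NSet μ D β G (2 * l i) \ MSet μ (H i) (κ i))) := by ring
        _ ≤ 2 * A * (4 * β * β * κ i * μ (NSet μ D β G (l i))) := by gcongr
        _ = ((8 * A * β * β * κ i : ℝ≥0) : ℝ≥0∞) * μ (NSet μ D β G (l i)) := by push_cast; ring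
        _ ≤ _ := by
          gcongr
          refine le_trans ?_ (hκl i)
          gcongr
          exact le_self_add
    have h3 : μ (NSet μ D β G (l (i + 1))) ≤
        μ (NSet μ D β G (2 * l i) \ MSet μ (H i) (κ i)) + μ (MSet μ (H i) (κ i)) := by
      rw [hls]
      refine (measure_mono ?_).trans (measure_union_le _ _)
      rw [sdiff_union_self]
      exact subset_union_left
    have e : (l (i + 1) : ℝ≥0∞) ^ Q = A * (l i : ℝ≥0∞) ^ Q := by
      rw [hls, hA, ENNReal.coe_mul, ENNReal.mul_rpow_of_nonneg _ _ hQ.le]; simp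
    calc 2 * v (i + 1) = (l i : ℝ≥0∞) ^ Q * (2 * A * μ (NSet μ D β G (l (i + 1)))) := by
          simp only [v]; rw [e]; ring
      _ ≤ (l i : ℝ≥0∞) ^ Q * (2 * A * (μ (NSet μ D β G (2 * l i) \ MSet μ (H i) (κ i)) +
          μ (MSet μ (H i) (κ i)))) := by gcongr
      _ = (l i : ℝ≥0∞) ^ Q * (2 * A * μ (NSet μ D β G (2 * l i) \ MSet μ (H i) (κ i))) +
          2 * (A * w i) := by simp only [w]; ring
      _ ≤ _ := add_le_add (mul_le_mul' le_rfl h2) le_rfl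
  have hsum := tsum_le_of_succ_le hstep
  rw [ENNReal.tsum_mul_left] at hsum
  have hv0 : v 0 = (ℓ : ℝ≥0∞) ^ Q * μ (NSet μ D β G ℓ) := by simp [v, l]
  -- The layers start at `β * ℓ`, since almost everywhere `G > β * l` implies membership in the
  -- `NSet` of level `l`.
  have hlay := lintegral_rpow_le_tsum (μ := μ) hG (a := β * ℓ) (mul_ne_zero hβ0 hℓ) hQ.le
  have hC : (((2 * β) ^ Q : ℝ≥0) : ℝ≥0∞) = (2 * β) ^ Q := by
    rw [ENNReal.coe_rpow_of_nonneg _ hQ.le]; push_cast; rfl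
  calc _ ≤ _ := hlay
    _ ≤ ∑' k, (((2 * β) ^ Q : ℝ≥0) : ℝ≥0∞) * v k := by
        refine ENNReal.tsum_le_tsum fun k => ?_
        have e1 : ((2 ^ (k + 1) * (β * ℓ) : ℝ≥0) : ℝ≥0∞) ^ Q =
            (((2 * β) ^ Q : ℝ≥0) : ℝ≥0∞) * (l k : ℝ≥0∞) ^ Q := by
          rw [hC, ← ENNReal.mul_rpow_of_nonneg _ _ hQ.le]
          congr 1
          simp only [l]; push_cast; ring
        rw [e1, mul_assoc]
        refine mul_le_mul' le_rfl (mul_le_mul' le_rfl (measure_mono_ae ?_))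
        filter_upwards [ae_le_of_notMem_NSet hlam (by linarith) hdd hG (l k)] with z hz hzG
        by_contra hzN
        refine absurd hzG (not_lt.2 ((hz hzN).trans (le_of_eq ?_)))
        simp only [l]; ring
    _ = (((2 * β) ^ Q : ℝ≥0) : ℝ≥0∞) * ∑' k, v k := ENNReal.tsum_mul_left
    _ ≤ (((2 * β) ^ Q : ℝ≥0) : ℝ≥0∞) * (2 * v 0 + 2 * (A * ∑' i, w i)) := by gcongr
    _ ≤ (((2 * β) ^ Q : ℝ≥0) : ℝ≥0∞) * ((2 + 2 * A) * v 0 + (2 + 2 * A) * ∑' i, w i) := by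
        rw [← mul_assoc 2 (A : ℝ≥0∞)]
        gcongr
        · exact le_self_add
        · exact le_add_self
    _ = _ := by rw [hv0]; push_cast; ring

end GoodLambda


/-! ### Square roots, geometric sums and the passage from RBMO to oscillation bounds. -/

lemma NNReal_edist_le {a b : ℝ≥0} {c : ℝ≥0} (h1 : a ≤ b + c) (h2 : b ≤ a + c) :
    edist a b ≤ c := by
  rw [edist_nndist, NNReal.nndist_eq]
  exact ENNReal.coe_le_coe.2 (max_le (tsub_le_iff_left.2 h1) (tsub_le_iff_left.2 h2))

/-- Subadditivity of the square root. It allows replacing `|T f|` by its root in all oscillation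
estimates. -/
lemma edist_rpow_half_le {a b c : ℝ≥0} (h1 : a ≤ b + c) (h2 : b ≤ a + c) :
    edist (a ^ (1 / 2 : ℝ)) (b ^ (1 / 2 : ℝ)) ≤ ((c ^ (1 / 2 : ℝ) : ℝ≥0) : ℝ≥0∞) := by
  have key : ∀ {a b c : ℝ≥0}, a ≤ b + c →
      a ^ (1 / 2 : ℝ) ≤ b ^ (1 / 2 : ℝ) + c ^ (1 / 2 : ℝ) := fun h =>
    (NNReal.rpow_le_rpow h (by norm_num)).trans
      (NNReal.rpow_add_le_add_rpow _ _ (by norm_num) (by norm_num))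
  exact NNReal_edist_le (key h1) (key h2)

lemma ENNReal_tsum_rpow_le {ι : Type*} (x : ι → ℝ≥0∞) {P : ℝ} (hP : 1 ≤ P) :
    ∑' i, x i ^ P ≤ (∑' i, x i) ^ P := by
  set S := ∑' i, x i
  have e : ∀ y : ℝ≥0∞, y ^ P = y ^ (P - 1) * y := fun y => by
    conv_lhs => rw [show P = (P - 1) + 1 by ring]
    rw [ENNReal.rpow_add_of_nonneg _ _ (by linarith) zero_le_one, ENNReal.rpow_one]
  calc ∑' i, x i ^ P ≤ ∑' i, S ^ (P - 1) * x i := by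
        refine ENNReal.tsum_le_tsum fun i => ?_
        rw [e]
        gcongr
        exact ENNReal.le_tsum i
    _ = S ^ P := by rw [ENNReal.tsum_mul_left, e S]

/-- The terms grow by the ratio `1 + e`, so `e` times a partial sum is at most the next term, and
that is at most `(1 + e) Y`. -/
lemma tsum_geometric_truncated_le (a e Y : ℝ≥0∞) :
    (∑' i : ℕ, if (1 + e) ^ i * a < Y then (1 + e) ^ i * a else 0) * e ≤ (1 + e) * Y := by
  set b : ℕ → ℝ≥0∞ := fun i => if (1 + e) ^ i * a < Y then (1 + e) ^ i * a else 0
  have key : ∀ n, (∑ i ∈ Finset.range n, b i) * e ≤ (1 + e) ^ n * a ∧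
      (∑ i ∈ Finset.range n, b i) * e ≤ (1 + e) * Y := by
    intro n
    induction n with
    | zero => simp
    | succ n ih =>
      rw [Finset.sum_range_succ, add_mul]
      by_cases h : (1 + e) ^ n * a < Y
      · have hb : b n = (1 + e) ^ n * a := if_pos h
        have h1 : (∑ i ∈ Finset.range n, b i) * e + b n * e ≤ (1 + e) ^ (n + 1) * a := by
          rw [hb]
          calc _ ≤ (1 + e) ^ n * a + (1 + e) ^ n * a * e := add_le_add ih.1 le_rfl
            _ = _ := by ring
        refine ⟨h1, h1.trans ?_⟩
        calc (1 + e) ^ (n + 1) * a = (1 + e) * ((1 + e) ^ n * a) := by ring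
          _ ≤ _ := by gcongr
      · have hb : b n = 0 := if_neg h
        rw [hb, zero_mul, add_zero]
        refine ⟨ih.1.trans ?_, ih.2⟩
        gcongr
        · exact le_self_add
        · omega
  rw [ENNReal.tsum_eq_iSup_nat, ENNReal.iSup_mul]
  exact iSup_le fun n => (key n).2

section Sums

variable {X : Type*} [MeasurableSpace X] {μ : Measure X}

/-- After exchanging sum and integral, only the heights below `|f z|` contribute at `z`. They form a
truncated geometric series dominated by its largest term. -/
lemma tsum_rpow_mul_setLIntegral_le {p₁ p : ℝ} (hp₁ : 0 ≤ p₁) (hp : p₁ < p) {t : ℕ → ℝ≥0}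
    {a e : ℝ≥0∞} (ht : ∀ i, (t i : ℝ≥0∞) ^ (p - p₁) = (1 + e) ^ i * a) {f : X → ℂ}
    (hf : Measurable f) :
    (∑' i, (t i : ℝ≥0∞) ^ (p - p₁) * ∫⁻ z in {z | (t i : ℝ≥0∞) < ‖f z‖ₑ}, ‖f z‖ₑ ^ p₁ ∂μ) * e ≤
      (1 + e) * ∫⁻ z, ‖f z‖ₑ ^ p ∂μ := by
  have hm : ∀ i, MeasurableSet {z | (t i : ℝ≥0∞) < ‖f z‖ₑ} := fun i =>
    measurableSet_lt measurable_const hf.enorm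
  set w : ℕ → X → ℝ≥0∞ := fun i => {z | (t i : ℝ≥0∞) < ‖f z‖ₑ}.indicator
    fun z => (t i : ℝ≥0∞) ^ (p - p₁) * ‖f z‖ₑ ^ p₁
  have hw : ∀ i, Measurable (w i) := fun i =>
    ((hf.enorm.pow_const p₁).const_mul _).indicator (hm i)
  have e1 : ∀ i, (t i : ℝ≥0∞) ^ (p - p₁) * ∫⁻ z in {z | (t i : ℝ≥0∞) < ‖f z‖ₑ}, ‖f z‖ₑ ^ p₁ ∂μ =
      ∫⁻ z, w i z ∂μ := by
    intro i
    rw [lintegral_indicator (hm i), lintegral_const_mul _ (hf.enorm.pow_const p₁)]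
  simp only [e1]
  rw [← lintegral_tsum fun i => (hw i).aemeasurable, ← lintegral_mul_const _ (Measurable.tsum hw),
    ← lintegral_const_mul _ (hf.enorm.pow_const p)]
  refine lintegral_mono fun z => ?_
  have hpz : ‖f z‖ₑ ^ p = ‖f z‖ₑ ^ (p - p₁) * ‖f z‖ₑ ^ p₁ := by
    rw [← ENNReal.rpow_add_of_nonneg _ _ (by linarith) hp₁]; congr 1; ring
  have e2 : ∀ i, w i z ≤ (if (1 + e) ^ i * a < ‖f z‖ₑ ^ (p - p₁) then (1 + e) ^ i * a else 0) *
      ‖f z‖ₑ ^ p₁ := by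
    intro i
    by_cases hz : (t i : ℝ≥0∞) < ‖f z‖ₑ
    · have h1 := ENNReal.rpow_lt_rpow hz (sub_pos.2 hp)
      rw [ht] at h1
      simp only [w]
      rw [indicator_of_mem (show z ∈ {z | (t i : ℝ≥0∞) < ‖f z‖ₑ} from hz), if_pos h1, ht]
    · simp only [w]
      rw [indicator_of_notMem (show z ∉ {z | (t i : ℝ≥0∞) < ‖f z‖ₑ} from hz)]
      exact bot_le
  calc (∑' i, w i z) * e ≤ (∑' i, (if (1 + e) ^ i * a < ‖f z‖ₑ ^ (p - p₁) then (1 + e) ^ i * a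
        else 0) * ‖f z‖ₑ ^ p₁) * e := by gcongr with i; exact e2 i
    _ = ((∑' i, if (1 + e) ^ i * a < ‖f z‖ₑ ^ (p - p₁) then (1 + e) ^ i * a else 0) * e) *
        ‖f z‖ₑ ^ p₁ := by rw [ENNReal.tsum_mul_right]; ring
    _ ≤ ((1 + e) * ‖f z‖ₑ ^ (p - p₁)) * ‖f z‖ₑ ^ p₁ := by
        exact mul_le_mul' (tsum_geometric_truncated_le _ _ _) le_rfl
    _ = _ := by rw [hpz, mul_assoc]

/-- A bounded function in `L^p` belongs to `L^{p₀}` for `p < p₀ ≤ ∞`. -/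
lemma eLpNorm_le_of_bounded {p : ℝ} (hp : 0 < p) {p₀ : ℝ≥0∞} (hp₀ : ENNReal.ofReal p ≤ p₀)
    {g : X → ℂ} {M A : ℝ≥0} (hM : ∀ᵐ z ∂μ, ‖g z‖ₑ ≤ M) (hA : ∫⁻ z, ‖g z‖ₑ ^ p ∂μ ≤ A) :
    eLpNorm g p₀ μ ≤ (M : ℝ≥0∞) ^ (1 - p * p₀⁻¹.toReal) * (A : ℝ≥0∞) ^ p₀⁻¹.toReal := by
  rcases eq_or_ne p₀ ∞ with rfl | hp₀t
  · simp only [ENNReal.inv_top, ENNReal.toReal_zero, mul_zero, sub_zero, ENNReal.rpow_one,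
      ENNReal.rpow_zero, mul_one, eLpNorm_exponent_top]
    exact eLpNormEssSup_le_of_ae_enorm_bound hM
  have hp₀0 : p₀ ≠ 0 := by
    rintro rfl
    simp at hp₀
    linarith
  have hle : p ≤ p₀.toReal := (ENNReal.ofReal_le_iff_le_toReal hp₀t).1 hp₀
  have hpos : 0 < p₀.toReal := ENNReal.toReal_pos hp₀0 hp₀t
  rw [eLpNorm_eq_lintegral_rpow_enorm_toReal hp₀0 hp₀t, ENNReal.toReal_inv]
  have h1 : ∫⁻ z, ‖g z‖ₑ ^ p₀.toReal ∂μ ≤ (M : ℝ≥0∞) ^ (p₀.toReal - p) * A := by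
    calc _ ≤ ∫⁻ z, (M : ℝ≥0∞) ^ (p₀.toReal - p) * ‖g z‖ₑ ^ p ∂μ := by
          refine lintegral_mono_ae ?_
          filter_upwards [hM] with z hz
          calc ‖g z‖ₑ ^ p₀.toReal = ‖g z‖ₑ ^ (p₀.toReal - p) * ‖g z‖ₑ ^ p := by
                rw [← ENNReal.rpow_add_of_nonneg _ _ (by linarith) hp.le]; congr 1; ring
            _ ≤ _ := by gcongr
      _ = (M : ℝ≥0∞) ^ (p₀.toReal - p) * ∫⁻ z, ‖g z‖ₑ ^ p ∂μ := by
          refine lintegral_const_mul' _ _ ?_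
          exact ENNReal.rpow_ne_top_of_nonneg (by linarith) ENNReal.coe_ne_top
      _ ≤ _ := by gcongr
  calc _ ≤ ((M : ℝ≥0∞) ^ (p₀.toReal - p) * A) ^ (1 / p₀.toReal) :=
        ENNReal.rpow_le_rpow h1 (by positivity)
    _ = _ := by
      rw [ENNReal.mul_rpow_of_nonneg _ _ (by positivity), ← ENNReal.rpow_mul, one_div]
      congr 2
      field_simp

/-- The level `s` of the root is the level `s²` of `u`: weak `L^P` becomes weak `L^{2P}`, whose
exponent is at least `2` when `P ≥ 1`. -/
lemma rpow_mul_measure_le_weakNorm {P : ℝ} (hP : 0 < P) (u : AEFun ℂ μ) (s : ℝ≥0) :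
    (s : ℝ≥0∞) ^ (2 * P) * μ {z | s < ‖u z‖₊ ^ (1 / 2 : ℝ)} ≤ weakNorm μ P u ^ P := by
  have h1 : ((s ^ (2 : ℝ) : ℝ≥0) : ℝ≥0∞) * μ {x | ((s ^ (2 : ℝ) : ℝ≥0) : ℝ≥0∞) < ‖u x‖ₑ} ^ (1 / P) ≤
      weakNorm μ P u := le_iSup (fun t : ℝ≥0 => (t : ℝ≥0∞) * μ {x | (t : ℝ≥0∞) < ‖u x‖ₑ} ^
          (1 / P)) _
  have e : {z | s < ‖u z‖₊ ^ (1 / 2 : ℝ)} = {x | ((s ^ (2 : ℝ) : ℝ≥0) : ℝ≥0∞) < ‖u x‖ₑ} := by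
    ext z
    simp only [mem_ofPred_eq]
    rw [enorm_eq_nnnorm, ENNReal.coe_lt_coe, one_div,
      NNReal.lt_rpow_inv_iff (by norm_num : (0 : ℝ) < 2)]
  rw [e]
  refine le_trans (le_of_eq ?_) (ENNReal.rpow_le_rpow h1 hP.le)
  rw [ENNReal.mul_rpow_of_nonneg _ _ hP.le, ← ENNReal.rpow_mul, one_div_mul_cancel hP.ne',
    ENNReal.rpow_one, ENNReal.coe_rpow_of_nonneg _ (by norm_num), ← ENNReal.rpow_mul]

end Sums

/-! ### Oscillation of the square root of an RBMO function. -/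

section Osc

variable {X : Type*} [MetricSpace X] [MeasurableSpace X] {μ : Measure X} {lam : X → ℝ → ℝ}
  {ρ : ℝ}

lemma OscBound.mono {G H : X → ℝ≥0} {κ κ' : ℝ≥0} {g : X → ℝ → ℝ≥0} (h : OscBound μ lam ρ G H κ g)
    (hκ : κ ≤ κ') : OscBound μ lam ρ G H κ' g :=
  ⟨fun c r hr => (h.osc c r hr).trans (by gcongr), fun x y r R hr hR hs =>
    (h.diff x y r R hr hR hs).trans (by gcongr)⟩

/-- A function in `RBMO`, perturbed by `b`, has square root of controlled oscillation. -/
lemma exists_oscBound_of_isRBMOConst (hρ : 1 ≤ ρ) {φ : AEFun ℂ μ} {C : ℝ≥0}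
    (hφ : IsRBMOConst μ lam ρ φ C) {F b : X → ℂ}
    (h1 : ∀ᵐ z ∂μ, ‖F z‖ ≤ ‖φ z‖ + ‖b z‖) (h2 : ∀ᵐ z ∂μ, ‖φ z‖ ≤ ‖F z‖ + ‖b z‖) :
    ∃ g, OscBound μ lam ρ (fun z => ‖F z‖₊ ^ (1 / 2 : ℝ)) (fun z => ‖b z‖₊ ^ (1 / 2 : ℝ))
      (C ^ (1 / 2 : ℝ)) g := by
  obtain ⟨-, fB, hosc, hdiff⟩ := hφ
  refine ⟨fun c r => ‖fB c r‖₊ ^ (1 / 2 : ℝ), fun c r hr => ?_, fun x y r R hr hR hs => ?_⟩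
  · have hφm : Measurable fun z => φ z - fB c r :=
      φ.stronglyMeasurable.measurable.sub measurable_const
    have hpt : ∀ᵐ z ∂μ, edist (‖F z‖₊ ^ (1 / 2 : ℝ)) (‖fB c r‖₊ ^ (1 / 2 : ℝ)) ≤
        ‖φ z - fB c r‖ₑ ^ (1 / 2 : ℝ) + ((‖b z‖₊ ^ (1 / 2 : ℝ) : ℝ≥0) : ℝ≥0∞) := by
      filter_upwards [h1, h2] with z hz1 hz2
      have t1 : ‖φ z‖ ≤ ‖fB c r‖ + ‖φ z - fB c r‖ := by
        have := norm_add_le (fB c r) (φ z - fB c r)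
        rwa [add_sub_cancel] at this
      have t2 : ‖fB c r‖ ≤ ‖φ z‖ + ‖φ z - fB c r‖ := by
        have := norm_sub_le (φ z) (φ z - fB c r)
        rwa [sub_sub_cancel] at this
      have t3 : ‖F z‖₊ ≤ ‖fB c r‖₊ + (‖φ z - fB c r‖₊ + ‖b z‖₊) := by
        rw [← NNReal.coe_le_coe]; push_cast; linarith
      have t4 : ‖fB c r‖₊ ≤ ‖F z‖₊ + (‖φ z - fB c r‖₊ + ‖b z‖₊) := by
        rw [← NNReal.coe_le_coe]; push_cast; linarith
      refine (edist_rpow_half_le t3 t4).trans ?_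
      rw [enorm_eq_nnnorm, ← ENNReal.coe_rpow_of_nonneg _ (by norm_num), ← ENNReal.coe_add]
      exact ENNReal.coe_le_coe.2 (NNReal.rpow_add_le_add_rpow _ _ (by norm_num) (by norm_num))
    have hhol : ∫⁻ z in ball c r, ‖φ z - fB c r‖ₑ ^ (1 / 2 : ℝ) ∂μ ≤
        ((C ^ (1 / 2 : ℝ) : ℝ≥0) : ℝ≥0∞) * μ (ball c (ρ * r)) := by
      -- The Cauchy–Schwarz inequality passes from the mean of the root to the root of the mean.
      have h := ENNReal.lintegral_mul_le_Lp_mul_Lq (μ.restrict (ball c r))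
        (Real.HolderConjugate.two_two) (f := fun z => ‖φ z - fB c r‖ₑ ^ (1 / 2 : ℝ))
        (g := fun _ => 1) (hφm.enorm.pow_const _).aemeasurable aemeasurable_const
      simp only [Pi.mul_apply, mul_one, ← ENNReal.rpow_mul, one_div_mul_cancel
        (two_ne_zero (α := ℝ)), ENNReal.rpow_one, ENNReal.one_rpow, lintegral_one,
        Measure.restrict_apply_univ] at h
      refine h.trans ?_
      have hball : μ (ball c r) ≤ μ (ball c (ρ * r)) :=
        measure_mono (ball_subset_ball (by nlinarith))
      calc _ ≤ (C * μ (ball c (ρ * r))) ^ (1 / 2 : ℝ) * μ (ball c (ρ * r)) ^ (1 / 2 : ℝ) := by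
            gcongr
            exact hosc c r hr
        _ = (C : ℝ≥0∞) ^ (1 / 2 : ℝ) *
            (μ (ball c (ρ * r)) ^ (1 / 2 : ℝ) * μ (ball c (ρ * r)) ^ (1 / 2 : ℝ)) := by
            rw [ENNReal.mul_rpow_of_nonneg _ _ (by norm_num), mul_assoc]
        _ = _ := by
            rw [← ENNReal.rpow_add_of_nonneg _ _ (by norm_num) (by norm_num),
              ENNReal.coe_rpow_of_nonneg _ (by norm_num)]
            norm_num
    calc _ ≤ ∫⁻ z in ball c r, (‖φ z - fB c r‖ₑ ^ (1 / 2 : ℝ) +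
          ((‖b z‖₊ ^ (1 / 2 : ℝ) : ℝ≥0) : ℝ≥0∞)) ∂μ := lintegral_mono_ae (ae_restrict_of_ae hpt)
      _ = ∫⁻ z in ball c r, ‖φ z - fB c r‖ₑ ^ (1 / 2 : ℝ) ∂μ +
          ∫⁻ z in ball c r, ((‖b z‖₊ ^ (1 / 2 : ℝ) : ℝ≥0) : ℝ≥0∞) ∂μ :=
          lintegral_add_left (hφm.enorm.pow_const _) _
      _ ≤ _ := by gcongr
  · have hd := hdiff x y r R hr hR hs
    have t1 : ‖fB x r‖₊ ≤ ‖fB y R‖₊ + ‖fB x r - fB y R‖₊ := by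
      have := nnnorm_add_le (fB y R) (fB x r - fB y R)
      rwa [add_sub_cancel] at this
    have t2 : ‖fB y R‖₊ ≤ ‖fB x r‖₊ + ‖fB x r - fB y R‖₊ := by
      have := nnnorm_sub_le (fB x r) (fB x r - fB y R)
      rwa [sub_sub_cancel] at this
    refine (edist_rpow_half_le t1 t2).trans ?_
    -- The difference bound for the roots carries `K^{1/2}`, which is at most `K` because `K ≥ 1`.
    have hK : coefK μ lam x r y R ^ (1 / 2 : ℝ) ≤ coefK μ lam x r y R := by
      conv_rhs => rw [← ENNReal.rpow_one (coefK μ lam x r y R)]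
      exact ENNReal.rpow_le_rpow_of_exponent_le one_le_coefK (by norm_num)
    calc ((‖fB x r - fB y R‖₊ ^ (1 / 2 : ℝ) : ℝ≥0) : ℝ≥0∞) = ‖fB x r - fB y R‖ₑ ^ (1 / 2 : ℝ) := by
          rw [ENNReal.coe_rpow_of_nonneg _ (by norm_num), enorm_eq_nnnorm]
      _ ≤ (C * coefK μ lam x r y R) ^ (1 / 2 : ℝ) := ENNReal.rpow_le_rpow hd (by norm_num)
      _ = (C : ℝ≥0∞) ^ (1 / 2 : ℝ) * coefK μ lam x r y R ^ (1 / 2 : ℝ) :=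
          ENNReal.mul_rpow_of_nonneg _ _ (by norm_num)
      _ ≤ _ := by
          rw [ENNReal.coe_rpow_of_nonneg _ (by norm_num)]
          gcongr

end Osc


/-! ### Exponents, and the exceptional set at a single level. -/

section Level

variable {X : Type*} [MeasurableSpace X] {μ : Measure X}

/-- With `e = 1/p₀` these are the relations among `p`, `q` and `P = p₀'`. The first makes the powers
of `t` match when level and height are linked by `κ² = A t^{p/q}`. -/
lemma exponent_identity {p q P e : ℝ} (hp : 1 < p) (hq : 0 < q) (hP : 0 < P)
    (h1 : 1 / q = 1 / p - e)
    (h2 : 1 / P = 1 - e) : p / q * (q - P) = P * (p - 1) ∧ P ≤ q := by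
  have hp0 : 0 < p := by linarith
  have e1 : e = 1 / p - 1 / q := by linarith
  have h3 : 1 / P = 1 - 1 / p + 1 / q := by linarith
  constructor
  · field_simp at h3 ⊢
    linarith
  · rw [← one_div_le_one_div hq hP, h3]
    have : 1 / p ≤ 1 := by rw [div_le_one hp0]; exact hp.le
    linarith

/-- Write `κ^{2q} = κ^{2(q-P)} κ^{2P}`. The first factor equals `A^{q-P} t^{P(p-1)}`; of `t^{p-1}`
the part `t^{p₁-1}` is absorbed by the bound on `w`, and `t^{p-p₁}` stays with `J`. -/
lemma rpow_mul_measure_le_of_weak {p p₁ q P : ℝ} (hp₁ : 1 < p₁) (hp : p₁ ≤ p) (hP : 1 ≤ P)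
    (hPq : P ≤ q) (hid : p / q * (q - P) = P * (p - 1)) {t A κ : ℝ≥0} (hκ : κ ^ (2 : ℝ) = A * t ^
        (p / q))
    {m w J C : ℝ≥0∞} (hm : (κ : ℝ≥0∞) ^ (2 * P) * m ≤ 2 ^ (2 * P) * (4 * w ^ P))
    (hw : (t : ℝ≥0∞) ^ (p₁ - 1) * w ≤ C * J) :
    (κ : ℝ≥0∞) ^ (2 * q) * m ≤ (A : ℝ≥0∞) ^ (q - P) * (2 ^ (2 * P) * 4 * C ^ P) *
      ((t : ℝ≥0∞) ^ (p - p₁) * J) ^ P := by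
  have hqP : 0 ≤ q - P := by linarith
  have hP0 : 0 ≤ P := by linarith
  have hpq : 0 ≤ p / q := div_nonneg (by linarith) (by linarith)
  have e1 : (κ : ℝ≥0∞) ^ (2 * q) = (A : ℝ≥0∞) ^ (q - P) * ((t : ℝ≥0∞) ^ (p - 1)) ^ P *
      (κ : ℝ≥0∞) ^ (2 * P) := by
    have h1 : (κ : ℝ≥0∞) ^ (2 * (q - P)) = (A : ℝ≥0∞) ^ (q - P) * ((t : ℝ≥0∞) ^ (p - 1)) ^ P := by
      rw [ENNReal.rpow_mul, ← ENNReal.coe_rpow_of_nonneg _ (by norm_num : (0 : ℝ) ≤ 2), hκ,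
        ENNReal.coe_mul, ENNReal.mul_rpow_of_nonneg _ _ hqP, ENNReal.coe_rpow_of_nonneg _ hpq,
        ← ENNReal.rpow_mul, hid, ← ENNReal.rpow_mul, mul_comm P]
    rw [← h1, ← ENNReal.rpow_add_of_nonneg _ _ (by linarith) (by linarith)]
    congr 1; ring
  have e2 : (t : ℝ≥0∞) ^ (p - 1) = (t : ℝ≥0∞) ^ (p - p₁) * (t : ℝ≥0∞) ^ (p₁ - 1) := by
    rw [← ENNReal.rpow_add_of_nonneg _ _ (by linarith) (by linarith)]
    congr 1; ring
  calc (κ : ℝ≥0∞) ^ (2 * q) * m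
      = (A : ℝ≥0∞) ^ (q - P) * ((t : ℝ≥0∞) ^ (p - 1)) ^ P * ((κ : ℝ≥0∞) ^ (2 * P) * m) := by
        rw [e1]; ring
    _ ≤ (A : ℝ≥0∞) ^ (q - P) * ((t : ℝ≥0∞) ^ (p - 1)) ^ P * (2 ^ (2 * P) * (4 * w ^ P)) := by
        gcongr
    _ = (A : ℝ≥0∞) ^ (q - P) * (2 ^ (2 * P) * 4) * ((t : ℝ≥0∞) ^ (p - 1) * w) ^ P := by
        rw [ENNReal.mul_rpow_of_nonneg _ _ hP0]; ring
    _ = (A : ℝ≥0∞) ^ (q - P) * (2 ^ (2 * P) * 4) *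
        ((t : ℝ≥0∞) ^ (p - p₁) * ((t : ℝ≥0∞) ^ (p₁ - 1) * w)) ^ P := by rw [e2, mul_assoc _ _ w]
    _ ≤ (A : ℝ≥0∞) ^ (q - P) * (2 ^ (2 * P) * 4) * ((t : ℝ≥0∞) ^ (p - p₁) * (C * J)) ^ P := by
        gcongr
    _ = (A : ℝ≥0∞) ^ (q - P) * (2 ^ (2 * P) * 4) * (C * ((t : ℝ≥0∞) ^ (p - p₁) * J)) ^ P := by
        congr 2; ring
    _ = _ := by rw [ENNReal.mul_rpow_of_nonneg C _ hP0]; ring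

end Level

/-! ### The main estimate for an operator satisfying the endpoint bounds. -/

variable {X : Type*} [MetricSpace X] [MeasurableSpace X] {μ : Measure X} {lam : X → ℝ → ℝ}
  {ρ σ : ℝ} {s : ℝ≥0∞} {D : ℝ} {β K : ℝ≥0} {up : X → ℝ → ℝ} {p q P : ℝ} {p₀ : ℝ≥0∞}
  {T : AEFun ℂ μ → AEFun ℂ μ}

/-- The endpoint hypotheses on the operator `T`: it maps `L^{p₀}` into `RBMO` and the Hardy space
into weak `L^P`. -/
structure EndpointBounded (μ : Measure X) (lam : X → ℝ → ℝ) (ρ σ : ℝ) (s p₀ : ℝ≥0∞) (P : ℝ)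
    (T : AEFun ℂ μ → AEFun ℂ μ) : Prop where
  sublinear_Lp : IsSublinearOn (Lp ℂ p₀ μ : Set (AEFun ℂ μ)) T
  sublinear_hardy : IsSublinearOn (hardySpace μ lam σ s) T
  rbmo : ∃ C : ℝ≥0, ∀ f ∈ Lp ℂ p₀ μ, rbmoNorm μ lam ρ (T f) ≤ C * eLpNorm f p₀ μ
  weak : ∃ C : ℝ≥0, ∀ f ∈ hardySpace μ lam σ s, weakNorm μ P (T f) ≤ C * hardyNorm μ lam σ s f

-- The reverse triangle inequality for a sublinear operator; it uses `g = f - b`, so `-b` must lie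
-- in the space as well.
omit [MetricSpace X] in
lemma IsSublinearOn.ae_comparable {S : Set (AEFun ℂ μ)} (hT : IsSublinearOn S T)
    {f g b : AEFun ℂ μ} (hg : g ∈ S) (hf : f ∈ S) (hb : b ∈ S) (hnb : (-1 : ℂ) • b ∈ S)
    (h : f = g + b) :
    (∀ᵐ z ∂μ, ‖T f z‖ ≤ ‖T g z‖ + ‖T b z‖) ∧ ∀ᵐ z ∂μ, ‖T g z‖ ≤ ‖T f z‖ + ‖T b z‖ := by
  refine ⟨h ▸ hT.1 g hg b hb, ?_⟩
  have hg' : g = f + (-1 : ℂ) • b := by rw [h, neg_one_smul]; abel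
  filter_upwards [hT.1 f hf _ hnb, hT.2 (-1) b hb] with z h1 h2
  rw [← hg', h2] at h1
  simpa using h1

variable [BorelSpace X] [Nonempty X]

lemma hardySpace_smul_mem (hσ : 1 ≤ σ) (hs : 1 ≤ s) {f : AEFun ℂ μ} (hf : f ∈ hardySpace μ lam σ s)
    (c : ℂ) : c • f ∈ hardySpace μ lam σ s := by
  have hf' : hardyNorm μ lam σ s f < ∞ := hf
  change hardyNorm μ lam σ s (c • f) < ∞
  rw [← hNorm_coe, hNorm_congr (AEEqFun.coeFn_smul c f)]
  refine (hNorm_smul_le hσ hs c f).trans_lt ?_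
  rw [hNorm_coe]
  exact ENNReal.mul_lt_top enorm_lt_top hf'

lemma hardySpace_add_mem (hσ : 1 ≤ σ) (hs : 1 ≤ s) {f g : AEFun ℂ μ}
    (hf : f ∈ hardySpace μ lam σ s) (hg : g ∈ hardySpace μ lam σ s) :
    f + g ∈ hardySpace μ lam σ s := by
  have hf' : hardyNorm μ lam σ s f < ∞ := hf
  have hg' : hardyNorm μ lam σ s g < ∞ := hg
  change hardyNorm μ lam σ s (f + g) < ∞
  rw [← hNorm_coe, hNorm_congr (AEEqFun.coeFn_add f g)]
  refine (hNorm_add_le hσ hs f g).trans_lt ?_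
  rw [hNorm_coe, hNorm_coe]
  exact ENNReal.add_lt_top.2 ⟨hf', hg'⟩

variable [SecondCountableTopology X]

/-- Decomposition of `f` at height `t`, with the resulting oscillation estimate for `T f`. -/
lemma EndpointBounded.exists_oscBound {p₁ : ℝ} (hρ : 1 ≤ ρ) (hσ : 1 ≤ σ) (hs : 1 ≤ s)
    (hp₁ : 1 < p₁) (hp : p₁ ≤ p) (hpp₀ : ENNReal.ofReal p ≤ p₀)
    (hq : 1 / q = 1 / p - p₀⁻¹.toReal) (hq0 : 0 < q)
    (hlam : IsDominatingFunction μ lam) (hD : 42 * σ ≤ D) (hdd : DoublingData μ lam D β K up)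
    (hT : EndpointBounded μ lam ρ σ s p₀ P T) :
    ∃ A C : ℝ≥0, A ≠ 0 ∧ ∀ (t : ℝ≥0) (f : AEFun ℂ μ), t ≠ 0 → f ∈ hardySpace μ lam σ s →
      ∫⁻ z, ‖f z‖ₑ ^ p ∂μ ≤ 1 → 1 < (t : ℝ≥0∞) ^ p * μ univ →
      ∃ (b : AEFun ℂ μ) (g : X → ℝ → ℝ≥0),
        OscBound μ lam ρ (fun z => ‖T f z‖₊ ^ (1 / 2 : ℝ)) (fun z => ‖T b z‖₊ ^ (1 / 2 : ℝ))
          ((A * t ^ (p / q)) ^ (1 / 2 : ℝ)) g ∧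
        (t : ℝ≥0∞) ^ (p₁ - 1) * weakNorm μ P (T b) ≤
          C * ∫⁻ z in {z | (t : ℝ≥0∞) < ‖f z‖ₑ}, ‖f z‖ₑ ^ p₁ ∂μ := by
  have hp0 : 0 < p := by linarith
  obtain ⟨C, hC⟩ := exists_good_add_bad (s := s) hσ hs hp₁ hp hlam hD hdd
  obtain ⟨Cr, hCr⟩ := hT.rbmo
  obtain ⟨Cw, hCw⟩ := hT.weak
  set e₀ := p₀⁻¹.toReal
  have he₀ : 0 ≤ e₀ := ENNReal.toReal_nonneg
  have hpq : p / q = 1 - p * e₀ := by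
    rw [div_eq_mul_one_div, hq]; field_simp
  have hpq0 : 0 < p / q := by positivity
  -- The summand `1` makes the bound for the RBMO norm strict, so that the infimum provides an
  -- admissible constant below it.
  refine ⟨Cr * (C ^ (p / q) * C ^ e₀) + 1, Cw * C, by positivity, ?_⟩
  intro t f ht hf hf1 hlt
  have htE : (t : ℝ≥0∞) ≠ 0 := ENNReal.coe_ne_zero.2 ht
  have hfm : Measurable f := f.stronglyMeasurable.measurable
  obtain ⟨g, b, hg, hb, hfgb, hgle, hgp, hbH⟩ := hC t f ht hfm
    (ne_top_of_le_ne_top ENNReal.one_ne_top hf1) (hf1.trans_lt hlt)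
  set gA : AEFun ℂ μ := AEEqFun.mk g hg.aestronglyMeasurable
  set bA : AEFun ℂ μ := AEEqFun.mk b hb.aestronglyMeasurable
  have hgA : gA =ᵐ[μ] g := AEEqFun.coeFn_mk _ _
  have hsum : f = gA + bA := by
    refine AEEqFun.ext ?_
    filter_upwards [AEEqFun.coeFn_add gA bA, hgA, AEEqFun.coeFn_mk b hb.aestronglyMeasurable] with
      z h1 h2 h3
    rw [h1, Pi.add_apply, h2, h3, hfgb z]
  have hbA : hardyNorm μ lam σ s bA = hNorm μ lam σ s b := (hNorm_mk _).symm
  have hJ := rpow_mul_setLIntegral_le (μ := μ) (t := t) (by linarith : 0 ≤ p₁) hp hfm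
  set J := ∫⁻ z in {z | (t : ℝ≥0∞) < ‖f z‖ₑ}, ‖f z‖ₑ ^ p₁ ∂μ
  have hpow0 : ∀ e : ℝ, (t : ℝ≥0∞) ^ e ≠ 0 := fun e =>
    (ENNReal.rpow_pos htE.bot_lt ENNReal.coe_ne_top).ne'
  have hJt : J ≠ ∞ := by
    intro h
    rw [h, ENNReal.mul_top (hpow0 _)] at hJ
    exact absurd (hJ.trans hf1) (by simp)
  have hbm : bA ∈ hardySpace μ lam σ s := by
    change hardyNorm μ lam σ s bA < ∞
    rw [hbA, lt_top_iff_ne_top]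
    intro h
    rw [h, ENNReal.mul_top (hpow0 _)] at hbH
    exact absurd hbH (not_le.2 (ENNReal.mul_lt_top ENNReal.coe_lt_top hJt.lt_top))
  have hnb := hardySpace_smul_mem hσ hs hbm (-1)
  -- Sublinearity is available on `H¹` and on `L^{p₀}` separately, and `f` need not lie in `L^{p₀}`.
  -- The comparison of `T f`, `T g` and `T b` takes place in `H¹`, where `g = f - b` lies; that `g`
  -- also belongs to `L^{p₀}` is used only for the RBMO bound.
  have hgm : gA ∈ hardySpace μ lam σ s := by
    have : gA = f + (-1 : ℂ) • bA := by rw [hsum, neg_one_smul]; abel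
    rw [this]
    exact hardySpace_add_mem hσ hs hf hnb
  obtain ⟨c1, c2⟩ := hT.sublinear_hardy.ae_comparable hgm hf hbm hnb hsum
  have hgL : eLpNorm gA p₀ μ ≤ ((C ^ (p / q) * C ^ e₀ : ℝ≥0) : ℝ≥0∞) * (t : ℝ≥0∞) ^ (p / q) := by
    rw [eLpNorm_congr_ae hgA]
    refine (eLpNorm_le_of_bounded (M := C * t) (A := C) hp0 hpp₀ (by exact_mod_cast hgle)
      (hgp.trans (mul_le_of_le_one_right' hf1))).trans (le_of_eq ?_)
    rw [← hpq, ENNReal.coe_mul, ENNReal.mul_rpow_of_nonneg _ _ hpq0.le, ENNReal.coe_mul,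
      ENNReal.coe_rpow_of_nonneg _ hpq0.le, ENNReal.coe_rpow_of_nonneg _ he₀]
    ring
  have htpq : (t : ℝ≥0∞) ^ (p / q) = ((t ^ (p / q) : ℝ≥0) : ℝ≥0∞) :=
    (ENNReal.coe_rpow_of_nonneg _ hpq0.le).symm
  have hgLp : gA ∈ Lp ℂ p₀ μ := by
    rw [Lp.mem_Lp_iff_eLpNorm_lt_top]
    refine hgL.trans_lt ?_
    rw [htpq]
    exact ENNReal.mul_lt_top ENNReal.coe_lt_top ENNReal.coe_lt_top
  have hrb : rbmoNorm μ lam ρ (T gA) <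
      (((Cr * (C ^ (p / q) * C ^ e₀) + 1) * t ^ (p / q) : ℝ≥0) : ℝ≥0∞) := by
    refine lt_of_le_of_lt ((hCr gA hgLp).trans (mul_le_mul' le_rfl hgL)) ?_
    rw [htpq, ← mul_assoc, ← ENNReal.coe_mul, ← ENNReal.coe_mul, ENNReal.coe_lt_coe]
    have : 0 < t ^ (p / q) := NNReal.rpow_pos ht.bot_lt
    gcongr
    exact lt_add_one _
  simp only [rbmoNorm, iInf_lt_iff] at hrb
  obtain ⟨C₁, hC₁, hC₁lt⟩ := hrb
  obtain ⟨gB, hgB⟩ := exists_oscBound_of_isRBMOConst hρ hC₁ c1 c2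
  refine ⟨bA, gB, hgB.mono (NNReal.rpow_le_rpow (ENNReal.coe_lt_coe.1 hC₁lt).le (by norm_num)), ?_⟩
  calc (t : ℝ≥0∞) ^ (p₁ - 1) * weakNorm μ P (T bA)
      ≤ (t : ℝ≥0∞) ^ (p₁ - 1) * (Cw * hNorm μ lam σ s b) := by
        gcongr
        rw [← hbA]
        exact hCw bA hbm
    _ = Cw * ((t : ℝ≥0∞) ^ (p₁ - 1) * hNorm μ lam σ s b) := by ring
    _ ≤ Cw * (C * J) := by gcongr
    _ = _ := by push_cast; ring

/-- The main estimate: the `L^q` norm of `T f` above a level is controlled by the distribution of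
`T f` at that level. -/
theorem EndpointBounded.exists_lintegral_le (hρ : 1 ≤ ρ) (hσ : 1 ≤ σ) (hs : 1 ≤ s) (hp : 1 < p)
    (hpp₀ : ENNReal.ofReal p ≤ p₀) (hq : 1 / q = 1 / p - p₀⁻¹.toReal) (hq0 : 0 < q)
    (hP : 1 / P = 1 - p₀⁻¹.toReal) (hP1 : 1 ≤ P) (hlam : IsDominatingFunction μ lam)
    (hD : 42 * σ ≤ D) (hDρ : 8 * ρ ≤ D) (hD48 : 48 ≤ D) (hdd : DoublingData μ lam D β K up)
    (hT : EndpointBounded μ lam ρ σ s p₀ P T) :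
    ∃ C c : ℝ≥0, c ≠ 0 ∧ ∀ (f : AEFun ℂ μ) (ℓ : ℝ≥0), ℓ ≠ 0 → f ∈ hardySpace μ lam σ s →
      ∫⁻ z, ‖f z‖ₑ ^ p ∂μ ≤ 1 → 1 < c * (ℓ : ℝ≥0∞) ^ (2 * q) * μ univ →
      β * μ (NSet μ D β (fun z => ‖T f z‖₊ ^ (1 / 2 : ℝ)) ℓ) < μ univ →
      ∫⁻ z in {z | β * ℓ < ‖T f z‖₊ ^ (1 / 2 : ℝ)}, ‖T f z‖ₑ ^ q ∂μ ≤
        C * ((ℓ : ℝ≥0∞) ^ (2 * q) *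
          μ (NSet μ D β (fun z => ‖T f z‖₊ ^ (1 / 2 : ℝ)) ℓ) + 1) := by
  have hp0 : 0 < p := by linarith
  have hP0 : 0 < P := by linarith
  obtain ⟨hid, hPq⟩ := exponent_identity hp hq0 hP0 hq hP
  -- Strictly above `1` for the decomposition, strictly below `p` for the geometric series over the
  -- levels.
  set p₁ := (1 + p) / 2
  have hp₁ : 1 < p₁ := by simp only [p₁]; linarith
  have hp₁p : p₁ < p := by simp only [p₁]; linarith
  obtain ⟨A, Cw, hA, hlevel⟩ := hT.exists_oscBound hρ hσ hs hp₁ hp₁p.le hpp₀ hq hq0 hlam hD hdd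
  obtain ⟨C₀, δ, hδ, hgl⟩ := exists_lintegral_rpow_le_of_oscBound hlam hdd
    (by linarith : 0 < ρ) hDρ hD48 (by positivity : 0 < 2 * q)
  -- the ratio of the geometric sum
  set γ := p - p₁
  have hγ : 0 < γ := sub_pos.2 hp₁p
  set a : ℝ := q / p
  have ha : 0 < a := by positivity
  set R : ℝ≥0 := (4 ^ a) ^ γ
  have hR : 1 < R := by
    refine NNReal.one_lt_rpow (NNReal.one_lt_rpow (by norm_num) ha) hγ
  obtain ⟨e, hRe⟩ := exists_add_of_le hR.le
  have he : e ≠ 0 := by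
    rintro rfl
    simp at hRe
    exact hR.ne' hRe
  set c1 : ℝ≥0∞ := ((1 + e : ℝ≥0) : ℝ≥0∞) / e
  have hc1 : c1 ≠ ∞ := ENNReal.div_ne_top ENNReal.coe_ne_top (by simpa using he)
  set c2 : ℝ≥0∞ := (A : ℝ≥0∞) ^ (q - P) * (2 ^ (2 * P) * 4 * (Cw : ℝ≥0∞) ^ P)
  have hc2 : c2 ≠ ∞ := by
    refine ENNReal.mul_ne_top (ENNReal.rpow_ne_top_of_nonneg (by linarith) ENNReal.coe_ne_top)
      (ENNReal.mul_ne_top (ENNReal.mul_ne_top ?_ (by norm_num)) ?_)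
    · exact ENNReal.rpow_ne_top_of_nonneg (by positivity) (by norm_num)
    · exact ENNReal.rpow_ne_top_of_nonneg hP0.le ENNReal.coe_ne_top
  set c3 : ℝ≥0∞ := ((δ⁻¹ : ℝ≥0) : ℝ≥0∞) ^ (2 * q) * (c2 * c1 ^ P)
  have hc3 : c3 ≠ ∞ := by
    refine ENNReal.mul_ne_top (ENNReal.rpow_ne_top_of_nonneg (by positivity) ENNReal.coe_ne_top)
      (ENNReal.mul_ne_top hc2 (ENNReal.rpow_ne_top_of_nonneg hP0.le hc1))
  refine ⟨C₀ * (1 + c3.toNNReal), (δ ^ (2 : ℝ) / A) ^ q, (NNReal.rpow_pos (by positivity)).ne', ?_⟩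
  intro f ℓ hℓ hf hf1 hbig hN
  set G : X → ℝ≥0 := fun z => ‖T f z‖₊ ^ (1 / 2 : ℝ)
  have hTm : ∀ h : AEFun ℂ μ, Measurable fun z => ‖T h z‖₊ ^ (1 / 2 : ℝ) := fun h =>
    (T h).stronglyMeasurable.measurable.nnnorm.pow_const _
  set κ : ℕ → ℝ≥0 := fun i => δ * (2 ^ i * ℓ)
  have hκ0 : ∀ i, κ i ≠ 0 := fun i => by positivity
  -- The height solving `κ i ^ 2 = A * t i ^ (p / q)`. Doubling the level multiplies the height by
  -- `4^{q/p}`.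
  set t : ℕ → ℝ≥0 := fun i => (κ i ^ (2 : ℝ) / A) ^ a
  have ht0 : ∀ i, t i ≠ 0 := fun i => (NNReal.rpow_pos (by have := hκ0 i; positivity)).ne'
  have htκ : ∀ i, κ i ^ (2 : ℝ) = A * t i ^ (p / q) := fun i => by
    simp only [t]
    rw [← NNReal.rpow_mul, show a * (p / q) = 1 by simp only [a]; field_simp, NNReal.rpow_one,
      mul_div_cancel₀ _ hA]
  have hκt : ∀ i, (A * t i ^ (p / q)) ^ (1 / 2 : ℝ) = κ i := fun i => by
    rw [← htκ, ← NNReal.rpow_mul]; norm_num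
  have htmono : ∀ i, t 0 ≤ t i := fun i => by
    simp only [t, κ]
    gcongr
    · norm_num
    · omega
  -- Thus the hypothesis on `ℓ` is precisely the smallness condition for decomposing `f` at the
  -- lowest height; the greater heights satisfy it a fortiori.
  have htp : ((t 0 : ℝ≥0) : ℝ≥0∞) ^ p =
      (((δ ^ (2 : ℝ) / A) ^ q : ℝ≥0) : ℝ≥0∞) * (ℓ : ℝ≥0∞) ^ (2 * q) := by
    rw [← ENNReal.coe_rpow_of_nonneg _ hp0.le, ← ENNReal.coe_rpow_of_nonneg _ (by positivity),
      ← ENNReal.coe_mul]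
    congr 1
    simp only [t, κ, pow_zero, one_mul]
    rw [← NNReal.rpow_mul, show a * p = q by simp only [a]; field_simp, NNReal.rpow_mul ℓ,
      ← NNReal.mul_rpow, NNReal.mul_rpow (x := δ)]
    congr 1
    ring
  have ht1 : ∀ i, 1 < (t i : ℝ≥0∞) ^ p * μ univ := fun i => by
    rw [← htp] at hbig
    refine hbig.trans_le ?_
    gcongr
    exact htmono i
  choose b g hosc hweak using fun i => hlevel (t i) f (ht0 i) hf hf1 (ht1 i)
  have hmain := hgl G (fun i z => ‖T (b i) z‖₊ ^ (1 / 2 : ℝ)) κ g ℓ (hTm f) hℓ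
    (fun i => by have := hosc i; rwa [hκt] at this) (fun i => le_rfl) hN
  have hGq : ∀ z, (G z : ℝ≥0∞) ^ (2 * q) = ‖T f z‖ₑ ^ q := fun z => by
    simp only [G]
    rw [ENNReal.coe_rpow_of_nonneg _ (by norm_num), ← ENNReal.rpow_mul, enorm_eq_nnnorm]
    congr 1; ring
  simp only [hGq] at hmain
  refine hmain.trans ?_
  set J : ℕ → ℝ≥0∞ := fun i => ∫⁻ z in {z | (t i : ℝ≥0∞) < ‖f z‖ₑ}, ‖f z‖ₑ ^ p₁ ∂μ
  have hterm : ∀ i, ((2 ^ i * ℓ : ℝ≥0) : ℝ≥0∞) ^ (2 * q) *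
      μ (MSet μ (fun z => ‖T (b i) z‖₊ ^ (1 / 2 : ℝ)) (κ i)) ≤
      ((δ⁻¹ : ℝ≥0) : ℝ≥0∞) ^ (2 * q) * (c2 * ((t i : ℝ≥0∞) ^ γ * J i) ^ P) := by
    intro i
    have h1 := measure_MSet_le (hTm (b i)) (by linarith : 2 ≤ 2 * P)
      (fun s => rpow_mul_measure_le_weakNorm hP0 (T (b i)) s) (hκ0 i)
    have h2 := rpow_mul_measure_le_of_weak hp₁ hp₁p.le hP1 hPq hid (htκ i) h1 (hweak i)
    have e1 : ((2 ^ i * ℓ : ℝ≥0) : ℝ≥0∞) = ((δ⁻¹ : ℝ≥0) : ℝ≥0∞) * κ i := by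
      rw [← ENNReal.coe_mul]
      congr 1
      simp only [κ]
      rw [← mul_assoc, inv_mul_cancel₀ hδ, one_mul]
    rw [e1, ENNReal.mul_rpow_of_nonneg _ _ (by positivity), mul_assoc]
    exact mul_le_mul' le_rfl h2
  have hgeom : ∑' i, (t i : ℝ≥0∞) ^ γ * J i ≤ c1 := by
    have h1 := tsum_rpow_mul_setLIntegral_le (μ := μ) (p₁ := p₁) (p := p) (t := t)
      (a := (t 0 : ℝ≥0∞) ^ γ) (e := e) (by linarith) hp₁p (fun i => by
        have e1 : t i = (4 ^ a) ^ i * t 0 := by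
          simp only [t, κ]
          rw [← NNReal.rpow_natCast (4 ^ a), ← NNReal.rpow_mul, mul_comm a, NNReal.rpow_mul,
            ← NNReal.mul_rpow, NNReal.rpow_natCast]
          congr 1
          rw [mul_div_assoc']
          congr 1
          have h2 : ((2 : ℝ≥0) ^ i) ^ 2 = 4 ^ i := by
            rw [← pow_mul, mul_comm, pow_mul]; norm_num
          simp only [NNReal.rpow_ofNat, pow_zero, one_mul]
          rw [← h2]
          ring
        rw [e1, ← ENNReal.coe_rpow_of_nonneg _ hγ.le, ← ENNReal.coe_rpow_of_nonneg _ hγ.le,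
          NNReal.mul_rpow, ENNReal.coe_mul]
        congr 1
        rw [← NNReal.rpow_natCast, ← NNReal.rpow_mul, mul_comm (i : ℝ), NNReal.rpow_mul,
          NNReal.rpow_natCast]
        change ((R ^ i : ℝ≥0) : ℝ≥0∞) = _
        rw [hRe]
        push_cast
        rfl) (f := f) f.stronglyMeasurable.measurable
    rw [ENNReal.le_div_iff_mul_le (Or.inl (by simpa using he)) (Or.inl ENNReal.coe_ne_top)]
    refine h1.trans ?_
    push_cast
    exact mul_le_of_le_one_right' hf1
  have hsum : ∑' i, ((2 ^ i * ℓ : ℝ≥0) : ℝ≥0∞) ^ (2 * q) *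
      μ (MSet μ (fun z => ‖T (b i) z‖₊ ^ (1 / 2 : ℝ)) (κ i)) ≤ c3 := by
    refine (ENNReal.tsum_le_tsum hterm).trans ?_
    rw [ENNReal.tsum_mul_left, ENNReal.tsum_mul_left]
    refine mul_le_mul' le_rfl (mul_le_mul' le_rfl ?_)
    -- Since `P ≥ 1`, the sum of the `P`-th powers is at most the `P`-th power of the sum.
    exact (ENNReal_tsum_rpow_le _ hP1).trans (ENNReal.rpow_le_rpow hgeom hP0.le)
  calc _ ≤ C₀ * ((ℓ : ℝ≥0∞) ^ (2 * q) * μ (NSet μ D β G ℓ) + c3) := by gcongr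
    _ ≤ C₀ * ((1 + c3) * ((ℓ : ℝ≥0∞) ^ (2 * q) * μ (NSet μ D β G ℓ)) + (1 + c3) * 1) := by
        refine mul_le_mul' le_rfl (add_le_add (le_mul_of_one_le_left' le_self_add) ?_)
        rw [mul_one]; exact le_add_self
    _ = _ := by
        push_cast
        rw [ENNReal.coe_toNNReal hc3]
        ring


/-! ### Finite measure: mean zero functions in `L^p` belong to `H¹`. -/

section FiniteMeasure

variable {X : Type*} [MetricSpace X] [MeasurableSpace X] {μ : Measure X} {lam : X → ℝ → ℝ}
  {ρ σ : ℝ} {s : ℝ≥0∞} {D : ℝ} {β K : ℝ≥0} {up : X → ℝ → ℝ} {p : ℝ}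
  [BorelSpace X] [Nonempty X]

-- When `μ` is finite, the coefficients of balls about `x` with radii bounded below are uniformly
-- bounded, so masses can be carried to one fixed ball from any distance.
omit [BorelSpace X] [Nonempty X] in
lemma IsDominatingFunction.coefK_le_of_le [OpensMeasurableSpace X]
    (hlam : IsDominatingFunction μ lam)
    {x : X} {r r₀ R : ℝ} (hr₀ : 0 < r₀) (hr : r₀ ≤ r) :
    coefK μ lam x r x R ≤ 1 + ENNReal.ofReal (1 / lam x r₀) * μ univ := by
  refine (coefK_le_one_add_gap (R' := 2 * R) le_rfl).trans (add_le_add le_rfl ?_)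
  refine (gap_mono hr le_rfl).trans ((hlam.gap_le_mul hr₀).trans ?_)
  gcongr
  exact subset_univ _

/-- On a space of finite measure, the mean zero functions in `L^p` belong to the Hardy space. -/
theorem exists_hNorm_le_of_integral_eq_zero [SecondCountableTopology X] (hσ : 1 ≤ σ) (hs : 1 ≤ s)
    (hp : 1 < p) (hlam : IsDominatingFunction μ lam) (hD : 42 * σ ≤ D)
    (hdd : DoublingData μ lam D β K up) (h0 : μ univ ≠ 0) (hfin : μ univ ≠ ∞) :
    ∃ C : ℝ≥0, ∀ f : X → ℂ, Measurable f → ∫⁻ z, ‖f z‖ₑ ^ p ∂μ ≠ ∞ → ∫ z, f z ∂μ = 0 →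
      hNorm μ lam σ s f ≤ C * (∫⁻ z, ‖f z‖ₑ ^ p ∂μ) ^ (1 / p) := by
  have hp0 : 0 < p := by linarith
  have hexp : 0 ≤ 1 - 1 / p := by rw [sub_nonneg, div_le_one hp0]; exact hp.le
  obtain ⟨C, hC⟩ := exists_hNorm_recenter_le (s := s) hσ hs hp hlam hD hdd
  obtain ⟨x₀⟩ := ‹Nonempty X›
  have : Nonempty X := ⟨x₀⟩
  obtain ⟨r₀, hr₀, hμr₀⟩ := exists_lt_measure_ball x₀ h0.bot_lt
  have hball : ∀ r, r₀ ≤ r → μ (ball x₀ r) ≠ 0 := fun r hr =>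
    (hμr₀.trans_le (measure_mono (ball_subset_ball hr))).ne'
  set k : ℝ≥0∞ := 1 + ENNReal.ofReal (1 / lam x₀ r₀) * μ univ
  have hk : k ≠ ∞ := ENNReal.add_ne_top.2 ⟨by simp, ENNReal.mul_ne_top ENNReal.ofReal_ne_top hfin⟩
  set Y := μ univ ^ (1 - 1 / p)
  have hY : Y ≠ ∞ := ENNReal.rpow_ne_top_of_nonneg hexp hfin
  have hup : ∀ r, r₀ ≤ r → r₀ ≤ up x₀ r := fun r hr => by
    have h1 := hdd.le_up x₀ r (hr₀.trans_le hr) (hball r hr)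
    nlinarith
  have hdbl : ∀ r, r₀ ≤ r → μ (ball x₀ (σ * up x₀ r)) ≤ β * μ (ball x₀ (up x₀ r)) := fun r hr => by
    have h1 := hup r hr
    exact (measure_mono (ball_subset_ball (by nlinarith))).trans
      (hdd.doubling_up x₀ r (hr₀.trans_le hr) (hball r hr))
  refine ⟨((C + β * (k + k)) * Y * 3).toNNReal, ?_⟩
  intro f hf hI hint
  rw [ENNReal.coe_toNNReal (by finiteness)]
  set I := ∫⁻ z, ‖f z‖ₑ ^ p ∂μ
  have hfi : Integrable f μ := by
    refine ⟨hf.aestronglyMeasurable, ?_⟩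
    have h1 := setLIntegral_enorm_le_rpow hp (μ := μ) hf.aestronglyMeasurable univ
    rw [setLIntegral_univ, setLIntegral_univ] at h1
    exact h1.trans_lt (ENNReal.mul_lt_top (ENNReal.rpow_lt_top_of_nonneg
        (by positivity) hI) hY.lt_top)
  by_cases hI0 : I = 0
  · rw [hNorm_congr (ae_eq_zero_of_lintegral_rpow hp0 hf hI0)]
    exact (hNorm_zero hσ hs).le.trans bot_le
  set ν := μ.withDensity fun z => ‖f z‖ₑ ^ p
  have hν : ∀ E, MeasurableSet E → ν E = ∫⁻ z in E, ‖f z‖ₑ ^ p ∂μ := fun E hE =>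
    withDensity_apply _ hE
  set U : ℕ → Set X := fun n => (ball x₀ (r₀ + n))ᶜ
  have hU : ∀ n, MeasurableSet (U n) := fun n => measurableSet_ball.compl
  -- The pieces are bounded sets with rapidly decreasing mass, which again makes the `L^p` norms of
  -- the pieces of `f` summable.
  obtain ⟨E, hEm, hEd, hEU, hEb, hEle⟩ := exists_partition_measure_le (ν := ν) (T := U)
    (ε := fun n => (2⁻¹ ^ n) ^ p * I) hU
    (fun m n h => compl_subset_compl.2 (ball_subset_ball (by gcongr)))
    (by
      refine eq_empty_of_forall_notMem fun z hz => ?_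
      obtain ⟨n, hn⟩ := exists_nat_gt (dist z x₀)
      refine mem_iInter.1 hz n ?_
      rw [mem_ball]; linarith)
    (by
      rw [hν _ (hU 0)]
      exact ne_top_of_le_ne_top hI (setLIntegral_le_lintegral _ _))
    (fun n => ENNReal.mul_pos (ENNReal.rpow_pos (by simp [ENNReal.pow_pos]) (by simp)).ne' hI0)
  choose m hm using hEb
  set a : ℕ → X → ℂ := fun n => (E n).indicator f
  set R : ℕ → ℝ := fun n => r₀ + m n
  have hR : ∀ n, r₀ ≤ R n := fun n => by simp [R]
  have ham : ∀ n, Measurable (a n) := fun n => hf.indicator (hEm n)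
  have hasupp : ∀ n z, z ∉ ball x₀ (R n) → a n z = 0 := fun n z hz =>
    indicator_of_notMem (fun h => Set.disjoint_left.1 (hm n) h hz) _
  have haI : ∀ n, ∫⁻ z, ‖a n z‖ₑ ^ p ∂μ = ν (E n) := fun n => by
    rw [hν _ (hEm n), ← lintegral_enorm_rpow_indicator hp0 (hEm n)]
  have hνI : ∀ n, ν (E n) ≤ I := fun n => by
    rw [hν _ (hEm n)]; exact setLIntegral_le_lintegral _ _
  have hsize : ∀ n, ballSize μ p σ x₀ (R n) (a n) ≤ ν (E n) ^ (1 / p) * Y := fun n => by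
    rw [ballSize, haI]
    exact mul_le_mul' le_rfl (ENNReal.rpow_le_rpow (measure_mono (subset_univ _)) hexp)
  have hmass : ∀ n, ‖∫ z, a n z ∂μ‖ₑ ≤ ν (E n) ^ (1 / p) * Y := fun n =>
    (enorm_integral_le_lintegral_enorm _).trans ((lintegral_enorm_le_ballSize hσ hp
      (hr₀.trans_le (hR n)) (ham n) (hasupp n)).trans (hsize n))
  have hpiece : ∀ n, hNorm μ lam σ s (fun z => a n z - (∫ w, a n w ∂μ) * ballAvg μ x₀
      (up x₀ r₀) z) ≤
      (C + β * (k + k)) * Y * ν (E n) ^ (1 / p) := by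
    intro n
    -- Each piece is recentred on its own ball, and its mass is then moved to the fixed ball of
    -- radius `up x₀ r₀`.
    have e : (fun z => a n z - (∫ w, a n w ∂μ) * ballAvg μ x₀ (up x₀ r₀) z) = fun z =>
        recenter μ up x₀ (R n) (a n) z + ((∫ w, a n w ∂μ) * ballAvg μ x₀ (up x₀ (R n)) z -
          (∫ w, a n w ∂μ) * ballAvg μ x₀ (up x₀ r₀) z) := by
      funext z; simp only [recenter]; ring
    rw [e]
    have hu1 := hup (R n) (hR n)
    have hu2 := hup r₀ le_rfl
    have h1 := hC x₀ (R n) (a n) (hr₀.trans_le (hR n)) (ham n) (hasupp n)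
      (by rw [haI]; exact ne_top_of_le_ne_top hI (hνI n))
    have h2 := hNorm_ballAvg_sub_ballAvg_le (s := s) (K₁ := k.toNNReal)
        (K₂ := k.toNNReal) hσ hs hlam
      (∫ w, a n w ∂μ) (hr₀.trans_le hu1) (hr₀.trans_le hu2) (y := x₀)
      (R := max (up x₀ (R n)) (up x₀ r₀)) (lt_max_of_lt_right (hr₀.trans_le hu2))
      (ball_subset_ball (le_max_left _ _)) (ball_subset_ball (le_max_right _ _))
      (hball _ hu1) (hball _ hu2) (hdbl _ (hR n)) (hdbl _ le_rfl)
      (by rw [ENNReal.coe_toNNReal hk]; exact hlam.coefK_le_of_le hr₀ hu1)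
      (by rw [ENNReal.coe_toNNReal hk]; exact hlam.coefK_le_of_le hr₀ hu2)
    rw [ENNReal.coe_toNNReal hk] at h2
    calc _ ≤ C * (ν (E n) ^ (1 / p) * Y) + ν (E n) ^ (1 / p) * Y * β * (k + k) :=
          (hNorm_add_le hσ hs _ _).trans (add_le_add (h1.trans (mul_le_mul' le_rfl (hsize n)))
            (h2.trans (mul_le_mul' (mul_le_mul' (hmass n) le_rfl) le_rfl)))
      _ = _ := by ring
  have hsumz : ∀ z, HasSum (fun n => a n z - (∫ w, a n w ∂μ) * ballAvg μ x₀ (up x₀ r₀) z)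
      (f z) := by
    intro z
    have h1 := hasSum_indicator_of_disjoint hEd f z
    have h2 := hasSum_integral_iUnion hEm hEd hfi.integrableOn
    rw [hEU] at h1 h2
    rw [indicator_univ] at h1
    -- The masses deposited on the fixed ball add up to the integral of `f`, which is zero.
    rw [setIntegral_univ, hint] at h2
    have h3 := h1.sub (h2.mul_right (ballAvg μ x₀ (up x₀ r₀) z))
    simp only [zero_mul, sub_zero] at h3
    simp only [a, integral_indicator (hEm _)]
    exact h3
  calc hNorm μ lam σ s f ≤ ∑' n, (C + β * (k + k)) * Y * ν (E n) ^ (1 / p) :=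
        (hNorm_le_tsum hσ hs hf.aestronglyMeasurable (Eventually.of_forall hsumz)).trans
          (ENNReal.tsum_le_tsum hpiece)
    _ = (C + β * (k + k)) * Y * ∑' n, ν (E n) ^ (1 / p) := ENNReal.tsum_mul_left
    _ ≤ (C + β * (k + k)) * Y * (3 * I ^ (1 / p)) := by
        gcongr
        exact tsum_rpow_one_div_le hp0 (hνI 0) hEle
    _ = _ := by ring

end FiniteMeasure


/-! ### Choice of the lowest level, for infinite and for finite measure. -/

lemma exists_lt_rpow_mul {w m : ℝ≥0∞} (hw : w ≠ ∞) (hm : m ≠ 0) {Q : ℝ} (hQ : 0 < Q) (a : ℝ≥0) :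
    ∃ ℓ : ℝ≥0, ℓ ≠ 0 ∧ a ≤ ℓ ∧ w < (ℓ : ℝ≥0∞) ^ Q * m := by
  set b : ℝ≥0 := (w / m).toNNReal + 1
  have hwm : w / m ≠ ∞ := ENNReal.div_ne_top hw hm
  refine ⟨max a (b ^ Q⁻¹), (lt_max_of_lt_right (NNReal.rpow_pos (by positivity))).ne',
    le_max_left _ _, ?_⟩
  rw [← ENNReal.coe_rpow_of_nonneg _ hQ.le, ← ENNReal.div_lt_iff (Or.inl hm)
    (Or.inr hw)]
  have h1 : b ≤ max a (b ^ Q⁻¹) ^ Q := by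
    calc b = (b ^ Q⁻¹) ^ Q := by rw [← NNReal.rpow_mul, inv_mul_cancel₀ hQ.ne', NNReal.rpow_one]
      _ ≤ _ := by gcongr; exact le_max_right _ _
  refine lt_of_lt_of_le ?_ (ENNReal.coe_le_coe.2 h1)
  rw [← ENNReal.coe_toNNReal hwm, ENNReal.coe_lt_coe]
  exact lt_add_one _

lemma mul_lt_of_rpow_mul_le {ℓ β : ℝ≥0} {Q : ℝ} {n w m : ℝ≥0∞} (h : (ℓ : ℝ≥0∞) ^ Q * n ≤ w)
    (hw : β * w < (ℓ : ℝ≥0∞) ^ Q * m) : β * n < m := by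
  refine lt_of_mul_lt_mul_left (lt_of_le_of_lt ?_ hw) (zero_le (a := (ℓ : ℝ≥0∞) ^ Q))
  calc (ℓ : ℝ≥0∞) ^ Q * (β * n) = β * ((ℓ : ℝ≥0∞) ^ Q * n) := by ring
    _ ≤ β * w := by gcongr

section Weak

variable {X : Type*} [MeasurableSpace X] {μ : Measure X}

lemma nnnorm_rpow_half_rpow (w : ℂ) (q : ℝ) :
    ((‖w‖₊ ^ (1 / 2 : ℝ) : ℝ≥0) : ℝ≥0∞) ^ (2 * q) = ‖w‖ₑ ^ q := by
  rw [ENNReal.coe_rpow_of_nonneg _ (by norm_num), ← ENNReal.rpow_mul, enorm_eq_nnnorm]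
  congr 1; ring

/-- Splitting the integral of a power at a level of the square root. -/
lemma lintegral_rpow_le_add {F : X → ℂ} (hF : Measurable F) {q : ℝ} (hq : 0 < q) (a : ℝ≥0) :
    ∫⁻ z, ‖F z‖ₑ ^ q ∂μ ≤ ∫⁻ z in {z | a < ‖F z‖₊ ^ (1 / 2 : ℝ)}, ‖F z‖ₑ ^ q ∂μ +
      (a : ℝ≥0∞) ^ (2 * q) * μ univ := by
  have hm : MeasurableSet {z | a < ‖F z‖₊ ^ (1 / 2 : ℝ)} :=
    measurableSet_lt measurable_const (hF.nnnorm.pow_const _)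
  rw [← lintegral_add_compl _ hm]
  gcongr
  calc _ ≤ ∫⁻ z in {z | a < ‖F z‖₊ ^ (1 / 2 : ℝ)}ᶜ, (a : ℝ≥0∞) ^ (2 * q) ∂μ := by
        refine setLIntegral_mono' hm.compl fun z hz => ?_
        rw [← nnnorm_rpow_half_rpow]
        refine ENNReal.rpow_le_rpow (ENNReal.coe_le_coe.2 ?_) (by positivity)
        simpa using hz
    _ ≤ _ := by
        rw [setLIntegral_const]
        gcongr
        exact subset_univ _

end Weak

variable {X : Type*} [MetricSpace X] [MeasurableSpace X] {μ : Measure X} {lam : X → ℝ → ℝ}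
  {ρ σ : ℝ} {s : ℝ≥0∞} {D : ℝ} {β K : ℝ≥0} {up : X → ℝ → ℝ} {p q P : ℝ} {p₀ : ℝ≥0∞}
  {T : AEFun ℂ μ → AEFun ℂ μ} [BorelSpace X] [Nonempty X]

omit [BorelSpace X] in
/-- On a space of finite measure, functions in `RBMO` are integrable. -/
lemma IsRBMOConst.lintegral_ne_top [OpensMeasurableSpace X] (hlam : IsDominatingFunction μ lam)
    (hfin : μ univ ≠ ∞)
    {φ : AEFun ℂ μ} {C : ℝ≥0} (hφ : IsRBMOConst μ lam ρ φ C) : ∫⁻ z, ‖φ z‖ₑ ∂μ ≠ ∞ := by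
  obtain ⟨-, fB, hosc, hdiff⟩ := hφ
  obtain ⟨x₀⟩ := ‹Nonempty X›
  set k : ℝ≥0∞ := 1 + ENNReal.ofReal (1 / lam x₀ 1) * μ univ
  have hk : k ≠ ∞ := ENNReal.add_ne_top.2 ⟨by simp, ENNReal.mul_ne_top ENNReal.ofReal_ne_top hfin⟩
  -- The numbers `fB x₀ (1 + n)` stay within `C k` of `fB x₀ 1`, so the bound is uniform in `n`.
  have hbd : ∀ n : ℕ, ∫⁻ z in ball x₀ (1 + n), ‖φ z‖ₑ ∂μ ≤
      C * μ univ + (‖fB x₀ 1‖ₑ + C * k) * μ univ := by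
    intro n
    have h1 : (1 : ℝ) ≤ 1 + n := by simp
    have h2 := hosc x₀ (1 + n) (by linarith)
    have h3 := hdiff x₀ x₀ 1 (1 + n) one_pos (by linarith) (ball_subset_ball h1)
    have h3' : ‖fB x₀ 1 - fB x₀ (1 + n)‖ₑ ≤ C * k := by
      refine h3.trans (mul_le_mul' le_rfl ?_)
      refine (coefK_le_one_add_gap (R' := 2 * (1 + n)) le_rfl).trans (add_le_add le_rfl ?_)
      refine (hlam.gap_le_mul one_pos).trans ?_
      gcongr
      exact subset_univ _
    have h4 : ‖fB x₀ (1 + n)‖ₑ ≤ ‖fB x₀ 1‖ₑ + C * k := by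
      have h5 := enorm_sub_le (a := fB x₀ 1) (b := fB x₀ 1 - fB x₀ (1 + n))
      rw [sub_sub_cancel] at h5
      exact h5.trans (add_le_add le_rfl h3')
    calc ∫⁻ z in ball x₀ (1 + n), ‖φ z‖ₑ ∂μ
        ≤ ∫⁻ z in ball x₀ (1 + n), (‖φ z - fB x₀ (1 + n)‖ₑ + ‖fB x₀ (1 + n)‖ₑ) ∂μ := by
          refine lintegral_mono fun z => ?_
          have h5 := enorm_add_le (φ z - fB x₀ (1 + n)) (fB x₀ (1 + n))
          rwa [sub_add_cancel] at h5
      _ = ∫⁻ z in ball x₀ (1 + n), ‖φ z - fB x₀ (1 + n)‖ₑ ∂μ +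
          ‖fB x₀ (1 + n)‖ₑ * μ (ball x₀ (1 + n)) := by
          rw [lintegral_add_right _ measurable_const, setLIntegral_const]
      _ ≤ _ := by
          refine add_le_add (h2.trans (mul_le_mul' le_rfl (measure_mono (subset_univ _))))
            (mul_le_mul' h4 (measure_mono (subset_univ _)))
  have hU : ⋃ n : ℕ, ball x₀ (1 + n : ℝ) = univ := by
    refine eq_univ_of_forall fun z => ?_
    obtain ⟨n, hn⟩ := exists_nat_gt (dist z x₀)
    exact mem_iUnion.2 ⟨n, by rw [mem_ball]; linarith⟩
  rw [← setLIntegral_univ, ← hU, setLIntegral_iUnion_of_directed _ (Monotone.directed_le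
    fun m n h => ball_subset_ball (by gcongr))]
  refine ne_top_of_le_ne_top ?_ (iSup_le hbd)
  finiteness

variable [SecondCountableTopology X]

/-- On a space of finite measure, `RBMO ⊆ L^q` for all finite `q`. -/
theorem IsRBMOConst.lintegral_rpow_ne_top (hρ : 1 ≤ ρ) (hlam : IsDominatingFunction μ lam)
    (hDρ : 8 * ρ ≤ D) (hD : 48 ≤ D) (hdd : DoublingData μ lam D β K up) (hfin : μ univ ≠ ∞)
    (h0 : μ univ ≠ 0) (hq : 0 < q) {φ : AEFun ℂ μ} {C : ℝ≥0} (hφ : IsRBMOConst μ lam ρ φ C) :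
    ∫⁻ z, ‖φ z‖ₑ ^ q ∂μ ≠ ∞ := by
  obtain ⟨C₀, δ, hδ, hgl⟩ := exists_lintegral_rpow_le_of_oscBound hlam hdd
    (by linarith : 0 < ρ) hDρ hD (by positivity : 0 < 2 * q)
  -- The good-λ machinery is used without perturbation: `H = 0`, so the exceptional sets are empty.
  obtain ⟨g, hg⟩ := exists_oscBound_of_isRBMOConst (F := φ) (b := fun _ => 0) hρ hφ
    (Eventually.of_forall fun z => by simp) (Eventually.of_forall fun z => by simp)
  have hφm : Measurable φ := φ.stronglyMeasurable.measurable
  set G : X → ℝ≥0 := fun z => ‖φ z‖₊ ^ (1 / 2 : ℝ)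
  have hG1 : ∫⁻ z, (G z : ℝ≥0∞) ∂μ ≠ ∞ := by
    have hle : ∫⁻ z, (G z : ℝ≥0∞) ∂μ ≤ ∫⁻ z, (1 + ‖φ z‖ₑ) ∂μ := by
      refine lintegral_mono fun z => ?_
      rw [enorm_eq_nnnorm, ← ENNReal.coe_one, ← ENNReal.coe_add, ENNReal.coe_le_coe]
      calc G z ≤ (1 + ‖φ z‖₊) ^ (1 / 2 : ℝ) := by
            simp only [G]; gcongr; exact le_add_self
        _ ≤ (1 + ‖φ z‖₊) ^ (1 : ℝ) :=
            NNReal.rpow_le_rpow_of_exponent_le le_self_add (by norm_num)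
        _ = _ := NNReal.rpow_one _
    refine ne_top_of_le_ne_top ?_ hle
    rw [lintegral_add_left measurable_const, lintegral_one]
    exact ENNReal.add_ne_top.2 ⟨hfin, hφ.lintegral_ne_top hlam hfin⟩
  -- A level at which the oscillation constant is small relative to `ℓ` and, by the weak type
  -- inequality, the high set has measure less than `μ univ / β`.
  obtain ⟨ℓ, hℓ, hκℓ, hbig⟩ := exists_lt_rpow_mul (w := β * (β * ∫⁻ z, (G z : ℝ≥0∞) ∂μ))
    (ENNReal.mul_ne_top ENNReal.coe_ne_top (ENNReal.mul_ne_top ENNReal.coe_ne_top hG1)) h0 one_pos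
    (C ^ (1 / 2 : ℝ) / δ)
  have hN : β * μ (NSet μ D β G ℓ) < μ univ := by
    refine mul_lt_of_rpow_mul_le ?_ hbig
    rw [ENNReal.rpow_one]
    exact mul_measure_NSet_le (by linarith)
  have hmain := hgl G (fun _ z => ‖(0 : ℂ)‖₊ ^ (1 / 2 : ℝ)) (fun _ => C ^ (1 / 2 : ℝ))
      (fun _ => g) ℓ
    (hφm.nnnorm.pow_const _) hℓ (fun _ => hg) (fun i => by
      rw [div_le_iff₀ hδ.bot_lt] at hκℓ
      calc C ^ (1 / 2 : ℝ) ≤ δ * (1 * ℓ) := by rwa [one_mul, mul_comm]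
        _ ≤ _ := by gcongr; exact one_le_pow₀ (by norm_num)) hN
  have hM : MSet μ (fun _ : X => ‖(0 : ℂ)‖₊ ^ (1 / 2 : ℝ)) (C ^ (1 / 2 : ℝ)) = ∅ := by
    refine eq_empty_of_forall_notMem ?_
    rintro x ⟨c, r, h, -⟩
    simp at h
  simp only [hM, measure_empty, mul_zero, tsum_zero, add_zero] at hmain
  simp only [G, nnnorm_rpow_half_rpow] at hmain
  refine ne_top_of_le_ne_top ?_ (lintegral_rpow_le_add hφm hq (β * ℓ))
  refine ENNReal.add_ne_top.2 ⟨ne_top_of_le_ne_top ?_ hmain, ?_⟩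
  · have : μ (NSet μ D β (fun z => ‖φ z‖₊ ^ (1 / 2 : ℝ)) ℓ) ≠ ∞ :=
      ne_top_of_le_ne_top hfin (measure_mono (subset_univ _))
    exact ENNReal.mul_ne_top ENNReal.coe_ne_top (ENNReal.mul_ne_top
      (ENNReal.rpow_ne_top_of_nonneg (by positivity) ENNReal.coe_ne_top) this)
  · finiteness

omit [Nonempty X] in
/-- The distribution of the doubling maximal function of `|T f|^{1/2}`. -/
lemma EndpointBounded.exists_measure_NSet_le (hP1 : 1 ≤ P) (hD48 : 48 ≤ D) (hβ : β ≠ 0)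
    (hT : EndpointBounded μ lam ρ σ s p₀ P T) :
    ∃ C : ℝ≥0, ∀ f ∈ hardySpace μ lam σ s, ∀ ℓ : ℝ≥0, ℓ ≠ 0 →
      (ℓ : ℝ≥0∞) ^ (2 * P) * μ (NSet μ D β (fun z => ‖T f z‖₊ ^ (1 / 2 : ℝ)) ℓ) ≤
        C * hardyNorm μ lam σ s f ^ P := by
  have hP0 : 0 < P := by linarith
  obtain ⟨Cw, hCw⟩ := hT.weak
  refine ⟨β ^ (2 * P) * (2 ^ (2 * P) * (4 * Cw ^ P)), fun f hf ℓ hℓ => ?_⟩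
  refine (measure_NSet_le (D := D) (by linarith) hβ ((T
      f).stronglyMeasurable.measurable.nnnorm.pow_const _)
    (by linarith : 2 ≤ 2 * P) (fun s => rpow_mul_measure_le_weakNorm hP0 (T f) s) hℓ).trans ?_
  push_cast
  rw [ENNReal.coe_rpow_of_nonneg _ (by positivity), ENNReal.coe_rpow_of_nonneg _ (by positivity),
    ENNReal.coe_rpow_of_nonneg _ hP0.le, mul_assoc, mul_assoc, mul_assoc,
    ← ENNReal.mul_rpow_of_nonneg _ _ hP0.le]
  gcongr
  · simp
  · exact hCw f hf

/-- The strong type bound on a space of infinite measure. -/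
theorem EndpointBounded.exists_lintegral_le_of_infinite (hρ : 1 ≤ ρ) (hσ : 1 ≤ σ) (hs : 1 ≤ s)
    (hp : 1 < p)
    (hpp₀ : ENNReal.ofReal p ≤ p₀) (hq : 1 / q = 1 / p - p₀⁻¹.toReal) (hq0 : 0 < q)
    (hP : 1 / P = 1 - p₀⁻¹.toReal) (hP1 : 1 ≤ P) (hlam : IsDominatingFunction μ lam)
    (hD : 42 * σ ≤ D) (hDρ : 8 * ρ ≤ D) (hD48 : 48 ≤ D) (hdd : DoublingData μ lam D β K up)
    (hinf : μ univ = ∞) (hT : EndpointBounded μ lam ρ σ s p₀ P T) :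
    ∃ C : ℝ≥0, ∀ f ∈ hardySpace μ lam σ s, ∫⁻ z, ‖f z‖ₑ ^ p ∂μ ≤ 1 →
      ∫⁻ z, ‖T f z‖ₑ ^ q ∂μ ≤ C := by
  have hP0 : 0 < P := by linarith
  have hβ : β ≠ 0 := (zero_lt_one.trans_le hdd.one_le_beta).ne'
  obtain ⟨hid, -⟩ := exponent_identity hp hq0 hP0 hq hP
  have hPq : 0 < q - P := by
    have h1 : 0 < p / q * (q - P) := by rw [hid]; exact mul_pos hP0 (by linarith)
    exact (pos_iff_pos_of_mul_pos h1).1 (by positivity)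
  obtain ⟨C, c, hc, hmain⟩ := hT.exists_lintegral_le hρ hσ hs hp hpp₀ hq hq0 hP hP1 hlam hD hDρ
      hD48 hdd
  obtain ⟨Cw, hCw⟩ := hT.exists_measure_NSet_le hP1 hD48 hβ
  refine ⟨C * 2, fun f hf hf1 => ?_⟩
  set G : X → ℝ≥0 := fun z => ‖T f z‖₊ ^ (1 / 2 : ℝ)
  have hTm : Measurable (T f) := (T f).stronglyMeasurable.measurable
  have hw : Cw * hardyNorm μ lam σ s f ^ P ≠ ∞ :=
    ENNReal.mul_ne_top ENNReal.coe_ne_top (ENNReal.rpow_ne_top_of_nonneg hP0.le (ne_of_lt hf))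
  have hsmall : ∀ ℓ : ℝ≥0, ℓ ≠ 0 → ∫⁻ z in {z | β * ℓ < G z}, ‖T f z‖ₑ ^ q ∂μ ≤ (C * 2 : ℝ≥0) := by
    intro ℓ' hℓ'
    -- The level is `1/L`, below `ℓ'`. The a priori bound `ℓ^{2P} μ(N) ≤ w < ∞` gives `ℓ^{2q} μ(N) ≤
    -- ℓ^{2(q-P)} w ≤ 1` for small `ℓ`. Only the finiteness of the Hardy norm is used, so the final
    -- constant does not depend on it.
    obtain ⟨L, hL, hLℓ, hLw⟩ := exists_lt_rpow_mul hw one_ne_zero (by linarith : 0 < 2 *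
        (q - P)) ℓ'⁻¹
    rw [mul_one] at hLw
    set ℓ := L⁻¹
    have hℓ : ℓ ≠ 0 := inv_ne_zero hL
    have hle : ℓ ≤ ℓ' := inv_le_of_inv_le₀ hℓ'.bot_lt hLℓ
    have hN := hCw f hf ℓ hℓ
    have hpow0 : (ℓ : ℝ≥0∞) ^ (2 * P) ≠ 0 :=
      (ENNReal.rpow_pos (ENNReal.coe_ne_zero.2 hℓ).bot_lt ENNReal.coe_ne_top).ne'
    have hNt : μ (NSet μ D β G ℓ) ≠ ∞ := by
      intro h
      rw [h, ENNReal.mul_top hpow0, top_le_iff] at hN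
      exact hw hN
    have h1 : (ℓ : ℝ≥0∞) ^ (2 * q) * μ (NSet μ D β G ℓ) ≤ 1 := by
      calc _ = (ℓ : ℝ≥0∞) ^ (2 * (q - P)) * ((ℓ : ℝ≥0∞) ^ (2 * P) * μ (NSet μ D β G ℓ)) := by
            rw [← mul_assoc, ← ENNReal.rpow_add_of_nonneg _ _ (by linarith) (by linarith)]
            congr 2; ring
        _ ≤ (ℓ : ℝ≥0∞) ^ (2 * (q - P)) * (L : ℝ≥0∞) ^ (2 * (q - P)) := by
            gcongr
            exact hN.trans hLw.le
        _ = 1 := by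
            rw [← ENNReal.mul_rpow_of_nonneg _ _ (by linarith), ← ENNReal.coe_mul,
              inv_mul_cancel₀ hL]
            simp
    have h2 := hmain f ℓ hℓ hf hf1 (by
      rw [hinf, ENNReal.mul_top]
      · simp
      · refine mul_ne_zero (by simpa using hc)
          (ENNReal.rpow_pos (ENNReal.coe_ne_zero.2 hℓ).bot_lt ENNReal.coe_ne_top).ne') (by
      rw [hinf]
      exact ENNReal.mul_lt_top ENNReal.coe_lt_top hNt.lt_top)
    calc _ ≤ ∫⁻ z in {z | β * ℓ < G z}, ‖T f z‖ₑ ^ q ∂μ := by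
          refine lintegral_mono_set fun z (hz : β * ℓ' < G z) => lt_of_le_of_lt ?_ hz
          gcongr
      _ ≤ C * (1 + 1) := h2.trans (by gcongr)
      _ = _ := by push_cast; norm_num
  have hU : ⋃ n : ℕ, {z | β * (1 / (n + 1 : ℝ≥0)) < G z} = {z | 0 < G z} := by
    ext z
    simp only [mem_iUnion, mem_ofPred_eq]
    refine ⟨fun ⟨n, hn⟩ => bot_le.trans_lt hn, fun h => ?_⟩
    obtain ⟨n, hn⟩ := exists_nat_one_div_lt (K := ℝ≥0) (div_pos h hβ.bot_lt)
    exact ⟨n, by rwa [lt_div_iff₀ hβ.bot_lt, mul_comm] at hn⟩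
  have hsupp : ∫⁻ z, ‖T f z‖ₑ ^ q ∂μ = ∫⁻ z in {z | 0 < G z}, ‖T f z‖ₑ ^ q ∂μ := by
    rw [setLIntegral_eq_of_support_subset]
    intro z hz
    have : T f z ≠ 0 := by
      rintro h
      simp [h, hq0] at hz
    change 0 < ‖T f z‖₊ ^ (1 / 2 : ℝ)
    exact NNReal.rpow_pos (by simpa using this)
  have hmono : Monotone fun n : ℕ => {z | β * (1 / (n + 1 : ℝ≥0)) < G z} := fun m n h z hz =>
    lt_of_le_of_lt (show β * (1 / (n + 1 : ℝ≥0)) ≤ β * (1 / (m + 1 : ℝ≥0)) by gcongr) hz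
  rw [hsupp, ← hU, setLIntegral_iUnion_of_directed _ hmono.directed_le]
  exact iSup_le fun n => hsmall _ (by positivity)

/-- The strong type bound for mean zero functions on a space of finite measure. -/
theorem EndpointBounded.exists_lintegral_le_of_finite (hρ : 1 ≤ ρ) (hσ : 1 ≤ σ) (hs : 1 ≤ s)
    (hp : 1 < p)
    (hpp₀ : ENNReal.ofReal p ≤ p₀) (hq : 1 / q = 1 / p - p₀⁻¹.toReal) (hq0 : 0 < q)
    (hP : 1 / P = 1 - p₀⁻¹.toReal) (hP1 : 1 ≤ P) (hlam : IsDominatingFunction μ lam)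
    (hD : 42 * σ ≤ D) (hDρ : 8 * ρ ≤ D) (hD48 : 48 ≤ D) (hdd : DoublingData μ lam D β K up)
    (hfin : μ univ ≠ ∞) (h0 : μ univ ≠ 0) (hT : EndpointBounded μ lam ρ σ s p₀ P T) :
    ∃ C : ℝ≥0, ∀ f ∈ hardySpace μ lam σ s, ∫⁻ z, ‖f z‖ₑ ^ p ∂μ ≤ 1 →
      ∫⁻ z, ‖T f z‖ₑ ^ q ∂μ ≤ C := by
  have hP0 : 0 < P := by linarith
  have hp0 : 0 < p := by linarith
  have hβ : β ≠ 0 := (zero_lt_one.trans_le hdd.one_le_beta).ne'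
  obtain ⟨C, c, hc, hmain⟩ := hT.exists_lintegral_le hρ hσ hs hp hpp₀ hq hq0 hP hP1 hlam hD hDρ
      hD48 hdd
  obtain ⟨Cw, hCw⟩ := hT.exists_measure_NSet_le hP1 hD48 hβ
  obtain ⟨Ch, hCh⟩ := exists_hNorm_le_of_integral_eq_zero (s := s) hσ hs hp hlam hD hdd h0 hfin
  -- The unit ball has `H¹` norm at most `Ch`, so one level `ℓ₁` makes the high sets small for all
  -- `f` in it. The level `ℓ ≥ ℓ₁` in addition permits the decomposition at the lowest height.
  obtain ⟨ℓ₁, hℓ₁, -, hbig₁⟩ := exists_lt_rpow_mul (w := β * (Cw * (Ch : ℝ≥0∞) ^ P))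
      (by finiteness) h0
    (by positivity : 0 < 2 * P) 0
  obtain ⟨ℓ, hℓ, hle, hbig⟩ := exists_lt_rpow_mul (w := ((c⁻¹ : ℝ≥0) : ℝ≥0∞)) (by finiteness) h0
    (by positivity : 0 < 2 * q) ℓ₁
  refine ⟨(C * ((ℓ : ℝ≥0∞) ^ (2 * q) * μ univ + 1) +
    ((β * ℓ : ℝ≥0) : ℝ≥0∞) ^ (2 * q) * μ univ).toNNReal, fun f hf hf1 => ?_⟩
  rw [ENNReal.coe_toNNReal (by finiteness)]
  have hf0 : ∫ z, f z ∂μ = 0 := by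
    refine integral_eq_zero_of_hNorm_lt_top (lam := lam) hσ hs ?_
    rw [hNorm_coe]; exact hf
  have hH : hardyNorm μ lam σ s f ≤ Ch := by
    rw [← hNorm_coe]
    refine (hCh f f.stronglyMeasurable.measurable (ne_top_of_le_ne_top ENNReal.one_ne_top hf1)
      hf0).trans (mul_le_of_le_one_right' ?_)
    exact ENNReal.rpow_le_one hf1 (by positivity)
  have hN : β * μ (NSet μ D β (fun z => ‖T f z‖₊ ^ (1 / 2 : ℝ)) ℓ) < μ univ := by
    refine mul_lt_of_rpow_mul_le (Q := 2 * P) ((hCw f hf ℓ hℓ).trans ?_) (hbig₁.trans_le ?_)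
    · gcongr
    · gcongr
  have h1 := hmain f ℓ hℓ hf hf1 (by
    rw [mul_assoc]
    calc (1 : ℝ≥0∞) = c * ((c⁻¹ : ℝ≥0) : ℝ≥0∞) := by
          rw [← ENNReal.coe_mul, mul_inv_cancel₀ hc, ENNReal.coe_one]
      _ < _ := ENNReal.mul_lt_mul_right (by simpa using hc) ENNReal.coe_ne_top hbig) hN
  refine (lintegral_rpow_le_add (T f).stronglyMeasurable.measurable hq0 (β * ℓ)).trans ?_
  gcongr
  refine (le_of_eq ?_).trans (h1.trans ?_)
  · simp
  · gcongr
    exact subset_univ _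


/-! ### From the unit ball to all functions by homogeneity. -/

section Homogeneity

variable {X : Type*} [MeasurableSpace X] {μ : Measure X} {T : AEFun ℂ μ → AEFun ℂ μ}
  {S : Set (AEFun ℂ μ)} {p q : ℝ≥0∞}

lemma eLpNorm_coe_smul (c : ℂ) (f : AEFun ℂ μ) :
    eLpNorm (c • f : AEFun ℂ μ) p μ = ‖c‖ₑ * eLpNorm f p μ := by
  rw [eLpNorm_congr_ae (AEEqFun.coeFn_smul c f), eLpNorm_const_smul]

lemma IsSublinearOn.eLpNorm_smul (hT : IsSublinearOn S T) (c : ℂ) {f : AEFun ℂ μ} (hf : f ∈ S) :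
    eLpNorm (T (c • f)) q μ = ‖c‖ₑ * eLpNorm (T f) q μ := by
  rw [← eLpNorm_const_smul]
  refine eLpNorm_congr_norm_ae ?_
  filter_upwards [hT.2 c f hf] with z hz
  rw [hz, Pi.smul_apply, norm_smul]

/-- A bound on the unit ball gives a bound for all functions. -/
lemma IsSublinearOn.exists_eLpNorm_le (hT : IsSublinearOn S T)
    (hS : ∀ (c : ℂ), ∀ f ∈ S, c • f ∈ S) (hp0 : p ≠ 0) (hp : p ≠ ∞) (hq0 : q ≠ 0) (hq : q ≠ ∞)
    {C : ℝ≥0} (h : ∀ f ∈ S, ∫⁻ z, ‖f z‖ₑ ^ p.toReal ∂μ ≤ 1 →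
      ∫⁻ z, ‖T f z‖ₑ ^ q.toReal ∂μ ≤ C) :
    ∃ C' : ℝ≥0, ∀ f ∈ S, eLpNorm f p μ < ∞ → eLpNorm (T f) q μ ≤ C' * eLpNorm f p μ := by
  have hp' := ENNReal.toReal_pos hp0 hp
  refine ⟨C ^ (1 / q.toReal), fun f hf hft => ?_⟩
  set N := eLpNorm f p μ
  by_cases hN : N = 0
  · have hf0 : f = 0 := by
      refine AEEqFun.ext (((eLpNorm_eq_zero_iff f.aestronglyMeasurable hp0).1 hN).trans ?_)
      exact AEEqFun.coeFn_zero.symm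
    have h0 := hT.eLpNorm_smul (q := q) 0 hf
    rw [zero_smul, ← hf0] at h0
    rw [h0]
    simp
  set c : ℂ := ((N.toReal⁻¹ : ℝ) : ℂ)
  have hc : ‖c‖ₑ = N⁻¹ := by
    have : 0 < N.toReal := ENNReal.toReal_pos hN hft.ne
    simp only [c]
    rw [← ofReal_norm, Complex.norm_real, Real.norm_eq_abs, abs_of_pos (inv_pos.2 this),
      ENNReal.ofReal_inv_of_pos this, ENNReal.ofReal_toReal hft.ne]
  have h1 : eLpNorm (c • f : AEFun ℂ μ) p μ = 1 := by
    rw [eLpNorm_coe_smul, hc, ENNReal.inv_mul_cancel hN hft.ne]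
  have h2 : ∫⁻ z, ‖(c • f : AEFun ℂ μ) z‖ₑ ^ p.toReal ∂μ ≤ 1 := by
    rw [eLpNorm_eq_lintegral_rpow_enorm_toReal hp0 hp] at h1
    have h2 := congrArg (· ^ p.toReal) h1
    simp only [← ENNReal.rpow_mul, one_div_mul_cancel hp'.ne', ENNReal.rpow_one,
      ENNReal.one_rpow] at h2
    exact h2.le
  have h3 : eLpNorm (T (c • f)) q μ ≤ (C ^ (1 / q.toReal) : ℝ≥0) := by
    rw [eLpNorm_eq_lintegral_rpow_enorm_toReal hq0 hq, ENNReal.coe_rpow_of_nonneg _ (by positivity)]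
    exact ENNReal.rpow_le_rpow (h _ (hS c f hf) h2) (by positivity)
  rw [hT.eLpNorm_smul c hf, hc] at h3
  calc eLpNorm (T f) q μ = N⁻¹ * eLpNorm (T f) q μ * N := by
        rw [mul_right_comm, ENNReal.inv_mul_cancel hN hft.ne, one_mul]
    _ ≤ _ := by gcongr

end Homogeneity

/-! ### Subtraction of the mean value on a space of finite measure. -/

section Correction

variable {X : Type*} [MeasurableSpace X] {μ : Measure X} {p : ℝ≥0∞}

/-- The mean value is controlled by the `L^p` norm. -/
lemma exists_enorm_mean_le (hp : 1 ≤ p) (hfin : μ univ ≠ ∞) (h0 : μ univ ≠ 0) :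
    ∃ B : ℝ≥0, ∀ f : AEFun ℂ μ, ‖(∫ z, f z ∂μ) / ((μ univ).toReal : ℂ)‖ₑ ≤ B * eLpNorm f p μ := by
  refine ⟨(μ univ ^ (1 / (1 : ℝ≥0∞).toReal - 1 / p.toReal) * (μ univ)⁻¹).toNNReal, fun f => ?_⟩
  have hr : 0 < (μ univ).toReal := ENNReal.toReal_pos h0 hfin
  have h1 : 0 ≤ 1 / (1 : ℝ≥0∞).toReal - 1 / p.toReal := by
    rcases eq_or_ne p ∞ with rfl | hpt
    · simp
    · have : 1 ≤ p.toReal := by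
        rw [← ENNReal.toReal_one]
        exact ENNReal.toReal_mono hpt hp
      rw [ENNReal.toReal_one, div_one, sub_nonneg, div_le_one (by linarith)]
      exact this
  rw [ENNReal.coe_toNNReal (ENNReal.mul_ne_top (ENNReal.rpow_ne_top_of_nonneg h1 hfin)
    (ENNReal.inv_ne_top.2 h0)), div_eq_mul_inv, enorm_mul,
    enorm_inv (by simpa using hr.ne'), ← ofReal_norm (E := ℂ)
        ((μ univ).toReal : ℂ), Complex.norm_real, Real.norm_eq_abs,
    abs_of_pos hr, ENNReal.ofReal_toReal hfin]
  calc _ ≤ eLpNorm f p μ * μ univ ^ (1 / (1 : ℝ≥0∞).toReal - 1 / p.toReal) * (μ univ)⁻¹ := by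
        gcongr
        refine (enorm_integral_le_lintegral_enorm _).trans ?_
        rw [← eLpNorm_one_eq_lintegral_enorm]
        exact eLpNorm_le_eLpNorm_mul_rpow_measure_univ hp f.aestronglyMeasurable
    _ = _ := by ring

lemma memLp_const_one (hfin : μ univ ≠ ∞) : MemLp (fun _ : X => (1 : ℂ)) p μ := by
  have : IsFiniteMeasure μ := ⟨hfin.lt_top⟩
  exact memLp_const 1

/-- A function minus its mean value. -/
noncomputable def subMean (f : AEFun ℂ μ) : AEFun ℂ μ :=
  f + (-((∫ z, f z ∂μ) / ((μ univ).toReal : ℂ))) • AEEqFun.const X 1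

lemma const_one_mem_Lp (hfin : μ univ ≠ ∞) : (AEEqFun.const X 1 : AEFun ℂ μ) ∈ Lp ℂ p μ := by
  rw [Lp.mem_Lp_iff_memLp]
  exact (memLp_congr_ae (AEEqFun.coeFn_const X (1 : ℂ))).2 (memLp_const_one hfin)

lemma subMean_mem_Lp (hfin : μ univ ≠ ∞) {f : AEFun ℂ μ} (hf : f ∈ Lp ℂ p μ) :
    subMean f ∈ Lp ℂ p μ :=
  add_mem hf (Lp.const_smul_mem_Lp _ ⟨_, const_one_mem_Lp hfin⟩)

lemma integral_subMean (hfin : μ univ ≠ ∞) (h0 : μ univ ≠ 0) (hp : 1 ≤ p) {f : AEFun ℂ μ}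
    (hf : f ∈ Lp ℂ p μ) : ∫ z, subMean f z ∂μ = 0 := by
  have : IsFiniteMeasure μ := ⟨hfin.lt_top⟩
  have hr : 0 < (μ univ).toReal := ENNReal.toReal_pos h0 hfin
  have hfi : Integrable f μ := ((Lp.mem_Lp_iff_memLp).1 hf).integrable hp
  set m : ℂ := -((∫ z, f z ∂μ) / ((μ univ).toReal : ℂ))
  have e : subMean f =ᵐ[μ] fun z => f z + m := by
    filter_upwards [AEEqFun.coeFn_add f (m • AEEqFun.const X 1),
      AEEqFun.coeFn_smul m (AEEqFun.const X 1 : AEFun ℂ μ),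
      AEEqFun.coeFn_const (μ := μ) X (1 : ℂ)] with z h1 h2 h3
    unfold subMean
    rw [h1, Pi.add_apply, h2, Pi.smul_apply, h3]
    simp
  have hr' : ((μ univ).toReal : ℂ) ≠ 0 := by simpa using hr.ne'
  rw [integral_congr_ae e, integral_add hfi (integrable_const _), integral_const, Measure.real,
    Complex.real_smul]
  simp only [m]
  field_simp
  ring

lemma eLpNorm_add_smul_le (hp : 1 ≤ p) (f g : AEFun ℂ μ) (c : ℂ) :
    eLpNorm (f + c • g : AEFun ℂ μ) p μ ≤ eLpNorm f p μ + ‖c‖ₑ * eLpNorm g p μ := by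
  rw [eLpNorm_congr_ae (AEEqFun.coeFn_add f (c • g)), ← eLpNorm_coe_smul]
  exact eLpNorm_add_le f.aestronglyMeasurable (c • g).aestronglyMeasurable hp

lemma exists_eLpNorm_subMean_le (hp : 1 ≤ p) (hfin : μ univ ≠ ∞) (h0 : μ univ ≠ 0) :
    ∃ B : ℝ≥0, ∀ f : AEFun ℂ μ, eLpNorm (subMean f) p μ ≤ B * eLpNorm f p μ := by
  obtain ⟨B, hB⟩ := exists_enorm_mean_le (μ := μ) hp hfin h0
  have hone : eLpNorm (AEEqFun.const X 1 : AEFun ℂ μ) p μ ≠ ∞ :=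
    (Lp.mem_Lp_iff_eLpNorm_lt_top.1 (const_one_mem_Lp hfin)).ne
  refine ⟨1 + B * (eLpNorm (AEEqFun.const X 1 : AEFun ℂ μ) p μ).toNNReal, fun f => ?_⟩
  refine (eLpNorm_add_smul_le hp f _ _).trans ?_
  rw [enorm_neg]
  push_cast
  rw [ENNReal.coe_toNNReal hone]
  calc _ ≤ eLpNorm f p μ + B * eLpNorm f p μ * eLpNorm (AEEqFun.const X 1 : AEFun ℂ μ) p μ := by
        gcongr
        exact hB f
    _ = _ := by ring

/-- If `T` is bounded on mean zero functions and at the constants, it is bounded. -/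
lemma IsSublinearOn.exists_eLpNorm_le_of_subMean {T : AEFun ℂ μ → AEFun ℂ μ} {p₀ q : ℝ≥0∞}
    (hT : IsSublinearOn (Lp ℂ p₀ μ : Set (AEFun ℂ μ)) T) (hp : 1 ≤ p) (hq : 1 ≤ q)
    (hfin : μ univ ≠ ∞) (h0 : μ univ ≠ 0) {C : ℝ≥0}
    (h1 : eLpNorm (T (AEEqFun.const X 1)) q μ ≠ ∞)
    (h : ∀ f ∈ Lp ℂ p₀ μ, eLpNorm (T (subMean f)) q μ ≤ C * eLpNorm (subMean f) p μ) :
    ∃ C' : ℝ≥0, ∀ f ∈ Lp ℂ p₀ μ, eLpNorm (T f) q μ ≤ C' * eLpNorm f p μ := by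
  obtain ⟨B, hB⟩ := exists_enorm_mean_le (μ := μ) hp hfin h0
  obtain ⟨B', hB'⟩ := exists_eLpNorm_subMean_le (μ := μ) hp hfin h0
  refine ⟨C * B' + B * (eLpNorm (T (AEEqFun.const X 1)) q μ).toNNReal, fun f hf => ?_⟩
  set m : ℂ := (∫ z, f z ∂μ) / ((μ univ).toReal : ℂ)
  have hone : (AEEqFun.const X 1 : AEFun ℂ μ) ∈ Lp ℂ p₀ μ := const_one_mem_Lp hfin
  have e : f = subMean f + m • AEEqFun.const X 1 := by
    simp only [subMean, m, neg_smul]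
    abel
  have hs := hT.1 (subMean f) (subMean_mem_Lp hfin hf) (m • AEEqFun.const X 1)
    (Lp.const_smul_mem_Lp m ⟨_, hone⟩)
  rw [← e] at hs
  push_cast
  rw [ENNReal.coe_toNNReal h1]
  calc eLpNorm (T f) q μ ≤ eLpNorm (fun z => ‖T (subMean f) z‖ + ‖T
      (m • AEEqFun.const X 1) z‖) q μ :=
        eLpNorm_mono_ae_real hs
    _ ≤ eLpNorm (T (subMean f)) q μ + eLpNorm (T (m • AEEqFun.const X 1)) q μ := by
        refine (eLpNorm_add_le (T _).aestronglyMeasurable.norm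
          (T _).aestronglyMeasurable.norm hq).trans ?_
        rw [eLpNorm_norm, eLpNorm_norm]
    _ ≤ C * (B' * eLpNorm f p μ) + B * eLpNorm f p μ * eLpNorm (T (AEEqFun.const X 1)) q μ := by
        rw [hT.eLpNorm_smul m hone]
        exact add_le_add ((h f hf).trans (mul_le_mul' le_rfl (hB' f))) (mul_le_mul' (hB f) le_rfl)
    _ = _ := by ring

end Correction


/-! ### Density in `L^p`. -/

section Approximation

variable {X : Type*} [MetricSpace X] [MeasurableSpace X] {μ : Measure X} {lam : X → ℝ → ℝ}
  {σ : ℝ} {s : ℝ≥0∞} {p : ℝ≥0∞}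

/-- Bounded functions with bounded support are dense in `L^p`. -/
lemma exists_bounded_approx [OpensMeasurableSpace X] (x₀ : X) (hp0 : p ≠ 0) (hp : p ≠ ∞)
    {f : X → ℂ} (hf : Measurable f)
    (hfp : eLpNorm f p μ ≠ ∞) {ε : ℝ≥0∞} (hε : ε ≠ 0) : ∃ (g : X → ℂ) (n : ℕ), Measurable g ∧
      0 < n ∧ (∀ z, ‖g z‖ₑ ≤ n) ∧ (∀ z, z ∉ ball x₀ n → g z = 0) ∧
      eLpNorm (fun z => f z - g z) p μ ≤ ε := by
  have hp' := ENNReal.toReal_pos hp0 hp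
  have hI : ∫⁻ z, ‖f z‖ₑ ^ p.toReal ∂μ ≠ ∞ := by
    rw [eLpNorm_eq_lintegral_rpow_enorm_toReal hp0 hp] at hfp
    intro h
    rw [h, ENNReal.top_rpow_of_pos (by positivity)] at hfp
    exact hfp rfl
  set ν := μ.withDensity fun z => ‖f z‖ₑ ^ p.toReal
  have hν : ∀ E, MeasurableSet E → ν E = ∫⁻ z in E, ‖f z‖ₑ ^ p.toReal ∂μ := fun E hE =>
    withDensity_apply _ hE
  set U : ℕ → Set X := fun n => (ball x₀ (n + 1 : ℝ) ∩ {z | ‖f z‖ₑ ≤ (n + 1 : ℕ)})ᶜ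
  have hU : ∀ n, MeasurableSet (U n) := fun n =>
    (measurableSet_ball.inter (measurableSet_le hf.enorm measurable_const)).compl
  obtain ⟨φ, -, hφ⟩ := exists_strictMono_measure_le (ν := ν) (ε := fun _ => ε ^ p.toReal) hU
    (fun m n h => compl_subset_compl.2 (inter_subset_inter (ball_subset_ball (by gcongr))
      fun z (hz : ‖f z‖ₑ ≤ (m + 1 : ℕ)) => hz.trans (by exact_mod_cast Nat.succ_le_succ h)))
    (by
      refine eq_empty_of_forall_notMem fun z hz => ?_
      obtain ⟨n, hn⟩ := exists_nat_gt (dist z x₀)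
      obtain ⟨m, hm⟩ := ENNReal.exists_nat_gt (enorm_ne_top (x := f z))
      refine mem_iInter.1 hz (max n m) ⟨?_, ?_⟩
      · rw [mem_ball]
        refine hn.trans_le ?_
        have : (n : ℝ) ≤ (max n m : ℕ) := by exact_mod_cast le_max_left _ _
        linarith
      · refine hm.le.trans ?_
        exact_mod_cast (le_max_right n m).trans (Nat.le_succ _))
    (by
      rw [hν _ (hU 0)]
      exact ne_top_of_le_ne_top hI (setLIntegral_le_lintegral _ _))
    (fun n => ENNReal.rpow_pos_of_nonneg hε.bot_lt hp'.le)
  set n := φ 0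
  refine ⟨(U n)ᶜ.indicator f, n + 1, hf.indicator (hU n).compl, by omega, fun z => ?_,
    fun z hz => ?_, ?_⟩
  · by_cases h : z ∈ (U n)ᶜ
    · rw [indicator_of_mem h]
      simp only [U, compl_compl] at h
      exact h.2
    · rw [indicator_of_notMem h]; simp
  · refine indicator_of_notMem (fun h => hz ?_) _
    simp only [U, compl_compl] at h
    exact_mod_cast h.1
  · have e : (fun z => f z - (U n)ᶜ.indicator f z) = (U n).indicator f := by
      funext z
      by_cases h : z ∈ U n <;> simp [h]
    rw [e, eLpNorm_eq_lintegral_rpow_enorm_toReal hp0 hp, lintegral_enorm_rpow_indicator hp' (hU n),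
      ← hν _ (hU n)]
    calc _ ≤ (ε ^ p.toReal) ^ (1 / p.toReal) := ENNReal.rpow_le_rpow (hφ 0) (by positivity)
      _ = ε := by rw [← ENNReal.rpow_mul, mul_one_div_cancel hp'.ne', ENNReal.rpow_one]

lemma memLp_of_bounded_of_support [OpensMeasurableSpace X] (hlam : IsDominatingFunction μ lam)
    {x₀ : X} {r : ℝ} {M : ℝ≥0}
    {g : X → ℂ} (hg : Measurable g) (hM : ∀ z, ‖g z‖ₑ ≤ M) (hsupp : ∀ z, z ∉ ball x₀ r → g z = 0)
    (p : ℝ≥0∞) : MemLp g p μ := by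
  have h1 : MemLp ((ball x₀ r).indicator fun _ => (M : ℝ)) p μ :=
    memLp_indicator_const p measurableSet_ball (M : ℝ) (Or.inr (hlam.measure_ball_lt_top x₀ r).ne)
  refine h1.mono hg.aestronglyMeasurable (Eventually.of_forall fun z => ?_)
  by_cases hz : z ∈ ball x₀ r
  · rw [indicator_of_mem hz]
    have := hM z
    rw [enorm_eq_nnnorm, ENNReal.coe_le_coe] at this
    simpa using NNReal.coe_le_coe.2 this
  · simp [hsupp z hz]

omit [MetricSpace X] in
lemma eLpNorm_sub_mk {f : AEFun ℂ μ} {g : X → ℂ} (hg : AEStronglyMeasurable g μ) :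
    eLpNorm (f - AEEqFun.mk g hg : AEFun ℂ μ) p μ = eLpNorm (fun z => f z - g z) p μ := by
  refine eLpNorm_congr_ae ?_
  filter_upwards [AEEqFun.coeFn_sub f (AEEqFun.mk g hg), AEEqFun.coeFn_mk g hg] with z h1 h2
  rw [h1, Pi.sub_apply, h2]

/-- On a space of finite measure `L^{p₀}` is dense in `L^p`. -/
lemma exists_mem_Lp_approx [OpensMeasurableSpace X] (x₀ : X) (hlam : IsDominatingFunction μ lam)
    (hp0 : p ≠ 0) (hp : p ≠ ∞)
    (p₀ : ℝ≥0∞) {f : AEFun ℂ μ} (hf : f ∈ Lp ℂ p μ) {ε : ℝ≥0∞} (hε : ε ≠ 0) :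
    ∃ g ∈ Lp ℂ p₀ μ, eLpNorm (f - g : AEFun ℂ μ) p μ ≤ ε := by
  obtain ⟨g, n, hg, -, hgn, hsupp, hle⟩ := exists_bounded_approx x₀ hp0 hp
    f.stronglyMeasurable.measurable (Lp.mem_Lp_iff_eLpNorm_lt_top.1 hf).ne hε
  refine ⟨AEEqFun.mk g hg.aestronglyMeasurable, ?_, (eLpNorm_sub_mk _).trans_le hle⟩
  rw [Lp.mem_Lp_iff_memLp]
  exact (memLp_congr_ae (AEEqFun.coeFn_mk _ _)).2
    (memLp_of_bounded_of_support hlam (M := n) hg (by simpa using hgn) hsupp p₀)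

variable [BorelSpace X] [Nonempty X]

/-- On a space of infinite measure the Hardy space is dense in `L^p`. -/
lemma exists_mem_hardySpace_approx (hσ : 1 ≤ σ) (hs : 1 ≤ s) (hlam : IsDominatingFunction μ lam)
    (hp1 : 1 < p) (hp : p ≠ ∞) (hinf : μ univ = ∞) {f : AEFun ℂ μ} (hf : f ∈ Lp ℂ p μ) {ε : ℝ≥0∞}
    (hε : ε ≠ 0) : ∃ g ∈ Lp ℂ p μ, g ∈ hardySpace μ lam σ s ∧
      eLpNorm (f - g : AEFun ℂ μ) p μ ≤ ε := by
  obtain ⟨x₀⟩ := ‹Nonempty X›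
  have : Nonempty X := ⟨x₀⟩
  have hp0 : p ≠ 0 := (zero_lt_one.trans hp1).ne'
  have hpr : 1 < p.toReal := by
    rw [← ENNReal.toReal_one]; exact (ENNReal.toReal_lt_toReal (by simp) hp).2 hp1
  have hε2 : ε / 2 ≠ 0 := by simpa using hε
  obtain ⟨g, n, hg, hn, hgn, hsupp, hle⟩ := exists_bounded_approx x₀ hp0 hp
    f.stronglyMeasurable.measurable (Lp.mem_Lp_iff_eLpNorm_lt_top.1 hf).ne hε2
  set m := ∫ z, g z ∂μ
  have hexp : 0 < 1 - 1 / p.toReal := by rw [sub_pos, div_lt_one (by linarith)]; exact hpr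
  -- On a ball of measure exceeding `a`, spreading the mass `m` evenly has `L^p` norm at most `|m|
  -- μ(B)^{1/p-1} ≤ ε/2`. Such a ball exists because `μ` is infinite and `p > 1`.
  set a : ℝ≥0∞ := (‖m‖ₑ / (ε / 2)) ^ (1 - 1 / p.toReal)⁻¹
  have ha : a < μ univ := by
    rw [hinf]
    exact ENNReal.rpow_lt_top_of_nonneg (by positivity) (ENNReal.div_ne_top enorm_ne_top hε2)
  obtain ⟨R, hR, haR⟩ := exists_lt_measure_ball x₀ ha
  have h0 : μ (ball x₀ R) ≠ 0 := (bot_le.trans_lt haR).ne'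
  have ht := (hlam.measure_ball_lt_top x₀ R).ne
  have hballLp : ∀ q, MemLp (ballAvg μ x₀ R) q μ := fun q =>
    memLp_of_bounded_of_support hlam (x₀ := x₀) (r := R) (M := (μ (ball x₀ R))⁻¹.toNNReal)
      (measurable_ballAvg x₀ R) (fun z => by
        rw [ENNReal.coe_toNNReal (ENNReal.inv_ne_top.2 h0)]
        exact enorm_ballAvg_le h0 ht z) (fun z hz => ballAvg_of_notMem hz) q
  have hgLp : MemLp g p μ := memLp_of_bounded_of_support hlam (M := n) hg
      (by simpa using hgn) hsupp p
  have hballnorm : eLpNorm (ballAvg μ x₀ R) p μ * μ (ball x₀ R) ^ (1 - 1 / p.toReal) ≤ 1 := by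
    unfold ballAvg
    have e : ‖((μ (ball x₀ R)).toReal : ℂ)⁻¹‖ₑ = (μ (ball x₀ R))⁻¹ := by
      have hr : 0 < (μ (ball x₀ R)).toReal := ENNReal.toReal_pos h0 ht
      rw [enorm_inv (by simpa using hr.ne'), ← ofReal_norm, Complex.norm_real, Real.norm_eq_abs,
        abs_of_pos hr, ENNReal.ofReal_toReal ht]
    rw [eLpNorm_indicator_const measurableSet_ball hp0 hp, e, mul_assoc,
      ← ENNReal.rpow_add_of_nonneg _ _ (by positivity) hexp.le, add_sub_cancel, ENNReal.rpow_one,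
      ENNReal.inv_mul_cancel h0 ht]
  have hmball : eLpNorm (fun z => m * ballAvg μ x₀ R z) p μ ≤ ε / 2 := by
    have e : eLpNorm (fun z => m * ballAvg μ x₀ R z) p μ = ‖m‖ₑ * eLpNorm (ballAvg μ x₀ R) p μ :=
      eLpNorm_const_smul m (ballAvg μ x₀ R) p μ
    rw [e]
    have h1 : ‖m‖ₑ / (ε / 2) ≤ μ (ball x₀ R) ^ (1 - 1 / p.toReal) := by
      calc ‖m‖ₑ / (ε / 2) = a ^ (1 - 1 / p.toReal) := by
            simp only [a]
            rw [← ENNReal.rpow_mul, inv_mul_cancel₀ hexp.ne', ENNReal.rpow_one]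
        _ ≤ _ := ENNReal.rpow_le_rpow haR.le hexp.le
    by_cases hεt : ε / 2 = ∞
    · rw [hεt]; exact le_top
    rw [ENNReal.div_le_iff hε2 hεt] at h1
    calc _ ≤ μ (ball x₀ R) ^ (1 - 1 / p.toReal) * (ε / 2) *
          eLpNorm (ballAvg μ x₀ R) p μ := by gcongr
      _ = eLpNorm (ballAvg μ x₀ R) p μ * μ (ball x₀ R) ^ (1 - 1 / p.toReal) * (ε / 2) := by ring
      _ ≤ 1 * (ε / 2) := by gcongr
      _ = _ := one_mul _
  set u : X → ℂ := fun z => g z - m * ballAvg μ x₀ R z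
  have hu : Measurable u := hg.sub ((measurable_ballAvg x₀ R).const_mul m)
  have huLp : MemLp u p μ := hgLp.sub ((hballLp p).const_mul m)
  have hn0 : (0 : ℝ) < n := by exact_mod_cast hn
  have hH : hNorm μ lam σ s u < ∞ := by
    -- Only finiteness of the Hardy norm is wanted, so this quotient for the single ball can play
    -- the role of the doubling constant.
    have hβ : μ (ball x₀ (σ * R)) / μ (ball x₀ R) ≠ ∞ :=
      ENNReal.div_ne_top (hlam.measure_ball_lt_top _ _).ne h0
    have h1 := hNorm_sub_ballAvg_le (lam := lam) (s := s) (u := g) (M := n)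
      (K₁ := (coefK μ lam x₀ n x₀ (max n R)).toNNReal) (K₂ := (coefK μ lam x₀ R x₀
          (max n R)).toNNReal)
      (β := (μ (ball x₀ (σ * R)) / μ (ball x₀ R)).toNNReal)
      hσ hs hlam hg.aestronglyMeasurable
      (Eventually.of_forall (by simpa using hgn)) hn0 hR (lt_max_of_lt_left hn0) (y := x₀)
      (ball_subset_ball (le_max_left _ _)) (ball_subset_ball (le_max_right _ _))
      (Eventually.of_forall hsupp) h0
      (by rw [ENNReal.coe_toNNReal hβ, ENNReal.div_mul_cancel h0 ht])
      (by rw [ENNReal.coe_toNNReal (hlam.coefK_lt_top hn0).ne])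
      (by rw [ENNReal.coe_toNNReal (hlam.coefK_lt_top hR).ne])
    refine h1.trans_lt ?_
    have := hlam.measure_ball_lt_top x₀ (σ * n)
    finiteness
  refine ⟨AEEqFun.mk u hu.aestronglyMeasurable, ?_, ?_, ?_⟩
  · rw [Lp.mem_Lp_iff_memLp]
    exact (memLp_congr_ae (AEEqFun.coeFn_mk _ _)).2 huLp
  · change hardyNorm _ _ _ _ _ < ∞
    rw [← hNorm_mk]; exact hH
  · rw [eLpNorm_sub_mk]
    have e : (fun z => f z - u z) = (fun z => f z - g z) + fun z => m * ballAvg μ x₀ R z := by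
      funext z; simp only [u, Pi.add_apply]; ring
    rw [e]
    refine (eLpNorm_add_le (f.aestronglyMeasurable.sub hg.aestronglyMeasurable)
      (((measurable_ballAvg x₀ R).const_mul m).aestronglyMeasurable) hp1.le).trans ?_
    exact (add_le_add hle hmball).trans (ENNReal.add_halves ε).le

end Approximation


/-! ### Extension of operators from dense subspaces. -/

/-- Extension of a map that is Lipschitz on a dense set `W` and on a further set `W₂` to a
continuous map. -/
lemma exists_continuous_extension {E F : Type*} [PseudoEMetricSpace E] [EMetricSpace F]
    [CompleteSpace F] {W W₂ : Set E} {A : E → F} {C C₂ : ℝ≥0} (hA : LipschitzOnWith C A W)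
    (hA₂ : LipschitzOnWith C₂ A W₂) (hW : Dense W) (hW₂ : W₂ ⊆ closure (W ∩ W₂)) :
    ∃ Φ : E → F, Continuous Φ ∧ (∀ f ∈ W, Φ f = A f) ∧ ∀ f ∈ W₂, Φ f = A f := by
  have hu : UniformContinuous fun w : W => A w := hA.to_restrict.uniformContinuous
  have hi : IsUniformInducing ((↑) : W → E) := isUniformEmbedding_subtype_val.isUniformInducing
  have hd : DenseRange ((↑) : W → E) := hW.denseRange_val
  set Φ := (hi.isDenseInducing hd).extend fun w : W => A w
  have hΦ : Continuous Φ := (uniformContinuous_uniformly_extend hi hd hu).continuous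
  have hΦW : ∀ f ∈ W, Φ f = A f := fun f hf =>
    (hi.isDenseInducing hd).extend_eq hu.continuous ⟨f, hf⟩
  refine ⟨Φ, hΦ, hΦW, fun f hf => ?_⟩
  -- Points of `W₂` are approached within `W ∩ W₂`, where the extension agrees with `A` and both are
  -- continuous.
  have hne : (𝓝[W ∩ W₂] f).NeBot := mem_closure_iff_nhdsWithin_neBot.1 (hW₂ hf)
  have h1 : Tendsto Φ (𝓝[W ∩ W₂] f) (𝓝 (Φ f)) := hΦ.continuousAt.mono_left nhdsWithin_le_nhds
  have h2 : Tendsto A (𝓝[W ∩ W₂] f) (𝓝 (A f)) :=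
    (hA₂.continuousOn f hf).mono_left (nhdsWithin_mono f inter_subset_right)
  refine tendsto_nhds_unique h1 (h2.congr' ?_)
  filter_upwards [self_mem_nhdsWithin] with g hg
  exact (hΦW g hg.1).symm

variable {X : Type*} [MeasurableSpace X] {μ : Measure X} {p q : ℝ≥0∞}

/-- The element of `L^q` given by a function, and zero if the function does not belong to `L^q`. -/
noncomputable def toLpOrZero {G : Type*} [NormedAddCommGroup G] (q : ℝ≥0∞) (u : AEFun G μ) :
    Lp G q μ :=
  open Classical in if h : u ∈ Lp G q μ then ⟨u, h⟩ else 0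

lemma coe_toLpOrZero {G : Type*} [NormedAddCommGroup G] {u : AEFun G μ} (h : u ∈ Lp G q μ) :
    (toLpOrZero q u : AEFun G μ) = u := by
  unfold toLpOrZero
  rw [dif_pos h]

/-- The modulus of a function. -/
noncomputable def absFun (u : AEFun ℂ μ) : AEFun ℝ μ :=
  AEEqFun.comp (fun w : ℂ => ‖w‖) continuous_norm u

lemma coeFn_absFun (u : AEFun ℂ μ) : absFun u =ᵐ[μ] fun z => ‖u z‖ :=
  AEEqFun.coeFn_comp _ _ _

lemma absFun_mem_Lp {u : AEFun ℂ μ} (h : u ∈ Lp ℂ q μ) : absFun u ∈ Lp ℝ q μ := by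
  rw [Lp.mem_Lp_iff_eLpNorm_lt_top] at h ⊢
  rwa [eLpNorm_congr_ae (coeFn_absFun u), eLpNorm_norm]

lemma IsLinearOn.isSublinearOn {S : Set (AEFun ℂ μ)} {T : AEFun ℂ μ → AEFun ℂ μ}
    (hT : IsLinearOn S T) : IsSublinearOn S T := by
  refine ⟨fun f hf g hg => ?_, fun c f hf => ?_⟩
  · rw [hT.1 f hf g hg]
    filter_upwards [AEEqFun.coeFn_add (T f) (T g)] with z hz
    rw [hz]
    exact norm_add_le _ _
  · rw [hT.2 c f hf]
    filter_upwards [AEEqFun.coeFn_smul c (T f)] with z hz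
    rw [hz, Pi.smul_apply, norm_smul]

section Extension

variable [Fact (1 ≤ p)] [Fact (1 ≤ q)] {T : AEFun ℂ μ → AEFun ℂ μ} {W W₂ : Submodule ℂ (AEFun ℂ μ)}
  {C : ℝ≥0}

/-- A sublinear operator need not be continuous, but its modulus is: `||T f| - |T g|| ≤ |T (f -
g)|`. -/
lemma lipschitzOnWith_absFun (hWp : ∀ f ∈ W, f ∈ Lp ℂ p μ) (hT : IsSublinearOn (W : Set
    (AEFun ℂ μ)) T)
    (hC : ∀ f ∈ W, eLpNorm (T f) q μ ≤ C * eLpNorm f p μ) :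
    LipschitzOnWith C (fun f : Lp ℂ p μ => toLpOrZero q (absFun (T f))) {f |
        (f : AEFun ℂ μ) ∈ W} := by
  have hmem : ∀ f ∈ W, T f ∈ Lp ℂ q μ := fun f hf => by
    rw [Lp.mem_Lp_iff_eLpNorm_lt_top]
    exact (hC f hf).trans_lt (ENNReal.mul_lt_top ENNReal.coe_lt_top
      (Lp.mem_Lp_iff_eLpNorm_lt_top.1 (hWp f hf)))
  intro f hf g hg
  have hfg : (f - g : AEFun ℂ μ) ∈ W := sub_mem hf hg
  have hc := hT.ae_comparable (f := (f : AEFun ℂ μ)) (g := (g : AEFun ℂ μ)) hg hf hfg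
    (W.smul_mem _ hfg) (by abel)
  rw [Lp.edist_def, Lp.edist_def]
  have e1 := coeFn_absFun (T f)
  have e2 := coeFn_absFun (T g)
  rw [← coe_toLpOrZero (absFun_mem_Lp (hmem _ hf))] at e1
  rw [← coe_toLpOrZero (absFun_mem_Lp (hmem _ hg))] at e2
  calc _ ≤ eLpNorm (T (f - g : AEFun ℂ μ)) q μ := by
        refine eLpNorm_mono_ae ?_
        filter_upwards [hc.1, hc.2, e1, e2] with z h1 h2 h3 h4
        rw [Pi.sub_apply, h3, h4, Real.norm_eq_abs, abs_sub_le_iff]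
        constructor <;> linarith
    _ ≤ C * eLpNorm (f - g : AEFun ℂ μ) p μ := hC _ hfg
    _ = _ := by
        congr 1
        exact eLpNorm_congr_ae (AEEqFun.coeFn_sub _ _)

lemma lipschitzOnWith_linear (hWp : ∀ f ∈ W, f ∈ Lp ℂ p μ) (hT : IsLinearOn (W : Set (AEFun ℂ μ)) T)
    (hC : ∀ f ∈ W, eLpNorm (T f) q μ ≤ C * eLpNorm f p μ) :
    LipschitzOnWith C (fun f : Lp ℂ p μ => toLpOrZero q (T f)) {f | (f : AEFun ℂ μ) ∈ W} := by
  have hmem : ∀ f ∈ W, T f ∈ Lp ℂ q μ := fun f hf => by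
    rw [Lp.mem_Lp_iff_eLpNorm_lt_top]
    exact (hC f hf).trans_lt (ENNReal.mul_lt_top ENNReal.coe_lt_top
      (Lp.mem_Lp_iff_eLpNorm_lt_top.1 (hWp f hf)))
  intro f hf g hg
  have hfg : (f - g : AEFun ℂ μ) ∈ W := sub_mem hf hg
  have h := hT.1 g hg (f - g : AEFun ℂ μ) hfg
  rw [add_sub_cancel] at h
  rw [Lp.edist_def, Lp.edist_def, coe_toLpOrZero (hmem _ hf), coe_toLpOrZero (hmem _ hg)]
  calc _ = eLpNorm (T (f - g : AEFun ℂ μ)) q μ := by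
        refine eLpNorm_congr_ae ?_
        filter_upwards [AEEqFun.coeFn_add (T g) (T (f - g : AEFun ℂ μ))] with z hz
        rw [Pi.sub_apply, h, hz, Pi.add_apply, add_sub_cancel_left]
    _ ≤ C * eLpNorm (f - g : AEFun ℂ μ) p μ := hC _ hfg
    _ = _ := by
        congr 1
        exact eLpNorm_congr_ae (AEEqFun.coeFn_sub _ _)

omit [Fact (1 ≤ q)] in
lemma mem_closure_of_approx {V : Set (AEFun ℂ μ)} (hV : ∀ f ∈ V, f ∈ Lp ℂ p μ) (f : Lp ℂ p μ)
    (h : ∀ ε : ℝ≥0∞, ε ≠ 0 → ∃ g ∈ V, eLpNorm ((f : AEFun ℂ μ) - g : AEFun ℂ μ) p μ ≤ ε) :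
    f ∈ closure {f : Lp ℂ p μ | (f : AEFun ℂ μ) ∈ V} := by
  rw [EMetric.mem_closure_iff]
  intro ε hε
  obtain ⟨δ, hδ, hδε⟩ := exists_between hε
  obtain ⟨g, hg, hle⟩ := h δ hδ.ne'
  refine ⟨⟨g, hV g hg⟩, hg, ?_⟩
  rw [Lp.edist_def]
  refine lt_of_le_of_lt ?_ hδε
  rwa [← eLpNorm_congr_ae (AEEqFun.coeFn_sub _ _)]

/-- Extension of a bounded sublinear operator from a dense subspace of `L^p`. -/
theorem exists_sublinear_extension (hWp : ∀ f ∈ W, f ∈ Lp ℂ p μ) (hWp₂ : ∀ f ∈ W₂, f ∈ Lp ℂ p μ)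
    (hT : IsSublinearOn (W : Set (AEFun ℂ μ)) T) (hT₂ : IsSublinearOn (W₂ : Set (AEFun ℂ μ)) T)
    {C₂ : ℝ≥0} (hC : ∀ f ∈ W, eLpNorm (T f) q μ ≤ C * eLpNorm f p μ)
    (hC₂ : ∀ f ∈ W₂, eLpNorm (T f) q μ ≤ C₂ * eLpNorm f p μ)
    (hdense : ∀ f ∈ Lp ℂ p μ, ∀ ε : ℝ≥0∞, ε ≠ 0 → ∃ g ∈ W, eLpNorm (f - g : AEFun ℂ μ) p μ ≤ ε)
    (hdense₂ : ∀ f ∈ W₂, ∀ ε : ℝ≥0∞, ε ≠ 0 →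
      ∃ g ∈ W, g ∈ W₂ ∧ eLpNorm (f - g : AEFun ℂ μ) p μ ≤ ε) :
    ∃ T' : AEFun ℂ μ → AEFun ℂ μ, IsSublinearOn (Lp ℂ p μ : Set (AEFun ℂ μ)) T' ∧
      (∀ f ∈ Lp ℂ p μ, eLpNorm (T' f) q μ ≤ C * eLpNorm f p μ) ∧
      (∀ f ∈ W, T' f = T f) ∧ (∀ f ∈ W₂, T' f = T f) ∧
      (IsLinearOn (W : Set (AEFun ℂ μ)) T → IsLinearOn (W₂ : Set (AEFun ℂ μ)) T →
        IsLinearOn (Lp ℂ p μ : Set (AEFun ℂ μ)) T') := by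
  classical
  have hmem : ∀ f, f ∈ W ∨ f ∈ W₂ → T f ∈ Lp ℂ q μ := by
    intro f hf
    rw [Lp.mem_Lp_iff_eLpNorm_lt_top]
    rcases hf with hf | hf
    · exact (hC f hf).trans_lt (ENNReal.mul_lt_top ENNReal.coe_lt_top
        (Lp.mem_Lp_iff_eLpNorm_lt_top.1 (hWp f hf)))
    · exact (hC₂ f hf).trans_lt (ENNReal.mul_lt_top ENNReal.coe_lt_top
        (Lp.mem_Lp_iff_eLpNorm_lt_top.1 (hWp₂ f hf)))
  set V : Set (Lp ℂ p μ) := {f | (f : AEFun ℂ μ) ∈ W}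
  set V₂ : Set (Lp ℂ p μ) := {f | (f : AEFun ℂ μ) ∈ W₂}
  have hV : Dense V := fun f => mem_closure_of_approx (V := W) hWp f (hdense f f.2)
  have hV₂ : V₂ ⊆ closure (V ∩ V₂) := fun f hf =>
    mem_closure_of_approx (V := (W : Set (AEFun ℂ μ)) ∩ W₂) (fun g hg => hWp g hg.1) f
      fun ε hε => by
        obtain ⟨g, h1, h2, h3⟩ := hdense₂ f hf ε hε
        exact ⟨g, ⟨h1, h2⟩, h3⟩
  have hVd : DenseRange ((↑) : V → Lp ℂ p μ) := hV.denseRange_val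
  -- For a linear operator `T` itself extends continuously. Otherwise only the modulus does, and
  -- this suffices because sublinearity and the norm bound involve nothing else.
  by_cases hlin : IsLinearOn (W : Set (AEFun ℂ μ)) T ∧ IsLinearOn (W₂ : Set (AEFun ℂ μ)) T
  · obtain ⟨Φ, hΦ, hΦ1, hΦ2⟩ := exists_continuous_extension
      (lipschitzOnWith_linear (q := q) hWp hlin.1 hC) (lipschitzOnWith_linear
          (q := q) hWp₂ hlin.2 hC₂)
      hV hV₂
    have hcoe : ∀ f (h : f ∈ W ∨ f ∈ W₂), ((toLpOrZero q (T f) : Lp ℂ q μ) : AEFun ℂ μ) = T f :=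
      fun f h => coe_toLpOrZero (hmem f h)
    have hadd : ∀ f g, Φ (f + g) = Φ f + Φ g := fun f g => by
      refine hVd.induction_on₂ (p := fun f g => Φ (f + g) = Φ f + Φ g)
        (isClosed_eq (by fun_prop) (by fun_prop)) (fun a b => ?_) f g
      have hab : (a + b : Lp ℂ p μ) ∈ V := W.add_mem a.2 b.2
      rw [hΦ1 _ hab, hΦ1 _ a.2, hΦ1 _ b.2]
      apply Subtype.ext
      refine (hcoe _ (Or.inl hab)).trans ((hlin.1.1 _ a.2 _ b.2).trans ?_)
      exact (congrArg₂ (· + ·) (hcoe _ (Or.inl a.2)) (hcoe _ (Or.inl b.2))).symm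
    have hsmul : ∀ (c : ℂ) f, Φ (c • f) = c • Φ f := fun c f => by
      refine hVd.induction_on (p := fun f => Φ (c • f) = c • Φ f) f
        (isClosed_eq (by fun_prop) (by fun_prop)) (fun a => ?_)
      have hca : (c • a : Lp ℂ p μ) ∈ V := W.smul_mem c a.2
      rw [hΦ1 _ hca, hΦ1 _ a.2]
      apply Subtype.ext
      refine (hcoe _ (Or.inl hca)).trans ((hlin.1.2 c _ a.2).trans ?_)
      exact (congrArg (c • ·) (hcoe _ (Or.inl a.2))).symm
    have hbd : ∀ f, ‖Φ f‖ ≤ C * ‖f‖ := fun f => by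
      refine hVd.induction_on (p := fun f => ‖Φ f‖ ≤ C * ‖f‖) f
        (isClosed_le (by fun_prop) (by fun_prop)) (fun a => ?_)
      rw [hΦ1 _ a.2, Lp.norm_def, Lp.norm_def, hcoe _ (Or.inl a.2)]
      refine (ENNReal.toReal_mono ?_ (hC _ a.2)).trans (by simp)
      exact ENNReal.mul_ne_top ENNReal.coe_ne_top (Lp.eLpNorm_ne_top _)
    set T' : AEFun ℂ μ → AEFun ℂ μ := fun f => if h : f ∈ Lp ℂ p μ then
        (Φ ⟨f, h⟩ : AEFun ℂ μ) else 0
    have hT' : ∀ f (h : f ∈ Lp ℂ p μ), T' f = Φ ⟨f, h⟩ := fun f h => dif_pos h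
    have hT'lin : IsLinearOn (Lp ℂ p μ : Set (AEFun ℂ μ)) T' := by
      refine ⟨fun f hf g hg => ?_, fun c f hf => ?_⟩
      · rw [hT' f hf, hT' g hg, hT' (f + g) (add_mem hf hg), ← AddSubgroup.coe_add, ← hadd]
        rfl
      · rw [hT' f hf, hT' (c • f) (Lp.const_smul_mem_Lp c ⟨f, hf⟩)]
        exact congrArg Subtype.val (hsmul c ⟨f, hf⟩)
    refine ⟨T', hT'lin.isSublinearOn, fun f hf => ?_, fun f hf => ?_, fun f hf => ?_,
      fun _ _ => hT'lin⟩
    · rw [hT' f hf]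
      have h := hbd ⟨f, hf⟩
      rw [Lp.norm_def, Lp.norm_def] at h
      rw [← ENNReal.toReal_le_toReal (Lp.eLpNorm_ne_top _)
        (ENNReal.mul_ne_top ENNReal.coe_ne_top (Lp.eLpNorm_ne_top (⟨f, hf⟩ : Lp ℂ p μ)))]
      simpa using h
    · rw [hT' f (hWp f hf), hΦ1 ⟨f, hWp f hf⟩ hf]
      exact hcoe f (Or.inl hf)
    · rw [hT' f (hWp₂ f hf), hΦ2 ⟨f, hWp₂ f hf⟩ hf]
      exact hcoe f (Or.inr hf)
  · obtain ⟨Φ, hΦ, hΦ1, hΦ2⟩ := exists_continuous_extension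
      (lipschitzOnWith_absFun (q := q) hWp hT hC) (lipschitzOnWith_absFun
          (q := q) hWp₂ hT₂ hC₂) hV hV₂
    have hcoe : ∀ f (h : f ∈ W ∨ f ∈ W₂),
        (toLpOrZero q (absFun (T f)) : Lp ℝ q μ) =ᵐ[μ] fun z => ‖T f z‖ := fun f h => by
      rw [coe_toLpOrZero (absFun_mem_Lp (hmem f h))]
      exact coeFn_absFun _
    have hnonneg : ∀ f, 0 ≤ Φ f := fun f => by
      refine hVd.induction_on (p := fun f => 0 ≤ Φ f) f
        (isClosed_le (by fun_prop) (by fun_prop)) (fun a => ?_)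
      rw [hΦ1 _ a.2, ← Lp.coeFn_nonneg]
      filter_upwards [hcoe _ (Or.inl a.2)] with z hz
      rw [hz]
      exact norm_nonneg _
    have hadd : ∀ f g, Φ (f + g) ≤ Φ f + Φ g := fun f g => by
      refine hVd.induction_on₂ (p := fun f g => Φ (f + g) ≤ Φ f + Φ g)
        (isClosed_le (by fun_prop) (by fun_prop)) (fun a b => ?_) f g
      have hab : (a + b : Lp ℂ p μ) ∈ V := W.add_mem a.2 b.2
      rw [hΦ1 _ hab, hΦ1 _ a.2, hΦ1 _ b.2, ← Lp.coeFn_le]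
      filter_upwards [hcoe _ (Or.inl hab), hcoe _ (Or.inl a.2), hcoe _ (Or.inl b.2),
        Lp.coeFn_add (toLpOrZero q (absFun (T a)) : Lp ℝ q μ) (toLpOrZero q (absFun (T b))),
        hT.1 _ a.2 _ b.2] with z h1 h2 h3 h4 h5
      rw [h1, h4, Pi.add_apply, h2, h3]
      exact h5
    have hsmul : ∀ (c : ℂ) f, Φ (c • f) = ‖c‖ • Φ f := fun c f => by
      refine hVd.induction_on (p := fun f => Φ (c • f) = ‖c‖ • Φ f) f
        (isClosed_eq (by fun_prop) (by fun_prop)) (fun a => ?_)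
      have hca : (c • a : Lp ℂ p μ) ∈ V := W.smul_mem c a.2
      rw [hΦ1 _ hca, hΦ1 _ a.2]
      refine Lp.ext ?_
      filter_upwards [hcoe _ (Or.inl hca), hcoe _ (Or.inl a.2),
        Lp.coeFn_smul ‖c‖ (toLpOrZero q (absFun (T a)) : Lp ℝ q μ), hT.2 c _ a.2] with z h1 h2 h3 h4
      rw [h1, h3, Pi.smul_apply, h2, smul_eq_mul]
      exact h4
    have hbd : ∀ f, ‖Φ f‖ ≤ C * ‖f‖ := fun f => by
      refine hVd.induction_on (p := fun f => ‖Φ f‖ ≤ C * ‖f‖) f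
        (isClosed_le (by fun_prop) (by fun_prop)) (fun a => ?_)
      rw [hΦ1 _ a.2, Lp.norm_def, Lp.norm_def, eLpNorm_congr_ae (hcoe _ (Or.inl a.2)), eLpNorm_norm]
      refine (ENNReal.toReal_mono ?_ (hC _ a.2)).trans (by simp)
      exact ENNReal.mul_ne_top ENNReal.coe_ne_top (Lp.eLpNorm_ne_top _)
    -- The given values are kept on `W` and `W₂`; elsewhere the nonnegative extension of the modulus
    -- is taken as the value. In all cases the modulus of `T' f` is `Φ f`.
    set T' : AEFun ℂ μ → AEFun ℂ μ := fun f => if f ∈ W ∨ f ∈ W₂ then T f else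
      if h : f ∈ Lp ℂ p μ then AEEqFun.comp Complex.ofReal Complex.continuous_ofReal
          (Φ ⟨f, h⟩) else 0
    have hTW : ∀ f, f ∈ W ∨ f ∈ W₂ → T' f = T f := fun f h => if_pos h
    have hT' : ∀ f (h : f ∈ Lp ℂ p μ), (fun z => ‖T' f z‖) =ᵐ[μ] Φ ⟨f, h⟩ := by
      intro f h
      by_cases hf : f ∈ W ∨ f ∈ W₂
      · have e : Φ ⟨f, h⟩ = toLpOrZero q (absFun (T f)) := by
          rcases hf with hf | hf
          · exact hΦ1 ⟨f, h⟩ hf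
          · exact hΦ2 ⟨f, h⟩ hf
        rw [hTW f hf, e]
        exact (hcoe f hf).symm
      · have e : T' f = AEEqFun.comp Complex.ofReal Complex.continuous_ofReal (Φ ⟨f, h⟩) := by
          simp only [T']
          rw [if_neg hf, dif_pos h]
        rw [e]
        filter_upwards [AEEqFun.coeFn_comp Complex.ofReal Complex.continuous_ofReal
          (Φ ⟨f, h⟩ : AEFun ℝ μ), (Lp.coeFn_nonneg _).2 (hnonneg ⟨f, h⟩)] with z h1 h2
        rw [h1, Function.comp_apply, Complex.norm_real, Real.norm_eq_abs, abs_of_nonneg h2]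
    refine ⟨T', ⟨fun f hf g hg => ?_, fun c f hf => ?_⟩, fun f hf => ?_, fun f hf => hTW f
        (Or.inl hf),
      fun f hf => hTW f (Or.inr hf), fun h1 h2 => absurd ⟨h1, h2⟩ hlin⟩
    · filter_upwards [hT' f hf, hT' g hg, hT' (f + g) (add_mem hf hg),
        (Lp.coeFn_le _ _).2 (hadd ⟨f, hf⟩ ⟨g, hg⟩), Lp.coeFn_add (Φ ⟨f, hf⟩) (Φ ⟨g, hg⟩)]
        with z h1 h2 h3 h4 h5
      rw [h5, Pi.add_apply] at h4
      rw [h1, h2, h3]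
      exact h4
    · filter_upwards [hT' f hf, hT' (c • f) (Lp.const_smul_mem_Lp c ⟨f, hf⟩),
        Lp.coeFn_smul ‖c‖ (Φ ⟨f, hf⟩)] with z h1 h2 h3
      rw [h1, h2]
      have e : Φ ⟨c • f, Lp.const_smul_mem_Lp c ⟨f, hf⟩⟩ = ‖c‖ • Φ ⟨f, hf⟩ := hsmul c ⟨f, hf⟩
      rw [e, h3, Pi.smul_apply, smul_eq_mul]
    · rw [← eLpNorm_norm, eLpNorm_congr_ae (hT' f hf)]
      have h := hbd ⟨f, hf⟩
      rw [Lp.norm_def, Lp.norm_def] at h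
      rw [← ENNReal.toReal_le_toReal (Lp.eLpNorm_ne_top _)
        (ENNReal.mul_ne_top ENNReal.coe_ne_top (Lp.eLpNorm_ne_top (⟨f, hf⟩ : Lp ℂ p μ)))]
      simpa using h

end Extension


/-! ### Assembly: the extension in the two cases and the final theorem. -/

lemma subMean_sub {X : Type*} [MeasurableSpace X] {μ : Measure X} {f g : AEFun ℂ μ}
    (hf : Integrable f μ) (hg : Integrable g μ) : subMean (f - g) = subMean f - subMean g := by
  have e : ∫ z, (f - g : AEFun ℂ μ) z ∂μ = ∫ z, f z ∂μ - ∫ z, g z ∂μ := by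
    rw [integral_congr_ae (AEEqFun.coeFn_sub f g)]
    exact integral_sub hf hg
  unfold subMean
  rw [e, sub_div]
  module

variable {X : Type*} [MetricSpace X] [MeasurableSpace X] {μ : Measure X} {lam : X → ℝ → ℝ}
  {ρ σ : ℝ} {s : ℝ≥0∞} {D : ℝ} {β K : ℝ≥0} {up : X → ℝ → ℝ} {P : ℝ} {p q p₀ : ℝ≥0∞}
  {T : AEFun ℂ μ → AEFun ℂ μ} [BorelSpace X] [Nonempty X]

/-- The subspace `H¹ ∩ L^p`. -/
def hardyLp (μ : Measure X) (lam : X → ℝ → ℝ) (hσ : 1 ≤ σ) (hs : 1 ≤ s) (p : ℝ≥0∞) :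
    Submodule ℂ (AEFun ℂ μ) where
  carrier := {f | f ∈ Lp ℂ p μ ∧ f ∈ hardySpace μ lam σ s}
  zero_mem' := by
    refine ⟨zero_mem _, ?_⟩
    change hardyNorm μ lam σ s 0 < ∞
    rw [← hNorm_coe, hNorm_congr AEEqFun.coeFn_zero]
    exact (hNorm_zero (μ := μ) (lam := lam) hσ hs).trans_lt ENNReal.zero_lt_top
  add_mem' := fun hf hg => ⟨add_mem hf.1 hg.1, hardySpace_add_mem hσ hs hf.2 hg.2⟩
  smul_mem' := fun c f hf => ⟨Lp.const_smul_mem_Lp c ⟨f, hf.1⟩, hardySpace_smul_mem hσ hs hf.2 c⟩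

omit [MetricSpace X] [BorelSpace X] [Nonempty X] in
lemma IsSublinearOn.mono {S S' : Set (AEFun ℂ μ)} (hT : IsSublinearOn S T) (h : S' ⊆ S) :
    IsSublinearOn S' T :=
  ⟨fun f hf g hg => hT.1 f (h hf) g (h hg), fun c f hf => hT.2 c f (h hf)⟩

omit [MetricSpace X] [BorelSpace X] [Nonempty X] in
lemma IsLinearOn.mono {S S' : Set (AEFun ℂ μ)} (hT : IsLinearOn S T) (h : S' ⊆ S) :
    IsLinearOn S' T :=
  ⟨fun f hf g hg => hT.1 f (h hf) g (h hg), fun c f hf => hT.2 c f (h hf)⟩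

variable [SecondCountableTopology X] [Fact (1 ≤ p)] [Fact (1 ≤ q)]

/-- Interpolation on a space of infinite measure. -/
theorem EndpointBounded.exists_extension_of_infinite (hρ : 1 ≤ ρ) (hσ : 1 ≤ σ) (hs : 1 ≤ s)
    (hp1 : 1 < p) (hp : p ≠ ∞) (hpp₀ : p ≤ p₀) (hq : q ≠ ∞)
    (hpq : 1 / q.toReal = 1 / p.toReal - p₀⁻¹.toReal)
    (hP : 1 / P = 1 - p₀⁻¹.toReal) (hP1 : 1 ≤ P) (hlam : IsDominatingFunction μ lam)
    (hD : 42 * σ ≤ D) (hDρ : 8 * ρ ≤ D) (hD48 : 48 ≤ D) (hdd : DoublingData μ lam D β K up)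
    (hinf : μ univ = ∞) (hT : EndpointBounded μ lam ρ σ s p₀ P T) :
    ∃ T' : AEFun ℂ μ → AEFun ℂ μ, IsSublinearOn (Lp ℂ p μ : Set (AEFun ℂ μ)) T' ∧
      (∃ C : ℝ≥0, ∀ f ∈ Lp ℂ p μ, eLpNorm (T' f) q μ ≤ C * eLpNorm f p μ) ∧
      (∀ f ∈ Lp ℂ p μ, f ∈ hardySpace μ lam σ s → T' f = T f) ∧
      (IsLinearOn (hardySpace μ lam σ s) T → IsLinearOn (Lp ℂ p μ : Set (AEFun ℂ μ)) T') := by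
  have hp0 : p ≠ 0 := (zero_lt_one.trans hp1).ne'
  have hq0 : q ≠ 0 := (zero_lt_one.trans_le (Fact.out : 1 ≤ q)).ne'
  have hpr : 1 < p.toReal := by
    rw [← ENNReal.toReal_one]; exact (ENNReal.toReal_lt_toReal (by simp) hp).2 hp1
  obtain ⟨C₀, hC₀⟩ := hT.exists_lintegral_le_of_infinite hρ hσ hs hpr
    (by rwa [ENNReal.ofReal_toReal hp]) hpq (ENNReal.toReal_pos hq0 hq) hP hP1 hlam hD hDρ hD48 hdd
        hinf
  obtain ⟨C, hC⟩ := hT.sublinear_hardy.exists_eLpNorm_le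
    (fun c f hf => hardySpace_smul_mem hσ hs hf c) hp0 hp hq0 hq hC₀
  set W := hardyLp μ lam hσ hs p
  have hWS : (W : Set (AEFun ℂ μ)) ⊆ hardySpace μ lam σ s := fun f hf => hf.2
  have hCW : ∀ f ∈ W, eLpNorm (T f) q μ ≤ C * eLpNorm f p μ := fun f hf =>
    hC f hf.2 (Lp.mem_Lp_iff_eLpNorm_lt_top.1 hf.1)
  obtain ⟨T', h1, h2, h3, -, h5⟩ := exists_sublinear_extension (W := W) (W₂ := W) (fun f hf => hf.1)
    (fun f hf => hf.1) (hT.sublinear_hardy.mono hWS) (hT.sublinear_hardy.mono hWS) hCW hCW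
    (fun f hf ε hε => by
      obtain ⟨g, hg1, hg2, hg3⟩ := exists_mem_hardySpace_approx hσ hs hlam hp1 hp hinf hf hε
      exact ⟨g, ⟨hg1, hg2⟩, hg3⟩)
    (fun f hf ε hε => ⟨f, hf, hf, by
      rw [sub_self, eLpNorm_congr_ae AEEqFun.coeFn_zero, eLpNorm_zero]; exact bot_le⟩)
  exact ⟨T', h1, ⟨C, h2⟩, fun f hf hf' => h3 f ⟨hf, hf'⟩, fun h => h5 (h.mono hWS) (h.mono hWS)⟩

/-- Interpolation on a space of finite measure. -/
theorem EndpointBounded.exists_extension_of_finite (hρ : 1 ≤ ρ) (hσ : 1 ≤ σ) (hs : 1 ≤ s)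
    (hp1 : 1 < p) (hp : p ≠ ∞) (hpp₀ : p ≤ p₀) (hq : q ≠ ∞)
    (hpq : 1 / q.toReal = 1 / p.toReal - p₀⁻¹.toReal)
    (hP : 1 / P = 1 - p₀⁻¹.toReal) (hP1 : 1 ≤ P) (hlam : IsDominatingFunction μ lam)
    (hD : 42 * σ ≤ D) (hDρ : 8 * ρ ≤ D) (hD48 : 48 ≤ D) (hdd : DoublingData μ lam D β K up)
    (hfin : μ univ ≠ ∞) (h0 : μ univ ≠ 0) (hT : EndpointBounded μ lam ρ σ s p₀ P T) :
    ∃ T' : AEFun ℂ μ → AEFun ℂ μ, IsSublinearOn (Lp ℂ p μ : Set (AEFun ℂ μ)) T' ∧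
      (∃ C : ℝ≥0, ∀ f ∈ Lp ℂ p μ, eLpNorm (T' f) q μ ≤ C * eLpNorm f p μ) ∧
      (∀ f ∈ Lp ℂ p μ, f ∈ hardySpace μ lam σ s → T' f = T f) ∧ (∀ f ∈ Lp ℂ p₀ μ, T' f = T f) ∧
      (IsLinearOn (Lp ℂ p₀ μ : Set (AEFun ℂ μ)) T → IsLinearOn (hardySpace μ lam σ s) T →
        IsLinearOn (Lp ℂ p μ : Set (AEFun ℂ μ)) T') := by
  have hp0 : p ≠ 0 := (zero_lt_one.trans hp1).ne'
  have hq1 : 1 ≤ q := Fact.out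
  have hq0 : q ≠ 0 := (zero_lt_one.trans_le hq1).ne'
  have hqr := ENNReal.toReal_pos hq0 hq
  have hpr : 1 < p.toReal := by
    rw [← ENNReal.toReal_one]; exact (ENNReal.toReal_lt_toReal (by simp) hp).2 hp1
  have hfm : IsFiniteMeasure μ := ⟨hfin.lt_top⟩
  have hLp : Lp ℂ p₀ μ ≤ Lp ℂ p μ := Lp.antitone hpp₀
  have hint : ∀ f ∈ Lp ℂ p μ, Integrable f μ := fun f hf => (Lp.mem_Lp_iff_memLp.1 hf).integrable
      hp1.le
  obtain ⟨C₀, hC₀⟩ := hT.exists_lintegral_le_of_finite hρ hσ hs hpr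
    (by rwa [ENNReal.ofReal_toReal hp]) hpq hqr hP hP1 hlam hD hDρ hD48 hdd hfin h0
  obtain ⟨C₂, hC₂⟩ := hT.sublinear_hardy.exists_eLpNorm_le
    (fun c f hf => hardySpace_smul_mem hσ hs hf c) hp0 hp hq0 hq hC₀
  obtain ⟨Ch, hCh⟩ := exists_hNorm_le_of_integral_eq_zero (s := s) hσ hs hpr hlam hD hdd h0 hfin
  have hmemH : ∀ f ∈ Lp ℂ p μ, ∫ z, f z ∂μ = 0 → f ∈ hardySpace μ lam σ s := by
    intro f hf hf0
    have h1 := Lp.mem_Lp_iff_eLpNorm_lt_top.1 hf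
    rw [eLpNorm_eq_lintegral_rpow_enorm_toReal hp0 hp] at h1
    have h2 : ∫⁻ z, ‖f z‖ₑ ^ p.toReal ∂μ ≠ ∞ := by
      intro h
      rw [h, ENNReal.top_rpow_of_pos (by positivity)] at h1
      exact lt_irrefl _ h1
    change hardyNorm μ lam σ s f < ∞
    rw [← hNorm_coe]
    exact (hCh f f.stronglyMeasurable.measurable h2 hf0).trans_lt
      (ENNReal.mul_lt_top ENNReal.coe_lt_top h1)
  -- Two subspaces are needed: `L^{p₀}` is dense in `L^p`, while `H¹ ∩ L^p` contains only mean zero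
  -- functions. They meet in the mean zero functions of `L^{p₀}`, which are dense in `H¹ ∩ L^p`.
  set W₂ := hardyLp μ lam hσ hs p
  set W := Lp.LpSubmodule ℂ ℂ p₀ μ
  have hWS : (W₂ : Set (AEFun ℂ μ)) ⊆ hardySpace μ lam σ s := fun f hf => hf.2
  have hCW₂ : ∀ f ∈ W₂, eLpNorm (T f) q μ ≤ C₂ * eLpNorm f p μ := fun f hf =>
    hC₂ f hf.2 (Lp.mem_Lp_iff_eLpNorm_lt_top.1 hf.1)
  have hsub : ∀ f ∈ Lp ℂ p μ, subMean f ∈ W₂ := fun f hf =>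
    ⟨subMean_mem_Lp hfin hf, hmemH _ (subMean_mem_Lp hfin hf) (integral_subMean hfin h0 hp1.le hf)⟩
  -- Functions in `L^{p₀}` split into a mean zero part, covered by the `H¹` estimate, and a
  -- constant, for which only `T 1 ∈ L^q` is needed; this follows from `T 1 ∈ RBMO`.
  have hT1 : eLpNorm (T (AEEqFun.const X 1)) q μ ≠ ∞ := by
    obtain ⟨Cr, hCr⟩ := hT.rbmo
    have hone : (AEEqFun.const X 1 : AEFun ℂ μ) ∈ Lp ℂ p₀ μ := const_one_mem_Lp hfin
    have h1 : rbmoNorm μ lam ρ (T (AEEqFun.const X 1)) < ∞ := (hCr _ hone).trans_lt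
      (ENNReal.mul_lt_top ENNReal.coe_lt_top (Lp.mem_Lp_iff_eLpNorm_lt_top.1 hone))
    simp only [rbmoNorm, iInf_lt_iff] at h1
    obtain ⟨C₁, h2, -⟩ := h1
    rw [eLpNorm_eq_lintegral_rpow_enorm_toReal hq0 hq]
    exact ENNReal.rpow_ne_top_of_nonneg (by positivity)
      (h2.lintegral_rpow_ne_top hρ hlam hDρ hD48 hdd hfin h0 hqr)
  obtain ⟨C, hC⟩ := hT.sublinear_Lp.exists_eLpNorm_le_of_subMean hp1.le hq1 hfin h0 hT1
    fun f hf => hCW₂ _ (hsub f (hLp hf))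
  obtain ⟨B, hB⟩ := exists_eLpNorm_subMean_le (μ := μ) hp1.le hfin h0
  obtain ⟨x₀⟩ := ‹Nonempty X›
  obtain ⟨T', h1, h2, h3, h4, h5⟩ := exists_sublinear_extension (W := W) (W₂ := W₂)
    (fun f hf => hLp hf) (fun f hf => hf.1) hT.sublinear_Lp (hT.sublinear_hardy.mono hWS) hC hCW₂
    (fun f hf ε hε => exists_mem_Lp_approx x₀ hlam hp0 hp p₀ hf hε)
    (fun f hf ε hε => by
      -- Subtracting the mean increases the `L^p` norm by at most the factor `B`, and `f` has mean
      -- zero already. So the corrected approximant is still close to `f`.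
      obtain ⟨g, hg, hle⟩ := exists_mem_Lp_approx x₀ hlam hp0 hp p₀ hf.1 (ε := ε / (B + 1))
        (ENNReal.div_ne_zero.2 ⟨hε, by finiteness⟩)
      refine ⟨subMean g, subMean_mem_Lp hfin hg, hsub g (hLp hg), ?_⟩
      have hf0 : ∫ z, f z ∂μ = 0 := by
        refine integral_eq_zero_of_hNorm_lt_top (lam := lam) hσ hs ?_
        rw [hNorm_coe]; exact hf.2
      have e : subMean f = f := by simp [subMean, hf0]
      have e2 : f - subMean g = subMean (f - g) := by
        rw [subMean_sub (hint f hf.1) (hint g (hLp hg)), e]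
      rw [e2]
      calc _ ≤ (B : ℝ≥0∞) * (ε / (B + 1)) := (hB _).trans (by gcongr)
        _ ≤ (B + 1) * (ε / (B + 1)) := by gcongr; exact le_self_add
        _ = ε := ENNReal.mul_div_cancel (by simp) (by finiteness))
  exact ⟨T', h1, ⟨C, h2⟩, fun f hf hf' => h4 f ⟨hf, hf'⟩, fun f hf => h3 f hf,
    fun h h' => h5 h (h'.mono hWS)⟩

end NonHomogeneous

theorem theorem2p7 {X : Type*} [MetricSpace X] [MeasurableSpace X] [BorelSpace X]
    (μ : Measure X) (lam : X → ℝ → ℝ)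
    (hX : NonHomogeneous.GeometricallyDoubling X)
    (hlam : NonHomogeneous.IsDominatingFunction μ lam)
    -- the parameters in the definitions of `RBMO(μ)` and of `H¹(μ)`
    (ρ : ℝ) (hρ : 1 < ρ) (σ : ℝ) (hσ : 1 < σ) (s : ℝ≥0∞) (hs : 1 < s)
    (p₀ p₀' : ℝ≥0∞) (hp₀ : 1 < p₀) (hp₀' : p₀⁻¹ + p₀'⁻¹ = 1)
    (T : (NonHomogeneous.AEFun ℂ μ) → (NonHomogeneous.AEFun ℂ μ))
    (hT_L : NonHomogeneous.IsSublinearOn (Lp ℂ p₀ μ : Set (NonHomogeneous.AEFun ℂ μ)) T)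
    (hT_H : NonHomogeneous.IsSublinearOn (NonHomogeneous.hardySpace μ lam σ s) T)
    (hT_RBMO : ∃ C : ℝ≥0, ∀ f ∈ Lp ℂ p₀ μ,
      NonHomogeneous.rbmoNorm μ lam ρ (T f) ≤ C * eLpNorm f p₀ μ)
    (hT_weak : ∃ C : ℝ≥0, ∀ f ∈ NonHomogeneous.hardySpace μ lam σ s,
      NonHomogeneous.weakNorm μ p₀'.toReal (T f) ≤ C * NonHomogeneous.hardyNorm μ lam σ s f)
    (p q : ℝ≥0∞) (hp : 1 < p) (hpp₀ : p < p₀) (hq : q⁻¹ = p⁻¹ - p₀⁻¹) :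
    ∃ T' : (NonHomogeneous.AEFun ℂ μ) → (NonHomogeneous.AEFun ℂ μ),
      -- `T'` is a bounded sublinear operator from `L^p(μ)` into `L^q(μ)`
      NonHomogeneous.IsSublinearOn (Lp ℂ p μ : Set (NonHomogeneous.AEFun ℂ μ)) T' ∧
      (∃ C : ℝ≥0, ∀ f ∈ Lp ℂ p μ, eLpNorm (T' f) q μ ≤ C * eLpNorm f p μ) ∧
      -- `T'` extends `T`
      (∀ f ∈ Lp ℂ p μ, f ∈ NonHomogeneous.hardySpace μ lam σ s → T' f = T f) ∧
      (μ univ < ∞ → ∀ f ∈ Lp ℂ p₀ μ, T' f = T f) ∧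
      -- `T'` is linear if `T` is
      (NonHomogeneous.IsLinearOn (Lp ℂ p₀ μ : Set (NonHomogeneous.AEFun ℂ μ)) T →
        NonHomogeneous.IsLinearOn (NonHomogeneous.hardySpace μ lam σ s) T →
        NonHomogeneous.IsLinearOn (Lp ℂ p μ : Set (NonHomogeneous.AEFun ℂ μ)) T') := by
  open NonHomogeneous in
  -- For `μ = 0` all functions coincide almost everywhere and `T` itself serves.
  by_cases h0 : μ univ = 0
  · have hμ : μ = 0 := Measure.measure_univ_eq_zero.1 h0
    have hae : ∀ {Q : X → Prop}, ∀ᵐ x ∂μ, Q x := by rw [hμ]; simp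
    refine ⟨T, ⟨fun f _ g _ => hae, fun c f _ => hae⟩, ⟨0, fun f _ => ?_⟩, fun f _ _ => rfl,
      fun _ f _ => rfl, fun _ _ => ⟨fun f _ g _ => AEEqFun.ext hae, fun c f _ => AEEqFun.ext hae⟩⟩
    have : T f =ᵐ[μ] 0 := hae
    rw [eLpNorm_congr_ae this, eLpNorm_zero]
    exact bot_le
  have hne : Nonempty X := by
    by_contra h
    rw [not_nonempty_iff] at h
    exact h0 (by rw [univ_eq_empty_iff.2 h, measure_empty])
  have hsc : SecondCountableTopology X := hX.secondCountableTopology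
  have hpt : p ≠ ∞ := hpp₀.ne_top
  have hp0 : p ≠ 0 := (zero_lt_one.trans hp).ne'
  have hp₀0 : p₀ ≠ 0 := (zero_lt_one.trans hp₀).ne'
  have hqp : q⁻¹ ≤ p⁻¹ := hq ▸ tsub_le_self
  have hq1 : 1 ≤ q := by
    rw [← ENNReal.inv_le_one]
    exact hqp.trans (ENNReal.inv_le_one.2 hp.le)
  have hqt : q ≠ ∞ := by
    rintro rfl
    rw [ENNReal.inv_top] at hq
    exact absurd (ENNReal.inv_lt_inv.2 hpp₀) (not_lt.2 (tsub_eq_zero_iff_le.1 hq.symm))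
  have hp' : Fact (1 ≤ p) := ⟨hp.le⟩
  have hq' : Fact (1 ≤ q) := ⟨hq1⟩
  have hpq : 1 / q.toReal = 1 / p.toReal - p₀⁻¹.toReal := by
    rw [one_div, one_div, ← ENNReal.toReal_inv, ← ENNReal.toReal_inv, hq,
      ENNReal.toReal_sub_of_le (ENNReal.inv_le_inv.2 hpp₀.le) (ENNReal.inv_ne_top.2 hp0)]
  have hp₀'1 : p₀'⁻¹ ≤ 1 := hp₀' ▸ le_add_self
  have hP : 1 / p₀'.toReal = 1 - p₀⁻¹.toReal := by
    have h := congrArg ENNReal.toReal hp₀'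
    rw [ENNReal.toReal_add (ENNReal.inv_ne_top.2 hp₀0)
      (ne_top_of_le_ne_top ENNReal.one_ne_top hp₀'1), ENNReal.toReal_one] at h
    rw [one_div, ← ENNReal.toReal_inv]
    linarith
  have hp₀'t : p₀' ≠ ∞ := by
    rintro rfl
    rw [ENNReal.inv_top, add_zero, ENNReal.inv_eq_one] at hp₀'
    exact hp₀.ne' hp₀'
  have hP1 : 1 ≤ p₀'.toReal := by
    rw [← ENNReal.toReal_one]
    exact ENNReal.toReal_mono hp₀'t (ENNReal.inv_le_one.1 hp₀'1)
  have hT : EndpointBounded μ lam ρ σ s p₀ p₀'.toReal T := ⟨hT_L, hT_H, hT_RBMO, hT_weak⟩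
  -- The requirements are `42σ = 3 * 14σ` for the Calderón–Zygmund decomposition, and `8ρ` and `48 =
  -- 6 * 8` for the oscillation on the `8`-dilate in the good-λ estimate.
  obtain ⟨D, β, K, up, hD, -, hdd⟩ :=
    hlam.exists_doublingData hX (max (42 * σ) (max (8 * ρ) 48))
  have hDσ : 42 * σ ≤ D := (le_max_left _ _).trans hD
  have hDρ : 8 * ρ ≤ D := (le_max_left _ _).trans ((le_max_right _ _).trans hD)
  have hD48 : 48 ≤ D := (le_max_right _ _).trans ((le_max_right _ _).trans hD)
  by_cases hfin : μ univ = ∞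
  · obtain ⟨T', h1, h2, h3, h4⟩ := hT.exists_extension_of_infinite hρ.le hσ.le hs.le hp hpt hpp₀.le
      hqt hpq hP hP1 hlam hDσ hDρ hD48 hdd hfin
    exact ⟨T', h1, h2, h3, fun h => absurd hfin h.ne, fun _ => h4⟩
  · obtain ⟨T', h1, h2, h3, h4, h5⟩ := hT.exists_extension_of_finite hρ.le hσ.le hs.le hp hpt
      hpp₀.le
      hqt hpq hP hP1 hlam hDσ hDρ hD48 hdd hfin h0
    exact ⟨T', h1, h2, h3, fun _ => h4, h5⟩
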